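/- Let $S=\{\infty,p_1,\dots,p_s\}$ be a finite set of places of $\mathbb Q$ containing $\infty$ ($s\ge 0$), let $S_f=\{p_1,\dots,p_s\}$, $\mathbb Q_\infty=\mathbb R$, $\mathbb Q_S=\prod_{p\in S}\mathbb Q_p$, and let $\mathbb Z_S$ be the ring of rationals $z$ with $|z|_\ell\le 1$ for all primes $\ell\notin S_f$, embedded diagonally in $\mathbb Q_S$. Let $\mathbb N_S$ be the set of positive integers coprime to $p_1\cdots p_s$ and $\mathbb P_S$ the set of integers $p_1^{z_1}\cdots p_s^{z_s}$ with $z_j\ge 0$. For $q\in\mathbb N_S$ and $\mathbf k\in\mathbb Z_S^n$ put $\gcd(q,\mathbf k)=\gcd(q,\mathbf k')$, where $\mathbf k'$ is any integral vector in $\mathbb P_S\cdot\mathbf k$. On $\mathbb Q_S^d$ we use the product $d\mathbf v$ of Lebesgue measure on $\mathbb R^d$ and the Haar measures on $\mathbb Q_p^d$ with $\mathrm{vol}(\mathbb Z_p^d)=1$ ($p\in S_f$). Let $\mathrm{UL}_d(\mathbb Q_S)$ be the group of $\mathsf g=(g_p)_{p\in S}\in\prod_{p\in S}\mathrm{GL}_d(\mathbb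 Q_p)$ with $\det g_\infty=1$ and $|\det g_p|_p=1$ for $p\in S_f$, let $\mathrm{UL}_d(\mathbb Z_S)=\mathrm{UL}_d(\mathbb Q_S)\cap\mathrm{GL}_d(\mathbb Z_S)=\mathrm{SL}_d(\mathbb Z_S)$, and let $\widetilde\mu_S$ and $\widetilde\nu_S$ be the Haar measures of $\mathrm{UL}_d(\mathbb Q_S)$ and $\mathrm{SL}_d(\mathbb Q_S)$ for which $\mathrm{UL}_d(\mathbb Z_S)\backslash\mathrm{UL}_d(\mathbb Q_S)$ and $\mathrm{SL}_d(\mathbb Z_S)\backslash\mathrm{SL}_d(\mathbb Q_S)$ have total mass $1$. Let $1\ne q\in\mathbb N_S$ and $\mathbf p\in\mathbb Z_S^d$ with $\gcd(q,\mathbf p)=1$, and set $$Y_{\mathbf p/q}=\{(\mathbb Z_S^d+\tfrac{\mathbf p}{q})\mathsf g:\mathsf g\in\mathrm{UL}_d(\mathbb Q_S)\},\qquad Z_{\mathbf p/q}=\{(\mathbb Z_S^d+\tfrac{\mathbf p}{q})\mathsf g:\mathsf g\in\mathrm{SL}_d(\mathbb Q_S)\}.$$ These are the quotients of $\mathrm{UL}_d(\mathbb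 Q_S)$ and $\mathrm{SL}_d(\mathbb Q_S)$ by the stabilizer of $\mathbb Z_S^d+\mathbf p/q$, and carry the measures induced by $\widetilde\mu_S$ and $\widetilde\nu_S$. Let $f:\mathbb Q_S^d\to\mathbb R$ be a bounded Borel measurable function of compact support, and let $\widehat f(\Lambda)=\sum_{\mathbf k\in\Lambda}f(\mathbf k)$. (a) Let $d\ge 2$. Then the normalized measures $\widetilde\mu_S,\widetilde\nu_S$ exist, $J_q:=\widetilde\mu_S(Y_{\mathbf p/q})=\widetilde\nu_S(Z_{\mathbf p/q})$ is positive and finite, $\widehat f$ is integrable on $Y_{\mathbf p/q}$ and on $Z_{\mathbf p/q}$, and $$\frac1{J_q}\int_{Y_{\mathbf p/q}}\widehat f\,d\widetilde\mu_S=\frac1{J_q}\int_{Z_{\mathbf p/q}}\widehat f\,d\widetilde\nu_S=\int_{\mathbb Q_S^d}f(\mathbf v)\,d\mathbf v .$$ (b) Let $d\ge 3$. Then $\widehat f^{\,2}$ is integrable on $Y_{\mathbf p/q}$ and on $Z_{\mathbf p/q}$, and $$\frac1{J_q}\int_{Y_{\mathbf p/q}}\widehat f^{\,2}\,d\widetilde\mu_S=\frac1{J_q}\int_{Z_{\mathbf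 p/q}}\widehat f^{\,2}\,d\widetilde\nu_S=\Big(\int_{\mathbb Q_S^d}f\,d\mathbf v\Big)^2+\sum_{\substack{t\in\mathbb N_S\\ \gcd(t,q)=1}}\ \sum_{\substack{a\in q\mathbb Z_S+t\\ \gcd(a,t)=1}}\int_{\mathbb Q_S^d}f(t\mathbf v)f(a\mathbf v)\,d\mathbf v,$$ where the double series converges absolutely. -/

import Mathlib

open MeasureTheory Matrix
open scoped ENNReal

noncomputable section

namespace SArith

/-! A finite set `S` of primes stands for the set of places `S ∪ {∞}`. -/

/-- The prime numbers. -/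
abbrev Prm : Type := {p : ℕ // p.Prime}

instance factPrime (p : Prm) : Fact (p : ℕ).Prime := ⟨p.2⟩

/-! ### The measure on `ℚ_p` -/

instance padicMeasurableSpace (p : Prm) : MeasurableSpace ℚ_[p] := borel _

instance padicBorelSpace (p : Prm) : BorelSpace ℚ_[p] := ⟨rfl⟩

/-- The compact open unit ball `ℤ_p` of `ℚ_p`. -/
def padicUnitBall (p : Prm) : TopologicalSpace.PositiveCompacts ℚ_[p] where
  carrier := Metric.closedBall 0 1
  isCompact' := isCompact_closedBall 0 1
  interior_nonempty' :=
    ⟨0, Metric.ball_subset_interior_closedBall (Metric.mem_ball_self one_pos)⟩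

/-- `volume` on `ℚ_p` is the Haar measure which gives `ℤ_p` mass `1`. -/
instance padicMeasureSpace (p : Prm) : MeasureSpace ℚ_[p] where
  volume := Measure.addHaarMeasure (padicUnitBall p)

instance padicIsAddHaar (p : Prm) : (volume : Measure ℚ_[p]).IsAddHaarMeasure :=
  Measure.isAddHaarMeasure_addHaarMeasure (padicUnitBall p)

/-! ### The ring `ℚ_S` and the ring of `S`-integers -/

/-- `ℚ_S = ℝ × ∏_{p ∈ S} ℚ_p`, with the product topology, ring structure and measure. The measure
on `ℚ_S ^ d = (Fin d → QS S)` is the product measure `volume`. -/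
abbrev QS (S : Finset Prm) : Type := ℝ × (∀ p : S, ℚ_[(p : Prm)])

/-- The ring of `S`-integers, as a subring of `ℚ`: rationals `z` with `|z|_ℓ ≤ 1` for every
prime `ℓ ∉ S`. -/
def ZS (S : Finset Prm) : Subring ℚ where
  carrier := {z | ∀ l : Prm, l ∉ S → ‖(z : ℚ_[l])‖ ≤ 1}
  mul_mem' := by
    intro a b ha hb l hl
    have h1 := ha l hl
    have h2 := hb l hl
    push_cast
    rw [norm_mul]
    exact mul_le_one₀ h1 (norm_nonneg _) h2
  one_mem' := by intro l _; simp
  add_mem' := by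
    intro a b ha hb l hl
    push_cast
    exact (Padic.nonarchimedean _ _).trans (max_le (ha l hl) (hb l hl))
  zero_mem' := by intro l _; simp
  neg_mem' := by
    intro a ha l hl
    push_cast
    rw [norm_neg]
    exact ha l hl

/-- The diagonal embedding `ℤ_S → ℚ_S`. -/
def diag (S : Finset Prm) : ZS S →+* QS S := (algebraMap ℚ (QS S)).comp (ZS S).subtype

/-- Positive integers coprime to all primes in `S`. -/
def NS (S : Finset Prm) : Set ℕ := {n | 0 < n ∧ ∀ p ∈ S, Nat.Coprime n p}

/-- Positive integers all of whose prime factors lie in `S`. -/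
def PS (S : Finset Prm) : Set ℕ := {n | 0 < n ∧ ∀ l : Prm, (l : ℕ) ∣ n → l ∈ S}

/-- `gcd(q, k) = 1` for `q ∈ ℕ_S` and a vector `k` of `S`-integers: `gcd(q, k') = 1` for an integral
vector `k'` that is a multiple of `k` by an element of `ℙ_S`. (For `q ∈ ℕ_S` the choice of `k'` is
immaterial.) -/
def CoprimeS (S : Finset Prm) {n : ℕ} (q : ℕ) (k : Fin n → ZS S) : Prop :=
  ∃ c ∈ PS S, ∃ k' : Fin n → ℤ, (∀ i, (k' i : ℚ) = c * (k i : ℚ)) ∧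
    Nat.gcd q (Finset.univ.gcd fun i => (k' i).natAbs) = 1

/-! ### The groups -/

/-- `UL_d(ℚ_S)`, as a subgroup of `GL_d(ℚ_S)`: real determinant `1`, and `p`-adic determinants of
absolute value `1`. -/
def UL (S : Finset Prm) (d : ℕ) : Subgroup (GL (Fin d) (QS S)) where
  carrier := {g | (g : Matrix (Fin d) (Fin d) (QS S)).det.1 = 1 ∧
    ∀ p : S, ‖(g : Matrix (Fin d) (Fin d) (QS S)).det.2 p‖ = 1}
  mul_mem' := by
    rintro a b ⟨ha, ha'⟩ ⟨hb, hb'⟩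
    refine ⟨by simp [ha, hb], fun p => by simp [ha' p, hb' p]⟩
  one_mem' := by simp
  inv_mem' := by
    rintro a ⟨ha, ha'⟩
    have h : (a : Matrix (Fin d) (Fin d) (QS S)).det *
        ((a⁻¹ : GL (Fin d) (QS S)) : Matrix (Fin d) (Fin d) (QS S)).det = 1 := by
      rw [← Matrix.det_mul, ← Units.val_mul, mul_inv_cancel]; simp
    refine ⟨?_, fun p => ?_⟩
    · have := congrArg Prod.fst h
      rw [Prod.fst_mul, ha, one_mul] at this
      exact this
    · have := congrArg (fun x : QS S => ‖x.2 p‖) h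
      simp only [Prod.snd_mul, Pi.mul_apply, norm_mul, ha' p, one_mul, Prod.snd_one,
        Pi.one_apply, norm_one] at this
      exact this

/-- `SL_d(ℚ_S)`, as a subgroup of `GL_d(ℚ_S)`. -/
def SL (S : Finset Prm) (d : ℕ) : Subgroup (GL (Fin d) (QS S)) where
  carrier := {g | (g : Matrix (Fin d) (Fin d) (QS S)).det = 1}
  mul_mem' := by
    intro a b (ha : _ = _) (hb : _ = _)
    simp [ha, hb]
  one_mem' := by simp
  inv_mem' := by
    intro a (ha : _ = _)
    have h : (a : Matrix (Fin d) (Fin d) (QS S)).det *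
        ((a⁻¹ : GL (Fin d) (QS S)) : Matrix (Fin d) (Fin d) (QS S)).det = 1 := by
      rw [← Matrix.det_mul, ← Units.val_mul, mul_inv_cancel]; simp
    rw [ha, one_mul] at h
    exact h

variable {S : Finset Prm} {d : ℕ}

lemma continuous_det : Continuous fun g : GL (Fin d) (QS S) =>
    (g : Matrix (Fin d) (Fin d) (QS S)).det :=
  Continuous.matrix_det Units.continuous_val

lemma isClosed_UL : IsClosed (UL S d : Set (GL (Fin d) (QS S))) := by
  have h1 : IsClosed {g : GL (Fin d) (QS S) |
      (g : Matrix (Fin d) (Fin d) (QS S)).det.1 = 1} :=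
    isClosed_eq (continuous_fst.comp continuous_det) continuous_const
  have h2 : ∀ p : S, IsClosed {g : GL (Fin d) (QS S) |
      ‖(g : Matrix (Fin d) (Fin d) (QS S)).det.2 p‖ = 1} := fun p =>
    isClosed_eq (continuous_norm.comp ((continuous_apply p).comp
      (continuous_snd.comp continuous_det))) continuous_const
  have h3 := h1.inter (isClosed_iInter h2)
  convert h3 using 1
  ext g
  simp [UL, Set.mem_iInter]

lemma isClosed_SL : IsClosed (SL S d : Set (GL (Fin d) (QS S))) :=
  isClosed_eq continuous_det continuous_const

instance locallyCompactGL : LocallyCompactSpace (GL (Fin d) (QS S)) :=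
  haveI : LocallyCompactSpace (Matrix (Fin d) (Fin d) (QS S)) :=
    inferInstanceAs (LocallyCompactSpace (Fin d → Fin d → QS S))
  inferInstanceAs (LocallyCompactSpace (Matrix (Fin d) (Fin d) (QS S))ˣ)

instance locallyCompactUL : LocallyCompactSpace (UL S d) :=
  isClosed_UL.isClosedEmbedding_subtypeVal.locallyCompactSpace

instance locallyCompactSL : LocallyCompactSpace (SL S d) :=
  isClosed_SL.isClosedEmbedding_subtypeVal.locallyCompactSpace

/-! Below, `H` is one of the groups `UL_d(ℚ_S)` and `SL_d(ℚ_S)`. -/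

instance groupMeasurableSpace (H : Subgroup (GL (Fin d) (QS S))) : MeasurableSpace H := borel _

instance groupBorelSpace (H : Subgroup (GL (Fin d) (QS S))) : BorelSpace H := ⟨rfl⟩

/-- The arithmetic subgroup `H(ℤ_S) = H ∩ GL_d(ℤ_S)`, with `GL_d(ℤ_S)` embedded diagonally. -/
def integralPoints (H : Subgroup (GL (Fin d) (QS S))) : Subgroup H :=
  (Matrix.GeneralLinearGroup.map (n := Fin d) (diag S)).range.subgroupOf H

/-- The Haar measure on `H`, normalized such that `H(ℤ_S) \ H` has total mass `1`. -/
def normHaar (H : Subgroup (GL (Fin d) (QS S))) [LocallyCompactSpace H] : Measure H :=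
  (covolume (integralPoints H) H (Measure.haar : Measure H))⁻¹ • (Measure.haar : Measure H)

/-! ### Spaces of shifted lattices -/

/-- The shifted lattice `ℤ_S^d + p/q` in `ℚ_S^d`. -/
def shiftedLattice (q : ℕ) (p : Fin d → ZS S) : Set (Fin d → QS S) :=
  Set.range fun (k : Fin d → ZS S) (i : Fin d) =>
    algebraMap ℚ (QS S) ((k i : ℚ) + (p i : ℚ) / (q : ℚ))

/-- `Λ g` for a set `Λ` of row vectors. -/
def translate (Λ : Set (Fin d → QS S)) (g : GL (Fin d) (QS S)) : Set (Fin d → QS S) :=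
  (fun v => v ᵥ* (g : Matrix (Fin d) (Fin d) (QS S))) '' Λ

/-- The space `{Λ g : g ∈ H}`. -/
def OrbitSpace (H : Subgroup (GL (Fin d) (QS S))) (Λ : Set (Fin d → QS S)) : Type :=
  {L : Set (Fin d → QS S) // ∃ g : H, L = translate Λ g}

/-- The orbit map `g ↦ Λ g`. -/
def orbitMap (H : Subgroup (GL (Fin d) (QS S))) (Λ : Set (Fin d → QS S)) (g : H) :
    OrbitSpace H Λ := ⟨translate Λ g, g, rfl⟩

lemma translate_mul (Λ : Set (Fin d → QS S)) (g h : GL (Fin d) (QS S)) :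
    translate Λ (g * h) = translate (translate Λ g) h := by
  simp [translate, Set.image_image, Matrix.vecMul_vecMul]

lemma translate_one (Λ : Set (Fin d → QS S)) : translate Λ 1 = Λ := by
  simp [translate]

/-- The group `{g ∈ H : Λ g = Λ}`, so that `OrbitSpace H Λ` is the quotient `stab H Λ \ H`. -/
def stab (H : Subgroup (GL (Fin d) (QS S))) (Λ : Set (Fin d → QS S)) : Subgroup H where
  carrier := {g | translate Λ g = Λ}
  mul_mem' := by
    intro a b (ha : _ = _) (hb : _ = _)
    simp [translate_mul, ha, hb]
  one_mem' := translate_one Λ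
  inv_mem' := by
    intro a (ha : _ = _)
    have h : translate Λ ((a : GL (Fin d) (QS S)) * (a : GL (Fin d) (QS S))⁻¹) = Λ := by
      rw [mul_inv_cancel, translate_one]
    rw [translate_mul, ha] at h
    exact h

/-- The quotient σ-algebra. -/
instance orbitMeasurableSpace (H : Subgroup (GL (Fin d) (QS S))) (Λ : Set (Fin d → QS S)) :
    MeasurableSpace (OrbitSpace H Λ) :=
  MeasurableSpace.map (orbitMap H Λ) inferInstance

open scoped Classical in
/-- The measure induced on `OrbitSpace H Λ = stab H Λ \ H` by the normalized Haar measure of `H`: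
the image of its restriction to a fundamental domain for the left action of `stab H Λ` on `H` (it
does not depend on the fundamental domain; junk value `0` if there is none). -/
def orbitMeasure (H : Subgroup (GL (Fin d) (QS S))) [LocallyCompactSpace H]
    (Λ : Set (Fin d → QS S)) : Measure (OrbitSpace H Λ) :=
  if h : HasFundamentalDomain (stab H Λ) H (normHaar H) then
    ((normHaar H).restrict h.ExistsIsFundamentalDomain.choose).map (orbitMap H Λ)
  else 0

/-- `Y_{p/q} = {(ℤ_S^d + p/q) g : g ∈ UL_d(ℚ_S)}`. -/
abbrev Y (q : ℕ) (p : Fin d → ZS S) : Type := OrbitSpace (UL S d) (shiftedLattice q p)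

/-- `Z_{p/q} = {(ℤ_S^d + p/q) g : g ∈ SL_d(ℚ_S)}`. -/
abbrev Z (q : ℕ) (p : Fin d → ZS S) : Type := OrbitSpace (SL S d) (shiftedLattice q p)

/-- The measure `μ̃_S` on `Y_{p/q}`. -/
abbrev muY (q : ℕ) (p : Fin d → ZS S) : Measure (Y q p) :=
  orbitMeasure (UL S d) (shiftedLattice q p)

/-- The measure `ν̃_S` on `Z_{p/q}`. -/
abbrev nuZ (q : ℕ) (p : Fin d → ZS S) : Measure (Z q p) :=
  orbitMeasure (SL S d) (shiftedLattice q p)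

/-- The Siegel transform `f̂(Λ) = ∑_{k ∈ Λ} f(k)`. -/
def siegel (f : (Fin d → QS S) → ℝ) (Λ : Set (Fin d → QS S)) : ℝ := ∑' k : Λ, f k

/-! ### The index sets of the second moment formula -/

/-- `{t ∈ ℕ_S : gcd(t, q) = 1}`. -/
def indexT (S : Finset Prm) (q : ℕ) : Set ℕ := {t | t ∈ NS S ∧ Nat.gcd t q = 1}

/-- `{a ∈ q ℤ_S + t : gcd(a, t) = 1}`. -/
def indexA (S : Finset Prm) (q t : ℕ) : Set (ZS S) :=
  {a | (∃ b : ZS S, a = q * b + t) ∧ CoprimeS S t ![a]}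

/-- `∫ f(t v) f(a v) dv` over `ℚ_S^d`. -/
def pairIntegral (f : (Fin d → QS S) → ℝ) (t : ℕ) (a : ZS S) : ℝ :=
  ∫ v : Fin d → QS S, f ((t : ℚ) • v) * f ((a : ℚ) • v)

end SArith

end

open MeasureTheory Matrix
open scoped ENNReal

set_option linter.unusedSectionVars false

noncomputable section

namespace SArith

/-! ### Linear substitutions and Haar measure -/

section Substitution

variable {R : Type*} [CommRing R]
variable {E : Type*} [AddCommGroup E] [Module R E]
variable {n : Type*} [Fintype n]

/-! Let `Γ = SL_d(ℤ_S)`, which is the group of integral points of `UL_d(ℚ_S)` as well as of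
`SL_d(ℚ_S)`. Both groups are treated at once as a group `H` of matrices cut out by a condition on
the determinant (`IsDetKernel`). The stabilizer of `ℤ_S^d + p/q` has finite index in `Γ`: its cosets
correspond to the finitely many classes `x_j` of the orbit `(p/q)Γ` modulo `ℤ_S^d`. An integral over
the orbit space is therefore an integral, over a fundamental domain of `Γ` of mass one, of a sum
over the lattices `ℤ_S^d + x_j`. So `J_q` is the number of classes, for either group.

Mean values up to a constant. By Siegel's unfolding, a sum over the tuples of rows of elements of
`Γ` has mean `c ∫ Φ` with `c` finite (`lintegral_prim`, `normHaar_properties`). The unfolding takes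
place in the additive space of matrices, where Haar measure is `Γ`-invariant and Fubini splits off
rows; it is carried to `H` by an equivariant projection that rescales one column. Together with a
pigeonhole argument of Minkowski type, the same unfolding yields finiteness of the covolume by
induction on the dimension (`volume_isStrictFD_lt_top`). A `Γ`-invariant set of rational tuples,
each an invertible matrix times a primitive tuple, decomposes into orbits and so has mean `C ∫ Φ`
with some unknown `C` (`exists_const_of_invariant`).

The constants. No zeta value is computed. With `Φ` the indicator of a box of side `2N`, every
shifted lattice of covolume one contains about as many points as the volume of the box, and the
normalized counts are dominated by an integrable function (`tendsto_lintegral_latCount`). Letting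
`N` tend to infinity determines `C`.

First moment. Since `q ≠ 1`, the shifted lattices do not contain the origin, all their vectors are
rational multiples of primitive rows, and `C` is the number of classes (`ShiftFamily.first_moment`).

Second moment. The square of the Siegel transform is a sum over pairs of vectors of one shifted
lattice. The linearly independent pairs form an invariant set and contribute `C ∫∫`. The dependent
pairs are exactly the `(t v, a v)` with `(t, a)` in the index set of the formula and `v` in the
lattice shifted by `t⁻¹ x_j`, the inverse being taken modulo `q` (`ShiftFamily.dependent_iff`); the
first moment of these lattices gives the integrals of `f(t v) f(a v)`. For `d ≥ 3` the sum of
`‖z‖⁻ᵈ` over coprime integer pairs converges, so dependent pairs contribute only `O(N^d)` to a count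
of order `N^(2d)`, and `C` is again the number of classes (`ShiftFamily.second_moment`).

All of this concerns functions with values in `[0, ∞]`; `integral_tsum_of_lintegral_tsum` extends it
to signed functions. -/

/-- The action of a matrix on tuples of elements of a module. -/
def actE (A : Matrix n n R) (x : n → E) : n → E := fun i => ∑ j, A i j • x j

lemma actE_mul (A B : Matrix n n R) (x : n → E) : actE (A * B) x = actE A (actE B x) := by
  funext i
  simp only [actE, Matrix.mul_apply, Finset.sum_smul, Finset.smul_sum, mul_smul]
  rw [Finset.sum_comm]

variable [TopologicalSpace E] [IsTopologicalAddGroup E] [LocallyCompactSpace E]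
  [ContinuousConstSMul R E] [SecondCountableTopology E] [MeasureSpace E] [BorelSpace E]
  [(volume : Measure E).IsAddHaarMeasure]

lemma continuous_actE (A : Matrix n n R) : Continuous (actE A : (n → E) → n → E) := by
  unfold actE
  fun_prop

lemma measurable_actE (A : Matrix n n R) : Measurable (actE A : (n → E) → n → E) :=
  (continuous_actE A).measurable

variable (E) in
/-- `A` has invertible determinant and scales the measure of `n → E` by the Haar modulus of its
determinant. -/
def Scales [DecidableEq n] (A : Matrix n n R) : Prop :=
  ∃ u : Rˣ, (u : R) = A.det ∧
    (distribHaarChar E u) • Measure.map (actE A) (volume : Measure (n → E)) = volume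

variable [DecidableEq n]

lemma Scales.mul {A B : Matrix n n R} (hA : Scales E A) (hB : Scales E B) : Scales E (A * B) := by
  obtain ⟨u, hu, hA⟩ := hA
  obtain ⟨v, hv, hB⟩ := hB
  refine ⟨u * v, by simp [hu, hv], ?_⟩
  have : (actE (A * B) : (n → E) → n → E) = actE A ∘ actE B := by
    funext x; exact actE_mul A B x
  rw [this, ← Measure.map_map (measurable_actE A) (measurable_actE B), map_mul, mul_smul,
    ← Measure.map_smul, hB, hA]

/-- A shear translates one coordinate by a multiple of another, so translation invariance in that
single coordinate suffices. -/
lemma scales_transvection (t : TransvectionStruct n R) : Scales E t.toMatrix := by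
  refine ⟨1, by simp, ?_⟩
  rw [map_one, one_smul]
  have ht : Measurable (actE t.toMatrix : (n → E) → n → E) := measurable_actE _
  refine (Measure.pi_eq fun s hs ↦ ?_).symm
  have h2s : MeasurableSet (Set.univ.pi s) := .pi Set.countable_univ fun i _ ↦ hs i
  simp_rw [← Measure.pi_pi, ← lintegral_indicator_one h2s]
  rw [lintegral_map (measurable_one.indicator h2s) ht, volume_pi]
  -- Integrate first over the coordinate moved by the shear, with all the others fixed.
  refine lintegral_eq_of_lmarginal_eq {t.i} ((measurable_one.indicator h2s).comp ht)
    (measurable_one.indicator h2s) ?_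
  simp_rw [lmarginal_singleton]
  ext x
  obtain ⟨i, j, hij, c⟩ := t
  have key : ∀ y : E, actE (TransvectionStruct.toMatrix ⟨i, j, hij, c⟩) (Function.update x i y) =
      Function.update x i (y + c • x j) := by
    intro y
    funext k
    simp only [actE, TransvectionStruct.toMatrix_mk, transvection, Matrix.add_apply, add_smul,
      Finset.sum_add_distrib, Matrix.one_apply, ite_smul, one_smul, zero_smul,
      Finset.sum_ite_eq, Finset.mem_univ, if_true, Matrix.single_apply]
    by_cases hk : k = i
    · subst hk
      simp [Function.update_of_ne hij.symm]
    · simp [hk, Ne.symm hk]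
  simp only [key]
  exact lintegral_add_right_eq_self
    (fun y ↦ Set.indicator (Set.univ.pi s) 1 (Function.update x i y)) _

lemma scales_diagonal (w : n → Rˣ) : Scales E (Matrix.diagonal fun i => (w i : R)) := by
  refine ⟨∏ i, w i, by simp, ?_⟩
  refine (Measure.pi_eq fun s hs ↦ ?_).symm
  have h2s : MeasurableSet (Set.univ.pi s) := .pi Set.countable_univ fun i _ ↦ hs i
  rw [Measure.smul_apply, Measure.map_apply (measurable_actE _) h2s]
  have : (actE (Matrix.diagonal fun i => (w i : R)) : (n → E) → n → E) ⁻¹' Set.univ.pi s =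
      Set.univ.pi fun i => (fun x : E => (w i) • x) ⁻¹' s i := by
    ext x
    simp [actE, Matrix.diagonal_apply, Units.smul_def]
  rw [this, volume_pi_pi, map_prod, ENNReal.smul_def, smul_eq_mul, ENNReal.ofNNReal_finsetProd,
    ← Finset.prod_mul_distrib]
  refine Finset.prod_congr rfl fun i _ => ?_
  rw [distribHaarChar_mul]
  congr 1
  ext x
  rw [Set.mem_smul_set_iff_inv_smul_mem, Set.mem_preimage, smul_inv_smul]

/-- The matrix over `R` which is `M` on the factor `K` and the identity elsewhere. -/
def embFactor {K : Type*} [Field K] (j : K →ₙ+* R) (M : Matrix n n K) : Matrix n n R :=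
  fun a b => (if a = b then 1 - j 1 else 0) + j (M a b)

lemma embFactor_diagonal {K : Type*} [Field K] (j : K →ₙ+* R) (D : n → K) :
    embFactor j (Matrix.diagonal D) = Matrix.diagonal fun i => 1 - j 1 + j (D i) := by
  ext a b
  by_cases h : a = b
  · subst h; simp [embFactor]
  · simp [embFactor, h]

/-- `j 1` and `1 - j 1` are orthogonal idempotents, so the mixed products vanish. -/
lemma embFactor_mul {K : Type*} [Field K] (j : K →ₙ+* R) (M N : Matrix n n K) :
    embFactor j (M * N) = embFactor j M * embFactor j N := by
  have h1 : ∀ x : K, (1 - j 1) * j x = 0 := fun x => by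
    rw [sub_mul, one_mul, ← map_mul, one_mul, sub_self]
  have h2 : ∀ x : K, j x * (1 - j 1) = 0 := fun x => by rw [mul_comm, h1]
  have h3 : (1 - j 1) * (1 - j 1) = 1 - j 1 := by
    rw [mul_sub, mul_one, h1, sub_zero]
  ext a b
  simp only [embFactor, Matrix.mul_apply, map_sum, map_mul, add_mul, mul_add,
    Finset.sum_add_distrib, ite_mul, mul_ite, zero_mul, mul_zero, h1, h2, h3, ite_self,
    add_zero, zero_add]
  simp

lemma embFactor_transvection {K : Type*} [Field K] (j : K →ₙ+* R) (a b : n) (c : K) :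
    embFactor j (transvection a b c) = transvection a b (j c) := by
  ext x y
  by_cases h : x = y
  · subst h
    simp only [embFactor, transvection, Matrix.add_apply, Matrix.one_apply_eq, if_true, map_add,
      Matrix.single_apply]
    split_ifs <;> (try rw [map_zero]) <;> ring
  · simp only [embFactor, transvection, Matrix.add_apply, Matrix.one_apply_ne h, if_neg h, map_add,
      Matrix.single_apply]
    split_ifs <;> simp

/-- Over a field, an invertible matrix is a product of transvections and a diagonal matrix, and both
kinds embed into matrices of the same kind over `R`. As `R` itself is not a field, elimination is
done one factor at a time. -/
lemma scales_embFactor {K : Type*} [Field K] (j : K →ₙ+* R) (M : Matrix n n K) (hM : M.det ≠ 0) :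
    Scales E (embFactor j M) := by
  refine diagonal_transvection_induction_of_det_ne_zero (fun M => Scales E (embFactor j M)) M hM
    ?_ ?_ ?_
  · intro D hD
    have hD' : ∀ i, D i ≠ 0 := by
      rw [Matrix.det_diagonal, Finset.prod_ne_zero_iff] at hD
      exact fun i => hD i (Finset.mem_univ i)
    rw [embFactor_diagonal]
    have hmul : ∀ x y : K, x * y = 1 → (1 - j 1 + j x) * (1 - j 1 + j y) = 1 := by
      intro x y hxy
      have e : ∀ z, j 1 * j z = j z := fun z => by rw [← map_mul, one_mul]
      have e2 : j x * j y = j 1 := by rw [← map_mul, hxy]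
      have e3 := e 1
      have e4 := e x
      have e5 := e y
      linear_combination e3 - e4 - e5 + e2
    exact scales_diagonal (E := E) (fun i => ⟨1 - j 1 + j (D i), 1 - j 1 + j (D i)⁻¹,
      hmul _ _ (mul_inv_cancel₀ (hD' i)), hmul _ _ (inv_mul_cancel₀ (hD' i))⟩)
  · intro t
    obtain ⟨a, b, hab, c⟩ := t
    have := scales_transvection (E := E) (⟨a, b, hab, j c⟩ : TransvectionStruct n R)
    simp only [TransvectionStruct.toMatrix_mk] at this ⊢
    rwa [embFactor_transvection]
  · intro A B _ _ hA hB
    rw [embFactor_mul]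
    exact hA.mul hB

end Substitution

end SArith
end

open MeasureTheory Matrix
open scoped ENNReal Pointwise

set_option linter.unusedSectionVars false

noncomputable section

namespace SArith

/-! ### The ring `ℚ_S`: measure, units, and the lattice `ℤ_S` -/

variable {S : Finset Prm}

instance isAddHaarMeasure_volume_pi {n E : Type*} [Fintype n] [AddGroup E] [TopologicalSpace E]
    [IsTopologicalAddGroup E] [SecondCountableTopology E] [MeasureSpace E] [BorelSpace E]
    [SigmaFinite (volume : Measure E)]
    [(volume : Measure E).IsAddHaarMeasure] : (volume : Measure (n → E)).IsAddHaarMeasure :=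
  inferInstanceAs (Measure.pi fun _ : n => (volume : Measure E)).IsAddHaarMeasure

instance isAddHaarMeasure_volume_padicProd :
    (volume : Measure (∀ p : S, ℚ_[(p : Prm)])).IsAddHaarMeasure :=
  inferInstanceAs (Measure.pi fun p : S => (volume : Measure ℚ_[(p : Prm)])).IsAddHaarMeasure

instance isAddHaarMeasure_volume_QS : (volume : Measure (QS S)).IsAddHaarMeasure :=
  inferInstanceAs ((volume : Measure ℝ).prod
    (volume : Measure (∀ p : S, ℚ_[(p : Prm)]))).IsAddHaarMeasure

/-- The componentwise inverse on `ℚ_S`. -/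
def invR (x : QS S) : QS S := (x.1⁻¹, fun p => (x.2 p)⁻¹)

lemma measurable_invR : Measurable (invR : QS S → QS S) := by
  unfold invR
  refine Measurable.prodMk (by fun_prop) (measurable_pi_lambda _ fun p => ?_)
  exact ((measurable_pi_apply p).comp measurable_snd).inv

lemma isUnit_iff {x : QS S} : IsUnit x ↔ x.1 ≠ 0 ∧ ∀ p, x.2 p ≠ 0 := by
  rw [Prod.isUnit_iff, Pi.isUnit_iff]
  simp [isUnit_iff_ne_zero]

lemma mul_invR {x : QS S} (hx : IsUnit x) : x * invR x = 1 := by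
  obtain ⟨h1, h2⟩ := isUnit_iff.1 hx
  refine Prod.ext ?_ (funext fun p => ?_)
  · simp [invR, h1]
  · simp [invR, h2 p]

/-- The elements of `ℚ_S` with positive real component and `p`-adic components of absolute
value `1`. -/
def unitSet (S : Finset Prm) : Set (QS S) := {x | 0 < x.1 ∧ ∀ p, ‖x.2 p‖ = 1}

lemma isUnit_of_mem_unitSet {x : QS S} (hx : x ∈ unitSet S) : IsUnit x :=
  isUnit_iff.2 ⟨hx.1.ne', fun p h => by have := hx.2 p; simp [h] at this⟩

lemma mul_mem_unitSet {x y : QS S} (hx : x ∈ unitSet S) (hy : y ∈ unitSet S) :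
    x * y ∈ unitSet S :=
  ⟨mul_pos hx.1 hy.1, fun p => by simp [hx.2 p, hy.2 p]⟩

lemma invR_mem_unitSet {x : QS S} (hx : x ∈ unitSet S) : invR x ∈ unitSet S :=
  ⟨inv_pos.2 hx.1, fun p => by simp [invR, hx.2 p]⟩

lemma one_mem_unitSet : (1 : QS S) ∈ unitSet S := ⟨by simp, fun p => by simp⟩

lemma isOpen_unitSet : IsOpen (unitSet S) := by
  have h1 : IsOpen {x : QS S | 0 < x.1} := isOpen_lt continuous_const continuous_fst
  have h2 : ∀ p : S, IsOpen {x : QS S | ‖x.2 p‖ = 1} := by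
    intro p
    have : {x : QS S | ‖x.2 p‖ = 1} =
        (fun x : QS S => x.2 p) ⁻¹' Metric.sphere (0 : ℚ_[(p : Prm)]) 1 := by
      ext x; simp
    rw [this]
    exact (IsUltrametricDist.isOpen_sphere (0 : ℚ_[(p : Prm)]) one_ne_zero).preimage
      ((continuous_apply p).comp continuous_snd)
  have h3 := h1.inter (isOpen_iInter_of_finite h2)
  convert h3 using 1
  ext x
  simp [unitSet]

/-- The set of `x ∈ ℚ_S` with real component in `I` and integral `p`-adic components. -/
def boxR (S : Finset Prm) (I : Set ℝ) : Set (QS S) := {x | x.1 ∈ I ∧ ∀ p, ‖x.2 p‖ ≤ 1}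

lemma boxR_eq (I : Set ℝ) : boxR S I =
    I ×ˢ Set.univ.pi fun p : S => Metric.closedBall (0 : ℚ_[(p : Prm)]) 1 := by
  ext x; simp [boxR]

lemma measurableSet_boxR {I : Set ℝ} (hI : MeasurableSet I) : MeasurableSet (boxR S I) := by
  rw [boxR_eq]
  exact hI.prod (MeasurableSet.univ_pi fun p => Metric.isClosed_closedBall.measurableSet)

lemma volume_padic_closedBall (p : Prm) :
    volume (Metric.closedBall (0 : ℚ_[p]) 1) = 1 :=
  Measure.addHaarMeasure_self (K₀ := padicUnitBall p)

lemma volume_boxR (I : Set ℝ) : volume (boxR S I) = volume I := by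
  rw [boxR_eq, Measure.volume_eq_prod, Measure.prod_prod, volume_pi_pi]
  simp [volume_padic_closedBall]

/-- The modulus is read off from the box `[-1, 1] × ∏ ℤ_p`: multiplication by a p-adic number of
absolute value one preserves `ℤ_p`, so only the real side changes length. -/
lemma distribHaarChar_QS (u : (QS S)ˣ) (hu : ∀ p, ‖(u : QS S).2 p‖ = 1) :
    distribHaarChar (QS S) u = ‖(u : QS S).1‖₊ := by
  have hu1 : (u : QS S).1 ≠ 0 := (isUnit_iff.1 u.isUnit).1
  have hv : volume (boxR S (Set.Icc (-1) 1)) = 2 := by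
    rw [volume_boxR, Real.volume_Icc]; norm_num
  refine distribHaarChar_eq_of_measure_smul_eq_mul (μ := volume)
    (s := boxR S (Set.Icc (-1) 1)) (by simp [hv]) (by simp [hv]) ?_
  have : u • boxR S (Set.Icc (-1) 1) =
      boxR S (Set.Icc (-|(u : QS S).1|) |(u : QS S).1|) := by
    ext x
    rw [Set.mem_smul_set_iff_inv_smul_mem, Units.smul_def, smul_eq_mul]
    have h1 : ∀ y : QS S, (u : QS S) * ((u⁻¹ : (QS S)ˣ) * y) = y := fun y => by
      rw [← mul_assoc]; simp
    constructor
    · rintro ⟨hx, hx'⟩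
      refine ⟨?_, fun p => ?_⟩
      · rw [Set.mem_Icc, ← abs_le] at hx
        rw [Set.mem_Icc, ← abs_le]
        conv_lhs => rw [← h1 x]
        rw [Prod.fst_mul, abs_mul]
        exact mul_le_of_le_one_right (abs_nonneg _) hx
      · conv_lhs => rw [← h1 x]
        rw [Prod.snd_mul, Pi.mul_apply, norm_mul, hu p, one_mul]
        exact hx' p
    · rintro ⟨hx, hx'⟩
      refine ⟨?_, fun p => ?_⟩
      · rw [Set.mem_Icc, ← abs_le] at hx ⊢
        rw [← h1 x, Prod.fst_mul, abs_mul] at hx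
        exact le_of_mul_le_mul_left (by simpa using hx) (abs_pos.2 hu1)
      · have := hx' p
        rw [← h1 x, Prod.snd_mul, Pi.mul_apply, norm_mul, hu p, one_mul] at this
        exact this
  rw [this, volume_boxR, hv, Real.volume_Icc, ← enorm_eq_nnnorm, ← ofReal_norm, Real.norm_eq_abs,
    show (2 : ℝ≥0∞) = ENNReal.ofReal 2 by simp, ← ENNReal.ofReal_mul (abs_nonneg _)]
  congr 1; ring

lemma distribHaarChar_pi {m : Type*} [Fintype m] {R E : Type*} [CommRing R] [AddCommGroup E]
    [Module R E] [TopologicalSpace E] [IsTopologicalAddGroup E] [LocallyCompactSpace E]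
    [ContinuousConstSMul R E] [SecondCountableTopology E] [MeasureSpace E] [BorelSpace E]
    [(volume : Measure E).IsAddHaarMeasure] (u : Rˣ) :
    distribHaarChar (m → E) u = distribHaarChar E u ^ Fintype.card m := by
  obtain ⟨K⟩ : Nonempty (TopologicalSpace.PositiveCompacts E) := inferInstance
  have h0 : volume (K : Set E) ≠ 0 := (Measure.measure_pos_of_nonempty_interior _ K.interior_nonempty).ne'
  have h1 : volume (K : Set E) ≠ ∞ := K.isCompact.measure_lt_top.ne
  refine distribHaarChar_eq_of_measure_smul_eq_mul (μ := volume)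
    (s := Set.univ.pi fun _ : m => (K : Set E)) ?_ ?_ ?_
  · rw [volume_pi_pi]; simp [h0]
  · rw [volume_pi_pi]; simp [ENNReal.pow_eq_top_iff, h1]
  · have : u • (Set.univ.pi fun _ : m => (K : Set E)) =
        Set.univ.pi fun _ : m => u • (K : Set E) := by
      ext x
      simp [Set.mem_smul_set_iff_inv_smul_mem]
    rw [this, volume_pi_pi, volume_pi_pi]
    simp [← distribHaarChar_mul, mul_pow]

/-! ### The tiling by `ℤ_S` -/

/-- This is the principal part of a p-adic number: a fraction `m / p ^ k` cancels the polar part at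
`p` and is integral at all other primes. -/
lemma exists_rat_approx (p : Prm) (x : ℚ_[p]) :
    ∃ a : ℚ, ‖x + a‖ ≤ 1 ∧ ∀ l : Prm, l ≠ p → ‖(a : ℚ_[l])‖ ≤ 1 := by
  have hp0 : ((p : ℕ) : ℚ_[p]) ≠ 0 := by exact_mod_cast p.2.ne_zero
  obtain ⟨k, hk⟩ : ∃ k : ℕ, ‖((p : ℕ) : ℚ_[p]) ^ k * x‖ ≤ 1 := by
    obtain ⟨k, hk⟩ := pow_unbounded_of_one_lt ‖x‖
      (show (1 : ℝ) < (p : ℕ) by exact_mod_cast p.2.one_lt)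
    refine ⟨k, ?_⟩
    rw [norm_mul, Padic.norm_p_pow, _root_.zpow_neg, zpow_natCast,
      inv_mul_le_iff₀ (by have := p.2.pos; positivity), mul_one]
    exact hk.le
  obtain ⟨y, hy⟩ : ∃ y : ℤ_[p], (y : ℚ_[p]) = ((p : ℕ) : ℚ_[p]) ^ k * x := ⟨⟨_, hk⟩, rfl⟩
  -- Division by `p ^ k` multiplies the norm by `p ^ k`, so this precision leaves an error of norm
  -- at most one.
  obtain ⟨m, hm⟩ := PadicInt.denseRange_intCast.exists_dist_lt y
    (ε := ((p : ℕ) : ℝ) ^ (-(k : ℤ))) (by have := p.2.pos; positivity)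
  rw [dist_eq_norm, PadicInt.norm_def, PadicInt.coe_sub, PadicInt.coe_intCast, hy] at hm
  refine ⟨-(m / (p : ℕ) ^ k), ?_, fun l hl => ?_⟩
  · push_cast
    have : x + -((m : ℚ_[p]) / ((p : ℕ) : ℚ_[p]) ^ k) =
        (((p : ℕ) : ℚ_[p]) ^ k * x - m) / ((p : ℕ) : ℚ_[p]) ^ k := by
      field_simp; ring
    rw [this, norm_div, Padic.norm_p_pow]
    exact div_le_one_of_le₀ hm.le (by positivity)
  · push_cast
    rw [norm_neg, norm_div, norm_pow]
    have : ‖((p : ℕ) : ℚ_[l])‖ = 1 := by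
      rw [Padic.norm_natCast_eq_one_iff]
      exact (Nat.coprime_primes l.2 p.2).2 fun h => hl (Subtype.ext h)
    rw [this, one_pow, div_one]
    exact Padic.norm_int_le_one m

lemma exists_int_eq {z : ZS S} (hz : ∀ p ∈ S, ‖((z : ℚ) : ℚ_[p])‖ ≤ 1) :
    ∃ m : ℤ, (z : ℚ) = m := by
  have hall : ∀ l : Prm, ‖((z : ℚ) : ℚ_[l])‖ ≤ 1 := fun l => by
    by_cases hl : l ∈ S
    · exact hz l hl
    · exact z.2 l hl
  have : (z : ℚ).den = 1 := by
    by_contra h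
    obtain ⟨l, hl, hd⟩ := Nat.exists_prime_and_dvd h
    have : Fact l.Prime := ⟨hl⟩
    have h1 := PadicInt.isUnit_iff.1 (PadicInt.isUnit_den (p := l) _ (hall ⟨l, hl⟩))
    rw [PadicInt.norm_natCast_eq_one_iff] at h1
    exact hl.one_lt.ne' (Nat.eq_one_of_dvd_coprimes h1 dvd_rfl hd)
  exact ⟨(z : ℚ).num, ((Rat.den_eq_one_iff _).1 this).symm⟩

@[simp] lemma diag_fst (z : ZS S) : (diag S z).1 = ((z : ℚ) : ℝ) := by
  simp [diag]

@[simp] lemma diag_snd (z : ZS S) (p : S) : (diag S z).2 p = ((z : ℚ) : ℚ_[(p : Prm)]) := by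
  simp [diag]

lemma diag_injective : Function.Injective (diag S) := by
  intro a b h
  have := congrArg Prod.fst h
  simp only [diag_fst, Rat.cast_inj] at this
  exact Subtype.ext this

/-- Discreteness of `ℤ_S` in `ℚ_S`: the p-adic conditions force `z` to be an ordinary integer, and
the real one leaves only zero. -/
lemma eq_zero_of_small {z : ZS S} (h1 : |((z : ℚ) : ℝ)| < 1)
    (h2 : ∀ p ∈ S, ‖((z : ℚ) : ℚ_[p])‖ ≤ 1) : z = 0 := by
  obtain ⟨m, hm⟩ := exists_int_eq h2
  have : |(m : ℝ)| < 1 := by rw [hm] at h1; simpa using h1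
  have hm0 : m = 0 := by
    rw [← Int.abs_lt_one_iff]; exact_mod_cast this
  refine Subtype.ext ?_
  rw [hm, hm0]; simp

lemma intCast_mem_ZS (m : ℤ) : (m : ℚ) ∈ ZS S := intCast_mem _ m

/-- Subtract the principal parts at all primes of `S`; each is harmless at the other primes. A
further integer shift moves the real component into `[0, 1)` and does not spoil p-adic integrality.
-/
lemma exists_tile (x : QS S) : ∃ z : ZS S, diag S z + x ∈ boxR S (Set.Ico 0 1) := by
  choose a ha ha' using fun p : S => exists_rat_approx p (x.2 p)
  have hmem : (∑ p : S, a p) ∈ ZS S := by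
    refine sum_mem fun p _ l hl => ha' p l ?_
    rintro rfl; exact hl p.2
  have hp : ∀ p : S, ‖((∑ p : S, a p : ℚ) : ℚ_[(p : Prm)]) + x.2 p‖ ≤ 1 := by
    intro p
    rw [← Finset.add_sum_erase _ _ (Finset.mem_univ p)]
    push_cast
    rw [add_right_comm]
    refine (Padic.nonarchimedean _ _).trans (max_le ?_ ?_)
    · rw [add_comm]; exact ha p
    · refine IsUltrametricDist.norm_sum_le_of_forall_le_of_nonneg zero_le_one fun l hl => ?_
      exact ha' l p fun h => (Finset.ne_of_mem_erase hl) (Subtype.ext h.symm)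
  obtain ⟨m, hm⟩ : ∃ m : ℤ, m = ⌊((∑ p : S, a p : ℚ) : ℝ) + x.1⌋ := ⟨_, rfl⟩
  refine ⟨⟨∑ p : S, a p - m, sub_mem hmem (intCast_mem_ZS m)⟩, ⟨?_, fun p => ?_⟩⟩
  · simp only [Prod.fst_add, diag_fst, Set.mem_Ico, Rat.cast_sub, Rat.cast_intCast]
    have h1 := Int.floor_le (((∑ p : S, a p : ℚ) : ℝ) + x.1)
    have h2 := Int.lt_floor_add_one (((∑ p : S, a p : ℚ) : ℝ) + x.1)
    rw [← hm] at h1 h2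
    constructor <;> linarith
  · simp only [Prod.snd_add, Pi.add_apply, diag_snd, Rat.cast_sub, Rat.cast_intCast]
    have : ((∑ q : S, a q : ℚ) : ℚ_[(p : Prm)]) - (m : ℚ_[(p : Prm)]) + x.2 p =
        ((∑ q : S, a q : ℚ) : ℚ_[(p : Prm)]) + x.2 p + ((-m : ℤ) : ℚ_[(p : Prm)]) := by
      push_cast; ring
    rw [this]
    exact (Padic.nonarchimedean _ _).trans (max_le (hp p) (Padic.norm_int_le_one (-m)))

lemma exists_unique_tile (x : QS S) : ∃! z : ZS S, diag S z + x ∈ boxR S (Set.Ico 0 1) := by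
  obtain ⟨z₀, hz₀⟩ := exists_tile x
  refine ⟨z₀, hz₀, fun w hw => ?_⟩
  refine sub_eq_zero.1 (eq_zero_of_small ?_ ?_)
  · have h1 := hw.1
    have h2 := hz₀.1
    simp only [Prod.fst_add, diag_fst, Set.mem_Ico] at h1 h2
    push_cast
    rw [abs_lt]
    constructor <;> linarith [h1.1, h1.2, h2.1, h2.2]
  · intro p hp
    have h1 := hw.2 ⟨p, hp⟩
    have h2 := hz₀.2 ⟨p, hp⟩
    simp only [Prod.snd_add, Pi.add_apply, diag_snd] at h1 h2
    push_cast
    have : (((w : ℚ) : ℚ_[p]) - ((z₀ : ℚ) : ℚ_[p])) =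
      (((w : ℚ) : ℚ_[p]) + x.2 ⟨p, hp⟩) + -(((z₀ : ℚ) : ℚ_[p]) + x.2 ⟨p, hp⟩) := by ring
    rw [this]
    exact (Padic.nonarchimedean _ _).trans (max_le h1 (by rw [norm_neg]; exact h2))

end SArith
end

open MeasureTheory Matrix
open scoped ENNReal Pointwise

set_option linter.unusedSectionVars false

noncomputable section

namespace SArith

/-! ### The measure on matrices over `ℚ_S` -/

variable {S : Finset Prm}

/-! ### Change of variables by invertible matrices over `ℚ_S`, place by place. -/

section AllPlaces

variable {E : Type*} [AddCommGroup E] [Module (QS S) E] [TopologicalSpace E]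
  [IsTopologicalAddGroup E] [LocallyCompactSpace E]
  [ContinuousConstSMul (QS S) E] [SecondCountableTopology E] [MeasureSpace E] [BorelSpace E]
  [(volume : Measure E).IsAddHaarMeasure]
variable {n : Type*} [Fintype n] [DecidableEq n]

/-- The inclusion of the real factor. -/
def inclReal (S : Finset Prm) : ℝ →ₙ+* QS S where
  toFun x := (x, 0)
  map_mul' x y := by ext <;> simp
  map_zero' := rfl
  map_add' x y := by ext <;> simp

/-- The inclusion of a `p`-adic factor. -/
def inclPadic (p : S) : ℚ_[(p : Prm)] →ₙ+* QS S where
  toFun x := (0, Pi.single p x)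
  map_mul' x y := by
    refine Prod.ext (by simp) ?_
    exact Pi.single_mul (α := fun p : S => ℚ_[(p : Prm)]) p x y
  map_zero' := by simp
  map_add' x y := by
    refine Prod.ext (by simp) ?_
    exact Pi.single_add (f := fun p : S => ℚ_[(p : Prm)]) p x y

@[simp] lemma inclReal_apply (x : ℝ) : inclReal S x = (x, 0) := rfl

@[simp] lemma inclPadic_apply (p : S) (x : ℚ_[(p : Prm)]) :
    inclPadic p x = (0, Pi.single p x) := rfl

lemma matrix_ext_places {m : Type*} {A B : Matrix m n (QS S)}
    (h1 : A.map Prod.fst = B.map Prod.fst)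
    (h2 : ∀ p : S, A.map (fun x => x.2 p) = B.map (fun x => x.2 p)) : A = B := by
  ext i j p
  · exact congrFun (congrFun h1 i) j
  · exact congrFun (congrFun (h2 p) i) j

/-- The ring homomorphism to a `p`-adic factor. -/
def projPadic (p : S) : QS S →+* ℚ_[(p : Prm)] :=
  (Pi.evalRingHom _ p).comp (RingHom.snd ℝ (∀ p : S, ℚ_[(p : Prm)]))

lemma map_snd_mul (p : S) (A B : Matrix n n (QS S)) :
    (A * B).map (fun x => x.2 p) = A.map (fun x => x.2 p) * B.map (fun x => x.2 p) :=
  Matrix.map_mul (f := projPadic p)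

lemma map_fst_mul (A B : Matrix n n (QS S)) :
    (A * B).map Prod.fst = A.map Prod.fst * B.map Prod.fst :=
  Matrix.map_mul (f := RingHom.fst ℝ (∀ p : S, ℚ_[(p : Prm)]))

lemma det_map_fst (A : Matrix n n (QS S)) : (A.map Prod.fst).det = A.det.1 :=
  ((RingHom.fst ℝ (∀ p : S, ℚ_[(p : Prm)])).map_det A).symm

lemma det_map_snd (p : S) (A : Matrix n n (QS S)) : (A.map (fun x => x.2 p)).det = A.det.2 p :=
  ((projPadic p).map_det A).symm

/-- The matrix which agrees with `A` at the places in `T` and is the identity elsewhere. -/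
def partOf (A : Matrix n n (QS S)) (T : Finset S) : Matrix n n (QS S) :=
  Matrix.of fun i j => ((if i = j then 1 else 0),
    fun p => if p ∈ T then (A i j).2 p else if i = j then 1 else 0)

lemma partOf_map_fst (A : Matrix n n (QS S)) (T : Finset S) :
    (partOf A T).map Prod.fst = 1 := by
  ext i j; by_cases h : i = j <;> [subst h; skip] <;> simp [partOf, *]

lemma partOf_map_snd_mem (A : Matrix n n (QS S)) {T : Finset S} {p : S} (hp : p ∈ T) :
    (partOf A T).map (fun x => x.2 p) = A.map (fun x => x.2 p) := by
  ext i j; simp [partOf, hp]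

lemma partOf_map_snd_notMem (A : Matrix n n (QS S)) {T : Finset S} {p : S} (hp : p ∉ T) :
    (partOf A T).map (fun x => x.2 p) = 1 := by
  ext i j; by_cases h : i = j <;> [subst h; skip] <;> simp [partOf, *]

/-- Induction on the set of places: each new prime contributes one factor supported at that prime,
where elimination over the field `ℚ_p` applies. -/
lemma scales_partOf {A : Matrix n n (QS S)} (hA : IsUnit A.det) (T : Finset S) :
    Scales E (partOf A T) := by
  obtain ⟨h1, h2⟩ := isUnit_iff.1 hA
  induction T using Finset.induction_on with
  | empty =>
    have : partOf A ∅ = Matrix.diagonal fun _ : n => (((1 : (QS S)ˣ) : QS S)) := by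
      ext i j p <;> rcases eq_or_ne i j with rfl | h <;> simp [partOf, *]
    rw [this]
    exact scales_diagonal (E := E) (n := n) (R := QS S) (fun _ => 1)
  | insert p T hp ih =>
    have key : partOf A (insert p T) =
        partOf A T * embFactor (inclPadic p) (A.map fun x => x.2 p) := by
      refine matrix_ext_places ?_ fun l => ?_
      · have e1 : (embFactor (inclPadic p) (A.map fun x => x.2 p)).map Prod.fst = 1 := by
          ext i j; by_cases h : i = j <;> [subst h; skip] <;> simp [embFactor, *]
        rw [map_fst_mul, e1, mul_one, partOf_map_fst, partOf_map_fst]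
      · rw [map_snd_mul]
        by_cases hl : l = p
        · subst hl
          have e1 : (embFactor (inclPadic l) (A.map fun x => x.2 l)).map (fun x => x.2 l) =
              A.map fun x => x.2 l := by
            ext i j; by_cases h : i = j <;> [subst h; skip] <;> simp [embFactor, *]
          rw [e1, partOf_map_snd_notMem A hp, one_mul,
            partOf_map_snd_mem A (Finset.mem_insert_self _ _)]
        · have e1 : (embFactor (inclPadic p) (A.map fun x => x.2 p)).map (fun x => x.2 l) = 1 := by
            ext i j; by_cases h : i = j <;> [subst h; skip] <;> simp [embFactor, *]
          rw [e1, mul_one]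
          by_cases hT : l ∈ T
          · rw [partOf_map_snd_mem A hT, partOf_map_snd_mem A (Finset.mem_insert_of_mem hT)]
          · rw [partOf_map_snd_notMem A hT, partOf_map_snd_notMem A (by simp [hl, hT])]
    rw [key]
    exact ih.mul (scales_embFactor (E := E) (inclPadic p) (A.map fun x => x.2 p)
      (by rw [det_map_snd]; exact h2 p))

/-- The matrix is the product of its p-adic part and its real part, and each of these is handled
over fields. -/
lemma scales_of_isUnit_det {A : Matrix n n (QS S)} (hA : IsUnit A.det) : Scales E A := by
  have key : A = partOf A Finset.univ * embFactor (inclReal S) (A.map Prod.fst) := by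
    refine matrix_ext_places ?_ fun l => ?_
    · have e1 : (embFactor (inclReal S) (A.map Prod.fst)).map Prod.fst = A.map Prod.fst := by
        ext i j; by_cases h : i = j <;> [subst h; skip] <;> simp [embFactor, *]
      rw [map_fst_mul, e1, partOf_map_fst, one_mul]
    · have e1 : (embFactor (inclReal S) (A.map Prod.fst)).map (fun x => x.2 l) = 1 := by
        ext i j; by_cases h : i = j <;> [subst h; skip] <;> simp [embFactor, *]
      rw [map_snd_mul, e1, mul_one, partOf_map_snd_mem A (Finset.mem_univ l)]
  rw [key]
  exact (scales_partOf hA _).mul (scales_embFactor (E := E) (inclReal S) (A.map Prod.fst)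
    (by rw [det_map_fst]; exact (isUnit_iff.1 hA).1))

end AllPlaces

/-! ### Haar measure on rectangular matrices over `ℚ_S`. -/

section MatrixMeasure

variable {m n : Type*} [Fintype m] [Fintype n]

instance borelSpace_vec : BorelSpace (n → QS S) := Pi.borelSpace

instance secondCountable_vec : SecondCountableTopology (n → QS S) := inferInstance

instance sigmaFinite_vec : SigmaFinite (volume : Measure (n → QS S)) := inferInstance

instance isAddHaar_vec : (volume : Measure (n → QS S)).IsAddHaarMeasure :=
  isAddHaarMeasure_volume_pi

instance matrixMeasureSpace : MeasureSpace (Matrix m n (QS S)) :=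
  inferInstanceAs (MeasureSpace (m → n → QS S))

instance matrixBorelSpace : BorelSpace (Matrix m n (QS S)) :=
  (Pi.borelSpace : BorelSpace (m → n → QS S))

instance matrixSecondCountable : SecondCountableTopology (Matrix m n (QS S)) :=
  inferInstanceAs (SecondCountableTopology (m → n → QS S))

instance matrixLocallyCompact : LocallyCompactSpace (Matrix m n (QS S)) :=
  inferInstanceAs (LocallyCompactSpace (m → n → QS S))

instance matrixIsAddHaar : (volume : Measure (Matrix m n (QS S))).IsAddHaarMeasure :=
  (isAddHaarMeasure_volume_pi : (volume : Measure (m → n → QS S)).IsAddHaarMeasure)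

lemma volume_matrix_box (s : Set (QS S)) :
    volume {A : Matrix m n (QS S) | ∀ i j, A i j ∈ s} =
      (volume s) ^ (Fintype.card n * Fintype.card m) := by
  have : {A : Matrix m n (QS S) | ∀ i j, A i j ∈ s} =
      (Set.univ.pi fun _ : m => Set.univ.pi fun _ : n => s : Set (m → n → QS S)) := by
    ext A
    exact ⟨fun h i _ j _ => h i j, fun h i j => h i trivial j trivial⟩
  rw [this]
  refine (volume_pi_pi (α := fun _ : m => n → QS S) _).trans ?_
  simp [volume_pi_pi, ← pow_mul]

/-- Transposition carries Haar measure to a Haar measure, hence to a multiple of it; the multiple is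
one because the unit box is symmetric in rows and columns. -/
lemma measurePreserving_transpose :
    MeasurePreserving (Matrix.transpose : Matrix m n (QS S) → Matrix n m (QS S)) := by
  have hc : Continuous (Matrix.transpose : Matrix m n (QS S) → Matrix n m (QS S)) :=
    continuous_id.matrix_transpose
  have hc' : Continuous (Matrix.transpose : Matrix n m (QS S) → Matrix m n (QS S)) :=
    continuous_id.matrix_transpose
  refine ⟨hc.measurable, ?_⟩
  have hH : (Measure.map (Matrix.transpose : Matrix m n (QS S) → Matrix n m (QS S))
      volume).IsAddHaarMeasure :=
    (Matrix.transposeAddEquiv m n (QS S)).isAddHaarMeasure_map _ hc hc'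
  have hs := Measure.isAddLeftInvariant_eq_smul
    (Measure.map (Matrix.transpose : Matrix m n (QS S) → Matrix n m (QS S)) volume) volume
  set c := Measure.addHaarScalarFactor
    (Measure.map (Matrix.transpose : Matrix m n (QS S) → Matrix n m (QS S)) volume) volume
  have hb : MeasurableSet {A : Matrix n m (QS S) | ∀ i j, A i j ∈ boxR S (Set.Ico 0 1)} := by
    have h : ∀ i j, Measurable fun A : Matrix n m (QS S) => A i j := fun i j =>
      (continuous_id.matrix_elem i j).measurable
    simp only [Set.ofPred_forall]
    exact MeasurableSet.iInter fun i => MeasurableSet.iInter fun j =>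
      h i j (measurableSet_boxR measurableSet_Ico)
  have h1 := congrArg (fun μ : Measure (Matrix n m (QS S)) =>
    μ {A | ∀ i j, A i j ∈ boxR S (Set.Ico 0 1)}) hs
  simp only [Measure.smul_apply, Measure.map_apply hc.measurable hb] at h1
  have h2 : (Matrix.transpose : Matrix m n (QS S) → Matrix n m (QS S)) ⁻¹'
      {A | ∀ i j, A i j ∈ boxR S (Set.Ico 0 1)} = {A | ∀ i j, A i j ∈ boxR S (Set.Ico 0 1)} := by
    ext A
    exact ⟨fun h i j => h j i, fun h i j => h j i⟩
  rw [h2, volume_matrix_box, volume_matrix_box, volume_boxR, Real.volume_Ico] at h1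
  have h3 : c = 1 := by
    simp [ENNReal.smul_def] at h1
    exact h1.symm
  rw [hs, h3, one_smul]

variable [DecidableEq n]

/-- Left multiplication combines the rows, which are elements of `m → QS S`; this accounts for the
exponent `card m`. The p-adic determinants have absolute value one and do not contribute. -/
lemma scaling_mul_left {A : Matrix n n (QS S)} (h0 : A.det.1 ≠ 0) (h1 : ∀ p, ‖A.det.2 p‖ = 1) :
    (‖A.det.1‖₊ ^ Fintype.card m) • Measure.map (fun g : Matrix n m (QS S) => A * g) volume =
      volume := by
  have hA : IsUnit A.det := isUnit_iff.2 ⟨h0, fun p h => by have := h1 p; simp [h] at this⟩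
  obtain ⟨u, hu, h⟩ := scales_of_isUnit_det (E := m → QS S) hA
  rw [distribHaarChar_pi, distribHaarChar_QS u (by rw [hu]; exact h1), hu] at h
  have e : (actE A : (n → m → QS S) → n → m → QS S) =
      fun g : Matrix n m (QS S) => A * g := by
    funext g i j
    change (∑ k, A i k • g k) j = ∑ k, A i k * g k j
    simp [Finset.sum_apply]
  rw [e] at h
  exact h

lemma continuous_mul_left (A : Matrix n n (QS S)) :
    Continuous (fun g : Matrix n m (QS S) => A * g) := continuous_const.matrix_mul continuous_id

lemma continuous_mul_right (A : Matrix n n (QS S)) :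
    Continuous (fun g : Matrix m n (QS S) => g * A) := continuous_id.matrix_mul continuous_const

lemma lintegral_mul_left {A : Matrix n n (QS S)} (h0 : A.det.1 ≠ 0)
    (h1 : ∀ p, ‖A.det.2 p‖ = 1) {φ : Matrix n m (QS S) → ℝ≥0∞} (hφ : Measurable φ) :
    ∫⁻ g, φ g = ‖A.det.1‖ₑ ^ Fintype.card m * ∫⁻ g : Matrix n m (QS S), φ (A * g) := by
  conv_lhs => rw [← scaling_mul_left (m := m) h0 h1]
  rw [lintegral_smul_measure, lintegral_map hφ (continuous_mul_left A).measurable,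
    ENNReal.smul_def, ENNReal.coe_pow, smul_eq_mul]
  rfl

lemma lintegral_mul_right {A : Matrix n n (QS S)} (h0 : A.det.1 ≠ 0)
    (h1 : ∀ p, ‖A.det.2 p‖ = 1) {φ : Matrix m n (QS S) → ℝ≥0∞} (hφ : Measurable φ) :
    ∫⁻ g, φ g = ‖A.det.1‖ₑ ^ Fintype.card m * ∫⁻ g : Matrix m n (QS S), φ (g * A) := by
  have ht := measurePreserving_transpose (S := S) (m := n) (n := m)
  have hl := lintegral_mul_left (A := Aᵀ) (by simpa using h0) (by simpa using h1)
    (hφ.comp ht.measurable)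
  rw [det_transpose] at hl
  rw [← ht.lintegral_comp hφ]
  refine hl.trans ?_
  congr 1
  refine Eq.trans ?_ (ht.lintegral_comp (hφ.comp (continuous_mul_right A).measurable))
  simp [Matrix.transpose_mul]

lemma measurePreserving_mul_left {A : Matrix n n (QS S)} (h0 : |A.det.1| = 1)
    (h1 : ∀ p, ‖A.det.2 p‖ = 1) :
    MeasurePreserving (fun g : Matrix n m (QS S) => A * g) := by
  refine ⟨(continuous_mul_left A).measurable, ?_⟩
  have := scaling_mul_left (m := m) (A := A) (fun h => by simp [h] at h0) h1
  have h2 : ‖A.det.1‖₊ = 1 := NNReal.eq (by simpa using h0)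
  rwa [h2, one_pow, one_smul] at this

lemma measurePreserving_mul_right {A : Matrix n n (QS S)} (h0 : |A.det.1| = 1)
    (h1 : ∀ p, ‖A.det.2 p‖ = 1) :
    MeasurePreserving (fun g : Matrix m n (QS S) => g * A) := by
  have := (measurePreserving_transpose (S := S) (m := n) (n := m)).comp
    ((measurePreserving_mul_left (m := m) (A := Aᵀ) (by simpa using h0) (by simpa using h1)).comp
    (measurePreserving_transpose (S := S) (m := m) (n := n)))
  convert this using 1
  funext g
  simp [Matrix.transpose_mul]

lemma ae_fst_of_ae {P : ℝ → Prop} (h : ∀ᵐ t, P t) : ∀ᵐ t : QS S, P t.1 :=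
  Measure.quasiMeasurePreserving_fst.ae h

lemma ae_snd_of_ae (p : S) {P : ℚ_[(p : Prm)] → Prop} (h : ∀ᵐ t, P t) :
    ∀ᵐ t : QS S, P (t.2 p) :=
  Measure.quasiMeasurePreserving_snd.ae
    ((Measure.quasiMeasurePreserving_eval
      (μ := fun p : S => (volume : Measure ℚ_[(p : Prm)])) p).ae h)

/-- As a function of `t` the determinant is the characteristic polynomial of `-A`, which has
finitely many roots. -/
lemma ae_det_add_scalar_ne_zero {K : Type*} [Field K] [MeasurableSpace K] (μ : Measure K)
    [NullSingletonClass μ] (A : Matrix n n K) : ∀ᵐ t ∂μ, (A + Matrix.scalar n t).det ≠ 0 := by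
  classical
  have hfin : ((-A).charpoly.roots.toFinset : Set K).Finite := Finset.finite_toSet _
  have := hfin.measure_zero μ
  rw [ae_iff]
  refine measure_mono_null (fun t ht => ?_) this
  simp only [ne_eq, not_not, Set.mem_ofPred_eq] at ht
  simp only [Finset.mem_coe, Multiset.mem_toFinset]
  rw [Polynomial.mem_roots (Matrix.charpoly_monic _).ne_zero, Polynomial.IsRoot.def,
    Matrix.eval_charpoly, sub_neg_eq_add, add_comm, ht]

instance noAtoms_padic (p : Prm) : NullSingletonClass (volume : Measure ℚ_[p]) := by
  infer_instance

lemma continuous_matrix_det : Continuous (fun A : Matrix n n (QS S) => A.det) :=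
  continuous_id.matrix_det

lemma measurableSet_isUnit : MeasurableSet {x : QS S | IsUnit x} := by
  have : {x : QS S | IsUnit x} = {x | x.1 ≠ 0} ∩ {x | ∀ p, x.2 p ≠ 0} := by
    ext x; exact isUnit_iff
  rw [this]
  refine MeasurableSet.inter (measurable_fst (measurableSet_singleton 0).compl) ?_
  simp only [Set.ofPred_forall]
  exact MeasurableSet.iInter fun p =>
    ((measurable_pi_apply p).comp measurable_snd) (measurableSet_singleton 0).compl

lemma ae_isUnit_det_add (A : Matrix n n (QS S)) :
    ∀ᵐ t : QS S, IsUnit (A + Matrix.scalar n t).det := by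
  have h1 := ae_fst_of_ae (S := S) (ae_det_add_scalar_ne_zero volume (A.map Prod.fst))
  have h2 : ∀ᵐ t : QS S, ∀ p : S, (A.map (fun x => x.2 p) + Matrix.scalar n (t.2 p)).det ≠ 0 :=
    ae_all_iff.2 fun p => ae_snd_of_ae p (ae_det_add_scalar_ne_zero volume _)
  filter_upwards [h1, h2] with t h1 h2
  rw [isUnit_iff, ← det_map_fst]
  refine ⟨?_, fun p => ?_⟩
  · have e : (A + Matrix.scalar n t).map Prod.fst = A.map Prod.fst + Matrix.scalar n t.1 := by
      ext i j; by_cases h : i = j <;> simp [h, Matrix.scalar_apply]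
    rwa [e]
  · have e : (A + Matrix.scalar n t).map (fun x => x.2 p) =
        A.map (fun x => x.2 p) + Matrix.scalar n (t.2 p) := by
      ext i j; by_cases h : i = j <;> simp [h, Matrix.scalar_apply]
    rw [← det_map_snd, e]
    exact h2 p

/-- Average the indicator of the singular set over the shifts `A + t` with `t` in the unit box. For
fixed `A` almost no `t` gives a singular matrix, while by translation invariance the double integral
is the measure of the singular set. -/
lemma ae_isUnit_det : ∀ᵐ A : Matrix n n (QS S), IsUnit A.det := by
  set Z : Set (Matrix n n (QS S)) := {A | ¬ IsUnit A.det} with hZ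
  have hZm : MeasurableSet Z := (continuous_matrix_det.measurable measurableSet_isUnit).compl
  have hsc : Continuous fun x : Matrix n n (QS S) × QS S => x.1 + Matrix.scalar n x.2 := by
    refine continuous_fst.add ?_
    simp only [Matrix.scalar_apply]
    exact (continuous_pi fun _ => continuous_snd).matrix_diagonal
  have hm : Measurable fun x : Matrix n n (QS S) × QS S =>
      Z.indicator (1 : Matrix n n (QS S) → ℝ≥0∞) (x.1 + Matrix.scalar n x.2) :=
    (measurable_one.indicator hZm).comp hsc.measurable
  have key : ∫⁻ A : Matrix n n (QS S), ∫⁻ t in boxR S (Set.Ico 0 1),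
      Z.indicator (1 : Matrix n n (QS S) → ℝ≥0∞) (A + Matrix.scalar n t) = 0 := by
    have : ∀ A : Matrix n n (QS S), ∫⁻ t in boxR S (Set.Ico 0 1),
        Z.indicator (1 : Matrix n n (QS S) → ℝ≥0∞) (A + Matrix.scalar n t) = 0 := by
      intro A
      refine (lintegral_eq_zero_iff (hm.comp measurable_prodMk_left)).2 ?_
      refine ae_restrict_of_ae ?_
      filter_upwards [ae_isUnit_det_add A] with t ht
      have hn : A + Matrix.scalar n t ∉ Z := fun h => h ht
      exact Set.indicator_of_notMem hn _
    simp only [this, lintegral_zero]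
  rw [lintegral_lintegral_swap hm.aemeasurable] at key
  simp only [lintegral_add_right_eq_self (fun A => Z.indicator (1 : Matrix n n (QS S) → ℝ≥0∞) A),
    lintegral_indicator_one hZm, lintegral_const, Measure.restrict_apply MeasurableSet.univ,
    Set.univ_inter, volume_boxR, Real.volume_Ico] at key
  rw [ae_iff]
  simpa using key

end MatrixMeasure
end SArith
end

open MeasureTheory Matrix
open scoped ENNReal Pointwise

set_option linter.unusedSectionVars false

noncomputable section

namespace SArith

/-! ### Fundamental domains -/

/-- Second countability covers `W` by countably many open sets, none of which contains two distinct
translates of a point. The domain keeps, for every orbit, its unique point in the first of these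
sets that the orbit meets. The representatives are unique everywhere, not only almost everywhere. -/
lemma exists_strict_fundamentalDomain {X G : Type*} [TopologicalSpace X]
    [SecondCountableTopology X] [MeasurableSpace X] [BorelSpace X] [Group G] [Countable G]
    [MulAction G X] (hcont : ∀ g : G, Continuous fun x : X => g • x) (W : Set X)
    (hWm : MeasurableSet W) (hW : ∀ (g : G), ∀ x ∈ W, g • x ∈ W)
    (hloc : ∀ x ∈ W, ∃ O : Set X, IsOpen O ∧ x ∈ O ∧ ∀ g : G, ∀ y ∈ O, g • y ∈ O → g = 1) :
    ∃ D : Set X, MeasurableSet D ∧ D ⊆ W ∧ ∀ x ∈ W, ∃! g : G, g • x ∈ D := by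
  classical
  rcases W.eq_empty_or_nonempty with rfl | ⟨x₀, hx₀⟩
  · exact ⟨∅, MeasurableSet.empty, subset_rfl, by simp⟩
  choose! O hO hxO hinj using hloc
  obtain ⟨t, htW, htc, hcov⟩ := TopologicalSpace.countable_cover_nhdsWithin (s := W) (f := O)
    fun x hx => mem_nhdsWithin_of_mem_nhds ((hO x hx).mem_nhds (hxO x hx))
  have htne : t.Nonempty := by
    obtain ⟨y, hy, -⟩ := Set.mem_iUnion₂.1 (hcov hx₀)
    exact ⟨y, hy⟩
  obtain ⟨u, rfl⟩ := htc.exists_eq_range htne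
  have hu : ∀ n, u n ∈ W := fun n => htW ⟨n, rfl⟩
  refine ⟨⋃ n, (O (u n) ∩ W) ∩ ⋂ m, ⋂ (_ : m < n), ⋂ g : G, {x | g • x ∉ O (u m)}, ?_, ?_, ?_⟩
  · refine MeasurableSet.iUnion fun n => ((hO _ (hu n)).measurableSet.inter hWm).inter ?_
    refine MeasurableSet.iInter fun m => MeasurableSet.iInter fun _ => MeasurableSet.iInter
      fun g => ?_
    exact ((hcont g).measurable (hO _ (hu m)).measurableSet).compl
  · intro x hx
    obtain ⟨n, hn⟩ := Set.mem_iUnion.1 hx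
    exact hn.1.2
  · intro x hx
    -- The least such `n` depends only on the orbit of `x`, so two representatives of the orbit lie
    -- in the same open set.
    have hex : ∃ n, ∃ g : G, g • x ∈ O (u n) := by
      obtain ⟨y, ⟨n, rfl⟩, hy⟩ := Set.mem_iUnion₂.1 (hcov hx)
      exact ⟨n, 1, by simpa using hy⟩
    obtain ⟨g, hg⟩ := Nat.find_spec hex
    have hmin : ∀ m < Nat.find hex, ∀ g : G, g • x ∉ O (u m) := fun m hm g h =>
      Nat.find_min hex hm ⟨g, h⟩
    refine ⟨g, ?_, ?_⟩
    · refine Set.mem_iUnion.2 ⟨Nat.find hex, ⟨hg, hW g x hx⟩, ?_⟩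
      simp only [Set.mem_iInter]
      intro m hm g'
      simpa [smul_smul] using hmin m hm (g' * g)
    · intro g' hg'
      obtain ⟨n, hn, hn'⟩ := Set.mem_iUnion.1 hg'
      simp only [Set.mem_iInter] at hn'
      have hle : Nat.find hex ≤ n := Nat.find_min' hex ⟨g', hn.1⟩
      have : n = Nat.find hex := by
        by_contra hne
        have := hn' _ (lt_of_le_of_ne hle (Ne.symm hne)) (g * g'⁻¹)
        exact this (by simpa [smul_smul] using hg)
      subst this
      have := hinj _ (hu _) (g' * g⁻¹) (g • x) hg (by simpa [smul_smul] using hn.1)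
      exact mul_inv_eq_one.1 this

variable {S : Finset Prm} {n : Type*} [Fintype n] [DecidableEq n]

/-- `SL_n(ℤ_S)`. -/
abbrev SLZ (S : Finset Prm) (n : Type*) [Fintype n] [DecidableEq n] : Type _ :=
  Matrix.SpecialLinearGroup n (ZS S)

/-- The image of an element of `SL_n(ℤ_S)` in the matrices over `ℚ_S`. -/
def toQS (γ : SLZ S n) : Matrix n n (QS S) := (γ : Matrix n n (ZS S)).map (diag S)

@[simp] lemma toQS_one : toQS (1 : SLZ S n) = 1 := by
  simp [toQS]

@[simp] lemma toQS_mul (γ δ : SLZ S n) : toQS (γ * δ) = toQS γ * toQS δ := by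
  simp [toQS, Matrix.map_mul]

@[simp] lemma det_toQS (γ : SLZ S n) : (toQS γ).det = 1 := by
  have := (diag S).map_det (γ : Matrix n n (ZS S))
  rw [γ.2, map_one] at this
  exact this.symm

instance slzAction : MulAction (SLZ S n) (Matrix n n (QS S)) where
  smul γ g := toQS γ * g
  one_smul g := by change toQS 1 * g = g; simp
  mul_smul γ δ g := by
    change toQS (γ * δ) * g = toQS γ * (toQS δ * g)
    simp [Matrix.mul_assoc]

lemma slz_smul_def (γ : SLZ S n) (g : Matrix n n (QS S)) : γ • g = toQS γ * g := rfl

lemma det_slz_smul (γ : SLZ S n) (g : Matrix n n (QS S)) : (γ • g).det = g.det := by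
  simp [slz_smul_def]

lemma continuous_slz_smul (γ : SLZ S n) : Continuous fun g : Matrix n n (QS S) => γ • g :=
  continuous_mul_left (toQS γ)

instance slz_measurableConstSMul : MeasurableConstSMul (SLZ S n) (Matrix n n (QS S)) :=
  ⟨fun γ => (continuous_slz_smul γ).measurable⟩

lemma measurePreserving_slz_smul (γ : SLZ S n) :
    MeasurePreserving fun g : Matrix n n (QS S) => γ • g :=
  measurePreserving_mul_left (A := toQS γ) (by simp) (by simp)

instance countable_slz : Countable (SLZ S n) :=
  haveI : Countable (Matrix n n (ZS S)) := inferInstanceAs (Countable (n → n → ZS S))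
  Subtype.countable

variable (S n) in
/-- Matrices with determinant in `unitSet`. -/
def detUnits : Set (Matrix n n (QS S)) := {g | g.det ∈ unitSet S}

lemma isOpen_detUnits : IsOpen (detUnits S n) := isOpen_unitSet.preimage continuous_matrix_det

lemma slz_smul_mem_detUnits (γ : SLZ S n) (g : Matrix n n (QS S)) :
    γ • g ∈ detUnits S n ↔ g ∈ detUnits S n := by
  simp [detUnits, det_slz_smul]

/-- If `y` and `γ y` are both close to `g₀`, then `γ y · adj y - det y`, which equals `det y · (γ -
1)`, is small at every place. Dividing by `det y`, the entries of `γ - 1` are small elements of the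
discrete ring `ℤ_S`, hence zero. -/
lemma exists_open_injective (g₀ : Matrix n n (QS S)) (hg₀ : g₀ ∈ detUnits S n) :
    ∃ O : Set (Matrix n n (QS S)), IsOpen O ∧ g₀ ∈ O ∧
      ∀ γ : SLZ S n, ∀ y ∈ O, γ • y ∈ O → γ = 1 := by
  set c := g₀.det.1 with hc
  have hc0 : 0 < c := hg₀.1
  let Ψ : Matrix n n (QS S) × Matrix n n (QS S) → Matrix n n (QS S) :=
    fun x => x.2 * x.1.adjugate - x.1.det • 1
  have hΨ : Continuous Ψ :=
    (continuous_snd.matrix_mul continuous_fst.matrix_adjugate).sub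
      (continuous_fst.matrix_det.smul continuous_const)
  -- The bound `c / 2` matches the lower bound `c / 2 < det y` imposed on the neighbourhood below;
  -- their quotient is the bound `1` of `eq_zero_of_small`.
  let N : Set (Matrix n n (QS S)) := ⋂ i, ⋂ j, {A | |(A i j).1| < c / 2 ∧
    ∀ p, ‖(A i j).2 p‖ < 1}
  have hN : IsOpen N := by
    refine isOpen_iInter_of_finite fun i => isOpen_iInter_of_finite fun j => ?_
    have h : Continuous fun A : Matrix n n (QS S) => A i j := continuous_id.matrix_elem i j
    have e : {A : Matrix n n (QS S) | |(A i j).1| < c / 2 ∧ ∀ p, ‖(A i j).2 p‖ < 1} =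
        {A | |(A i j).1| < c / 2} ∩ ⋂ p, {A | ‖(A i j).2 p‖ < 1} := by
      ext A; simp
    rw [e]
    exact IsOpen.inter (isOpen_lt (continuous_fst.comp h).abs continuous_const)
      (isOpen_iInter_of_finite fun p => isOpen_lt
        ((continuous_apply p).comp (continuous_snd.comp h)).norm continuous_const)
  have h0 : Ψ (g₀, g₀) ∈ N := by
    have : Ψ (g₀, g₀) = 0 := by simp [Ψ, Matrix.mul_adjugate]
    rw [this]
    simp [N, hc0]
  obtain ⟨u, v, hu, hv, hgu, hgv, huv⟩ := isOpen_prod_iff.1 (hN.preimage hΨ) g₀ g₀ h0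
  refine ⟨u ∩ v ∩ (detUnits S n ∩ {x | c / 2 < x.det.1}), ?_, ?_, ?_⟩
  · exact (hu.inter hv).inter (isOpen_detUnits.inter (isOpen_lt continuous_const
      (continuous_fst.comp continuous_matrix_det)))
  · exact ⟨⟨hgu, hgv⟩, hg₀, by change c / 2 < c; linarith⟩
  · rintro γ y ⟨⟨hy1, -⟩, hyW, hyc⟩ ⟨⟨-, hy2⟩, -⟩
    have hmem : Ψ (y, γ • y) ∈ N := huv (Set.mk_mem_prod hy1 hy2)
    have hval : Ψ (y, γ • y) = y.det • (toQS γ - 1) := by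
      simp only [Ψ, slz_smul_def, Matrix.mul_assoc, Matrix.mul_adjugate, smul_sub]
      simp
    rw [hval] at hmem
    simp only [N, Set.mem_iInter] at hmem
    ext i j
    have hij : |((y.det • (toQS γ - 1)) i j).1| < c / 2 ∧
        ∀ p, ‖((y.det • (toQS γ - 1)) i j).2 p‖ < 1 := hmem i j
    have hent : (y.det • (toQS γ - 1)) i j =
        y.det * diag S (γ i j - (1 : Matrix n n (ZS S)) i j) := by
      by_cases h : i = j
      · subst h; simp [toQS]
      · simp [toQS, h]
    rw [hent] at hij
    have hz : (γ i j - (1 : Matrix n n (ZS S)) i j) = 0 := by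
      refine eq_zero_of_small ?_ fun p hp => ?_
      · have h1 := hij.1
        rw [Prod.fst_mul, diag_fst, abs_mul, abs_of_pos hyW.1] at h1
        have h2 : c / 2 < y.det.1 := hyc
        by_contra hcon
        push Not at hcon
        nlinarith
      · have h1 := hij.2 ⟨p, hp⟩
        rw [Prod.snd_mul, Pi.mul_apply, diag_snd, norm_mul, hyW.2 ⟨p, hp⟩, one_mul] at h1
        exact h1.le
    have := sub_eq_zero.1 hz
    rw [this]
    simp

/-- A measurable set of representatives for `SL_n(ℤ_S)` acting on `detUnits S n`. -/
structure IsStrictFD (D : Set (Matrix n n (QS S))) : Prop where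
  measurableSet : MeasurableSet D
  subset : D ⊆ detUnits S n
  exists_unique : ∀ g ∈ detUnits S n, ∃! γ : SLZ S n, γ • g ∈ D

lemma exists_isStrictFD : ∃ D : Set (Matrix n n (QS S)), IsStrictFD D := by
  obtain ⟨D, h1, h2, h3⟩ := exists_strict_fundamentalDomain (G := SLZ S n) continuous_slz_smul
    (detUnits S n) isOpen_detUnits.measurableSet
    (fun γ g hg => (slz_smul_mem_detUnits γ g).2 hg) exists_open_injective
  exact ⟨D, h1, h2, h3⟩

/-- The measure on matrices with determinant in `unitSet`. -/
def volU (S : Finset Prm) (n : Type*) [Fintype n] [DecidableEq n] :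
    Measure (Matrix n n (QS S)) := volume.restrict (detUnits S n)

lemma measurePreserving_slz_volU (γ : SLZ S n) :
    MeasurePreserving (fun g : Matrix n n (QS S) => γ • g) (volU S n) (volU S n) := by
  have := (measurePreserving_slz_smul γ).restrict_preimage
    (isOpen_detUnits (S := S) (n := n)).measurableSet
  have e : (fun g : Matrix n n (QS S) => γ • g) ⁻¹' detUnits S n = detUnits S n := by
    ext g
    exact slz_smul_mem_detUnits γ g
  rwa [e] at this

instance smulInvariant_volU : SMulInvariantMeasure (SLZ S n) (Matrix n n (QS S)) (volU S n) :=
  ⟨fun γ _ hs => (measurePreserving_slz_volU γ).measure_preimage hs.nullMeasurableSet⟩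

lemma IsStrictFD.isFundamentalDomain {D : Set (Matrix n n (QS S))} (hD : IsStrictFD D) :
    IsFundamentalDomain (SLZ S n) D (volU S n) := by
  have h : ∀ᵐ g ∂(volU S n), g ∈ detUnits S n :=
    ae_restrict_mem isOpen_detUnits.measurableSet
  refine IsFundamentalDomain.mk'' hD.measurableSet.nullMeasurableSet ?_ ?_ ?_
  · filter_upwards [h] with g hg
    exact (hD.exists_unique g hg).exists
  · intro γ hγ
    refine Disjoint.aedisjoint ?_
    rw [Set.disjoint_left]
    rintro x ⟨y, hy, rfl⟩ hx
    exact hγ ((hD.exists_unique y (hD.subset hy)).unique hx (by simpa using hy))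
  · intro γ
    exact (measurePreserving_slz_volU γ).quasiMeasurePreserving

end SArith
end

open MeasureTheory Matrix
open scoped ENNReal Pointwise

set_option linter.unusedSectionVars false

noncomputable section

namespace SArith

/-! ### Unfolding -/

/-- Grouping the group elements by the fibres of `π` turns `∑ Ψ` into the full orbit sum of `φ`, and
the integral of an orbit sum over a fundamental domain is the integral over the whole space. -/
lemma lintegral_unfold {X G T : Type*} [MeasurableSpace X] [Group G] [Countable G] [MulAction G X]
    [MeasurableConstSMul G X] {μ : Measure X} [SMulInvariantMeasure G X μ] {D : Set X}
    (hD : IsFundamentalDomain G D μ) (π : G → T) {φ : X → ℝ≥0∞} (hφ : Measurable φ)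
    (Ψ : T → X → ℝ≥0∞)
    (h : ∀ᵐ x ∂μ, ∀ t, Ψ t x = ∑' γ : {γ : G // π γ = t}, φ ((γ : G) • x)) :
    ∫⁻ x in D, ∑' t, Ψ t x ∂μ = ∫⁻ x, φ x ∂μ := by
  have hm : ∀ g : G, Measurable fun x => φ (g • x) := fun g => hφ.comp (measurable_const_smul g)
  rw [hD.lintegral_eq_tsum'' φ, ← lintegral_tsum fun g : G => (hm g).aemeasurable]
  refine lintegral_congr_ae (ae_restrict_of_ae ?_)
  filter_upwards [h] with x hx
  simp only [hx]
  rw [← (Equiv.sigmaFiberEquiv π).tsum_eq]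
  exact (ENNReal.tsum_sigma fun t (γ : {γ : G // π γ = t}) => φ ((γ : G) • x)).symm

variable {S : Finset Prm}

/-! ### Splitting off the first rows of a matrix, and the stabilizer of these rows. -/

section Decomposition

variable {κ ι n : Type*} [Fintype κ] [Fintype ι] [Fintype n]

lemma measurable_matrix {m α : Type*} [Fintype m] [MeasurableSpace α] {f : α → Matrix m n (QS S)}
    (hf : ∀ i j, Measurable fun x => f x i j) : Measurable f :=
  measurable_pi_lambda _ fun i => measurable_pi_lambda _ fun j => hf i j

lemma measurable_matrix_elem {m : Type*} [Fintype m] (i : m) (j : n) :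
    Measurable fun A : Matrix m n (QS S) => A i j :=
  (continuous_id.matrix_elem i j).measurable

lemma measurePreserving_toRows :
    MeasurePreserving (fun g : Matrix (κ ⊕ ι) n (QS S) => (g.toRows₁, g.toRows₂))
      volume (volume.prod volume) :=
  volume_measurePreserving_sumPiEquivProdPi (fun _ : κ ⊕ ι => n → QS S)

lemma measurable_fromRows :
    Measurable fun x : Matrix κ n (QS S) × Matrix ι n (QS S) => fromRows x.1 x.2 := by
  refine measurable_matrix fun i j => ?_
  rcases i with i | i
  · exact (measurable_matrix_elem i j).comp measurable_fst
  · exact (measurable_matrix_elem i j).comp measurable_snd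

lemma lintegral_fromRows {φ : Matrix (κ ⊕ ι) n (QS S) → ℝ≥0∞} (hφ : Measurable φ) :
    ∫⁻ g, φ g = ∫⁻ X : Matrix κ n (QS S), ∫⁻ Z : Matrix ι n (QS S), φ (fromRows X Z) := by
  have h := measurePreserving_toRows (S := S) (κ := κ) (ι := ι) (n := n)
  have hm : Measurable fun x : Matrix κ n (QS S) × Matrix ι n (QS S) =>
    φ (fromRows x.1 x.2) := hφ.comp measurable_fromRows
  rw [← lintegral_prod (fun x : Matrix κ n (QS S) × Matrix ι n (QS S) => φ (fromRows x.1 x.2))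
    hm.aemeasurable, ← h.lintegral_comp hm]
  simp

lemma lintegral_fromCols {φ : Matrix n (κ ⊕ ι) (QS S) → ℝ≥0∞} (hφ : Measurable φ) :
    ∫⁻ g, φ g = ∫⁻ X : Matrix n κ (QS S), ∫⁻ Z : Matrix n ι (QS S), φ (fromCols X Z) := by
  have ht := measurePreserving_transpose (S := S) (m := κ ⊕ ι) (n := n)
  have ht1 := measurePreserving_transpose (S := S) (m := κ) (n := n)
  have ht2 := measurePreserving_transpose (S := S) (m := ι) (n := n)
  have hm : Measurable fun x : Matrix n κ (QS S) × Matrix n ι (QS S) =>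
      φ (fromCols x.1 x.2) := by
    refine hφ.comp (measurable_matrix fun i j => ?_)
    rcases j with j | j
    · exact (measurable_matrix_elem i j).comp measurable_fst
    · exact (measurable_matrix_elem i j).comp measurable_snd
  have hφt : Measurable fun g : Matrix (κ ⊕ ι) n (QS S) => φ gᵀ := hφ.comp ht.measurable
  rw [← ht.lintegral_comp hφ, lintegral_fromRows hφt, ← ht1.lintegral_comp hm.lintegral_prod_right]
  refine lintegral_congr fun X => ?_
  have hm2 : Measurable fun Z : Matrix n ι (QS S) => φ (fromCols Xᵀ Z) :=
    hm.comp measurable_prodMk_left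
  rw [← ht2.lintegral_comp hm2]
  simp [transpose_fromRows]

variable [DecidableEq κ]

lemma ae_isUnit_det_toCols : ∀ᵐ X : Matrix κ (κ ⊕ ι) (QS S), IsUnit X.toCols₁.det := by
  have h1 := measurePreserving_transpose (S := S) (m := κ) (n := κ ⊕ ι)
  have h2 := Measure.quasiMeasurePreserving_fst.comp
    (measurePreserving_toRows (S := S) (κ := κ) (ι := ι) (n := κ)).quasiMeasurePreserving
  have h3 := (h2.comp h1.quasiMeasurePreserving).ae (ae_isUnit_det (S := S) (n := κ))
  filter_upwards [h3] with X hX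
  rw [← det_transpose]
  exact hX

variable [DecidableEq ι]

/-- The group is countable, so one null set serves all its elements. Off this set the normalization
below is available for every translate of `g`. -/
lemma ae_generic : ∀ᵐ g : Matrix (κ ⊕ ι) (κ ⊕ ι) (QS S), ∀ γ : SLZ S (κ ⊕ ι),
    IsUnit (γ • g).toRows₁.toCols₁.det := by
  rw [ae_all_iff]
  intro γ
  have h2 := Measure.quasiMeasurePreserving_fst.comp
    (measurePreserving_toRows (S := S) (κ := κ) (ι := ι) (n := κ ⊕ ι)).quasiMeasurePreserving
  exact (h2.comp (measurePreserving_slz_smul γ).quasiMeasurePreserving).ae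
    (ae_isUnit_det_toCols (S := S) (κ := κ) (ι := ι))

/-- A matrix of determinant one whose first rows are `X`. -/
def sectionMat (i₀ : ι) (X : Matrix κ (κ ⊕ ι) (QS S)) : Matrix (κ ⊕ ι) (κ ⊕ ι) (QS S) :=
  fromBlocks X.toCols₁ X.toCols₂ 0 (diagonal (Function.update 1 i₀ (invR X.toCols₁.det)))

lemma det_sectionMat (i₀ : ι) {X : Matrix κ (κ ⊕ ι) (QS S)} (hX : IsUnit X.toCols₁.det) :
    (sectionMat i₀ X).det = 1 := by
  rw [sectionMat, det_fromBlocks_zero₂₁, det_diagonal, Finset.prod_update_of_mem (by simp)]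
  simp [mul_invR hX]

lemma sectionMat_toRows (i₀ : ι) (X : Matrix κ (κ ⊕ ι) (QS S)) :
    (sectionMat i₀ X).toRows₁ = X := by
  refine Matrix.ext fun i j => ?_
  rcases j with j | j <;> rfl

lemma measurable_sectionMat (i₀ : ι) :
    Measurable (sectionMat i₀ : Matrix κ (κ ⊕ ι) (QS S) → _) := by
  refine measurable_matrix fun i j => ?_
  rcases i with i | i
  · rcases j with j | j
    · exact measurable_matrix_elem i (Sum.inl j)
    · exact measurable_matrix_elem i (Sum.inr j)
  · rcases j with j | j
    · exact measurable_const
    · change Measurable fun X : Matrix κ (κ ⊕ ι) (QS S) =>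
        diagonal (Function.update 1 i₀ (invR X.toCols₁.det)) i j
      by_cases hij : i = j
      · subst hij
        simp only [diagonal_apply_eq]
        by_cases hi : i = i₀
        · subst hi
          simp only [Function.update_self]
          refine measurable_invR.comp (continuous_matrix_det.measurable.comp ?_)
          exact measurable_matrix fun a b => measurable_matrix_elem a (Sum.inl b)
        · simp only [Function.update_of_ne hi]
          exact measurable_const
      · simp only [diagonal_apply_ne _ hij]
        exact measurable_const

/-- The matrix `g s⁻¹` where `s` is the matrix of determinant one with the same first rows. -/
def normalized (i₀ : ι) (g : Matrix (κ ⊕ ι) (κ ⊕ ι) (QS S)) : Matrix (κ ⊕ ι) (κ ⊕ ι) (QS S) :=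
  g * (sectionMat i₀ g.toRows₁).adjugate

lemma measurable_toRows₁ {m : Type*} [Fintype m] :
    Measurable (toRows₁ : Matrix (κ ⊕ ι) m (QS S) → _) :=
  measurable_matrix fun i j => measurable_matrix_elem (Sum.inl i) j

lemma measurable_normalized (i₀ : ι) :
    Measurable (normalized i₀ : Matrix (κ ⊕ ι) (κ ⊕ ι) (QS S) → _) := by
  have h1 : Continuous fun x : Matrix (κ ⊕ ι) (κ ⊕ ι) (QS S) × Matrix (κ ⊕ ι) (κ ⊕ ι) (QS S) =>
    x.1 * x.2.adjugate := continuous_fst.matrix_mul continuous_snd.matrix_adjugate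
  exact h1.measurable.comp
    (measurable_id.prodMk ((measurable_sectionMat i₀).comp measurable_toRows₁))

lemma toRows₁_mul {m : Type*} [Fintype m] (A : Matrix (κ ⊕ ι) n (QS S)) (B : Matrix n m (QS S)) :
    (A * B).toRows₁ = A.toRows₁ * B := rfl

lemma toRows₁_one : (1 : Matrix (κ ⊕ ι) (κ ⊕ ι) (QS S)).toRows₁ = fromCols 1 0 := by
  refine Matrix.ext fun i j => ?_
  rcases j with j | j
  · by_cases h : i = j
    · subst h; simp
    · simp [h]
  · simp

lemma normalized_toRows (i₀ : ι) {g : Matrix (κ ⊕ ι) (κ ⊕ ι) (QS S)}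
    (hg : IsUnit g.toRows₁.toCols₁.det) : (normalized i₀ g).toRows₁ = fromCols 1 0 := by
  rw [normalized, toRows₁_mul]
  conv_lhs => enter [1]; rw [← sectionMat_toRows i₀ g.toRows₁]
  rw [← toRows₁_mul, mul_adjugate, det_sectionMat i₀ hg, one_smul, toRows₁_one]

lemma normalized_eq (i₀ : ι) {g : Matrix (κ ⊕ ι) (κ ⊕ ι) (QS S)}
    (hg : IsUnit g.toRows₁.toCols₁.det) :
    normalized i₀ g = fromBlocks 1 0 (normalized i₀ g).toBlocks₂₁
      (normalized i₀ g).toBlocks₂₂ := by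
  have h := normalized_toRows i₀ hg
  refine Matrix.ext fun i j => ?_
  rcases i with i | i
  · have := congrFun (congrFun h i) j
    rcases j with j | j
    · exact this
    · exact this
  · rcases j with j | j <;> rfl

lemma det_normalized (i₀ : ι) {g : Matrix (κ ⊕ ι) (κ ⊕ ι) (QS S)}
    (hg : IsUnit g.toRows₁.toCols₁.det) : (normalized i₀ g).det = g.det := by
  rw [normalized, det_mul, det_adjugate, det_sectionMat i₀ hg, one_pow, mul_one]

lemma det_toBlocks_normalized (i₀ : ι) {g : Matrix (κ ⊕ ι) (κ ⊕ ι) (QS S)}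
    (hg : IsUnit g.toRows₁.toCols₁.det) : (normalized i₀ g).toBlocks₂₂.det = g.det := by
  rw [← det_normalized i₀ hg]
  conv_rhs => rw [normalized_eq i₀ hg]
  rw [det_fromBlocks_zero₁₂, det_one, one_mul]

/-- The set of `g` whose normalization has lower blocks in the unit box and in `D`. -/
def unfoldSet (i₀ : ι) (D : Set (Matrix ι ι (QS S))) : Set (Matrix (κ ⊕ ι) (κ ⊕ ι) (QS S)) :=
  {g | IsUnit g.toRows₁.toCols₁.det ∧
    (∀ i j, (normalized i₀ g).toBlocks₂₁ i j ∈ boxR S (Set.Ico 0 1)) ∧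
    (normalized i₀ g).toBlocks₂₂ ∈ D}

lemma measurableSet_unfoldSet (i₀ : ι) {D : Set (Matrix ι ι (QS S))} (hD : MeasurableSet D) :
    MeasurableSet (unfoldSet (κ := κ) i₀ D) := by
  have h1 : MeasurableSet {g : Matrix (κ ⊕ ι) (κ ⊕ ι) (QS S) | IsUnit g.toRows₁.toCols₁.det} := by
    refine (continuous_matrix_det.measurable.comp ?_) measurableSet_isUnit
    exact measurable_matrix fun a b => measurable_matrix_elem (Sum.inl a) (Sum.inl b)
  have h2 : ∀ i j, MeasurableSet {g : Matrix (κ ⊕ ι) (κ ⊕ ι) (QS S) |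
      (normalized i₀ g).toBlocks₂₁ i j ∈ boxR S (Set.Ico 0 1)} := fun i j =>
    ((measurable_matrix_elem (Sum.inr i) (Sum.inl j)).comp (measurable_normalized i₀))
      (measurableSet_boxR measurableSet_Ico)
  have h3 : MeasurableSet {g : Matrix (κ ⊕ ι) (κ ⊕ ι) (QS S) |
      (normalized i₀ g).toBlocks₂₂ ∈ D} := by
    have : Measurable fun g : Matrix (κ ⊕ ι) (κ ⊕ ι) (QS S) => (normalized i₀ g).toBlocks₂₂ :=
      measurable_matrix fun a b =>
        (measurable_matrix_elem (Sum.inr a) (Sum.inr b)).comp (measurable_normalized i₀)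
    exact this hD
  have e : unfoldSet (κ := κ) i₀ D = {g | IsUnit g.toRows₁.toCols₁.det} ∩
      ((⋂ i, ⋂ j, {g | (normalized i₀ g).toBlocks₂₁ i j ∈ boxR S (Set.Ico 0 1)}) ∩
      {g | (normalized i₀ g).toBlocks₂₂ ∈ D}) := by
    ext g; simp [unfoldSet]
  rw [e]
  exact h1.inter ((MeasurableSet.iInter fun i => MeasurableSet.iInter fun j => h2 i j).inter h3)

/-- The element `(1 0; z γ)` of `SL(ℤ_S)`. -/
def lowerSL (z : Matrix ι κ (ZS S)) (γ : SLZ S ι) : SLZ S (κ ⊕ ι) :=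
  ⟨fromBlocks 1 0 z γ, by rw [det_fromBlocks_zero₁₂, det_one, one_mul]; exact γ.2⟩

lemma toQS_lowerSL (z : Matrix ι κ (ZS S)) (γ : SLZ S ι) :
    toQS (lowerSL z γ) = fromBlocks 1 0 (z.map (diag S)) (toQS γ) := by
  simp only [toQS, lowerSL, fromBlocks_map]
  congr 1
  · simp
  · simp

/-- These are all elements of the stabilizer of the block row `(1 0)`; the lower right block
inherits determinant one. -/
lemma exists_eq_lowerSL {ε : SLZ S (κ ⊕ ι)} (h : (toQS ε).toRows₁ = fromCols 1 0) :
    ∃ z γ, ε = lowerSL z γ := by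
  have hblock : (ε : Matrix (κ ⊕ ι) (κ ⊕ ι) (ZS S)) =
      fromBlocks 1 0 (ε : Matrix (κ ⊕ ι) (κ ⊕ ι) (ZS S)).toBlocks₂₁
        (ε : Matrix (κ ⊕ ι) (κ ⊕ ι) (ZS S)).toBlocks₂₂ := by
    refine Matrix.ext fun i j => ?_
    rcases i with i | i
    · have := congrFun (congrFun h i) j
      rcases j with j | j
      · have h2 : diag S (ε (Sum.inl i) (Sum.inl j)) = (1 : Matrix κ κ (QS S)) i j := this
        refine diag_injective (h2.trans ?_)
        by_cases hij : i = j
        · subst hij; simp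
        · simp [hij]
      · have h2 : diag S (ε (Sum.inl i) (Sum.inr j)) = 0 := this
        exact diag_injective (h2.trans (map_zero _).symm)
    · rcases j with j | j <;> rfl
  have hdet : (ε : Matrix (κ ⊕ ι) (κ ⊕ ι) (ZS S)).toBlocks₂₂.det = 1 := by
    have := ε.2
    rwa [hblock, det_fromBlocks_zero₁₂, det_one, one_mul] at this
  exact ⟨_, ⟨_, hdet⟩, Subtype.ext hblock⟩

lemma normalized_lowerSL_smul (i₀ : ι) (z : Matrix ι κ (ZS S)) (γ : SLZ S ι)
    (g : Matrix (κ ⊕ ι) (κ ⊕ ι) (QS S)) :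
    (lowerSL z γ • g).toRows₁ = g.toRows₁ ∧
    normalized i₀ (lowerSL z γ • g) = toQS (lowerSL z γ) * normalized i₀ g := by
  have h1 : (lowerSL z γ • g).toRows₁ = g.toRows₁ := by
    have : (toQS (lowerSL z γ)).toRows₁ = (1 : Matrix (κ ⊕ ι) (κ ⊕ ι) (QS S)).toRows₁ := by
      rw [toQS_lowerSL, toRows₁_one]
      refine Matrix.ext fun i j => ?_
      rcases j with j | j <;> rfl
    rw [slz_smul_def, toRows₁_mul, this, ← toRows₁_mul, Matrix.one_mul]
  refine ⟨h1, ?_⟩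
  rw [normalized, h1, slz_smul_def, normalized, Matrix.mul_assoc]

lemma lowerSL_blocks (z : Matrix ι κ (ZS S)) (γ : SLZ S ι) (Y : Matrix ι κ (QS S))
    (g : Matrix ι ι (QS S)) : toQS (lowerSL z γ) * fromBlocks 1 0 Y g =
      fromBlocks 1 0 (z.map (diag S) + toQS γ * Y) (γ • g) := by
  rw [toQS_lowerSL, fromBlocks_multiply, slz_smul_def]
  simp

/-- The elements with the same first rows as `γ₀` form a coset of the group of matrices `(1 0; z
γ')`. There is exactly one `γ'` that brings the lower right block into `D`, and then exactly one
integral `z` that brings the lower left block into the unit box. Thus `unfoldSet` is a fundamental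
domain for the stabilizer of the first rows. -/
lemma exists_unique_fiber (i₀ : ι) {D : Set (Matrix ι ι (QS S))} (hD : IsStrictFD D)
    {g : Matrix (κ ⊕ ι) (κ ⊕ ι) (QS S)} (hg : g ∈ detUnits S (κ ⊕ ι))
    (hgen : ∀ γ : SLZ S (κ ⊕ ι), IsUnit (γ • g).toRows₁.toCols₁.det) (γ₀ : SLZ S (κ ⊕ ι)) :
    ∃! γ : SLZ S (κ ⊕ ι), (toQS γ).toRows₁ = (toQS γ₀).toRows₁ ∧ γ • g ∈ unfoldSet i₀ D := by
  have hrows : ∀ (z : Matrix ι κ (ZS S)) (γ' : SLZ S ι) (γ : SLZ S (κ ⊕ ι)),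
      (toQS (lowerSL z γ' * γ)).toRows₁ = (toQS γ).toRows₁ := fun z γ' γ => by
    rw [toQS_mul]
    exact (normalized_lowerSL_smul i₀ z γ' (toQS γ)).1
  have hblk : ∀ (z : Matrix ι κ (ZS S)) (γ' : SLZ S ι) (γ : SLZ S (κ ⊕ ι)),
      normalized i₀ ((lowerSL z γ' * γ) • g) = fromBlocks 1 0
        (z.map (diag S) + toQS γ' * (normalized i₀ (γ • g)).toBlocks₂₁)
        (γ' • (normalized i₀ (γ • g)).toBlocks₂₂) := fun z γ' γ => by
    rw [mul_smul, (normalized_lowerSL_smul i₀ z γ' (γ • g)).2]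
    conv_lhs => rw [normalized_eq i₀ (hgen γ)]
    exact lowerSL_blocks _ _ _ _
  refine existsUnique_of_exists_of_unique ?_ ?_
  · have hW : (normalized i₀ (γ₀ • g)).toBlocks₂₂ ∈ detUnits S ι := by
      change _ ∈ unitSet S
      rw [det_toBlocks_normalized i₀ (hgen γ₀), det_slz_smul]
      exact hg
    obtain ⟨γ', hγ', -⟩ := hD.exists_unique _ hW
    choose z hz using fun i j => (exists_unique_tile
      ((toQS γ' * (normalized i₀ (γ₀ • g)).toBlocks₂₁) i j)).exists
    refine ⟨lowerSL (Matrix.of z) γ' * γ₀, hrows _ _ _, hgen _, ?_, ?_⟩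
    · intro i j
      rw [hblk, toBlocks_fromBlocks₂₁]
      exact hz i j
    · rw [hblk, toBlocks_fromBlocks₂₂]
      exact hγ'
  · rintro γ₁ γ₂ ⟨h1, h1'⟩ ⟨h2, h2'⟩
    have hε : (toQS (γ₂ * γ₁⁻¹)).toRows₁ = fromCols 1 0 := by
      rw [toQS_mul, toRows₁_mul, h2, ← h1, ← toRows₁_mul, ← toQS_mul, mul_inv_cancel, toQS_one,
        toRows₁_one]
    obtain ⟨z, γ', hzγ⟩ := exists_eq_lowerSL hε
    have h12 : γ₂ = lowerSL z γ' * γ₁ := by rw [← hzγ]; simp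
    have hb := h2'.2
    rw [h12, hblk, toBlocks_fromBlocks₂₁, toBlocks_fromBlocks₂₂] at hb
    have hγ' : γ' = 1 := (hD.exists_unique _ (hD.subset h1'.2.2)).unique hb.2
      (by simpa using h1'.2.2)
    subst hγ'
    have hz : z = 0 := by
      refine Matrix.ext fun i j => ?_
      refine (exists_unique_tile ((normalized i₀ (γ₁ • g)).toBlocks₂₁ i j)).unique ?_ ?_
      · have := hb.1 i j
        rw [toQS_one, Matrix.one_mul] at this
        exact this
      · simpa using h1'.2.1 i j
    subst hz
    rw [h12]
    have : lowerSL (0 : Matrix ι κ (ZS S)) 1 = 1 := by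
      refine Subtype.ext ?_
      change fromBlocks 1 0 0 _ = _
      simp
    rw [this, one_mul]

variable (S κ ι) in
/-- The set of the first rows of elements of `SL(ℤ_S)`. -/
def primRows : Set (Matrix κ (κ ⊕ ι) (QS S)) :=
  Set.range fun γ : SLZ S (κ ⊕ ι) => (toQS γ).toRows₁

lemma fromRows_section (i₀ : ι) (X : Matrix κ (κ ⊕ ι) (QS S)) (Y : Matrix ι κ (QS S))
    (g : Matrix ι ι (QS S)) :
    fromRows X (fromCols Y g * sectionMat i₀ X) = fromBlocks 1 0 Y g * sectionMat i₀ X := by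
  have : fromBlocks (1 : Matrix κ κ (QS S)) 0 Y g = fromRows (fromCols 1 0) (fromCols Y g) := by
    refine Matrix.ext fun i j => ?_
    rcases i with i | i <;> rcases j with j | j <;> rfl
  rw [this, fromRows_mul, ← toRows₁_one, ← toRows₁_mul, Matrix.one_mul, sectionMat_toRows]

/-- The unfolding formula for sums over tuples of rows of `SL(ℤ_S)`. -/
theorem lintegral_primRows (i₀ : ι) {D : Set (Matrix (κ ⊕ ι) (κ ⊕ ι) (QS S))}
    (hD : IsStrictFD D) {D' : Set (Matrix ι ι (QS S))} (hD' : IsStrictFD D')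
    {Φ : Matrix κ (κ ⊕ ι) (QS S) → QS S → ℝ≥0∞} (hΦ : Measurable (Function.uncurry Φ)) :
    ∫⁻ g in D, ∑' X : primRows S κ ι, Φ ((X : Matrix κ (κ ⊕ ι) (QS S)) * g) g.det =
      ∫⁻ X, ∫⁻ g in D', Φ X g.det := by
  classical
  -- The cut-off to `unfoldSet` retains exactly one term of each fibre, so that summing `φ` over a
  -- fibre recovers one value of `Φ`.
  set φ : Matrix (κ ⊕ ι) (κ ⊕ ι) (QS S) → ℝ≥0∞ :=
    (unfoldSet i₀ D').indicator fun g => Φ g.toRows₁ g.det with hφ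
  have hφm : Measurable φ := (hΦ.comp (measurable_toRows₁.prodMk
    continuous_matrix_det.measurable)).indicator (measurableSet_unfoldSet i₀ hD'.measurableSet)
  have hDr : (volume : Measure (Matrix (κ ⊕ ι) (κ ⊕ ι) (QS S))).restrict D =
      (volU S (κ ⊕ ι)).restrict D := by
    rw [volU, Measure.restrict_restrict hD.measurableSet, Set.inter_eq_left.2 hD.subset]
  rw [hDr, lintegral_unfold hD.isFundamentalDomain
    (fun γ => (⟨(toQS γ).toRows₁, γ, rfl⟩ : primRows S κ ι)) hφm]
  -- Normalization preserves the determinant, so `φ` lives on `detUnits` and the restriction of the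
  -- measure can be dropped.
  · have hsub : ∀ g, φ g ≠ 0 → g ∈ detUnits S (κ ⊕ ι) := by
      intro g hg
      have hgE : g ∈ unfoldSet i₀ D' := by
        by_contra h
        exact hg (Set.indicator_of_notMem h _)
      have := hD'.subset hgE.2.2
      change _ ∈ unitSet S at this
      rwa [det_toBlocks_normalized i₀ hgE.1] at this
    have : ∫⁻ g, φ g ∂(volU S (κ ⊕ ι)) = ∫⁻ g, φ g := by
      rw [volU, ← lintegral_indicator isOpen_detUnits.measurableSet]
      refine lintegral_congr fun g => ?_
      by_cases hg : g ∈ detUnits S (κ ⊕ ι)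
      · simp [hg]
      · rw [Set.indicator_of_notMem hg]
        by_contra h
        exact hg (hsub g (Ne.symm h))
    rw [this, lintegral_fromRows hφm]
    refine lintegral_congr_ae ?_
    filter_upwards [ae_isUnit_det_toCols (S := S) (κ := κ) (ι := ι)] with X hX
    have hdet := det_sectionMat i₀ hX
    -- For fixed first rows `X`, write the remaining rows as `Z` times the section matrix of `X`.
    -- That matrix has determinant one, so the measure is unchanged, and the condition defining
    -- `unfoldSet` becomes a product condition on the two blocks of `Z`.
    have hmp := measurePreserving_mul_right (m := ι) (A := sectionMat i₀ X)
      (by simp [hdet]) (by simp [hdet])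
    have hm1 : Measurable fun Z : Matrix ι (κ ⊕ ι) (QS S) => φ (fromRows X Z) :=
      hφm.comp (measurable_fromRows.comp measurable_prodMk_left)
    have hm3 : Measurable fun Z : Matrix ι (κ ⊕ ι) (QS S) =>
      φ (fromRows X (Z * sectionMat i₀ X)) := hm1.comp hmp.measurable
    rw [← hmp.lintegral_comp hm1, lintegral_fromCols hm3]
    have hval : ∀ (Y : Matrix ι κ (QS S)) (g : Matrix ι ι (QS S)),
        φ (fromRows X (fromCols Y g * sectionMat i₀ X)) =
          {Y : Matrix ι κ (QS S) | ∀ i j, Y i j ∈ boxR S (Set.Ico 0 1)}.indicator 1 Y *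
            D'.indicator (fun g => Φ X g.det) g := by
      intro Y g
      rw [fromRows_section]
      have hr : (fromBlocks 1 0 Y g * sectionMat i₀ X).toRows₁ = X := by
        rw [← fromRows_section, toRows₁_fromRows]
      have hn : normalized i₀ (fromBlocks 1 0 Y g * sectionMat i₀ X) = fromBlocks 1 0 Y g := by
        rw [normalized, hr, Matrix.mul_assoc, mul_adjugate, hdet, one_smul, Matrix.mul_one]
      have hdg : (fromBlocks 1 0 Y g * sectionMat i₀ X).det = g.det := by
        rw [det_mul, hdet, mul_one, det_fromBlocks_zero₁₂, det_one, one_mul]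
      have hmem : fromBlocks 1 0 Y g * sectionMat i₀ X ∈ unfoldSet i₀ D' ↔
          (∀ i j, Y i j ∈ boxR S (Set.Ico 0 1)) ∧ g ∈ D' := by
        simp only [unfoldSet, Set.mem_ofPred_eq, hr, hn, hX, true_and, toBlocks_fromBlocks₂₁,
          toBlocks_fromBlocks₂₂]
      simp only [hφ, Set.indicator_apply, hmem, hr, hdg, Set.mem_ofPred_eq, Pi.one_apply]
      by_cases h1 : ∀ i j, Y i j ∈ boxR S (Set.Ico 0 1) <;> by_cases h2 : g ∈ D' <;>
        simp [h1, h2]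
    have hbox : MeasurableSet {Y : Matrix ι κ (QS S) | ∀ i j, Y i j ∈ boxR S (Set.Ico 0 1)} := by
      simp only [Set.ofPred_forall]
      exact MeasurableSet.iInter fun i => MeasurableSet.iInter fun j =>
        measurable_matrix_elem i j (measurableSet_boxR measurableSet_Ico)
    have hm2 : Measurable fun g : Matrix ι ι (QS S) => Φ X g.det :=
      hΦ.comp (measurable_const.prodMk continuous_matrix_det.measurable)
    simp only [hval]
    simp only [lintegral_const_mul _ (hm2.indicator hD'.measurableSet)]
    rw [lintegral_mul_const _ (measurable_one.indicator hbox), lintegral_indicator_one hbox,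
      volume_matrix_box, volume_boxR, Real.volume_Ico, lintegral_indicator hD'.measurableSet]
    simp
  · have hmem : ∀ᵐ g ∂(volU S (κ ⊕ ι)), g ∈ detUnits S (κ ⊕ ι) :=
      ae_restrict_mem isOpen_detUnits.measurableSet
    filter_upwards [hmem, ae_restrict_of_ae (ae_generic (S := S) (κ := κ) (ι := ι))] with g hg hgen
    rintro ⟨_, γ₀, rfl⟩
    obtain ⟨γ₁, ⟨h1, h1'⟩, huniq⟩ := exists_unique_fiber i₀ hD' hg hgen γ₀
    rw [tsum_eq_single ⟨γ₁, Subtype.ext h1⟩]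
    · simp only [hφ]
      rw [Set.indicator_of_mem h1', det_slz_smul, slz_smul_def, toRows₁_mul, h1]
    · rintro ⟨γ, hγ⟩ hne
      refine Set.indicator_of_notMem (fun hmem => hne ?_) _
      exact Subtype.ext (huniq γ ⟨congrArg Subtype.val hγ, hmem⟩)

end Decomposition

end SArith
end

open MeasureTheory Matrix
open scoped ENNReal Pointwise

set_option linter.unusedSectionVars false

noncomputable section

namespace SArith

/-! ### Reduction of vectors over `ℤ` and `ℤ_S` -/

section IntReduction

variable {n R : Type*} [Fintype n] [DecidableEq n] [CommRing R]

/-- The transvection `1 + c E_{ij}` as an element of the special linear group. -/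
def transvectionSL (i j : n) (h : i ≠ j) (c : R) : Matrix.SpecialLinearGroup n R :=
  ⟨transvection i j c, det_transvection_of_ne i j h c⟩

lemma vecMul_transvection (i j : n) (c : R) (v : n → R) :
    v ᵥ* transvection i j c = v + Pi.single j (v i * c) := by
  ext k
  rw [transvection, Matrix.vecMul_add, Matrix.vecMul_one, Pi.add_apply, Pi.add_apply]
  congr 1
  rw [Matrix.vecMul, dotProduct]
  simp only [Matrix.single_apply, Pi.single_apply]
  by_cases h : k = j
  · subst h; simp
  · simp [h, Ne.symm h]

lemma vecMul_transvectionSL (i j : n) (h : i ≠ j) (c : R) (v : n → R) :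
    v ᵥ* (transvectionSL i j h c : Matrix n n R) = v + Pi.single j (v i * c) :=
  vecMul_transvection i j c v

/-- Elements of the special linear group fixing the basis row vectors `e_i`, `i ∈ s`. -/
def fixRows (R : Type*) [CommRing R] (s : Set n) : Set (Matrix.SpecialLinearGroup n R) :=
  {γ | ∀ i ∈ s, Pi.single i 1 ᵥ* (γ : Matrix n n R) = Pi.single i 1}

lemma one_mem_fixRows (s : Set n) : 1 ∈ fixRows R s := by
  intro i _; simp

lemma mul_mem_fixRows {s : Set n} {γ δ : Matrix.SpecialLinearGroup n R} (hγ : γ ∈ fixRows R s)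
    (hδ : δ ∈ fixRows R s) : γ * δ ∈ fixRows R s := by
  intro i hi
  rw [Matrix.SpecialLinearGroup.coe_mul, ← Matrix.vecMul_vecMul, hγ i hi, hδ i hi]

lemma transvectionSL_mem_fixRows {s : Set n} {i j : n} (h : i ≠ j) (hi : i ∉ s) (c : R) :
    transvectionSL i j h c ∈ fixRows R s := by
  intro k hk
  have : k ≠ i := fun e => hi (e ▸ hk)
  rw [vecMul_transvectionSL, Pi.single_eq_of_ne (Ne.symm this)]
  simp

lemma natAbs_sub_lt {a b : ℤ} (ha : a ≠ 0) (hb : b ≠ 0) (hab : a.natAbs ≤ b.natAbs) :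
    ∃ c : ℤ, (b + a * c).natAbs < b.natAbs := by
  rcases le_total 0 a with h1 | h1 <;> rcases le_total 0 b with h2 | h2
  · exact ⟨-1, by omega⟩
  · exact ⟨1, by omega⟩
  · exact ⟨1, by omega⟩
  · exact ⟨-1, by omega⟩

/-- Euclid's algorithm by minimality: if the sum of the absolute values outside `s` is minimal, two
nonzero entries cannot coexist there, since a transvection would shrink the larger one.
Transvections whose source index lies outside `s` fix the basis rows indexed by `s`. -/
lemma exists_fixRows_vecMul_int (s : Set n) {i₁ : n} (hi₁ : i₁ ∉ s) (v : n → ℤ) :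
    ∃ γ ∈ fixRows ℤ s, ∀ j, j ∉ s → j ≠ i₁ →
      (v ᵥ* (γ : Matrix n n ℤ)) j = 0 := by
  classical
  let T : Finset n := Finset.univ.filter fun j => j ∉ s
  have hT : ∀ j, j ∈ T ↔ j ∉ s := fun j => by simp [T]
  let size : Matrix.SpecialLinearGroup n ℤ → ℕ := fun γ =>
    ∑ j ∈ T, ((v ᵥ* (γ : Matrix n n ℤ)) j).natAbs
  have hex : ∃ k, ∃ γ ∈ fixRows ℤ s, size γ = k := ⟨_, 1, one_mem_fixRows s, rfl⟩
  obtain ⟨γ, hγ, hk⟩ := Nat.find_spec hex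
  have hmin : ∀ δ ∈ fixRows ℤ s, size γ ≤ size δ := fun δ hδ => by
    rw [hk]; exact Nat.find_min' hex ⟨δ, hδ, rfl⟩
  set w := v ᵥ* (γ : Matrix n n ℤ) with hw
  have key : ∀ i ∈ T, ∀ j ∈ T, i ≠ j → w i ≠ 0 → w j ≠ 0 → ¬ (w i).natAbs ≤ (w j).natAbs := by
    intro i hi j hj hij hwi hwj hle
    obtain ⟨c, hc⟩ := natAbs_sub_lt hwi hwj hle
    have := hmin (γ * transvectionSL i j hij c)
      (mul_mem_fixRows hγ (transvectionSL_mem_fixRows hij ((hT i).1 hi) c))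
    refine absurd this (not_le.2 ?_)
    simp only [size, Matrix.SpecialLinearGroup.coe_mul, ← Matrix.vecMul_vecMul,
      vecMul_transvectionSL]
    rw [← hw]
    refine Finset.sum_lt_sum (fun k _ => ?_) ⟨j, hj, ?_⟩
    · by_cases hkj : k = j
      · subst hkj; simpa using hc.le
      · simp [hkj]
    · simpa using hc
  have key' : ∀ i ∈ T, ∀ j ∈ T, i ≠ j → w i = 0 ∨ w j = 0 := by
    intro i hi j hj hij
    by_contra! h
    rcases le_total (w i).natAbs (w j).natAbs with hle | hle
    · exact key i hi j hj hij h.1 h.2 hle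
    · exact key j hj i hi hij.symm h.2 h.1 hle
  by_cases hall : ∀ j ∈ T, j ≠ i₁ → w j = 0
  · exact ⟨γ, hγ, fun j hj hj1 => hall j ((hT j).2 hj) hj1⟩
  · push Not at hall
    obtain ⟨j, hj, hj1, hwj⟩ := hall
    -- The surviving entry sits at `j`: the first shear copies it to `i₁`, where the entry is zero,
    -- and the second one clears position `j`. A plain transposition would have determinant `-1`.
    refine ⟨γ * transvectionSL j i₁ hj1 1 * transvectionSL i₁ j hj1.symm (-1),
      mul_mem_fixRows (mul_mem_fixRows hγ (transvectionSL_mem_fixRows _ ((hT j).1 hj) _))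
        (transvectionSL_mem_fixRows _ hi₁ _), fun k hk hk1 => ?_⟩
    have hw1 : w i₁ = 0 := (key' i₁ ((hT _).2 hi₁) j hj hj1.symm).resolve_right hwj
    simp only [Matrix.SpecialLinearGroup.coe_mul, ← Matrix.vecMul_vecMul, vecMul_transvectionSL]
    rw [← hw]
    by_cases hkj : k = j
    · subst hkj
      simp [hw1, hk1]
    · have : w k = 0 := (key' k ((hT _).2 hk) j hj hkj).resolve_right hwj
      simp [hkj, hk1, this]

end IntReduction

variable {S : Finset Prm} {n : Type*} [Fintype n] [DecidableEq n]

lemma one_mem_PS : 1 ∈ PS S := ⟨one_pos, fun l hl => absurd (Nat.dvd_one.1 hl) l.2.one_lt.ne'⟩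

lemma mul_mem_PS {a b : ℕ} (ha : a ∈ PS S) (hb : b ∈ PS S) : a * b ∈ PS S :=
  ⟨Nat.mul_pos ha.1 hb.1, fun l hl => (l.2.dvd_mul.1 hl).elim (ha.2 l) (hb.2 l)⟩

lemma prod_mem_PS {ι : Type*} (s : Finset ι) (f : ι → ℕ) (h : ∀ i ∈ s, f i ∈ PS S) :
    ∏ i ∈ s, f i ∈ PS S := by
  classical
  induction s using Finset.induction_on with
  | empty => exact one_mem_PS
  | insert a s ha ih =>
    rw [Finset.prod_insert ha]
    exact mul_mem_PS (h a (Finset.mem_insert_self _ _))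
      (ih fun i hi => h i (Finset.mem_insert_of_mem hi))

lemma one_mem_NS : 1 ∈ NS S := ⟨one_pos, fun _ _ => Nat.coprime_one_left _⟩

lemma mul_mem_NS {a b : ℕ} (ha : a ∈ NS S) (hb : b ∈ NS S) : a * b ∈ NS S :=
  ⟨Nat.mul_pos ha.1 hb.1, fun p hp => Nat.Coprime.mul_left (ha.2 p hp) (hb.2 p hp)⟩

lemma coprime_of_mem_PS_NS {a b : ℕ} (ha : a ∈ PS S) (hb : b ∈ NS S) : Nat.Coprime a b :=
  Nat.Coprime.symm <| Nat.coprime_of_dvd fun k hk hkb hka => by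
    have := hb.2 ⟨k, hk⟩ (ha.2 ⟨k, hk⟩ hka)
    exact (hk.coprime_iff_not_dvd.1 this.symm) hkb

lemma exists_PS_mul_NS (k : ℕ) (hk : k ≠ 0) : ∃ s ∈ PS S, ∃ m ∈ NS S, k = s * m := by
  classical
  induction k using Nat.recOnMul with
  | zero => exact absurd rfl hk
  | one => exact ⟨1, one_mem_PS, 1, one_mem_NS, rfl⟩
  | prime p hp =>
    by_cases h : (⟨p, hp⟩ : Prm) ∈ S
    · refine ⟨p, ⟨hp.pos, fun l hl => ?_⟩, 1, one_mem_NS, (mul_one _).symm⟩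
      have : l = ⟨p, hp⟩ := Subtype.ext ((Nat.prime_dvd_prime_iff_eq l.2 hp).1 hl)
      rwa [this]
    · refine ⟨1, one_mem_PS, p, ⟨hp.pos, fun l hl => ?_⟩, (one_mul _).symm⟩
      refine (Nat.coprime_primes hp l.2).2 fun e => h ?_
      have : l = ⟨p, hp⟩ := Subtype.ext e.symm
      rwa [← this]
  | mul a b iha ihb =>
    obtain ⟨s, hs, m, hm, rfl⟩ := iha (left_ne_zero_of_mul hk)
    obtain ⟨s', hs', m', hm', rfl⟩ := ihb (right_ne_zero_of_mul hk)
    exact ⟨_, mul_mem_PS hs hs', _, mul_mem_NS hm hm', by ring⟩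

lemma norm_natCast_eq_one {l : Prm} {k : ℕ} (h : ¬ (l : ℕ) ∣ k) : ‖(k : ℚ_[l])‖ = 1 :=
  (Padic.norm_natCast_eq_one_iff).2 ((Nat.Prime.coprime_iff_not_dvd l.2).2 h)

lemma den_mem_PS (z : ZS S) : (z : ℚ).den ∈ PS S := by
  refine ⟨(z : ℚ).pos, fun l hl => ?_⟩
  by_contra hS
  have h1 := PadicInt.isUnit_iff.1 (PadicInt.isUnit_den (p := l) _ (z.2 l hS))
  rw [PadicInt.norm_natCast_eq_one_iff] at h1
  exact l.2.one_lt.ne' (Nat.eq_one_of_dvd_coprimes h1 dvd_rfl hl)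

lemma inv_mem_ZS {s : ℕ} (hs : s ∈ PS S) : (s : ℚ)⁻¹ ∈ ZS S := by
  intro l hl
  have := norm_natCast_eq_one (l := l) (k := s) fun h => hl (hs.2 l h)
  push_cast
  rw [norm_inv, this, inv_one]

lemma exists_common_den {ι : Type*} [Fintype ι] (v : ι → ZS S) :
    ∃ c ∈ PS S, ∃ k : ι → ℤ, ∀ i, (k i : ℚ) = c * (v i : ℚ) := by
  classical
  refine ⟨∏ i, (v i : ℚ).den, prod_mem_PS _ _ fun i _ => den_mem_PS (v i),
    fun i => (v i : ℚ).num * ∏ j ∈ Finset.univ.erase i, ((v j : ℚ).den : ℤ), fun i => ?_⟩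
  rw [← Finset.mul_prod_erase _ _ (Finset.mem_univ i)]
  push_cast
  rw [← Rat.mul_den_eq_num (v i : ℚ)]
  ring

/-- The diagonal matrix with entries `u` at `i`, `u⁻¹` at `j`. -/
lemma exists_diagonal_SL {R : Type*} [CommRing R] (u : Rˣ) {i j : n} (hij : i ≠ j) :
    ∃ δ : Matrix.SpecialLinearGroup n R, ∀ v : n → R, (v ᵥ* (δ : Matrix n n R)) i = v i * u ∧
      (∀ k, k ≠ i → v k = 0 → (v ᵥ* (δ : Matrix n n R)) k = 0) ∧
      (∀ k, k ≠ i → k ≠ j → (v ᵥ* (δ : Matrix n n R)) k = v k) := by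
  refine ⟨⟨diagonal (Function.update (Function.update 1 j ((u⁻¹ : Rˣ) : R)) i (u : R)), ?_⟩,
    fun v => ?_⟩
  · rw [det_diagonal, ← Finset.mul_prod_erase _ _ (Finset.mem_univ i),
      ← Finset.mul_prod_erase _ _ (Finset.mem_erase.2 ⟨hij.symm, Finset.mem_univ j⟩),
      Finset.prod_eq_one]
    · simp [hij.symm]
    · intro k hk
      simp only [Finset.mem_erase] at hk
      simp [hk.1, hk.2.1]
  · simp only [vecMul_diagonal]
    refine ⟨by simp, fun k hk h => by simp [h], fun k hk hk' => by simp [hk, hk']⟩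

lemma vecMul_eq_self_of_fixRows {R : Type*} [CommRing R] {s : Set n}
    {γ : Matrix.SpecialLinearGroup n R} (hγ : γ ∈ fixRows R s) {w : n → R}
    (hw : ∀ j, j ∉ s → w j = 0) : w ᵥ* (γ : Matrix n n R) = w := by
  have e : w = ∑ i, w i • (Pi.single i 1 : n → R) := by
    ext j; simp [Finset.sum_apply, Pi.single_apply]
  conv_lhs => rw [e]
  conv_rhs => rw [e]
  rw [Matrix.sum_vecMul]
  refine Finset.sum_congr rfl fun i _ => ?_
  rw [Matrix.smul_vecMul]
  by_cases hi : i ∈ s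
  · rw [hγ i hi]
  · rw [hw i hi, zero_smul, zero_smul]

lemma vecMul_SL_injective {R : Type*} [CommRing R] (γ : Matrix.SpecialLinearGroup n R) :
    Function.Injective fun v : n → R => v ᵥ* (γ : Matrix n n R) := by
  intro v w h
  have := congrArg (fun x => x ᵥ* ((γ⁻¹ : Matrix.SpecialLinearGroup n R) : Matrix n n R)) h
  simpa only [Matrix.vecMul_vecMul, ← Matrix.SpecialLinearGroup.coe_mul, mul_inv_cancel,
    Matrix.SpecialLinearGroup.coe_one, Matrix.vecMul_one] using this

/-- The unit of `ℤ_S` attached to a quotient of elements of `ℙ_S`. -/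
def unitOfPS {a b : ℕ} (ha : a ∈ PS S) (hb : b ∈ PS S) : (ZS S)ˣ where
  val := ⟨a * (b : ℚ)⁻¹, mul_mem (natCast_mem _ a) (inv_mem_ZS hb)⟩
  inv := ⟨b * (a : ℚ)⁻¹, mul_mem (natCast_mem _ b) (inv_mem_ZS ha)⟩
  val_inv := Subtype.ext <| by
    have h1 : (a : ℚ) ≠ 0 := by exact_mod_cast ha.1.ne'
    have h2 : (b : ℚ) ≠ 0 := by exact_mod_cast hb.1.ne'
    change (a * (b : ℚ)⁻¹) * (b * (a : ℚ)⁻¹) = 1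
    field_simp
  inv_val := Subtype.ext <| by
    have h1 : (a : ℚ) ≠ 0 := by exact_mod_cast ha.1.ne'
    have h2 : (b : ℚ) ≠ 0 := by exact_mod_cast hb.1.ne'
    change (b * (a : ℚ)⁻¹) * (a * (b : ℚ)⁻¹) = 1
    field_simp

lemma coe_unitOfPS {a b : ℕ} (ha : a ∈ PS S) (hb : b ∈ PS S) :
    ((unitOfPS ha hb : ZS S) : ℚ) = a * (b : ℚ)⁻¹ := rfl

/-- The sign, the denominator and the part of the numerator composed of primes of `S` are all units
of `ℤ_S`. -/
lemma exists_unit_mul_eq_natCast {z : ZS S} (hz : z ≠ 0) :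
    ∃ u : (ZS S)ˣ, ∃ m ∈ NS S, z * u = m := by
  have hz0 : (z : ℚ) ≠ 0 := fun h => hz (Subtype.ext h)
  obtain ⟨s, hs, m, hm, hsm⟩ := exists_PS_mul_NS (S := S) (z : ℚ).num.natAbs
    (Int.natAbs_ne_zero.2 (Rat.num_ne_zero.2 hz0))
  have hs0 : (s : ℚ) ≠ 0 := by exact_mod_cast hs.1.ne'
  have hden := den_mem_PS z
  have hd0 : ((z : ℚ).den : ℚ) ≠ 0 := by exact_mod_cast hden.1.ne'
  have hnum : (z : ℚ) * (z : ℚ).den = (z : ℚ).num := Rat.mul_den_eq_num _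
  rcases Int.natAbs_eq (z : ℚ).num with h | h
  · refine ⟨unitOfPS hden hs, m, hm, Subtype.ext ?_⟩
    rw [Subring.coe_mul, coe_unitOfPS, ← mul_assoc, hnum, h, hsm]
    push_cast
    field_simp
  · refine ⟨-unitOfPS hden hs, m, hm, Subtype.ext ?_⟩
    rw [Units.val_neg, mul_neg, Subring.coe_neg, Subring.coe_mul, coe_unitOfPS, ← mul_assoc,
      hnum, h, hsm]
    push_cast
    field_simp

/-- Clear denominators by an element of `ℙ_S` and reduce over `ℤ`. The remaining entry is then
multiplied by a unit to land in `ℕ_S`; the second free index `i₂` absorbs the inverse unit, so that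
the determinant stays one. -/
lemma exists_fixRows_vecMul (s : Set n) {i₁ i₂ : n} (hi₁ : i₁ ∉ s) (hi₂ : i₂ ∉ s) (h12 : i₁ ≠ i₂)
    (v : n → ZS S) (hv : ∃ j, j ∉ s ∧ v j ≠ 0) :
    ∃ γ ∈ fixRows (ZS S) s, ∃ m ∈ NS S, (v ᵥ* (γ : Matrix n n (ZS S))) i₁ = m ∧
      ∀ j, j ∉ s → j ≠ i₁ → (v ᵥ* (γ : Matrix n n (ZS S))) j = 0 := by
  obtain ⟨c, hc, k, hk⟩ := exists_common_den v
  have hc0 : (c : ZS S) ≠ 0 := by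
    have := hc.1.ne'
    exact_mod_cast this
  obtain ⟨γ₀, hγ₀, h0⟩ := exists_fixRows_vecMul_int s hi₁ k
  let φ := Int.castRingHom (ZS S)
  let γ : SLZ S n := Matrix.SpecialLinearGroup.map φ γ₀
  have hcoe : (γ : Matrix n n (ZS S)) = (γ₀ : Matrix n n ℤ).map φ := rfl
  have hγ : γ ∈ fixRows (ZS S) s := by
    intro i hi
    have h1 : (Pi.single i 1 : n → ZS S) = φ ∘ (Pi.single i 1 : n → ℤ) := by
      ext j
      by_cases hj : j = i
      · subst hj; simp
      · simp [hj]
    rw [hcoe, h1]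
    ext j
    rw [← RingHom.map_vecMul, hγ₀ i hi]
    rfl
  have hkv : φ ∘ k = (c : ZS S) • v := by
    ext j
    simpa [φ] using hk j
  have hvγ : ∀ j, (c : ZS S) * (v ᵥ* (γ : Matrix n n (ZS S))) j =
      φ ((k ᵥ* (γ₀ : Matrix n n ℤ)) j) := by
    intro j
    rw [RingHom.map_vecMul, hkv, Matrix.smul_vecMul]
    rfl
  have hzero : ∀ j, j ∉ s → j ≠ i₁ → (v ᵥ* (γ : Matrix n n (ZS S))) j = 0 := by
    intro j hj hj1
    have := hvγ j
    rw [h0 j hj hj1, map_zero] at this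
    exact (mul_eq_zero.1 this).resolve_left hc0
  have hne : (v ᵥ* (γ : Matrix n n (ZS S))) i₁ ≠ 0 := by
    intro h
    have hall : ∀ j, j ∉ s → (v ᵥ* (γ : Matrix n n (ZS S))) j = 0 := fun j hj => by
      by_cases hj1 : j = i₁
      · rw [hj1, h]
      · exact hzero j hj hj1
    -- If nothing survives outside `s`, then `v γ` is supported on `s` and hence fixed by `γ`.
    -- Injectivity gives `v = v γ`, contrary to the nonzero entry of `v` outside `s`.
    have hfix := vecMul_eq_self_of_fixRows hγ hall
    have := vecMul_SL_injective γ hfix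
    obtain ⟨j, hj, hvj⟩ := hv
    exact hvj (by rw [← this]; exact hall j hj)
  obtain ⟨u, m, hm, hum⟩ := exists_unit_mul_eq_natCast hne
  obtain ⟨δ, hδ⟩ := exists_diagonal_SL u h12
  refine ⟨γ * δ, mul_mem_fixRows hγ fun i hi => ?_, m, hm, ?_, fun j hj hj1 => ?_⟩
  · have hi1 : i ≠ i₁ := fun h => hi₁ (h ▸ hi)
    have hi2 : i ≠ i₂ := fun h => hi₂ (h ▸ hi)
    ext j
    by_cases hj1 : j = i₁
    · subst hj1; rw [(hδ _).1]; simp [hi1.symm]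
    · by_cases hj2 : j = i₂
      · subst hj2; rw [(hδ _).2.1 _ hj1 (by simp [hi2.symm])]; simp [hi2.symm]
      · rw [(hδ _).2.2 j hj1 hj2]
  · rw [Matrix.SpecialLinearGroup.coe_mul, ← Matrix.vecMul_vecMul, (hδ _).1, hum]
  · rw [Matrix.SpecialLinearGroup.coe_mul, ← Matrix.vecMul_vecMul,
      (hδ _).2.1 _ hj1 (hzero j hj hj1)]

lemma single_vecMul_eq {R : Type*} [CommRing R] (M : Matrix n n R) (i : n) (r : R) :
    Pi.single i r ᵥ* M = r • M i := by
  ext j; simp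

lemma eq_vecMul_inv {R : Type*} [CommRing R] {γ : Matrix.SpecialLinearGroup n R} {v w : n → R}
    (h : v ᵥ* (γ : Matrix n n R) = w) :
    v = w ᵥ* ((γ⁻¹ : Matrix.SpecialLinearGroup n R) : Matrix n n R) := by
  rw [← h, Matrix.vecMul_vecMul, ← Matrix.SpecialLinearGroup.coe_mul, mul_inv_cancel,
    Matrix.SpecialLinearGroup.coe_one, Matrix.vecMul_one]

/-- A nonzero vector of `S`-integers is a multiple of a row of an element of `SL(ℤ_S)`. -/
lemma exists_eq_smul_row {i₁ i₂ : n} (h12 : i₁ ≠ i₂) {v : n → ZS S} (hv : v ≠ 0) :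
    ∃ γ : SLZ S n, ∃ m ∈ NS S, v = (m : ZS S) • γ i₁ := by
  obtain ⟨j, hj⟩ := Function.ne_iff.1 hv
  obtain ⟨γ, -, m, hm, h1, h2⟩ := exists_fixRows_vecMul (S := S) (∅ : Set n) (i₁ := i₁) (i₂ := i₂)
    (by simp) (by simp) h12 v ⟨j, by simp, hj⟩
  refine ⟨γ⁻¹, m, hm, ?_⟩
  have : v ᵥ* (γ : Matrix n n (ZS S)) = Pi.single i₁ (m : ZS S) := by
    ext j
    by_cases hj : j = i₁
    · subst hj; simp [h1]
    · rw [h2 j (by simp) hj]; simp [hj]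
  rw [eq_vecMul_inv this, single_vecMul_eq]

/-- `ℤ_S / c` coincides with `ℤ / c`, because the denominators of `S`-integers are invertible modulo
`c`. -/
lemma exists_natCast_add_mul {c : ℕ} (hc : c ∈ NS S) (b : ZS S) :
    ∃ b' < c, ∃ z : ZS S, b = b' + c * z := by
  have hden := den_mem_PS b
  have hcop : IsCoprime ((b : ℚ).den : ℤ) (c : ℤ) :=
    Nat.isCoprime_iff_coprime.2 (coprime_of_mem_PS_NS hden hc)
  obtain ⟨x, y, hxy⟩ := hcop
  have hd0 : ((b : ℚ).den : ℚ) ≠ 0 := by exact_mod_cast hden.1.ne'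
  have hnum : (b : ℚ) * (b : ℚ).den = (b : ℚ).num := Rat.mul_den_eq_num _
  have hc0 : (0 : ℤ) < c := by exact_mod_cast hc.1
  set N := (b : ℚ).num * x with hN
  have hdm : N = N % c + c * (N / c) := (Int.emod_add_mul_ediv N c).symm
  have hNb : b = N + c * (y * b) := by
    refine Subtype.ext ?_
    push_cast
    have h2 : (x : ℚ) * (b : ℚ).den + y * c = 1 := by exact_mod_cast hxy
    rw [hN]; push_cast; rw [← hnum]
    linear_combination (-(b : ℚ)) * h2
  refine ⟨(N % c).toNat, ?_, (N / c : ℤ) + y * b, ?_⟩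
  · have := Int.emod_lt_of_pos N hc0
    have := Int.emod_nonneg N hc0.ne'
    omega
  · have h3 : (((N % c).toNat : ℤ) : ZS S) = ((N % c : ℤ) : ZS S) := by
      rw [Int.toNat_of_nonneg (Int.emod_nonneg N hc0.ne')]
    rw [Int.cast_natCast] at h3
    rw [h3]
    conv_lhs => rw [hNb, hdm]
    push_cast
    ring

/-- A pair of independent vectors of `S`-integers in terms of two rows of an element of
`SL(ℤ_S)`. -/
lemma exists_eq_two_rows {i₀ i₁ i₂ : n} (h01 : i₀ ≠ i₁) (h02 : i₀ ≠ i₂) (h12 : i₁ ≠ i₂)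
    {v w : n → ZS S} (hvw : ∀ a b : ZS S, a • v + b • w = 0 → a = 0 ∧ b = 0) :
    ∃ γ : SLZ S n, ∃ a ∈ NS S, ∃ c ∈ NS S, ∃ b < c, v = (a : ZS S) • γ i₀ ∧
      w = (b : ZS S) • γ i₀ + (c : ZS S) • γ i₁ := by
  have hv : v ≠ 0 := by
    rintro rfl
    exact one_ne_zero (hvw 1 0 (by simp)).1
  obtain ⟨γ₁, a, ha, hva⟩ := exists_eq_smul_row (S := S) h01 hv
  have ha0 : (a : ZS S) ≠ 0 := by
    have := ha.1.ne'
    exact_mod_cast this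
  set w' := w ᵥ* ((γ₁⁻¹ : SLZ S n) : Matrix n n (ZS S)) with hw'
  have hww' : w = w' ᵥ* (γ₁ : Matrix n n (ZS S)) := by
    have := eq_vecMul_inv (γ := γ₁⁻¹) hw'.symm
    rwa [inv_inv] at this
  -- Otherwise `w` would be a multiple of the row carrying `v`, against independence.
  have hne : ∃ j, j ∉ ({i₀} : Set n) ∧ w' j ≠ 0 := by
    by_contra! hcon
    have e : w' = Pi.single i₀ (w' i₀) := by
      ext j
      by_cases hj : j = i₀
      · subst hj; simp
      · rw [hcon j hj]; simp [hj]
    have hw2 : w = w' i₀ • γ₁ i₀ := by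
      rw [hww']; conv_lhs => rw [e]
      exact single_vecMul_eq _ _ _
    have := (hvw (w' i₀) (-(a : ZS S)) (by rw [hva, hw2, smul_smul, smul_smul, ← add_smul]; ring_nf; simp)).2
    exact ha0 (neg_eq_zero.1 this)
  obtain ⟨γ₂, hγ₂, c, hc, h1, h2⟩ := exists_fixRows_vecMul (S := S) ({i₀} : Set n) (i₁ := i₁)
    (i₂ := i₂) (by simpa using h01.symm) (by simpa using h02.symm) h12 w' hne
  set b := (w' ᵥ* (γ₂ : Matrix n n (ZS S))) i₀ with hb
  have hw2 : w' ᵥ* (γ₂ : Matrix n n (ZS S)) = Pi.single i₀ b + Pi.single i₁ (c : ZS S) := by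
    ext j
    by_cases hj0 : j = i₀
    · subst hj0; simp [h01, ← hb]
    · by_cases hj1 : j = i₁
      · subst hj1; rw [h1]; simp [hj0]
      · rw [h2 j (by simpa using hj0) hj1]; simp [hj0, hj1]
  have hfix : (γ₂⁻¹ : SLZ S n) i₀ = (Pi.single i₀ 1 : n → ZS S) := by
    have := eq_vecMul_inv (hγ₂ i₀ rfl)
    rw [single_vecMul_eq, one_smul] at this
    exact this.symm
  obtain ⟨b', hb', z, hz⟩ := exists_natCast_add_mul hc b
  have hrow : ∀ (γ δ : SLZ S n) (i : n), (γ * δ) i = (γ i) ᵥ* (δ : Matrix n n (ZS S)) :=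
    fun γ δ i => rfl
  have ht : ∀ i, (transvectionSL i₁ i₀ h01.symm z : SLZ S n) i =
      (Pi.single i 1 + Pi.single i₀ ((Pi.single i 1 : n → ZS S) i₁ * z) : n → ZS S) := fun i => by
    rw [← vecMul_transvectionSL i₁ i₀ h01.symm z, single_vecMul_eq, one_smul]
  -- The extra shear adds `z` times row `i₀` to row `i₁`, which replaces the coefficient `b` by its
  -- residue `b'` modulo `c` and leaves row `i₀` alone.
  refine ⟨transvectionSL i₁ i₀ h01.symm z * (γ₂⁻¹ * γ₁), a, ha, c, hc, b', hb', ?_, ?_⟩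
  · rw [hrow, ht]
    simp only [Pi.single_eq_of_ne h01.symm, zero_mul, Pi.single_zero, add_zero]
    rw [single_vecMul_eq, one_smul, hva]
    congr 1
    rw [hrow, hfix, single_vecMul_eq, one_smul]
  · rw [hrow, hrow, ht, ht]
    simp only [Pi.single_eq_of_ne h01.symm, zero_mul, Pi.single_zero, add_zero, Pi.single_eq_same,
      one_mul]
    rw [hww', eq_vecMul_inv hw2, Matrix.vecMul_vecMul, ← Matrix.SpecialLinearGroup.coe_mul,
      Matrix.add_vecMul, Matrix.add_vecMul]
    simp only [single_vecMul_eq, one_smul]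
    rw [hz, add_smul, smul_add, smul_smul]
    abel

end SArith
end

open MeasureTheory Matrix
open scoped ENNReal Pointwise

set_option linter.unusedSectionVars false

noncomputable section

namespace SArith

/-! ### Change of index set -/

variable {S : Finset Prm}

section Reindex

variable {m n m' n' : Type*} [Fintype m] [Fintype n] [Fintype m'] [Fintype n']

lemma measurePreserving_submatrix_rows (e : m' ≃ m) :
    MeasurePreserving (fun A : Matrix m n (QS S) => A.submatrix e id) := by
  have h := volume_measurePreserving_piCongrLeft (fun _ : m' => n → QS S) e.symm
  have e1 : (fun A : Matrix m n (QS S) => A.submatrix e id) =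
      (MeasurableEquiv.piCongrLeft (fun _ : m' => n → QS S) e.symm : (m → n → QS S) → _) := by
    funext A
    refine Matrix.ext fun i j => ?_
    have := MeasurableEquiv.piCongrLeft_apply_apply (β := fun _ : m' => n → QS S) e.symm A (e i)
    rw [Equiv.symm_apply_apply] at this
    exact (congrFun this j).symm
  rw [e1]
  exact h

lemma measurePreserving_submatrix (e : m' ≃ m) (e' : n' ≃ n) :
    MeasurePreserving (fun A : Matrix m n (QS S) => A.submatrix e e') := by
  have h1 := measurePreserving_submatrix_rows (S := S) (n := n) e
  have h2 := (measurePreserving_transpose (S := S) (m := n') (n := m')).comp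
    ((measurePreserving_submatrix_rows (S := S) (n := m') e').comp
      (measurePreserving_transpose (S := S) (m := m') (n := n)))
  exact h2.comp h1

variable [DecidableEq m] [DecidableEq n]

/-- Change of the index set in the special linear group. -/
def reindexSL (e : m ≃ n) : SLZ S m ≃ SLZ S n where
  toFun γ := ⟨(γ : Matrix m m (ZS S)).submatrix e.symm e.symm, by
    rw [det_submatrix_equiv_self]; exact γ.2⟩
  invFun γ := ⟨(γ : Matrix n n (ZS S)).submatrix e e, by
    rw [det_submatrix_equiv_self]; exact γ.2⟩
  left_inv γ := by ext; simp
  right_inv γ := by ext; simp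

lemma toQS_reindexSL (e : m ≃ n) (γ : SLZ S m) :
    toQS (reindexSL e γ) = (toQS γ).submatrix e.symm e.symm := rfl

lemma reindexSL_smul (e : m ≃ n) (γ : SLZ S m) (g : Matrix m m (QS S)) :
    (γ • g).submatrix e.symm e.symm = reindexSL e γ • g.submatrix e.symm e.symm := by
  rw [slz_smul_def, slz_smul_def, toQS_reindexSL, Matrix.submatrix_mul_equiv]

lemma IsStrictFD.reindex (e : m ≃ n) {D : Set (Matrix n n (QS S))} (hD : IsStrictFD D) :
    IsStrictFD {g : Matrix m m (QS S) | g.submatrix e.symm e.symm ∈ D} := by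
  have hdet : ∀ g : Matrix m m (QS S), g.submatrix e.symm e.symm ∈ detUnits S n ↔
      g ∈ detUnits S m := fun g => by
    simp only [detUnits, Set.mem_ofPred_eq, det_submatrix_equiv_self]
  refine ⟨(measurePreserving_submatrix e.symm e.symm).measurable hD.measurableSet,
    fun g hg => (hdet g).1 (hD.subset hg), fun g hg => ?_⟩
  obtain ⟨γ, hγ, hu⟩ := hD.exists_unique _ ((hdet g).2 hg)
  refine ⟨(reindexSL e).symm γ, ?_, fun δ hδ => ?_⟩
  · change _ ∈ D
    rw [reindexSL_smul, Equiv.apply_symm_apply]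
    exact hγ
  · rw [Equiv.eq_symm_apply]
    refine hu _ ?_
    change _ ∈ D at hδ
    rwa [reindexSL_smul] at hδ

end Reindex

/-! ### Rational matrices -/

section Rational

variable {κ ι n : Type*} [Fintype κ] [Fintype ι] [Fintype n]

/-- The image of a rational matrix in the matrices over `ℚ_S`. -/
def ratMat (S : Finset Prm) {κ n : Type*} (X : Matrix κ n ℚ) : Matrix κ n (QS S) :=
  X.map (algebraMap ℚ (QS S))

instance countable_ratMatrix : Countable (Matrix κ n ℚ) := inferInstanceAs (Countable (κ → n → ℚ))

lemma ratMat_mul {l : Type*} (X : Matrix κ n ℚ) (Y : Matrix n l ℚ) :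
    ratMat S (X * Y) = ratMat S X * ratMat S Y := Matrix.map_mul

lemma ratMat_add (X Y : Matrix κ n ℚ) : ratMat S (X + Y) = ratMat S X + ratMat S Y :=
  Matrix.map_add _ (map_add _) _ _

lemma algebraMap_injective : Function.Injective (algebraMap ℚ (QS S)) := (algebraMap ℚ (QS S)).injective

lemma ratMat_injective : Function.Injective (ratMat S : Matrix κ n ℚ → _) :=
  Matrix.map_injective algebraMap_injective

variable [DecidableEq κ] [DecidableEq ι] [DecidableEq n]

/-- An element of `SL(ℤ_S)` as a rational matrix. -/
def toQ (γ : SLZ S n) : Matrix n n ℚ := (γ : Matrix n n (ZS S)).map (ZS S).subtype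

lemma ratMat_toQ (γ : SLZ S n) : ratMat S (toQ γ) = toQS γ := rfl

@[simp] lemma toQ_one : toQ (1 : SLZ S n) = 1 := by simp [toQ]

@[simp] lemma toQ_mul (γ δ : SLZ S n) : toQ (γ * δ) = toQ γ * toQ δ :=
  Matrix.map_mul

/-- The tuples of rows with indices `e (inl k)` of elements of `SL_n(ℤ_S)`. -/
def prim (S : Finset Prm) (e : κ ⊕ ι ≃ n) : Set (Matrix κ n ℚ) :=
  Set.range fun γ : SLZ S n => (toQ γ).submatrix (fun k => e (Sum.inl k)) id

lemma submatrix_mul_toQ (f : κ → n) (γ δ : SLZ S n) :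
    (toQ γ).submatrix f id * toQ δ = (toQ (γ * δ)).submatrix f id := by
  rw [toQ_mul]; rfl

/-- The unfolding formula for sums over tuples of rows of `SL(ℤ_S)`. -/
theorem lintegral_prim (e : κ ⊕ ι ≃ n) (i₀ : ι) {D : Set (Matrix n n (QS S))}
    (hD : IsStrictFD D) {D' : Set (Matrix ι ι (QS S))} (hD' : IsStrictFD D')
    {Φ : Matrix κ n (QS S) → QS S → ℝ≥0∞} (hΦ : Measurable (Function.uncurry Φ)) :
    ∫⁻ g in D, ∑' X : prim S e, Φ (ratMat S (X : Matrix κ n ℚ) * g) g.det =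
      ∫⁻ X, ∫⁻ g in D', Φ X g.det := by
  have hmp := measurePreserving_submatrix (S := S) e.symm e.symm
  have hmp' := measurePreserving_submatrix (S := S) (Equiv.refl κ) e
  have hmp'' := measurePreserving_submatrix (S := S) (Equiv.refl κ) e.symm
  set Φ' : Matrix κ (κ ⊕ ι) (QS S) → QS S → ℝ≥0∞ :=
    fun X δ => Φ (X.submatrix (Equiv.refl κ) e.symm) δ with hΦ'def
  have hΦ' : Measurable (Function.uncurry Φ') := by
    have : Function.uncurry Φ' = Function.uncurry Φ ∘ fun x : Matrix κ (κ ⊕ ι) (QS S) × QS S =>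
      (x.1.submatrix (Equiv.refl κ) e.symm, x.2) := rfl
    rw [this]
    exact hΦ.comp ((hmp''.measurable.comp measurable_fst).prodMk measurable_snd)
  have key := lintegral_primRows i₀ (hD.reindex e) hD' hΦ'
  have hrhs : ∫⁻ X : Matrix κ (κ ⊕ ι) (QS S), ∫⁻ g in D', Φ' X g.det =
      ∫⁻ X, ∫⁻ g in D', Φ X g.det := by
    refine hmp''.lintegral_comp (f := fun X => ∫⁻ g in D', Φ X g.det) ?_
    refine Measurable.lintegral_prod_right' (f := fun x : Matrix κ n (QS S) × Matrix ι ι (QS S) =>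
      Φ x.1 x.2.det) ?_
    exact hΦ.comp (measurable_fst.prodMk (continuous_matrix_det.measurable.comp measurable_snd))
  rw [← hrhs, ← key]
  have hsub : ∀ (F : Matrix n n (QS S) → ℝ≥0∞), Measurable F → ∫⁻ g in D, F g =
      ∫⁻ g in {g : Matrix (κ ⊕ ι) (κ ⊕ ι) (QS S) | g.submatrix e.symm e.symm ∈ D},
        F (g.submatrix e.symm e.symm) := fun F hF =>
    (hmp.restrict_preimage hD.measurableSet).lintegral_comp hF |>.symm
  rw [hsub]
  · refine lintegral_congr fun g => ?_
    -- The group element chosen for `X` is arbitrary, but only its first rows are used, and these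
    -- are determined by `X`.
    let E : primRows S κ ι ≃ prim S e := Equiv.ofBijective
      (fun X => ⟨Matrix.of fun k j => (X.2.choose (Sum.inl k) (e.symm j) : ℚ),
        reindexSL e X.2.choose, by
          refine Matrix.ext fun k j => ?_
          change ((X.2.choose (e.symm (e (Sum.inl k))) (e.symm j) : ZS S) : ℚ) = _
          rw [Equiv.symm_apply_apply]; rfl⟩) (by
        constructor
        · rintro X Y h
          have h1 := congrArg Subtype.val h
          refine Subtype.ext ?_
          rw [← X.2.choose_spec, ← Y.2.choose_spec]
          refine Matrix.ext fun k j => ?_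
          have h2 : (X.2.choose (Sum.inl k) (e.symm (e j)) : ℚ) =
            Y.2.choose (Sum.inl k) (e.symm (e j)) := congrFun (congrFun h1 k) (e j)
          rw [Equiv.symm_apply_apply] at h2
          change algebraMap ℚ (QS S) _ = algebraMap ℚ (QS S) _
          exact congrArg _ h2
        · rintro ⟨_, γ, rfl⟩
          set X : primRows S κ ι := ⟨_, (reindexSL e).symm γ, rfl⟩ with hX
          refine ⟨X, Subtype.ext (Matrix.ext fun k j => ?_)⟩
          have h1 := congrFun (congrFun X.2.choose_spec k) (e.symm j)
          have h2 : diag S (X.2.choose (Sum.inl k) (e.symm j)) =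
            diag S (γ (e (Sum.inl k)) (e (e.symm j))) := h1
          have h3 := diag_injective h2
          rw [Equiv.apply_symm_apply] at h3
          exact congrArg Subtype.val h3)
    have hE : ∀ X : primRows S κ ι, ratMat S (E X : Matrix κ n ℚ) =
        (X : Matrix κ (κ ⊕ ι) (QS S)).submatrix (Equiv.refl κ) e.symm := by
      intro X
      refine Matrix.ext fun k j => ?_
      exact congrFun (congrFun X.2.choose_spec k) (e.symm j)
    rw [← E.tsum_eq]
    refine tsum_congr fun X => ?_
    simp only [hΦ'def]
    rw [det_submatrix_equiv_self, hE, Matrix.submatrix_mul_equiv]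
  · refine Measurable.tsum fun X => ?_
    have hc : Measurable fun g : Matrix n n (QS S) => ratMat S (X : Matrix κ n ℚ) * g := by
      have : Continuous fun g : Matrix n n (QS S) => ratMat S (X : Matrix κ n ℚ) * g :=
        continuous_const.matrix_mul continuous_id
      exact this.measurable
    exact hΦ.comp (hc.prodMk continuous_matrix_det.measurable)

end Rational

end SArith
end

open MeasureTheory Matrix
open scoped ENNReal Pointwise

set_option linter.unusedSectionVars false

noncomputable section

namespace SArith

/-! ### Lattices of matrices and tilings -/

variable {S : Finset Prm} {κ n : Type*} [Fintype κ] [Fintype n] [DecidableEq n]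

/-- The matrices with entries in `ℤ_S`. -/
def intMat (S : Finset Prm) (κ n : Type*) : AddSubgroup (Matrix κ n ℚ) where
  carrier := {X | ∀ i j, X i j ∈ ZS S}
  add_mem' ha hb i j := add_mem (ha i j) (hb i j)
  zero_mem' _ _ := zero_mem _
  neg_mem' ha i j := neg_mem (ha i j)

lemma toQ_mem (γ : SLZ S n) : toQ γ ∈ intMat S n n := fun i j => (γ i j).2

lemma mul_mem_intMat {l : Type*} {X : Matrix κ n ℚ} {Y : Matrix n l ℚ} (hX : X ∈ intMat S κ n)
    (hY : Y ∈ intMat S n l) : X * Y ∈ intMat S κ l := fun i j => by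
  rw [Matrix.mul_apply]
  exact sum_mem fun k _ => mul_mem (hX i k) (hY k j)

/-- The lattice of all `X h`, where `X` has entries in `ℤ_S`. -/
def lat (S : Finset Prm) (κ : Type*) [Fintype κ] (h : Matrix n n (QS S)) :
    AddSubgroup (Matrix κ n (QS S)) :=
  (intMat S κ n).map
    (AddMonoidHom.mk' (fun X => ratMat S X * h) fun X Y => by rw [ratMat_add, Matrix.add_mul])

instance countable_lat (h : Matrix n n (QS S)) : Countable (lat S κ h) := by
  have : ((lat S κ h : AddSubgroup _) : Set (Matrix κ n (QS S))).Countable :=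
    ((intMat S κ n : Set (Matrix κ n ℚ)).to_countable).image _
  exact this.to_subtype

/-- A fundamental domain for `lat`, contained in a prescribed small `p`-adic set when `s` is
divisible by high powers of the primes in `S`. -/
def tile (κ : Type*) (s : ℕ) (h : Matrix n n (QS S)) : Set (Matrix κ n (QS S)) :=
  {Y | ∀ i j, algebraMap ℚ (QS S) (s : ℚ)⁻¹ * (Y * h⁻¹) i j ∈ boxR S (Set.Ico 0 1)}

lemma measurableSet_tile (s : ℕ) (h : Matrix n n (QS S)) : MeasurableSet (tile κ s h) := by
  simp only [tile, Set.ofPred_forall]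
  refine MeasurableSet.iInter fun i => MeasurableSet.iInter fun j => ?_
  have : Continuous fun Y : Matrix κ n (QS S) => algebraMap ℚ (QS S) (s : ℚ)⁻¹ * (Y * h⁻¹) i j :=
    continuous_const.mul ((continuous_mul_right h⁻¹).matrix_elem i j)
  exact this.measurable (measurableSet_boxR measurableSet_Ico)

lemma mul_nonsing_inv_cancel {h : Matrix n n (QS S)} (hh : IsUnit h.det) (X : Matrix κ n (QS S)) :
    X * h * h⁻¹ = X := by
  rw [Matrix.mul_assoc, Matrix.mul_nonsing_inv _ hh, Matrix.mul_one]

/-- In the coordinates `Y h⁻¹ / s` this is the tiling by `ℤ_S` in each entry. Since `s` is a unit of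
`ℤ_S`, the lattice does not depend on it: `s` only makes the tile smaller p-adically and longer in
the real directions. -/
lemma exists_unique_mem_tile {s : ℕ} (hs : s ∈ PS S) {h : Matrix n n (QS S)} (hh : IsUnit h.det)
    (Y : Matrix κ n (QS S)) :
    ∃! X : intMat S κ n, ratMat S (X : Matrix κ n ℚ) * h + Y ∈ tile κ s h := by
  have hs0 : (s : ℚ) ≠ 0 := by exact_mod_cast hs.1.ne'
  have hmem : ∀ X : Matrix κ n ℚ, ratMat S X * h + Y ∈ tile κ s h ↔ ∀ i j,
      algebraMap ℚ (QS S) ((s : ℚ)⁻¹ * X i j) + algebraMap ℚ (QS S) (s : ℚ)⁻¹ * (Y * h⁻¹) i j ∈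
        boxR S (Set.Ico 0 1) := fun X => by
    simp only [tile, Set.mem_ofPred_eq, Matrix.add_mul, mul_nonsing_inv_cancel hh,
      Matrix.add_apply, mul_add, map_mul]
    rfl
  choose z hz hzu using fun i j => exists_unique_tile
    (algebraMap ℚ (QS S) (s : ℚ)⁻¹ * (Y * h⁻¹) i j)
  refine ⟨⟨Matrix.of fun i j => (s : ℚ) * z i j, fun i j => mul_mem (natCast_mem _ s) (z i j).2⟩,
    (hmem _).2 fun i j => ?_, fun X hX => Subtype.ext (Matrix.ext fun i j => ?_)⟩
  · change algebraMap ℚ (QS S) ((s : ℚ)⁻¹ * (s * z i j)) + _ ∈ _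
    rw [inv_mul_cancel_left₀ hs0]
    exact hz i j
  · have h1 := (hmem _).1 hX i j
    have h2 := hzu i j ⟨(s : ℚ)⁻¹ * (X : Matrix κ n ℚ) i j, mul_mem (inv_mem_ZS hs) (X.2 i j)⟩ h1
    have h3 := congrArg Subtype.val h2
    change (s : ℚ)⁻¹ * (X : Matrix κ n ℚ) i j = z i j at h3
    change _ = (s : ℚ) * z i j
    rw [← h3, mul_inv_cancel_left₀ hs0]

lemma isAddFundamentalDomain_tile {s : ℕ} (hs : s ∈ PS S) {h : Matrix n n (QS S)}
    (hh : IsUnit h.det) : IsAddFundamentalDomain (lat S κ h) (tile κ s h) := by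
  refine IsAddFundamentalDomain.mk' (measurableSet_tile s h).nullMeasurableSet fun Y => ?_
  obtain ⟨X, hX, hu⟩ := exists_unique_mem_tile hs hh Y
  refine ⟨⟨ratMat S (X : Matrix κ n ℚ) * h, X, X.2, rfl⟩, hX, ?_⟩
  rintro ⟨_, X', hX', rfl⟩ hm
  have := hu ⟨X', hX'⟩ hm
  exact Subtype.ext (by rw [← this]; rfl)

/-- All fundamental domains of one lattice have equal volume, so `s` may be replaced by `1`; that
tile is the image of the unit box under right multiplication by `h`. -/
lemma volume_tile {s : ℕ} (hs : s ∈ PS S) {h : Matrix n n (QS S)} (h0 : h.det.1 ≠ 0)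
    (h1 : ∀ p, ‖h.det.2 p‖ = 1) :
    volume (tile κ s h) = ‖h.det.1‖ₑ ^ Fintype.card κ := by
  have hh : IsUnit h.det := isUnit_iff.2 ⟨h0, fun p h => by have := h1 p; simp [h] at this⟩
  rw [(isAddFundamentalDomain_tile (κ := κ) hs hh).measure_eq
    (isAddFundamentalDomain_tile one_mem_PS hh)]
  have hm := measurableSet_tile (κ := κ) 1 h
  rw [← lintegral_indicator_one hm, lintegral_mul_right h0 h1 (measurable_one.indicator hm)]
  have e : ∀ g : Matrix κ n (QS S), (tile κ 1 h).indicator (1 : Matrix κ n (QS S) → ℝ≥0∞) (g * h) =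
      {A : Matrix κ n (QS S) | ∀ i j, A i j ∈ boxR S (Set.Ico 0 1)}.indicator 1 g := by
    intro g
    refine Set.indicator_eq_indicator ?_ rfl
    simp only [tile, Set.mem_ofPred_eq, mul_nonsing_inv_cancel hh, Nat.cast_one, inv_one, map_one,
      one_mul]
  have hb : MeasurableSet {A : Matrix κ n (QS S) | ∀ i j, A i j ∈ boxR S (Set.Ico 0 1)} := by
    simp only [Set.ofPred_forall]
    exact MeasurableSet.iInter fun i => MeasurableSet.iInter fun j =>
      measurable_matrix_elem i j (measurableSet_boxR measurableSet_Ico)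
  simp only [e]
  rw [lintegral_indicator_one hb, volume_matrix_box, volume_boxR]
  simp

/-- Matrices whose entries lie in the box with real part `I`. -/
def boxM (S : Finset Prm) (κ n : Type*) (I : Set ℝ) : Set (Matrix κ n (QS S)) :=
  {A | ∀ i j, A i j ∈ boxR S I}

lemma measurableSet_boxM {I : Set ℝ} (hI : MeasurableSet I) : MeasurableSet (boxM S κ n I) := by
  simp only [boxM, Set.ofPred_forall]
  exact MeasurableSet.iInter fun i => MeasurableSet.iInter fun j =>
    measurable_matrix_elem i j (measurableSet_boxR hI)

lemma volume_boxM (I : Set ℝ) :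
    volume (boxM S κ n I) = volume I ^ (Fintype.card n * Fintype.card κ) := by
  rw [boxM, volume_matrix_box, volume_boxR]

/-- Minkowski's theorem: a lattice of covolume less than `2` has a short vector. -/
lemma exists_short_vector [Nonempty κ] [Nonempty n] {h : Matrix n n (QS S)} (h0 : 0 < h.det.1)
    (h1 : ∀ p, ‖h.det.2 p‖ = 1) (h2 : h.det.1 < 2) :
    ∃ X ∈ intMat S κ n, X ≠ 0 ∧ ratMat S X * h ∈ boxM S κ n (Set.Ioo (-2) 2) := by
  have hh : IsUnit h.det := isUnit_iff.2 ⟨h0.ne', fun p h => by have := h1 p; simp [h] at this⟩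
  have hlt : volume (tile κ 1 h) < volume (boxM S κ n (Set.Ico 0 2)) := by
    rw [volume_tile one_mem_PS h0.ne' h1, volume_boxM, Real.volume_Ico]
    have e1 : ‖h.det.1‖ₑ < 2 := by
      rw [← ofReal_norm, Real.norm_eq_abs, abs_of_pos h0]
      simpa using (ENNReal.ofReal_lt_ofReal_iff zero_lt_two).2 h2
    calc ‖h.det.1‖ₑ ^ Fintype.card κ < 2 ^ Fintype.card κ :=
          ENNReal.pow_right_strictMono Fintype.card_ne_zero e1
      _ ≤ (2 : ℝ≥0∞) ^ (Fintype.card n * Fintype.card κ) :=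
          pow_le_pow_right₀ one_le_two (Nat.le_mul_of_pos_left _ Fintype.card_pos)
      _ = _ := by simp
  -- The box has larger volume than the tile, so two distinct lattice translates of it overlap. The
  -- difference of the two lattice points is a difference of two points of the box, with real
  -- entries in `(-2, 2)`; convexity plays no role.
  obtain ⟨⟨_, X, hX, rfl⟩, ⟨_, Y, hY, rfl⟩, hne, hdis⟩ := exists_pair_mem_lattice_not_disjoint_vadd
    (isAddFundamentalDomain_tile (κ := κ) one_mem_PS hh)
    (measurableSet_boxM (S := S) (κ := κ) (n := n) measurableSet_Ico).nullMeasurableSet hlt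
  rw [Set.not_disjoint_iff] at hdis
  obtain ⟨_, ⟨A, hA, rfl⟩, ⟨B, hB, hAB⟩⟩ := hdis
  have hAB' : ratMat S Y * h + B = ratMat S X * h + A := hAB
  refine ⟨Y - X, sub_mem hY hX, fun e => hne ?_, fun i j => ?_⟩
  · rw [sub_eq_zero] at e
    subst e
    rfl
  · have e : ratMat S (Y - X) * h = A - B := by
      have : ratMat S Y = ratMat S (Y - X) + ratMat S X := by rw [← ratMat_add]; simp
      rw [this, Matrix.add_mul] at hAB'
      rw [eq_sub_iff_add_eq]
      have := hAB'
      have h4 : ratMat S (Y - X) * h + B + ratMat S X * h = A + ratMat S X * h := by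
        rw [add_right_comm, this, add_comm]
      exact add_right_cancel h4
    rw [e]
    have hA' := hA i j
    have hB' := hB i j
    refine ⟨?_, fun p => ?_⟩
    · have a1 := hA'.1
      have b1 := hB'.1
      rw [Set.mem_Ico] at a1 b1
      rw [Matrix.sub_apply, Prod.fst_sub, Set.mem_Ioo]
      constructor <;> linarith [a1.1, a1.2, b1.1, b1.2]
    · rw [Matrix.sub_apply, Prod.snd_sub, Pi.sub_apply, sub_eq_add_neg]
      exact (Padic.nonarchimedean _ _).trans (max_le (hA'.2 p) (by rw [norm_neg]; exact hB'.2 p))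

/-! ### Finiteness of the covolume -/

lemma norm_natCast_eq_one_of_mem_NS {m : ℕ} (hm : m ∈ NS S) (p : S) :
    ‖((m : ℚ) : ℚ_[(p : Prm)])‖ = 1 := by
  rw [Rat.cast_natCast]
  refine norm_natCast_eq_one fun h => ?_
  exact p.1.2.one_lt.ne' (Nat.eq_one_of_dvd_coprimes (hm.2 p p.2) h dvd_rfl)

lemma mem_boxR_of_natCast_mul {m : ℕ} (hm : m ∈ NS S) {R : ℝ} {x : QS S}
    (h : algebraMap ℚ (QS S) m * x ∈ boxR S (Set.Ioo (-R) R)) :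
    x ∈ boxR S (Set.Ioo (-R) R) := by
  obtain ⟨h1, h2⟩ := h
  refine ⟨?_, fun p => ?_⟩
  · rw [Set.mem_Ioo, ← abs_lt] at h1 ⊢
    have h3 : (algebraMap ℚ (QS S) m * x).1 = (m : ℝ) * x.1 := by simp
    rw [h3, abs_mul, Nat.abs_cast] at h1
    have : (1 : ℝ) ≤ m := by exact_mod_cast hm.1
    nlinarith [abs_nonneg x.1]
  · have h3 : (algebraMap ℚ (QS S) m * x).2 p = ((m : ℚ) : ℚ_[(p : Prm)]) * x.2 p := by simp
    have := h2 p
    rwa [h3, norm_mul, norm_natCast_eq_one_of_mem_NS hm, one_mul] at this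

lemma exists_prim_row {ι : Type*} [Fintype ι] (e : Unit ⊕ ι ≃ n) (i₀ : ι)
    {X : Matrix Unit n ℚ} (hX : X ∈ intMat S Unit n) (hX0 : X ≠ 0) :
    ∃ Y ∈ prim S e, ∃ m ∈ NS S, X = (m : ℚ) • Y := by
  have hne : e (Sum.inl ()) ≠ e (Sum.inr i₀) := by simp
  obtain ⟨γ, m, hm, h⟩ := exists_eq_smul_row (S := S) hne
    (v := fun j => ⟨X () j, hX () j⟩) (fun h => hX0 (Matrix.ext fun i j =>
      congrArg Subtype.val (congrFun h j)))
  refine ⟨_, ⟨γ, rfl⟩, m, hm, Matrix.ext fun i j => ?_⟩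
  have := congrArg Subtype.val (congrFun h j)
  simpa [toQ] using this

/-- The lattice of every `g` with real determinant less than `2` has a short vector, hence a short
primitive one. So the volume is at most the integral of the number of short primitive vectors, which
unfolds to the volume of a box times the same volume one dimension lower. Without a bound on the
determinant the volume would be infinite already for `1 × 1` matrices. -/
theorem volume_isStrictFD_lt_top (k : ℕ) :
    ∀ D : Set (Matrix (Fin (k + 1)) (Fin (k + 1)) (QS S)), IsStrictFD D →
      volume (D ∩ {g | g.det.1 < 2}) < ∞ := by
  induction k with
  | zero =>
    intro D hD
    refine (measure_mono (t := boxM S (Fin 1) (Fin 1) (Set.Ioo 0 2)) ?_).trans_lt ?_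
    · rintro g ⟨hg, hg2⟩
      have h1 := hD.subset hg
      have h2 : g.det.1 < 2 := hg2
      change g.det ∈ unitSet S at h1
      rw [det_fin_one] at h1 h2
      intro i j
      rw [Subsingleton.elim i 0, Subsingleton.elim j 0]
      exact ⟨⟨h1.1, h2⟩, fun p => (h1.2 p).le⟩
    · rw [volume_boxM, Real.volume_Ioo]; simp
  | succ k ih =>
    intro D hD
    obtain ⟨D', hD'⟩ := exists_isStrictFD (S := S) (n := Fin (k + 1))
    have hD'fin := ih D' hD'
    let e : Unit ⊕ Fin (k + 1) ≃ Fin (k + 2) := Fintype.equivOfCardEq (by simp; omega)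
    have hBm : MeasurableSet (boxM S Unit (Fin (k + 2)) (Set.Ioo (-2) 2)) :=
      measurableSet_boxM measurableSet_Ioo
    have hTm : MeasurableSet {δ : QS S | δ.1 < 2} := measurableSet_lt measurable_fst measurable_const
    set Φ : Matrix Unit (Fin (k + 2)) (QS S) → QS S → ℝ≥0∞ := fun X δ =>
      (boxM S Unit (Fin (k + 2)) (Set.Ioo (-2) 2)).indicator 1 X *
        {δ : QS S | δ.1 < 2}.indicator 1 δ with hΦdef
    have hΦ : Measurable (Function.uncurry Φ) :=
      ((measurable_one.indicator hBm).comp measurable_fst).mul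
        ((measurable_one.indicator hTm).comp measurable_snd)
    have key := lintegral_prim e 0 hD hD' hΦ
    have hT : MeasurableSet {g : Matrix (Fin (k + 2)) (Fin (k + 2)) (QS S) | g.det.1 < 2} :=
      continuous_matrix_det.measurable hTm
    have hT' : MeasurableSet {g : Matrix (Fin (k + 1)) (Fin (k + 1)) (QS S) | g.det.1 < 2} :=
      continuous_matrix_det.measurable hTm
    have hle : volume (D ∩ {g | g.det.1 < 2}) ≤
        ∫⁻ g in D, ∑' X : prim S e, Φ (ratMat S (X : Matrix Unit (Fin (k + 2)) ℚ) * g) g.det := by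
      rw [← setLIntegral_one, ← lintegral_indicator (hD.measurableSet.inter hT),
        ← lintegral_indicator hD.measurableSet]
      refine lintegral_mono fun g => ?_
      by_cases hg : g ∈ D ∩ {g | g.det.1 < 2}
      · rw [Set.indicator_of_mem hg, Set.indicator_of_mem hg.1]
        obtain ⟨X, hX, hX0, hXg⟩ := exists_short_vector (κ := Unit) (hD.subset hg.1).1
          (hD.subset hg.1).2 hg.2
        obtain ⟨Y, hY, m, hm, rfl⟩ := exists_prim_row e 0 hX hX0
        -- The factor `m` is at least one in the real place and a unit at the primes of `S`, so
        -- dividing by it keeps the vector in the box.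
        have hYg : ratMat S Y * g ∈ boxM S Unit (Fin (k + 2)) (Set.Ioo (-2) 2) := by
          intro i j
          refine mem_boxR_of_natCast_mul hm ?_
          have := hXg i j
          have e2 : (ratMat S ((m : ℚ) • Y) * g) i j =
              algebraMap ℚ (QS S) m * (ratMat S Y * g) i j := by
            simp only [Matrix.mul_apply, ratMat, Matrix.map_apply, Matrix.smul_apply, smul_eq_mul,
              map_mul, Finset.mul_sum, mul_assoc]
          rwa [e2] at this
        refine le_trans ?_ (ENNReal.le_tsum ⟨Y, hY⟩)
        have hdet : g.det ∈ {δ : QS S | δ.1 < 2} := hg.2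
        simp only [hΦdef]
        rw [Set.indicator_of_mem hYg, Set.indicator_of_mem hdet]
        simp
      · rw [Set.indicator_of_notMem hg]
        exact zero_le
    refine hle.trans_lt ?_
    rw [key]
    have hin : ∀ X, ∫⁻ g in D', Φ X g.det =
        (boxM S Unit (Fin (k + 2)) (Set.Ioo (-2) 2)).indicator 1 X *
          volume (D' ∩ {g | g.det.1 < 2}) := by
      intro X
      simp only [hΦdef]
      rw [lintegral_const_mul]
      · congr 1
        rw [Set.inter_comm, ← Measure.restrict_apply hT', ← lintegral_indicator_one hT']
        rfl
      · exact (measurable_one.indicator hTm).comp continuous_matrix_det.measurable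
    simp only [hin]
    rw [lintegral_mul_const _ (measurable_one.indicator hBm), lintegral_indicator_one hBm,
      volume_boxM, Real.volume_Ioo]
    refine ENNReal.mul_lt_top ?_ hD'fin
    exact ENNReal.pow_lt_top ENNReal.ofReal_lt_top

end SArith
end

open MeasureTheory Matrix
open scoped ENNReal Pointwise

set_option linter.unusedSectionVars false

noncomputable section

namespace SArith

/-! ### The groups `UL` and `SL`, and their Haar measures -/

variable {S : Finset Prm} {d : ℕ}

/-- `H` is the group of matrices with determinant in the kernel of the idempotent endomorphism `α`
of the monoid `ℚ_S`, which does not change real components. -/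
structure IsDetKernel (H : Subgroup (GL (Fin d) (QS S))) (α : QS S →* QS S) : Prop where
  continuous : Continuous α
  fst_eq : ∀ x, (α x).1 = x.1
  mem_unitSet : ∀ x ∈ unitSet S, α x ∈ unitSet S
  idem : ∀ x, α (α x) = α x
  mem_iff : ∀ g : GL (Fin d) (QS S), g ∈ H ↔
    (g : Matrix (Fin d) (Fin d) (QS S)).det ∈ unitSet S ∧
      α (g : Matrix (Fin d) (Fin d) (QS S)).det = 1

/-- The endomorphism of `ℚ_S` which replaces all `p`-adic components by `1`. -/
def realPart (S : Finset Prm) : QS S →* QS S where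
  toFun x := (x.1, 1)
  map_one' := rfl
  map_mul' x y := by ext <;> simp

lemma isDetKernel_UL : IsDetKernel (UL S d) (realPart S) where
  continuous := continuous_fst.prodMk continuous_const
  fst_eq _ := rfl
  mem_unitSet x hx := ⟨hx.1, fun p => by simp [realPart]⟩
  idem _ := rfl
  mem_iff g := by
    constructor
    · rintro ⟨h1, h2⟩
      exact ⟨⟨by rw [h1]; exact one_pos, h2⟩, Prod.ext h1 rfl⟩
    · rintro ⟨h1, h2⟩
      exact ⟨congrArg Prod.fst h2, h1.2⟩

lemma isDetKernel_SL : IsDetKernel (SL S d) (MonoidHom.id (QS S)) where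
  continuous := continuous_id
  fst_eq _ := rfl
  mem_unitSet _ hx := hx
  idem _ := rfl
  mem_iff g := by
    constructor
    · intro (h : _ = _)
      rw [h]
      exact ⟨one_mem_unitSet, rfl⟩
    · rintro ⟨-, h⟩
      exact h

instance secondCountable_GL : SecondCountableTopology (GL (Fin d) (QS S)) :=
  have : SecondCountableTopology (Matrix (Fin d) (Fin d) (QS S))ᵐᵒᵖ :=
    MulOpposite.opHomeomorph.symm.isEmbedding.secondCountableTopology
  (Units.isEmbedding_embedProduct (M := Matrix (Fin d) (Fin d) (QS S))).secondCountableTopology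

instance secondCountable_subgroup (H : Subgroup (GL (Fin d) (QS S))) :
    SecondCountableTopology H := TopologicalSpace.Subtype.secondCountableTopology _

lemma continuousOn_invR : ContinuousOn (invR : QS S → QS S) (unitSet S) := by
  intro x hx
  obtain ⟨h1, h2⟩ := isUnit_iff.1 (isUnit_of_mem_unitSet hx)
  refine ContinuousAt.continuousWithinAt ?_
  refine ContinuousAt.prodMk (continuousAt_fst.inv₀ h1) (continuousAt_pi.2 fun p => ?_)
  exact ContinuousAt.inv₀ ((continuous_apply p).comp continuous_snd).continuousAt (h2 p)

/-- An element of `detUnits` as an element of the general linear group. -/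
def toGL (g : Matrix (Fin d) (Fin d) (QS S)) (hg : g ∈ detUnits S (Fin d)) :
    GL (Fin d) (QS S) where
  val := g
  inv := invR g.det • g.adjugate
  val_inv := by
    rw [Matrix.mul_smul, mul_adjugate, smul_smul, mul_comm, mul_invR (isUnit_of_mem_unitSet hg),
      one_smul]
  inv_val := by
    rw [Matrix.smul_mul, adjugate_mul, smul_smul, mul_comm, mul_invR (isUnit_of_mem_unitSet hg),
      one_smul]

lemma continuous_toGL {X : Type*} [TopologicalSpace X] {f : X → Matrix (Fin d) (Fin d) (QS S)}
    (hf : Continuous f) (hf' : ∀ x, f x ∈ detUnits S (Fin d)) :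
    Continuous fun x => toGL (f x) (hf' x) := by
  refine Units.continuous_iff.2 ⟨hf, ?_⟩
  have : Continuous fun x => invR (f x).det :=
    continuousOn_invR.comp_continuous hf.matrix_det fun x => hf' x
  exact this.smul hf.matrix_adjugate

variable {H : Subgroup (GL (Fin d) (QS S))} {α : QS S →* QS S}

/-- The underlying matrix. -/
abbrev mat (h : H) : Matrix (Fin d) (Fin d) (QS S) := ((h : GL (Fin d) (QS S)) : Matrix _ _ (QS S))

lemma continuous_mat : Continuous (mat : H → _) := Units.continuous_val.comp continuous_subtype_val

lemma mat_mul (g h : H) : mat (g * h) = mat g * mat h := rfl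

lemma IsDetKernel.det_mem (hH : IsDetKernel H α) (h : H) : (mat h).det ∈ unitSet S :=
  ((hH.mem_iff h).1 h.2).1

lemma IsDetKernel.map_det (hH : IsDetKernel H α) (h : H) : α (mat h).det = 1 :=
  ((hH.mem_iff h).1 h.2).2

lemma IsDetKernel.det_fst (hH : IsDetKernel H α) (h : H) : (mat h).det.1 = 1 := by
  rw [← hH.fst_eq, hH.map_det]; rfl

/-- The diagonal matrix with one entry different from `1`. -/
def diagAt (i₀ : Fin d) (x : QS S) : Matrix (Fin d) (Fin d) (QS S) :=
  diagonal (Function.update 1 i₀ x)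

lemma det_diagAt (i₀ : Fin d) (x : QS S) : (diagAt i₀ x).det = x := by
  rw [diagAt, det_diagonal, ← Finset.mul_prod_erase _ _ (Finset.mem_univ i₀), Finset.prod_eq_one]
  · simp
  · intro k hk
    simp [(Finset.mem_erase.1 hk).1]

lemma continuous_diagAt (i₀ : Fin d) : Continuous (diagAt i₀ : QS S → _) := by
  refine Continuous.matrix_diagonal ?_
  exact continuous_const.update i₀ continuous_id

lemma diagAt_mul (i₀ : Fin d) (x y : QS S) : diagAt i₀ x * diagAt i₀ y = diagAt i₀ (x * y) := by
  rw [diagAt, diagAt, diagonal_mul_diagonal, diagAt]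
  congr 1
  ext1 i
  by_cases h : i = i₀
  · subst h; simp
  · simp [h]

lemma diagAt_one (i₀ : Fin d) : diagAt i₀ (1 : QS S) = 1 := by
  have : Function.update (1 : Fin d → QS S) i₀ 1 = 1 := Function.update_eq_self i₀ 1
  rw [diagAt, this]
  exact diagonal_one

/-- The matrix part of the projection to `H`. -/
def projMat (α : QS S →* QS S) (i₀ : Fin d) (g : Matrix (Fin d) (Fin d) (QS S)) :
    Matrix (Fin d) (Fin d) (QS S) := g * diagAt i₀ (invR (α g.det))

lemma IsDetKernel.projMat_mem (hH : IsDetKernel H α) (i₀ : Fin d)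
    {g : Matrix (Fin d) (Fin d) (QS S)} (hg : g ∈ detUnits S (Fin d)) :
    projMat α i₀ g ∈ detUnits S (Fin d) := by
  change _ ∈ unitSet S
  rw [projMat, det_mul, det_diagAt]
  exact mul_mem_unitSet hg (invR_mem_unitSet (hH.mem_unitSet _ hg))

lemma IsDetKernel.toGL_projMat_mem (hH : IsDetKernel H α) (i₀ : Fin d)
    {g : Matrix (Fin d) (Fin d) (QS S)} (hg : g ∈ detUnits S (Fin d)) :
    toGL (projMat α i₀ g) (hH.projMat_mem i₀ hg) ∈ H := by
  refine (hH.mem_iff _).2 ⟨hH.projMat_mem i₀ hg, ?_⟩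
  change α (projMat α i₀ g).det = 1
  rw [projMat, det_mul, det_diagAt, map_mul]
  have h1 := mul_invR (isUnit_of_mem_unitSet (hH.mem_unitSet _ hg))
  have h2 := congrArg α h1
  rwa [map_mul, hH.idem, map_one] at h2

open scoped Classical in
/-- The projection of `detUnits` to `H` (with value `1` outside). -/
def proj (hH : IsDetKernel H α) (i₀ : Fin d) (g : Matrix (Fin d) (Fin d) (QS S)) : H :=
  if hg : g ∈ detUnits S (Fin d) then ⟨_, hH.toGL_projMat_mem i₀ hg⟩ else 1

lemma mat_proj (hH : IsDetKernel H α) (i₀ : Fin d) {g : Matrix (Fin d) (Fin d) (QS S)}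
    (hg : g ∈ detUnits S (Fin d)) : mat (proj hH i₀ g) = projMat α i₀ g := by
  rw [proj, dif_pos hg]
  rfl

lemma measurable_proj (hH : IsDetKernel H α) (i₀ : Fin d) : Measurable (proj hH i₀) := by
  refine measurable_of_restrict_of_restrict_compl isOpen_detUnits.measurableSet ?_ ?_
  · have e : (detUnits S (Fin d)).domRestrict (proj hH i₀) = fun g =>
        ⟨_, hH.toGL_projMat_mem i₀ g.2⟩ := by
      funext g
      exact dif_pos g.2
    rw [e]
    refine Continuous.measurable ?_
    refine Continuous.subtype_mk ?_ _
    refine continuous_toGL (f := fun g : detUnits S (Fin d) => projMat α i₀ g) ?_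
      fun g => hH.projMat_mem i₀ g.2
    have h1 : Continuous fun g : detUnits S (Fin d) =>
        α (g : Matrix (Fin d) (Fin d) (QS S)).det :=
      hH.continuous.comp (continuous_matrix_det.comp continuous_subtype_val)
    have h2 : Continuous fun g : detUnits S (Fin d) =>
        invR (α (g : Matrix (Fin d) (Fin d) (QS S)).det) :=
      continuousOn_invR.comp_continuous h1 fun g => hH.mem_unitSet _ g.2
    exact continuous_subtype_val.matrix_mul ((continuous_diagAt i₀).comp h2)
  · have e : (detUnits S (Fin d))ᶜ.domRestrict (proj hH i₀) = fun _ => 1 := by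
      funext g
      exact dif_neg g.2
    rw [e]
    exact measurable_const

lemma IsDetKernel.mul_mem_detUnits (hH : IsDetKernel H α) (h : H)
    {g : Matrix (Fin d) (Fin d) (QS S)} :
    mat h * g ∈ detUnits S (Fin d) ↔ g ∈ detUnits S (Fin d) := by
  have hh := hH.det_mem h
  constructor
  · rintro ⟨h1, h2⟩
    rw [det_mul] at h1 h2
    refine ⟨?_, fun p => ?_⟩
    · rw [Prod.fst_mul] at h1
      exact pos_of_mul_pos_right h1 hh.1.le
    · have := h2 p
      rwa [Prod.snd_mul, Pi.mul_apply, norm_mul, hh.2, one_mul] at this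
  · intro hg
    change _ ∈ unitSet S
    rw [det_mul]
    exact mul_mem_unitSet hh hg

/-- Because `α (det h) = 1`, the matrices `g` and `h g` receive the same column correction. -/
lemma proj_mul (hH : IsDetKernel H α) (i₀ : Fin d) (h : H) {g : Matrix (Fin d) (Fin d) (QS S)}
    (hg : g ∈ detUnits S (Fin d)) : proj hH i₀ (mat h * g) = h * proj hH i₀ g := by
  have hg' := (hH.mul_mem_detUnits h).2 hg
  refine Subtype.ext (Units.ext ?_)
  have e1 := mat_proj hH i₀ hg'
  have e2 := mat_proj hH i₀ hg
  refine e1.trans ?_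
  change _ = mat h * mat (proj hH i₀ g)
  rw [e2, projMat, projMat, det_mul, map_mul, hH.map_det, one_mul, Matrix.mul_assoc]

/-- The elements of `detUnits` of real determinant less than `2`. -/
def smallDet (S : Finset Prm) (d : ℕ) : Set (Matrix (Fin d) (Fin d) (QS S)) :=
  detUnits S (Fin d) ∩ {g | g.det.1 < 2}

lemma isOpen_smallDet : IsOpen (smallDet S d) :=
  isOpen_detUnits.inter (isOpen_lt (continuous_fst.comp continuous_matrix_det) continuous_const)

/-- A left-invariant measure on `H`, the image of additive Haar measure. -/
def imageMeasure (hH : IsDetKernel H α) (i₀ : Fin d) : Measure H :=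
  (volume.restrict (smallDet S d)).map (proj hH i₀)

/-- Left multiplication by an element of `H` preserves additive Haar measure and the set `smallDet`,
and it commutes with `proj`. -/
lemma isMulLeftInvariant_imageMeasure (hH : IsDetKernel H α) (i₀ : Fin d) :
    (imageMeasure hH i₀).IsMulLeftInvariant := by
  refine ⟨fun h => ?_⟩
  have hmul : Measurable fun x : H => h * x :=
    (continuous_const.mul continuous_id).measurable
  have hp := measurable_proj hH i₀
  have hmp := measurePreserving_mul_left (m := Fin d) (A := mat h)
    (by rw [hH.det_fst]; simp) (hH.det_mem h).2
  have hmp' := hmp.restrict_preimage (isOpen_smallDet (S := S) (d := d)).measurableSet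
  have hpre : (fun g : Matrix (Fin d) (Fin d) (QS S) => mat h * g) ⁻¹' smallDet S d =
      smallDet S d := by
    ext g
    simp only [smallDet, Set.mem_preimage, Set.mem_inter_iff, hH.mul_mem_detUnits h,
      Set.mem_ofPred_eq, det_mul, Prod.fst_mul, hH.det_fst, one_mul]
  rw [hpre] at hmp'
  rw [imageMeasure, Measure.map_map hmul hp]
  conv_rhs => rw [← hmp'.map_eq, Measure.map_map hp hmp.measurable]
  refine Measure.map_congr ?_
  filter_upwards [ae_restrict_mem (isOpen_smallDet (S := S) (d := d)).measurableSet] with g hg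
  exact (proj_mul hH i₀ h hg.1).symm

/-- A matrix is recovered from its projection by a diagonal factor with entry `α (det g)`. On
`smallDet` this entry stays in a compact box, so the preimage of a compact set lies in a compact set
of matrices. -/
lemma isFiniteMeasureOnCompacts_imageMeasure (hH : IsDetKernel H α) (i₀ : Fin d) :
    IsFiniteMeasureOnCompacts (imageMeasure hH i₀) := by
  refine ⟨fun K hK => ?_⟩
  rw [imageMeasure, Measure.map_apply (measurable_proj hH i₀) hK.isClosed.measurableSet,
    Measure.restrict_apply ((measurable_proj hH i₀) hK.isClosed.measurableSet)]
  have hB : IsCompact (boxR S (Set.Icc 0 2)) := by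
    rw [boxR_eq]
    exact isCompact_Icc.prod (isCompact_univ_pi fun p => isCompact_closedBall _ _)
  have hc : IsCompact ((fun x : Matrix (Fin d) (Fin d) (QS S) × Matrix (Fin d) (Fin d) (QS S) =>
      x.1 * x.2) '' ((mat '' K) ×ˢ (diagAt i₀ '' boxR S (Set.Icc 0 2)))) :=
    ((hK.image continuous_mat).prod (hB.image (continuous_diagAt i₀))).image
      (continuous_fst.matrix_mul continuous_snd)
  refine (measure_mono ?_).trans_lt hc.measure_lt_top
  rintro g ⟨hgK, hgW, hg2⟩
  have hu := hH.mem_unitSet _ hgW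
  refine ⟨(mat (proj hH i₀ g), diagAt i₀ (α g.det)), ⟨⟨_, hgK, rfl⟩, _, ⟨⟨hu.1.le, ?_⟩,
    fun p => (hu.2 p).le⟩, rfl⟩, ?_⟩
  · rw [hH.fst_eq]
    exact le_of_lt hg2
  · change mat (proj hH i₀ g) * diagAt i₀ (α g.det) = g
    rw [mat_proj hH i₀ hgW, projMat, Matrix.mul_assoc, diagAt_mul, mul_comm,
      mul_invR (isUnit_of_mem_unitSet hu), diagAt_one, Matrix.mul_one]

lemma imageMeasure_ne_zero (hH : IsDetKernel H α) (i₀ : Fin d) : imageMeasure hH i₀ ≠ 0 := by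
  intro h
  have h1 := congrArg (fun μ : Measure H => μ Set.univ) h
  simp only [imageMeasure, Measure.coe_zero, Pi.zero_apply] at h1
  rw [Measure.map_apply (measurable_proj hH i₀) MeasurableSet.univ, Set.preimage_univ,
    Measure.restrict_apply_univ] at h1
  have := (isOpen_smallDet (S := S) (d := d)).measure_pos volume
    ⟨1, by change _ ∈ unitSet S; rw [det_one]; exact one_mem_unitSet, by
      change (1 : Matrix (Fin d) (Fin d) (QS S)).det.1 < 2
      rw [det_one]; norm_num⟩
  have h2 := this.ne'
  exact h2 h1

/-- The copy of `SL_d(ℤ_S)` in `H`. -/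
def ofSLZ (hH : IsDetKernel H α) (γ : SLZ S (Fin d)) : H :=
  ⟨toGL (toQS γ) (by change _ ∈ unitSet S; rw [det_toQS]; exact one_mem_unitSet),
    (hH.mem_iff _).2 ⟨by change (toQS γ).det ∈ _; rw [det_toQS]; exact one_mem_unitSet, by
      change α (toQS γ).det = 1; rw [det_toQS, map_one]⟩⟩

lemma mat_ofSLZ (hH : IsDetKernel H α) (γ : SLZ S (Fin d)) : mat (ofSLZ hH γ) = toQS γ := rfl

lemma mat_injective : Function.Injective (mat : H → _) := fun _ _ h =>
  Subtype.ext (Units.ext h)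

/-- The determinant of an integral point is an element of `ℤ_S` whose real component is `1`, hence
it equals `1` at all places. This is the identity `UL_d(ℤ_S) = SL_d(ℤ_S)`. -/
lemma mem_integralPoints_iff (hH : IsDetKernel H α) (h : H) :
    h ∈ integralPoints H ↔ ∃ γ, ofSLZ hH γ = h := by
  constructor
  · rintro ⟨g, hg⟩
    have hm : (g : Matrix (Fin d) (Fin d) (ZS S)).map (diag S) = mat h :=
      congrArg (fun x : GL (Fin d) (QS S) => (x : Matrix (Fin d) (Fin d) (QS S))) hg
    have hdet : diag S (g : Matrix (Fin d) (Fin d) (ZS S)).det = (mat h).det := by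
      rw [← hm]; exact (diag S).map_det _
    have h1 : (g : Matrix (Fin d) (Fin d) (ZS S)).det = 1 := by
      have := congrArg Prod.fst hdet
      rw [diag_fst, hH.det_fst] at this
      exact Subtype.ext (by exact_mod_cast this)
    exact ⟨⟨g, h1⟩, mat_injective hm⟩
  · rintro ⟨γ, rfl⟩
    refine ⟨Matrix.SpecialLinearGroup.toGL γ, Units.ext ?_⟩
    rfl

lemma countable_integralPoints (hH : IsDetKernel H α) : Countable (integralPoints H) := by
  have : (integralPoints H : Set H) = Set.range (ofSLZ hH) := by
    ext h; exact mem_integralPoints_iff hH h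
  have h2 : (integralPoints H : Set H).Countable := by
    rw [this]; exact Set.countable_range _
  exact h2.to_subtype

/-- The elements of `H` in a given set of matrices. -/
def domainIn (H : Subgroup (GL (Fin d) (QS S))) (D : Set (Matrix (Fin d) (Fin d) (QS S))) :
    Set H := mat ⁻¹' D

lemma exists_unique_domainIn (hH : IsDetKernel H α) {D : Set (Matrix (Fin d) (Fin d) (QS S))}
    (hD : IsStrictFD D) (h : H) : ∃! γ : SLZ S (Fin d), ofSLZ hH γ * h ∈ domainIn H D :=
  hD.exists_unique (mat h) (hH.det_mem h)

lemma isFundamentalDomain_domainIn (hH : IsDetKernel H α)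
    {D : Set (Matrix (Fin d) (Fin d) (QS S))} (hD : IsStrictFD D) (μ : Measure H) :
    IsFundamentalDomain (integralPoints H) (domainIn H D) μ := by
  refine IsFundamentalDomain.mk' (continuous_mat.measurable hD.measurableSet).nullMeasurableSet
    fun h => ?_
  obtain ⟨γ, hγ, hu⟩ := exists_unique_domainIn hH hD h
  refine ⟨⟨ofSLZ hH γ, (mem_integralPoints_iff hH _).2 ⟨γ, rfl⟩⟩, hγ, ?_⟩
  rintro ⟨g, hg⟩ hgD
  obtain ⟨δ, rfl⟩ := (mem_integralPoints_iff hH _).1 hg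
  exact Subtype.ext (congrArg (ofSLZ hH) (hu δ hgD))

/-- The preimage under `proj` of a fundamental domain. -/
lemma isStrictFD_preimage_proj (hH : IsDetKernel H α) (i₀ : Fin d)
    {D : Set (Matrix (Fin d) (Fin d) (QS S))} (hD : IsStrictFD D) :
    IsStrictFD (detUnits S (Fin d) ∩ proj hH i₀ ⁻¹' domainIn H D) := by
  refine ⟨isOpen_detUnits.measurableSet.inter
    (measurable_proj hH i₀ (continuous_mat.measurable hD.measurableSet)),
    Set.inter_subset_left, fun g hg => ?_⟩
  have hiff : ∀ γ : SLZ S (Fin d), γ • g ∈ detUnits S (Fin d) ∩ proj hH i₀ ⁻¹' domainIn H D ↔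
      ofSLZ hH γ * proj hH i₀ g ∈ domainIn H D := fun γ => by
    rw [← proj_mul hH i₀ _ hg, mat_ofSLZ, ← slz_smul_def, Set.mem_inter_iff,
      slz_smul_mem_detUnits, Set.mem_preimage]
    exact ⟨fun h => h.2, fun h => ⟨hg, h⟩⟩
  simp only [hiff]
  exact exists_unique_domainIn hH hD _

/-- The unfolding formula on `H`. -/
lemma lintegral_prim_imageMeasure (hH : IsDetKernel H α) (i₀ : Fin d) {κ : Type*} [Fintype κ]
    [DecidableEq κ] {k : ℕ} (e : κ ⊕ Fin (k + 1) ≃ Fin d)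
    {D : Set (Matrix (Fin d) (Fin d) (QS S))} (hD : IsStrictFD D) :
    ∃ c : ℝ≥0∞, c ≠ ∞ ∧ ∀ Φ : Matrix κ (Fin d) (QS S) → ℝ≥0∞, Measurable Φ →
      ∫⁻ h in domainIn H D, ∑' X : prim S e, Φ (ratMat S (X : Matrix κ (Fin d) ℚ) * mat h)
        ∂(imageMeasure hH i₀) = c * ∫⁻ X, Φ X := by
  obtain ⟨D', hD'⟩ := exists_isStrictFD (S := S) (n := Fin (k + 1))
  have hTm : MeasurableSet {δ : QS S | δ.1 < 2} := measurableSet_lt measurable_fst measurable_const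
  -- The power of the determinant is the Jacobian of undoing the column correction on the `κ` rows;
  -- the cut-off comes from `smallDet` and makes the integral finite.
  refine ⟨∫⁻ g in D', {δ : QS S | δ.1 < 2}.indicator
    (fun δ => ‖δ.1‖ₑ ^ Fintype.card κ) g.det, ?_, fun Φ hΦ => ?_⟩
  · refine ne_of_lt (lt_of_le_of_lt (b := ∫⁻ g in D', {g : Matrix (Fin (k + 1)) (Fin (k + 1)) (QS S)
      | g.det.1 < 2}.indicator (fun _ => 2 ^ Fintype.card κ) g) ?_ ?_)
    · refine setLIntegral_mono_ae' hD'.measurableSet (Filter.Eventually.of_forall fun g hg => ?_)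
      by_cases h : g.det.1 < 2
      · rw [Set.indicator_of_mem (show g.det ∈ {δ : QS S | δ.1 < 2} from h),
          Set.indicator_of_mem (by exact h)]
        gcongr
        have h0 : 0 < g.det.1 := (hD'.subset hg).1
        rw [← ofReal_norm, Real.norm_eq_abs, abs_of_pos h0]
        simpa using ENNReal.ofReal_le_ofReal h.le
      · rw [Set.indicator_of_notMem (show g.det ∉ {δ : QS S | δ.1 < 2} from h)]
        exact zero_le
    · have hT : MeasurableSet {g : Matrix (Fin (k + 1)) (Fin (k + 1)) (QS S) | g.det.1 < 2} :=
        continuous_matrix_det.measurable hTm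
      rw [lintegral_indicator hT, lintegral_const, Measure.restrict_restrict hT,
        Measure.restrict_apply_univ, Set.inter_comm]
      exact ENNReal.mul_lt_top (by simp) (volume_isStrictFD_lt_top k D' hD')
  · have hp := measurable_proj hH i₀
    have hDm : MeasurableSet (domainIn H D) := continuous_mat.measurable hD.measurableSet
    have hc : ∀ X : Matrix κ (Fin d) (QS S), Measurable fun h : H => X * mat h := fun X =>
      (Continuous.matrix_mul continuous_const continuous_mat).measurable
    -- The correction made by `proj` depends on `g` only through its determinant, so it fits the
    -- unfolding formula with a test function of the rows and the determinant.
    set Ψ : Matrix κ (Fin d) (QS S) → QS S → ℝ≥0∞ := fun X δ =>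
      {δ : QS S | δ.1 < 2}.indicator 1 δ * Φ (X * diagAt i₀ (invR (α δ))) with hΨdef
    have hmm : Measurable fun x : Matrix κ (Fin d) (QS S) × Matrix (Fin d) (Fin d) (QS S) =>
        x.1 * x.2 := (continuous_fst.matrix_mul continuous_snd).measurable
    have hda : Measurable fun δ : QS S => diagAt i₀ (invR (α δ)) :=
      (continuous_diagAt i₀).measurable.comp (measurable_invR.comp hH.continuous.measurable)
    have hΨ : Measurable (Function.uncurry Ψ) :=
      ((measurable_one.indicator hTm).comp measurable_snd).mul
        (hΦ.comp (hmm.comp (measurable_fst.prodMk (hda.comp measurable_snd))))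
    have key := lintegral_prim e 0 (isStrictFD_preimage_proj hH i₀ hD) hD' hΨ
    have hlhs : ∫⁻ h in domainIn H D, ∑' X : prim S e,
        Φ (ratMat S (X : Matrix κ (Fin d) ℚ) * mat h) ∂(imageMeasure hH i₀) =
        ∫⁻ g in detUnits S (Fin d) ∩ proj hH i₀ ⁻¹' domainIn H D,
          ∑' X : prim S e, Ψ (ratMat S (X : Matrix κ (Fin d) ℚ) * g) g.det := by
      rw [imageMeasure, Measure.restrict_map hp hDm, lintegral_map _ hp,
        Measure.restrict_restrict (hp hDm)]
      · have hT : MeasurableSet {g : Matrix (Fin d) (Fin d) (QS S) | g.det.1 < 2} :=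
          continuous_matrix_det.measurable hTm
        have hset : proj hH i₀ ⁻¹' domainIn H D ∩ smallDet S d = {g | g.det.1 < 2} ∩
            (detUnits S (Fin d) ∩ proj hH i₀ ⁻¹' domainIn H D) := by
          ext g
          simp only [smallDet, Set.mem_inter_iff]
          tauto
        rw [hset, ← Measure.restrict_restrict hT, ← lintegral_indicator hT]
        refine setLIntegral_congr_fun (isOpen_detUnits.measurableSet.inter (hp hDm)) fun g hg => ?_
        by_cases h : g.det.1 < 2
        · simp only [hΨdef]
          rw [Set.indicator_of_mem (by exact h)]
          refine tsum_congr fun X => ?_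
          rw [Set.indicator_of_mem (show g.det ∈ {δ : QS S | δ.1 < 2} from h), Pi.one_apply,
            one_mul, mat_proj hH i₀ hg.1, projMat, Matrix.mul_assoc]
        · simp only [hΨdef]
          rw [Set.indicator_of_notMem (by exact h),
            Set.indicator_of_notMem (show g.det ∉ {δ : QS S | δ.1 < 2} from h)]
          simp
      · exact Measurable.tsum fun X => hΦ.comp (hc _)
    rw [hlhs, key]
    have hsw : Measurable (Function.uncurry fun (X : Matrix κ (Fin d) (QS S))
        (g : Matrix (Fin (k + 1)) (Fin (k + 1)) (QS S)) => Ψ X g.det) :=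
      hΨ.comp (measurable_fst.prodMk (continuous_matrix_det.measurable.comp measurable_snd))
    rw [lintegral_lintegral_swap hsw.aemeasurable, ← lintegral_mul_const]
    · refine setLIntegral_congr_fun hD'.measurableSet fun g hg => ?_
      simp only [hΨdef]
      by_cases h : g.det.1 < 2
      · have hmem : g.det ∈ {δ : QS S | δ.1 < 2} := h
        simp only [Set.indicator_of_mem hmem, Pi.one_apply, one_mul]
        have hu := hH.mem_unitSet _ (hD'.subset hg)
        have hi := invR_mem_unitSet hu
        have hdet := det_diagAt i₀ (invR (α g.det))
        rw [lintegral_mul_right (m := κ) (A := diagAt i₀ (invR (α g.det)))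
          (by rw [hdet]; exact hi.1.ne') (by rw [hdet]; exact hi.2) hΦ, hdet, ← mul_assoc,
          ← mul_pow]
        have h1 : ‖g.det.1‖ₑ * ‖(invR (α g.det)).1‖ₑ = 1 := by
          have : (invR (α g.det)).1 = g.det.1⁻¹ := by
            rw [invR, hH.fst_eq]
          rw [this, ← enorm_mul, mul_inv_cancel₀ (hD'.subset hg).1.ne']
          simp
        rw [h1, one_pow, one_mul]
      · have hmem : g.det ∉ {δ : QS S | δ.1 < 2} := h
        simp only [Set.indicator_of_notMem hmem, zero_mul, lintegral_zero]
    · refine Measurable.comp (Measurable.indicator ?_ hTm) continuous_matrix_det.measurable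
      exact (measurable_fst.enorm).pow_const _

lemma imageMeasure_domainIn_lt_top (hH : IsDetKernel H α) {k : ℕ} (hd : d = k + 1) (i₀ : Fin d)
    {D : Set (Matrix (Fin d) (Fin d) (QS S))} (hD : IsStrictFD D) :
    imageMeasure hH i₀ (domainIn H D) < ∞ := by
  subst hd
  have hDm : MeasurableSet (domainIn H D) := continuous_mat.measurable hD.measurableSet
  rw [imageMeasure, Measure.map_apply (measurable_proj hH i₀) hDm,
    Measure.restrict_apply (measurable_proj hH i₀ hDm)]
  refine (measure_mono ?_).trans_lt
    (volume_isStrictFD_lt_top k _ (isStrictFD_preimage_proj hH i₀ hD))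
  rintro g ⟨h1, h2, h3⟩
  exact ⟨⟨h2, h1⟩, h3⟩

/-- Normalization of the Haar measure, and the unfolding formula. -/
theorem normHaar_properties [LocallyCompactSpace H] (hH : IsDetKernel H α) {k : ℕ} (hd : d = k + 1)
    {D : Set (Matrix (Fin d) (Fin d) (QS S))} (hD : IsStrictFD D) :
    normHaar H (domainIn H D) = 1 ∧ (normHaar H).IsMulLeftInvariant ∧
    covolume (integralPoints H) H (normHaar H) = 1 ∧
    ∀ {κ : Type} [Fintype κ] [DecidableEq κ] {l : ℕ} (e : κ ⊕ Fin (l + 1) ≃ Fin d),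
    ∃ c : ℝ≥0∞, c ≠ ∞ ∧ ∀ Φ : Matrix κ (Fin d) (QS S) → ℝ≥0∞, Measurable Φ →
      ∫⁻ h in domainIn H D, ∑' X : prim S e, Φ (ratMat S (X : Matrix κ (Fin d) ℚ) * mat h)
        ∂(normHaar H) = c * ∫⁻ X, Φ X := by
  have : Countable (integralPoints H) := countable_integralPoints hH
  let i₀ : Fin d := ⟨0, by omega⟩
  have := isMulLeftInvariant_imageMeasure hH i₀
  have := isFiniteMeasureOnCompacts_imageMeasure hH i₀
  -- By uniqueness of Haar measure the image measure is `c₀` times it. As `c₀` is not zero,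
  -- finiteness of the image measure of the domain and the unfolding formula both pass to Haar
  -- measure.
  have hs := Measure.isMulLeftInvariant_eq_smul (imageMeasure hH i₀) (Measure.haar : Measure H)
  set c₀ := Measure.haarScalarFactor (imageMeasure hH i₀) (Measure.haar : Measure H)
  have hc₀ : c₀ ≠ 0 := by
    intro h
    rw [h, zero_smul] at hs
    exact imageMeasure_ne_zero hH i₀ hs
  have hfd := isFundamentalDomain_domainIn hH hD (Measure.haar : Measure H)
  have hne : (Measure.haar : Measure H) (domainIn H D) ≠ 0 :=
    hfd.measure_ne_zero (NeZero.ne _)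
  have hval : (c₀ : ℝ≥0∞) * (Measure.haar : Measure H) (domainIn H D) =
      imageMeasure hH i₀ (domainIn H D) := by
    rw [hs]; rfl
  have hlt : (Measure.haar : Measure H) (domainIn H D) ≠ ∞ := by
    intro h
    have := imageMeasure_domainIn_lt_top hH hd i₀ hD
    rw [← hval, h, ENNReal.mul_top (by exact_mod_cast hc₀)] at this
    exact this.ne rfl
  have hcov := hfd.covolume_eq_volume (Measure.haar : Measure H)
  have hone : normHaar H (domainIn H D) = 1 := by
    rw [normHaar, hcov, Measure.smul_apply, smul_eq_mul, ENNReal.inv_mul_cancel hne hlt]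
  have hinv : (normHaar H).IsMulLeftInvariant := by
    rw [normHaar]; infer_instance
  refine ⟨hone, hinv, ?_, ?_⟩
  · rw [(isFundamentalDomain_domainIn hH hD (normHaar H)).covolume_eq_volume, hone]
  · intro κ _ _ l e
    obtain ⟨c, hc, h⟩ := lintegral_prim_imageMeasure hH i₀ e hD
    refine ⟨((Measure.haar : Measure H) (domainIn H D))⁻¹ * (c₀ : ℝ≥0∞)⁻¹ * c, ?_, fun Φ hΦ => ?_⟩
    · refine ENNReal.mul_ne_top (ENNReal.mul_ne_top ?_ ?_) hc
      · exact ENNReal.inv_ne_top.2 hne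
      · exact ENNReal.inv_ne_top.2 (by exact_mod_cast hc₀)
    · have h1 := h Φ hΦ
      rw [hs, Measure.restrict_smul, lintegral_smul_measure] at h1
      rw [normHaar, hcov, Measure.restrict_smul, lintegral_smul_measure, smul_eq_mul, mul_assoc,
        mul_assoc, ← h1, ENNReal.smul_def, smul_eq_mul, ← mul_assoc (c₀ : ℝ≥0∞)⁻¹,
        ENNReal.inv_mul_cancel (by exact_mod_cast hc₀) ENNReal.coe_ne_top, one_mul]

end SArith
end

open MeasureTheory Matrix
open scoped ENNReal Pointwise

set_option linter.unusedSectionVars false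

noncomputable section

namespace SArith

/-! ### Random lattices: invariant families of rational matrices -/

variable {S : Finset Prm} {κ ι n : Type*} [Fintype κ] [Fintype ι] [Fintype n] [DecidableEq κ]
  [DecidableEq ι] [DecidableEq n]
variable {Ω : Type*} [MeasurableSpace Ω] {P : Measure Ω} {h : Ω → Matrix n n (QS S)}

/-- The mean value formula for sums over tuples of rows of `SL_n(ℤ_S)`. -/
def MeanValue (P : Measure Ω) (h : Ω → Matrix n n (QS S)) (e : κ ⊕ ι ≃ n) : Prop :=
  ∃ c : ℝ≥0∞, c ≠ ∞ ∧ ∀ Φ : Matrix κ n (QS S) → ℝ≥0∞, Measurable Φ →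
    ∫⁻ ω, ∑' X : prim S e, Φ (ratMat S (X : Matrix κ n ℚ) * h ω) ∂P = c * ∫⁻ X, Φ X

lemma measurable_mul_apply (hm : Measurable h) (X : Matrix κ n (QS S)) :
    Measurable fun ω => X * h ω := by
  have : Continuous fun g : Matrix n n (QS S) => X * g := continuous_const.matrix_mul continuous_id
  exact this.measurable.comp hm

lemma measurable_mul_left (A : Matrix κ κ (QS S)) :
    Measurable fun X : Matrix κ n (QS S) => A * X :=
  (continuous_const.matrix_mul continuous_id : Continuous fun X : Matrix κ n (QS S) => A * X).measurable

lemma isUnit_det_ratMat {A : Matrix κ κ ℚ} (hA : A.det ≠ 0) : IsUnit (ratMat S A).det := by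
  have : (ratMat S A).det = algebraMap ℚ (QS S) A.det := ((algebraMap ℚ (QS S)).map_det A).symm
  rw [this]
  exact (isUnit_iff_ne_zero.2 hA).map _

lemma exists_lintegral_mul_left {A : Matrix κ κ (QS S)} (hA : IsUnit A.det) :
    ∃ c : ℝ≥0∞, ∀ Φ : Matrix κ n (QS S) → ℝ≥0∞, Measurable Φ →
      ∫⁻ X : Matrix κ n (QS S), Φ (A * X) = c * ∫⁻ X, Φ X := by
  obtain ⟨u, -, h⟩ := scales_of_isUnit_det (E := n → QS S) hA
  have e : (actE A : (κ → n → QS S) → κ → n → QS S) =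
      fun g : Matrix κ n (QS S) => A * g := by
    funext g i j
    change (∑ k, A i k • g k) j = ∑ k, A i k * g k j
    simp [Finset.sum_apply]
  rw [e] at h
  set c := distribHaarChar (n → QS S) u with hc
  have hc0 : c ≠ 0 := distribHaarChar_pos.ne'
  refine ⟨(c : ℝ≥0∞)⁻¹, fun Φ hΦ => ?_⟩
  have h2 : ∫⁻ X : Matrix κ n (QS S), Φ X = c * ∫⁻ X : Matrix κ n (QS S), Φ (A * X) := by
    conv_lhs => rw [show (volume : Measure (Matrix κ n (QS S))) = c • Measure.map
      (fun g : Matrix κ n (QS S) => A * g) volume from h.symm]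
    rw [lintegral_smul_measure, lintegral_map hΦ (measurable_mul_left A)]
    rfl
  rw [h2, ← mul_assoc, ENNReal.inv_mul_cancel (by exact_mod_cast hc0) ENNReal.coe_ne_top, one_mul]

lemma prim_mul_toQ (e : κ ⊕ ι ≃ n) {Y : Matrix κ n ℚ} (hY : Y ∈ prim S e) (γ : SLZ S n) :
    Y * toQ γ ∈ prim S e := by
  obtain ⟨δ, rfl⟩ := hY
  exact ⟨δ * γ, (submatrix_mul_toQ _ _ _).symm⟩

lemma prim_transitive (e : κ ⊕ ι ≃ n) {Y Y' : Matrix κ n ℚ} (hY : Y ∈ prim S e)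
    (hY' : Y' ∈ prim S e) : ∃ γ : SLZ S n, Y' = Y * toQ γ := by
  obtain ⟨δ, rfl⟩ := hY
  obtain ⟨δ', rfl⟩ := hY'
  refine ⟨δ⁻¹ * δ', ?_⟩
  change _ = (toQ δ).submatrix _ id * toQ (δ⁻¹ * δ')
  rw [submatrix_mul_toQ, mul_inv_cancel_left]

/-- Sums over an invariant set of rational matrices have a mean value proportional to the
integral. -/
lemma exists_const_of_invariant (hm : Measurable h) {e : κ ⊕ ι ≃ n} (hP : MeanValue P h e)
    (L : Set (Matrix κ n ℚ)) (hL : ∀ X ∈ L, ∀ γ : SLZ S n, X * toQ γ ∈ L)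
    (hprim : ∀ X ∈ L, ∃ A : Matrix κ κ ℚ, A.det ≠ 0 ∧ ∃ Y ∈ prim S e, X = A * Y) :
    ∃ C : ℝ≥0∞, ∀ Φ : Matrix κ n (QS S) → ℝ≥0∞, Measurable Φ →
      ∫⁻ ω, ∑' X : L, Φ (ratMat S (X : Matrix κ n ℚ) * h ω) ∂P = C * ∫⁻ X, Φ X := by
  obtain ⟨c, -, hc⟩ := hP
  -- Split `L` into orbits under right multiplication by `SL_n(ℤ_S)`; there are countably many.
  let r : Setoid L :=
    { r := fun X Y => ∃ γ : SLZ S n, (Y : Matrix κ n ℚ) = (X : Matrix κ n ℚ) * toQ γ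
      iseqv := ⟨fun X => ⟨1, by simp⟩, fun {X Y} ⟨γ, hγ⟩ => ⟨γ⁻¹, by
        rw [hγ, Matrix.mul_assoc, ← toQ_mul, mul_inv_cancel, toQ_one, Matrix.mul_one]⟩,
        fun {X Y Z} ⟨γ, hγ⟩ ⟨δ, hδ⟩ => ⟨γ * δ, by rw [hδ, hγ, Matrix.mul_assoc, toQ_mul]⟩⟩ }
  have : Countable L := Subtype.countable
  have : Countable (Quotient r) := inferInstance
  choose A hA Y hY hAY using fun X : L => hprim X X.2
  choose χ hχ using fun X : L => exists_lintegral_mul_left (n := n)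
    (isUnit_det_ratMat (S := S) (hA X))
  have hinv : ∀ X : L, (A X)⁻¹ * A X = 1 := fun X =>
    Matrix.nonsing_inv_mul _ (isUnit_iff_ne_zero.2 (hA X))
  have hmemL : ∀ (X₀ : L) (Z : prim S e), ∃ γ : SLZ S n, A X₀ * (Z : Matrix κ n ℚ) =
      (X₀ : Matrix κ n ℚ) * toQ γ := fun X₀ Z => by
    obtain ⟨γ, hγ⟩ := prim_transitive e (hY X₀) Z.2
    refine ⟨γ, ?_⟩
    rw [hγ]
    conv_rhs => rw [hAY X₀]
    rw [Matrix.mul_assoc]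
  have hLmem : ∀ (X₀ : L) (Z : prim S e), A X₀ * (Z : Matrix κ n ℚ) ∈ L := fun X₀ Z => by
    obtain ⟨γ, hγ⟩ := hmemL X₀ Z
    rw [hγ]
    exact hL _ X₀.2 γ
  have hq : ∀ o : Quotient r, (Quotient.mk r o.out) = o := fun o => Quotient.out_eq o
  -- If a representative is `A Y` with `Y` primitive, then its whole orbit is `A` times the set of
  -- primitive tuples, because that set is a single orbit.
  have hout : ∀ o : Quotient r, Function.Bijective fun Z : prim S e =>
      (⟨⟨A o.out * (Z : Matrix κ n ℚ), hLmem o.out Z⟩, by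
        rw [← hq o]
        refine (Quotient.sound (s := r) ?_).symm
        obtain ⟨γ, hγ⟩ := hmemL o.out Z
        refine ⟨γ, ?_⟩
        simpa using hγ⟩ : {X : L // Quotient.mk r X = o}) := by
    intro o
    constructor
    · intro Z Z' hZ
      have h1 : A o.out * (Z : Matrix κ n ℚ) = A o.out * (Z' : Matrix κ n ℚ) :=
        congrArg (fun x => ((x : {X : L // Quotient.mk r X = o}).1 : Matrix κ n ℚ)) hZ
      have h2 := congrArg (fun M => (A o.out)⁻¹ * M) h1
      simp only [← Matrix.mul_assoc, hinv, Matrix.one_mul] at h2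
      exact Subtype.ext h2
    · rintro ⟨X, hX⟩
      obtain ⟨γ, hγ⟩ := Quotient.exact (s := r) ((hq o).trans hX.symm)
      refine ⟨⟨Y o.out * toQ γ, prim_mul_toQ e (hY _) γ⟩, Subtype.ext (Subtype.ext ?_)⟩
      change A o.out * (Y o.out * toQ γ) = X
      rw [hγ, ← Matrix.mul_assoc, ← hAY]
  -- Each orbit contributes the primitive constant times a Jacobian. The sum might be infinite; its
  -- value is found afterwards by counting points.
  refine ⟨∑' o : Quotient r, c * χ o.out, fun Φ hΦ => ?_⟩
  have hsum : ∀ ω, ∑' X : L, Φ (ratMat S (X : Matrix κ n ℚ) * h ω) =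
      ∑' o : Quotient r, ∑' Z : prim S e,
        Φ (ratMat S (A o.out) * (ratMat S (Z : Matrix κ n ℚ) * h ω)) := fun ω => by
    rw [← (Equiv.sigmaFiberEquiv (Quotient.mk r)).tsum_eq]
    refine (ENNReal.tsum_sigma fun (o : Quotient r) (X : {X : L // Quotient.mk r X = o}) =>
      Φ (ratMat S (X.1 : Matrix κ n ℚ) * h ω)).trans (tsum_congr fun o => ?_)
    rw [← (Equiv.ofBijective _ (hout o)).tsum_eq]
    refine tsum_congr fun Z => ?_
    rw [← Matrix.mul_assoc, ← ratMat_mul]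
    rfl
  simp only [hsum]
  rw [lintegral_tsum]
  · rw [← ENNReal.tsum_mul_right]
    refine tsum_congr fun o => ?_
    have h1 := hc (fun X => Φ (ratMat S (A o.out) * X)) (hΦ.comp (measurable_mul_left _))
    rw [h1, hχ _ Φ hΦ, mul_assoc]
  · intro o
    refine (Measurable.tsum fun Z => ?_).aemeasurable
    exact hΦ.comp ((measurable_mul_left _).comp (measurable_mul_apply hm _))

/-! ### Counting lattice points in large boxes -/

/-- The number of points of a shifted lattice of matrices in `B`. -/
def latCount (S : Finset Prm) (X₀ : Matrix κ n ℚ) (g : Matrix n n (QS S))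
    (B : Set (Matrix κ n (QS S))) : ℝ≥0∞ :=
  ∑' X : intMat S κ n, B.indicator (1 : Matrix κ n (QS S) → ℝ≥0∞)
    (ratMat S (X₀ + (X : Matrix κ n ℚ)) * g)

lemma measurable_latCount (hm : Measurable h) (X₀ : Matrix κ n ℚ) {B : Set (Matrix κ n (QS S))}
    (hB : MeasurableSet B) : Measurable fun ω => latCount S X₀ (h ω) B :=
  Measurable.tsum fun _ => (measurable_one.indicator hB).comp (measurable_mul_apply hm _)

lemma boxR_sub {I I' J : Set ℝ} (h : ∀ x ∈ I, ∀ y ∈ I', x - y ∈ J) {x y : QS S}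
    (hx : x ∈ boxR S I) (hy : y ∈ boxR S I') : x - y ∈ boxR S J :=
  ⟨h _ hx.1 _ hy.1, fun p => by
    rw [Prod.snd_sub, Pi.sub_apply, sub_eq_add_neg]
    exact (Padic.nonarchimedean _ _).trans (max_le (hx.2 p) (by rw [norm_neg]; exact hy.2 p))⟩

/-- Subtracting one point of the shifted lattice in `B` maps all the others injectively to points of
the unshifted lattice in `B'`. -/
lemma latCount_le_of_sub (X₀ : Matrix κ n ℚ) (g : Matrix n n (QS S))
    {B B' : Set (Matrix κ n (QS S))} (hBB : ∀ x ∈ B, ∀ y ∈ B, x - y ∈ B') :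
    latCount S X₀ g B ≤ latCount S 0 g B' := by
  by_cases hne : ∃ X₁ : intMat S κ n, ratMat S (X₀ + (X₁ : Matrix κ n ℚ)) * g ∈ B
  · obtain ⟨X₁, hX₁⟩ := hne
    rw [latCount, latCount, ← (Equiv.subRight X₁).tsum_eq (fun X : intMat S κ n => B'.indicator
      (1 : Matrix κ n (QS S) → ℝ≥0∞) (ratMat S (0 + (X : Matrix κ n ℚ)) * g))]
    refine ENNReal.tsum_le_tsum fun X => ?_
    by_cases hX : ratMat S (X₀ + (X : Matrix κ n ℚ)) * g ∈ B
    · have := hBB _ hX _ hX₁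
      have e : ratMat S (X₀ + (X : Matrix κ n ℚ)) * g - ratMat S (X₀ + (X₁ : Matrix κ n ℚ)) * g =
          ratMat S (0 + ((Equiv.subRight X₁ X : intMat S κ n) : Matrix κ n ℚ)) * g := by
        rw [← Matrix.sub_mul]
        congr 1
        refine Matrix.ext fun i j => ?_
        simp [ratMat]
      rw [e] at this
      rw [Set.indicator_of_mem hX, Set.indicator_of_mem this]
      simp
    · rw [Set.indicator_of_notMem hX]
      exact zero_le
  · push Not at hne
    rw [latCount]
    simp [Set.indicator_of_notMem (hne _)]

/-- The box is cut into unit cubes, and differences of points of one cube lie in the box over `(-1,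
1)`. The bound has the right order in `N` and serves as the dominating function. -/
lemma latCount_box_le (X₀ : Matrix κ n ℚ) (g : Matrix n n (QS S)) (N : ℕ) :
    latCount S X₀ g (boxM S κ n (Set.Ico (-(N : ℝ)) N)) ≤
      (2 * N : ℝ≥0∞) ^ (Fintype.card n * Fintype.card κ) *
        latCount S 0 g (boxM S κ n (Set.Ioo (-1) 1)) := by
  let cube : (κ → n → Fin (2 * N)) → Set (Matrix κ n (QS S)) := fun c =>
    {A | ∀ i j, A i j ∈ boxR S (Set.Ico (-(N : ℝ) + c i j) (-(N : ℝ) + c i j + 1))}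
  have hcover : ∀ A : Matrix κ n (QS S),
      (boxM S κ n (Set.Ico (-(N : ℝ)) N)).indicator (1 : Matrix κ n (QS S) → ℝ≥0∞) A ≤
        ∑ c, (cube c).indicator (1 : Matrix κ n (QS S) → ℝ≥0∞) A := by
    intro A
    by_cases hA : A ∈ boxM S κ n (Set.Ico (-(N : ℝ)) N)
    · have hfl : ∀ i j, ⌊(A i j).1 + N⌋₊ < 2 * N := fun i j => by
        have := (hA i j).1
        rw [Set.mem_Ico] at this
        rw [Nat.floor_lt (by linarith)]
        push_cast
        linarith
      have hmem : A ∈ cube fun i j => ⟨⌊(A i j).1 + N⌋₊, hfl i j⟩ := fun i j => by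
        have h0 := (hA i j).1
        rw [Set.mem_Ico] at h0
        have h1 := Nat.floor_le (show 0 ≤ (A i j).1 + N by linarith)
        have h2 := Nat.lt_floor_add_one ((A i j).1 + N)
        refine ⟨⟨?_, ?_⟩, (hA i j).2⟩
        · change -(N : ℝ) + (⌊(A i j).1 + N⌋₊ : ℝ) ≤ _
          linarith
        · change _ < -(N : ℝ) + (⌊(A i j).1 + N⌋₊ : ℝ) + 1
          linarith
      refine le_trans ?_ (Finset.single_le_sum (fun c _ => zero_le)
        (Finset.mem_univ fun i j => ⟨⌊(A i j).1 + N⌋₊, hfl i j⟩))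
      rw [Set.indicator_of_mem hA, Set.indicator_of_mem hmem]
    · rw [Set.indicator_of_notMem hA]
      exact zero_le
  have hcube : ∀ c, latCount S X₀ g (cube c) ≤
      latCount S 0 g (boxM S κ n (Set.Ioo (-1) 1)) := fun c => by
    refine latCount_le_of_sub X₀ g fun x hx y hy i j => ?_
    rw [Matrix.sub_apply]
    refine boxR_sub ?_ (hx i j) (hy i j)
    rintro a ⟨ha, ha'⟩ b ⟨hb, hb'⟩
    constructor <;> linarith
  calc latCount S X₀ g (boxM S κ n (Set.Ico (-(N : ℝ)) N))
      ≤ ∑' X : intMat S κ n, ∑ c, (cube c).indicator (1 : Matrix κ n (QS S) → ℝ≥0∞)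
          (ratMat S (X₀ + (X : Matrix κ n ℚ)) * g) := ENNReal.tsum_le_tsum fun X => hcover _
    _ = ∑ c, latCount S X₀ g (cube c) := Summable.tsum_finsetSum fun _ _ => ENNReal.summable
    _ ≤ ∑ _c : κ → n → Fin (2 * N), latCount S 0 g (boxM S κ n (Set.Ioo (-1) 1)) :=
        Finset.sum_le_sum fun c _ => hcube c
    _ = _ := by
        rw [Finset.sum_const, Finset.card_univ, nsmul_eq_mul]
        simp [← pow_mul]

lemma exists_PS_norm_le (S : Finset Prm) (C : ℝ) :
    ∃ s ∈ PS S, ∀ p : S, ‖((s : ℚ) : ℚ_[(p : Prm)])‖ * C ≤ 1 := by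
  obtain ⟨k, hk⟩ := pow_unbounded_of_one_lt C (one_lt_two (α := ℝ))
  have hP : (∏ p ∈ S, (p : ℕ)) ^ k ∈ PS S := by
    rw [← Finset.prod_pow]
    refine prod_mem_PS _ _ fun p hp => ⟨pow_pos p.2.pos k, fun l hl => ?_⟩
    have := (Nat.prime_dvd_prime_iff_eq l.2 p.2).1 (l.2.dvd_of_dvd_pow hl)
    rwa [Subtype.ext this]
  refine ⟨_, hP, fun p => ?_⟩
  have h1 : ‖((∏ l ∈ S, (l : ℕ) : ℕ) : ℚ_[(p : Prm)])‖ ≤ 1 / 2 := by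
    rw [← Finset.mul_prod_erase S (fun l => (l : ℕ)) p.2, Nat.cast_mul, norm_mul, Padic.norm_p]
    have h2 : ‖((∏ l ∈ S.erase (p : Prm), (l : ℕ) : ℕ) : ℚ_[(p : Prm)])‖ ≤ 1 := by
      have := Padic.norm_int_le_one (p := (p : Prm)) ((∏ l ∈ S.erase (p : Prm), (l : ℕ) : ℕ) : ℤ)
      rwa [Int.cast_natCast] at this
    have h3 : (((p : Prm) : ℕ) : ℝ)⁻¹ ≤ 1 / 2 := by
      rw [one_div]
      exact inv_anti₀ two_pos (by exact_mod_cast p.1.2.two_le)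
    calc _ ≤ (1 / 2 : ℝ) * 1 := mul_le_mul h3 h2 (norm_nonneg _) (by norm_num)
      _ = 1 / 2 := by ring
  rw [Rat.cast_natCast, Nat.cast_pow, norm_pow]
  have h4 : ‖((∏ l ∈ S, (l : ℕ) : ℕ) : ℚ_[(p : Prm)])‖ ^ k ≤ (1 / 2) ^ k :=
    pow_le_pow_left₀ (norm_nonneg _) h1 k
  rcases le_total C 0 with hC | hC
  · exact (mul_nonpos_of_nonneg_of_nonpos (by positivity) hC).trans zero_le_one
  · calc _ ≤ (1 / 2 : ℝ) ^ k * 2 ^ k := mul_le_mul h4 hk.le hC (by positivity)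
      _ = 1 := by rw [← mul_pow]; norm_num

/-- The set `tile` is contained in a box, for a suitable parameter. -/
lemma exists_tile_subset_box (g : Matrix n n (QS S)) (hg : IsUnit g.det) :
    ∃ s ∈ PS S, ∃ ρ : ℝ, 0 < ρ ∧ tile κ s g ⊆ boxM S κ n (Set.Ioo (-ρ) ρ) := by
  obtain ⟨s, hs, hsC⟩ := exists_PS_norm_le S (∑ i, ∑ j, ∑ p, ‖(g i j).2 p‖)
  have hnn : 0 ≤ ∑ i, ∑ j, |(g i j).1| :=
    Finset.sum_nonneg fun i _ => Finset.sum_nonneg fun j _ => abs_nonneg _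
  refine ⟨s, hs, s * (∑ i, ∑ j, |(g i j).1|) + 1, by positivity, fun Y hY i j => ?_⟩
  have hs0 : (s : ℚ) ≠ 0 := by exact_mod_cast hs.1.ne'
  set T : Matrix κ n (QS S) := algebraMap ℚ (QS S) (s : ℚ)⁻¹ • (Y * g⁻¹) with hT
  have hTbox : ∀ i j, T i j ∈ boxR S (Set.Ico 0 1) := fun i j => hY i j
  have hYT : Y = algebraMap ℚ (QS S) (s : ℚ) • (T * g) := by
    rw [hT, Matrix.smul_mul, smul_smul, ← map_mul, mul_inv_cancel₀ hs0, map_one, one_smul,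
      Matrix.mul_assoc, Matrix.nonsing_inv_mul _ hg, Matrix.mul_one]
  have hYij : Y i j = algebraMap ℚ (QS S) (s : ℚ) * ∑ k, T i k * g k j := by
    conv_lhs => rw [hYT]
    rfl
  rw [hYij]
  refine ⟨?_, fun p => ?_⟩
  · have e1 : (algebraMap ℚ (QS S) (s : ℚ) * ∑ k, T i k * g k j).1 =
        s * ∑ k, (T i k).1 * (g k j).1 := by simp [Prod.fst_sum]
    rw [e1, Set.mem_Ioo, ← abs_lt, abs_mul, Nat.abs_cast]
    have h2 : |∑ k, (T i k).1 * (g k j).1| ≤ ∑ i, ∑ j, |(g i j).1| := by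
      refine (Finset.abs_sum_le_sum_abs _ _).trans (Finset.sum_le_sum fun k _ => ?_)
      rw [abs_mul]
      have h3 := (hTbox i k).1
      rw [Set.mem_Ico] at h3
      have h4 : |(T i k).1| ≤ 1 := by rw [abs_of_nonneg h3.1]; exact h3.2.le
      calc |(T i k).1| * |(g k j).1| ≤ 1 * |(g k j).1| := by gcongr
        _ = |(g k j).1| := one_mul _
        _ ≤ _ := Finset.single_le_sum (f := fun j => |(g k j).1|) (fun j _ => abs_nonneg _)
            (Finset.mem_univ j)
    have : (s : ℝ) * |∑ k, (T i k).1 * (g k j).1| ≤ s * ∑ i, ∑ j, |(g i j).1| := by gcongr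
    linarith
  · have e1 : (algebraMap ℚ (QS S) (s : ℚ) * ∑ k, T i k * g k j).2 p =
        ((s : ℚ) : ℚ_[(p : Prm)]) * ∑ k, (T i k).2 p * (g k j).2 p := by
      simp [Prod.snd_sum, Finset.sum_apply]
    rw [e1, norm_mul]
    refine le_trans (mul_le_mul_of_nonneg_left ?_ (norm_nonneg _)) (hsC p)
    refine IsUltrametricDist.norm_sum_le_of_forall_le_of_nonneg ?_ fun k _ => ?_
    · exact Finset.sum_nonneg fun i _ => Finset.sum_nonneg fun j _ => Finset.sum_nonneg
        fun p _ => norm_nonneg _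
    · rw [norm_mul]
      calc ‖(T i k).2 p‖ * ‖(g k j).2 p‖ ≤ 1 * ‖(g k j).2 p‖ := by
            gcongr; exact (hTbox i k).2 p
        _ = ‖(g k j).2 p‖ := one_mul _
        _ ≤ ∑ p, ‖(g k j).2 p‖ := Finset.single_le_sum (f := fun p => ‖(g k j).2 p‖)
            (fun p _ => norm_nonneg _) (Finset.mem_univ p)
        _ ≤ ∑ j, ∑ p, ‖(g k j).2 p‖ := Finset.single_le_sum (f := fun j => ∑ p, ‖(g k j).2 p‖)
            (fun j _ => Finset.sum_nonneg fun p _ => norm_nonneg _) (Finset.mem_univ j)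
        _ ≤ _ := Finset.single_le_sum (f := fun k => ∑ j, ∑ p, ‖(g k j).2 p‖)
            (fun k _ => Finset.sum_nonneg fun j _ => Finset.sum_nonneg fun p _ => norm_nonneg _)
            (Finset.mem_univ k)

/-- Attach to each lattice point a tile of volume one. The count is the total volume of the tiles
attached to points in the box, and these tiles fill the box up to a margin `ρ`. The tile is chosen
p-adically integral, so that only the real sides need a margin. -/
lemma latCount_bounds (X₀ : Matrix κ n ℚ) {g : Matrix n n (QS S)} (h0 : g.det.1 = 1)
    (h1 : ∀ p, ‖g.det.2 p‖ = 1) : ∃ ρ : ℝ, 0 < ρ ∧ ∀ N : ℝ,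
      ENNReal.ofReal (2 * (N - ρ)) ^ (Fintype.card n * Fintype.card κ) ≤
        latCount S X₀ g (boxM S κ n (Set.Ico (-N) N)) ∧
      latCount S X₀ g (boxM S κ n (Set.Ico (-N) N)) ≤
        ENNReal.ofReal (2 * (N + ρ)) ^ (Fintype.card n * Fintype.card κ) := by
  have hg : IsUnit g.det := isUnit_iff.2
    ⟨by rw [h0]; exact one_ne_zero, fun p h => by have := h1 p; simp [h] at this⟩
  obtain ⟨s, hs, ρ, hρ, hsub⟩ := exists_tile_subset_box (κ := κ) g hg
  refine ⟨ρ, hρ, fun N => ?_⟩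
  have htm := measurableSet_tile (κ := κ) s g
  have hvol : volume (tile κ s g) = 1 := by
    rw [volume_tile hs (by rw [h0]; exact one_ne_zero) h1, h0]; simp
  set Y : intMat S κ n → Matrix κ n (QS S) := fun X =>
    ratMat S (X₀ + (X : Matrix κ n ℚ)) * g with hY
  -- The attached tiles cover every `Z` exactly once; the minus signs reverse the direction of
  -- translation in `exists_unique_mem_tile`.
  have hone : ∀ Z : Matrix κ n (QS S),
      ∑' X, (tile κ s g).indicator (1 : Matrix κ n (QS S) → ℝ≥0∞) (Z - Y X) = 1 := by
    intro Z
    obtain ⟨X, hX, hu⟩ := exists_unique_mem_tile hs hg (Z - ratMat S X₀ * g)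
    have e : ∀ X' : intMat S κ n, Z - Y X' = ratMat S ((-X' : intMat S κ n) : Matrix κ n ℚ) * g +
        (Z - ratMat S X₀ * g) := fun X' => by
      have : ratMat S ((-X' : intMat S κ n) : Matrix κ n ℚ) = - ratMat S (X' : Matrix κ n ℚ) := by
        refine Matrix.ext fun i j => ?_
        simp [ratMat]
      simp only [hY]
      rw [this, ratMat_add, Matrix.add_mul, Matrix.neg_mul]
      abel
    rw [tsum_eq_single (-X)]
    · rw [e, neg_neg, Set.indicator_of_mem hX]; rfl
    · intro X' hX'
      refine Set.indicator_of_notMem (fun hmem => hX' ?_) _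
      rw [e] at hmem
      rw [← hu _ hmem, neg_neg]
  have hcount : ∀ B : Set (Matrix κ n (QS S)), latCount S X₀ g B =
      ∫⁻ Z, ∑' X, B.indicator (1 : Matrix κ n (QS S) → ℝ≥0∞) (Y X) *
        (tile κ s g).indicator (1 : Matrix κ n (QS S) → ℝ≥0∞) (Z - Y X) := by
    intro B
    have hmeas : ∀ X, Measurable fun Z : Matrix κ n (QS S) =>
        (tile κ s g).indicator (1 : Matrix κ n (QS S) → ℝ≥0∞) (Z - Y X) := fun X =>
      (measurable_one.indicator htm).comp (measurable_sub_const _)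
    rw [lintegral_tsum fun X => ((hmeas X).const_mul _).aemeasurable, latCount]
    refine tsum_congr fun X => ?_
    rw [lintegral_const_mul _ (hmeas X), lintegral_sub_right_eq_self
      (fun Z => (tile κ s g).indicator (1 : Matrix κ n (QS S) → ℝ≥0∞) Z) (Y X),
      lintegral_indicator_one htm, hvol, mul_one]
  have hvb : ∀ R : ℝ, ENNReal.ofReal (2 * R) ^ (Fintype.card n * Fintype.card κ) =
      ∫⁻ Z, ∑' X, (boxM S κ n (Set.Ico (-R) R)).indicator (1 : Matrix κ n (QS S) → ℝ≥0∞) Z *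
        (tile κ s g).indicator (1 : Matrix κ n (QS S) → ℝ≥0∞) (Z - Y X) := fun R => by
    simp only [ENNReal.tsum_mul_left, hone, mul_one]
    rw [lintegral_indicator_one (measurableSet_boxM measurableSet_Ico), volume_boxM,
      Real.volume_Ico]
    congr 2
    ring
  rw [hcount, hvb, hvb]
  refine ⟨lintegral_mono fun Z => ENNReal.tsum_le_tsum fun X => ?_,
    lintegral_mono fun Z => ENNReal.tsum_le_tsum fun X => ?_⟩
  · by_cases hT : Z - Y X ∈ tile κ s g
    · refine mul_le_mul_left ?_ _
      by_cases hZ : Z ∈ boxM S κ n (Set.Ico (-(N - ρ)) (N - ρ))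
      · have hmem : Y X ∈ boxM S κ n (Set.Ico (-N) N) := fun i j => by
          have e : Y X i j = Z i j - (Z - Y X) i j := by rw [Matrix.sub_apply]; ring
          rw [e]
          refine boxR_sub ?_ (hZ i j) (hsub hT i j)
          rintro a ⟨ha, ha'⟩ b ⟨hb, hb'⟩
          constructor <;> linarith
        rw [Set.indicator_of_mem hZ, Set.indicator_of_mem hmem]
        simp
      · rw [Set.indicator_of_notMem hZ]
        exact zero_le
    · simp [Set.indicator_of_notMem hT]
  · by_cases hT : Z - Y X ∈ tile κ s g
    · refine mul_le_mul_left ?_ _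
      by_cases hZ : Y X ∈ boxM S κ n (Set.Ico (-N) N)
      · have hmem : Z ∈ boxM S κ n (Set.Ico (-(N + ρ)) (N + ρ)) := fun i j => by
          have e : Z i j = (Z - Y X) i j - (-Y X) i j := by
            rw [Matrix.sub_apply, Matrix.neg_apply]; ring
          rw [e]
          refine boxR_sub (I' := Set.Ioc (-N) N) ?_ (hsub hT i j) ?_
          · rintro a ⟨ha, ha'⟩ b ⟨hb, hb'⟩
            constructor <;> linarith
          · have := hZ i j
            refine ⟨?_, fun p => ?_⟩
            · have h3 := this.1
              rw [Set.mem_Ico] at h3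
              rw [Matrix.neg_apply, Prod.fst_neg]
              constructor <;> linarith [h3.1, h3.2]
            · rw [Matrix.neg_apply, Prod.snd_neg, Pi.neg_apply, norm_neg]
              exact this.2 p
        rw [Set.indicator_of_mem hZ, Set.indicator_of_mem hmem]
        simp
      · rw [Set.indicator_of_notMem hZ]
        exact zero_le
    · simp [Set.indicator_of_notMem hT]

/-- The number of points of a shifted lattice of covolume one in a large box. -/
lemma tendsto_latCount (X₀ : Matrix κ n ℚ) {g : Matrix n n (QS S)} (h0 : g.det.1 = 1)
    (h1 : ∀ p, ‖g.det.2 p‖ = 1) :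
    Filter.Tendsto (fun N : ℕ => ((2 * N : ℝ≥0∞) ^ (Fintype.card n * Fintype.card κ))⁻¹ *
      latCount S X₀ g (boxM S κ n (Set.Ico (-(N : ℝ)) N))) Filter.atTop (nhds 1) := by
  obtain ⟨ρ, hρ, hb⟩ := latCount_bounds X₀ h0 h1
  set D := Fintype.card n * Fintype.card κ with hD
  have key : ∀ c : ℝ, Filter.Tendsto (fun N : ℕ => ((2 * N : ℝ≥0∞) ^ D)⁻¹ *
      ENNReal.ofReal (2 * (N + c)) ^ D) Filter.atTop (nhds 1) := by
    intro c
    have h2 : Filter.Tendsto (fun N : ℕ => ENNReal.ofReal (1 + c / N) ^ D) Filter.atTop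
        (nhds 1) := by
      have h3 : Filter.Tendsto (fun N : ℕ => 1 + c / (N : ℝ)) Filter.atTop (nhds (1 + 0)) :=
        tendsto_const_nhds.add (tendsto_const_div_atTop_nhds_zero_nat c)
      have h4 := ((ENNReal.continuous_pow D).tendsto _).comp (ENNReal.tendsto_ofReal h3)
      simpa [Function.comp_def] using h4
    refine h2.congr' ?_
    filter_upwards [Filter.eventually_gt_atTop 0] with N hN
    have hN' : (0 : ℝ) < N := by exact_mod_cast hN
    have e : (2 * N : ℝ≥0∞) = ENNReal.ofReal (2 * N) := by
      rw [ENNReal.ofReal_mul zero_le_two]; simp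
    have h2N : ENNReal.ofReal (2 * N) ≠ 0 := by
      rw [Ne, ENNReal.ofReal_eq_zero]; linarith
    have e2 : (2 * (N + c) : ℝ) = 2 * N * (1 + c / N) := by field_simp
    rw [e, e2, ENNReal.ofReal_mul (q := 1 + c / N) (by positivity), mul_pow, ← mul_assoc,
      ENNReal.inv_mul_cancel (pow_ne_zero _ h2N) (ENNReal.pow_ne_top ENNReal.ofReal_ne_top), one_mul]
  refine tendsto_of_tendsto_of_tendsto_of_le_of_le (key (-ρ)) (key ρ) (fun N => ?_) (fun N => ?_)
  · exact mul_le_mul_right ((hb N).1) _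
  · exact mul_le_mul_right ((hb N).2) _

end SArith
end

open MeasureTheory Matrix
open scoped ENNReal Pointwise

set_option linter.unusedSectionVars false

noncomputable section

namespace SArith

/-! ### The first moment for random lattices -/

variable {S : Finset Prm} {κ ι n : Type*} [Fintype κ] [Fintype ι] [Fintype n] [DecidableEq κ]
  [DecidableEq ι] [DecidableEq n]
variable {Ω : Type*} [MeasurableSpace Ω] {P : Measure Ω} {h : Ω → Matrix n n (QS S)}

lemma tsum_NS_inv_pow_ne_top {k : ℕ} (hk : 2 ≤ k) : ∑' m : NS S, ((m : ℝ≥0∞) ^ k)⁻¹ ≠ ∞ := by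
  have hs : Summable fun m : ℕ => 1 / (m : ℝ) ^ k :=
    Real.summable_one_div_nat_pow.2 (by omega)
  refine ne_top_of_le_ne_top hs.tsum_ofReal_ne_top ?_
  refine le_trans (ENNReal.tsum_le_tsum fun m => ?_)
    (ENNReal.tsum_comp_le_tsum_of_injective Subtype.val_injective _)
  have hm : (0 : ℝ) < (m : ℕ) := by exact_mod_cast m.2.1
  rw [one_div, ENNReal.ofReal_inv_of_pos (by positivity), ENNReal.ofReal_pow hm.le]
  simp

lemma det_ratMat (A : Matrix κ κ ℚ) : (ratMat S A).det = algebraMap ℚ (QS S) A.det :=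
  ((algebraMap ℚ (QS S)).map_det A).symm

lemma lintegral_ratMat_mul {A : Matrix κ κ ℚ} {m : ℕ} (hm : m ∈ NS S) (hA : A.det = m)
    {Φ : Matrix κ n (QS S) → ℝ≥0∞} (hΦ : Measurable Φ) :
    ∫⁻ X : Matrix κ n (QS S), Φ (ratMat S A * X) =
      ((m : ℝ≥0∞) ^ Fintype.card n)⁻¹ * ∫⁻ X, Φ X := by
  have hm0 : m ≠ 0 := hm.1.ne'
  have h1 : (ratMat S A).det.1 = m := by rw [det_ratMat, hA]; simp
  have h2 : ∀ p, ‖(ratMat S A).det.2 p‖ = 1 := fun p => by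
    have : (ratMat S A).det.2 p = ((m : ℚ) : ℚ_[(p : Prm)]) := by rw [det_ratMat, hA]; simp
    rw [this, norm_natCast_eq_one_of_mem_NS hm]
  have h3 := lintegral_mul_left (m := n) (A := ratMat S A) (by rw [h1]; exact_mod_cast hm0) h2 hΦ
  have h4 : ‖(ratMat S A).det.1‖ₑ = m := by
    rw [h1, ← ofReal_norm]; simp
  rw [h3, h4, ← mul_assoc, ENNReal.inv_mul_cancel (pow_ne_zero _ (by exact_mod_cast hm0))
    (ENNReal.pow_ne_top (ENNReal.natCast_ne_top m)), one_mul]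

/-- A bound for the mean value of a sum over the nonzero lattice points. -/
lemma exists_bound_nonzero (hm : Measurable h) {e : Unit ⊕ ι ≃ n} (i₀ : ι)
    (hP : MeanValue P h e) : ∃ K : ℝ≥0∞, K ≠ ∞ ∧
      ∀ Φ : Matrix Unit n (QS S) → ℝ≥0∞, Measurable Φ →
        ∫⁻ ω, ∑' X : {X : Matrix Unit n ℚ // X ∈ intMat S Unit n ∧ X ≠ 0},
          Φ (ratMat S (X : Matrix Unit n ℚ) * h ω) ∂P ≤ K * ∫⁻ X, Φ X := by
  obtain ⟨c, hc, hmv⟩ := hP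
  have hcard : 2 ≤ Fintype.card n := by
    rw [← Fintype.card_congr e, Fintype.card_sum, Fintype.card_unit]
    have := Fintype.card_pos_iff.2 ⟨i₀⟩
    omega
  -- A nonzero lattice vector is `m` times a primitive one with `m ∈ ℕ_S`, and scaling by `m` costs
  -- `m⁻ⁿ`. The series converges since `n ≥ 2`.
  refine ⟨∑' m : NS S, c * ((m : ℝ≥0∞) ^ Fintype.card n)⁻¹, ?_, fun Φ hΦ => ?_⟩
  · rw [ENNReal.tsum_mul_left]
    exact ENNReal.mul_ne_top hc (tsum_NS_inv_pow_ne_top hcard)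
  choose Y hY m hmNS hXm using
    fun X : {X : Matrix Unit n ℚ // X ∈ intMat S Unit n ∧ X ≠ 0} => exists_prim_row e i₀ X.2.1 X.2.2
  let A : ℕ → Matrix Unit Unit ℚ := fun m => diagonal fun _ => (m : ℚ)
  have hA : ∀ m, (A m).det = m := fun m => by simp [A]
  have hXA : ∀ X : {X : Matrix Unit n ℚ // X ∈ intMat S Unit n ∧ X ≠ 0},
      (X : Matrix Unit n ℚ) = A (m X) * Y X := fun X => by
    conv_lhs => rw [hXm X]
    refine Matrix.ext fun i j => ?_
    simp [A]
  let F : Ω → NS S × prim S e → ℝ≥0∞ := fun ω x =>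
    Φ (ratMat S (A x.1) * (ratMat S (x.2 : Matrix Unit n ℚ) * h ω))
  have hinj : Function.Injective fun X => ((⟨m X, hmNS X⟩, ⟨Y X, hY X⟩) : NS S × prim S e) := by
    intro X X' hXX
    have h1 : m X = m X' := congrArg (fun x : NS S × prim S e => (x.1 : ℕ)) hXX
    have h2 : Y X = Y X' := congrArg (fun x : NS S × prim S e => (x.2 : Matrix Unit n ℚ)) hXX
    exact Subtype.ext (by rw [hXA X, hXA X', h1, h2])
  have hle : ∀ ω, ∑' X : {X : Matrix Unit n ℚ // X ∈ intMat S Unit n ∧ X ≠ 0},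
      Φ (ratMat S (X : Matrix Unit n ℚ) * h ω) ≤ ∑' m : NS S, ∑' Y : prim S e, F ω (m, Y) := by
    intro ω
    rw [← ENNReal.tsum_prod]
    refine le_trans (le_of_eq (tsum_congr fun X => ?_))
      (ENNReal.tsum_comp_le_tsum_of_injective hinj (F ω))
    simp only [F]
    rw [← Matrix.mul_assoc, ← ratMat_mul, ← hXA]
  refine (lintegral_mono hle).trans ?_
  have hFm : ∀ m Y, Measurable fun ω => F ω (m, Y) := fun m Y =>
    hΦ.comp ((measurable_mul_left _).comp (measurable_mul_apply hm _))
  rw [lintegral_tsum fun m => (Measurable.tsum fun Y => hFm m Y).aemeasurable,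
    ← ENNReal.tsum_mul_right]
  refine ENNReal.tsum_le_tsum fun m => ?_
  have h1 := hmv (fun X => Φ (ratMat S (A m) * X)) (hΦ.comp (measurable_mul_left _))
  simp only [F]
  rw [h1, lintegral_ratMat_mul m.2 (hA m) hΦ, mul_assoc]

lemma latCount_zero_le (g : Matrix n n (QS S)) (B : Set (Matrix κ n (QS S))) :
    latCount S 0 g B ≤ 1 + ∑' X : {X : Matrix κ n ℚ // X ∈ intMat S κ n ∧ X ≠ 0},
      B.indicator (1 : Matrix κ n (QS S) → ℝ≥0∞) (ratMat S (X : Matrix κ n ℚ) * g) := by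
  classical
  let f : intMat S κ n → ℝ≥0∞ := fun X =>
    B.indicator (1 : Matrix κ n (QS S) → ℝ≥0∞) (ratMat S (0 + (X : Matrix κ n ℚ)) * g)
  have hsplit : latCount S 0 g B = f 0 + ∑' X : {X : intMat S κ n // X ≠ 0}, f X := by
    change ∑' X, f X = _
    rw [← ENNReal.summable.tsum_add_tsum_compl (s := {0}) ENNReal.summable, tsum_singleton]
    rfl
  rw [hsplit]
  refine add_le_add (Set.indicator_le_self' (fun _ _ => zero_le) _) ?_
  refine le_trans (le_of_eq (tsum_congr fun X => ?_)) (ENNReal.tsum_comp_le_tsum_of_injective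
    (f := fun X : {X : intMat S κ n // X ≠ 0} => (⟨X.1.1, X.1.2, fun h0 => X.2 (Subtype.ext h0)⟩ :
      {X : Matrix κ n ℚ // X ∈ intMat S κ n ∧ X ≠ 0})) ?_ _)
  · simp only [f, zero_add]
  · intro X X' hXX
    have : (X.1 : Matrix κ n ℚ) = X'.1 := congrArg
      (fun Z : {X : Matrix κ n ℚ // X ∈ intMat S κ n ∧ X ≠ 0} => (Z : Matrix κ n ℚ)) hXX
    exact Subtype.ext (Subtype.ext this)

lemma lintegral_latCount_ne_top [IsProbabilityMeasure P] (hm : Measurable h) {e : Unit ⊕ ι ≃ n}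
    (i₀ : ι) (hP : MeanValue P h e) :
    ∫⁻ ω, latCount S 0 (h ω) (boxM S Unit n (Set.Ioo (-1) 1)) ∂P ≠ ∞ := by
  obtain ⟨K, hK, hb⟩ := exists_bound_nonzero hm i₀ hP
  have hBm : MeasurableSet (boxM S Unit n (Set.Ioo (-1) 1)) := measurableSet_boxM measurableSet_Ioo
  refine ne_top_of_le_ne_top ?_ (lintegral_mono fun ω => latCount_zero_le _ _)
  rw [lintegral_add_left measurable_const]
  refine ENNReal.add_ne_top.2 ⟨by simp, ?_⟩
  refine ne_top_of_le_ne_top ?_ (hb _ (measurable_one.indicator hBm))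
  rw [lintegral_indicator_one hBm, volume_boxM, Real.volume_Ioo]
  exact ENNReal.mul_ne_top hK (ENNReal.pow_ne_top ENNReal.ofReal_ne_top)

/-- Dominated convergence: for each lattice the normalized counts of the finitely many shifts tend
to one each, and `latCount_box_le` dominates them by a multiple of the integrable count in the box
over `(-1, 1)`. -/
lemma tendsto_lintegral_latCount [IsProbabilityMeasure P] (hm : Measurable h)
    (hdet : ∀ ω, (h ω).det.1 = 1 ∧ ∀ p, ‖(h ω).det.2 p‖ = 1) {J : Type*} [Fintype J]
    (x : J → Matrix κ n ℚ)
    (hG : ∫⁻ ω, latCount S 0 (h ω) (boxM S κ n (Set.Ioo (-1) 1)) ∂P ≠ ∞) :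
    Filter.Tendsto (fun N : ℕ => ((2 * N : ℝ≥0∞) ^ (Fintype.card n * Fintype.card κ))⁻¹ *
      ∫⁻ ω, ∑ j, latCount S (x j) (h ω) (boxM S κ n (Set.Ico (-(N : ℝ)) N)) ∂P)
      Filter.atTop (nhds (Fintype.card J)) := by
  set D := Fintype.card n * Fintype.card κ with hD
  have hBm : ∀ N : ℕ, MeasurableSet (boxM S κ n (Set.Ico (-(N : ℝ)) N)) := fun N =>
    measurableSet_boxM measurableSet_Ico
  have hcm : ∀ (N : ℕ), Measurable fun ω =>
      ∑ j, latCount S (x j) (h ω) (boxM S κ n (Set.Ico (-(N : ℝ)) N)) := fun N =>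
    Finset.measurable_fun_sum _ fun j _ => measurable_latCount hm _ (hBm N)
  have hmain := tendsto_lintegral_of_dominated_convergence (μ := P)
    (F := fun (N : ℕ) ω => ((2 * N : ℝ≥0∞) ^ D)⁻¹ *
      ∑ j, latCount S (x j) (h ω) (boxM S κ n (Set.Ico (-(N : ℝ)) N)))
    (f := fun _ => (Fintype.card J : ℝ≥0∞))
    (fun ω => Fintype.card J * latCount S 0 (h ω) (boxM S κ n (Set.Ioo (-1) 1)))
    (fun N => (hcm N).const_mul _) (fun N => Filter.Eventually.of_forall fun ω => ?_) ?_
    (Filter.Eventually.of_forall fun ω => ?_)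
  · simp only [lintegral_const, measure_univ, mul_one] at hmain
    refine hmain.congr fun N => ?_
    rw [lintegral_const_mul _ (hcm N)]
  · calc ((2 * N : ℝ≥0∞) ^ D)⁻¹ *
          ∑ j, latCount S (x j) (h ω) (boxM S κ n (Set.Ico (-(N : ℝ)) N))
        ≤ ((2 * N : ℝ≥0∞) ^ D)⁻¹ * ∑ _j : J, ((2 * N : ℝ≥0∞) ^ D *
            latCount S 0 (h ω) (boxM S κ n (Set.Ioo (-1) 1))) := by
          gcongr with j
          exact latCount_box_le (x j) (h ω) N
      _ = (((2 * N : ℝ≥0∞) ^ D)⁻¹ * (2 * N : ℝ≥0∞) ^ D) *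
            (Fintype.card J * latCount S 0 (h ω) (boxM S κ n (Set.Ioo (-1) 1))) := by
          rw [Finset.sum_const, Finset.card_univ, nsmul_eq_mul]; ring
      _ ≤ 1 * _ := by gcongr; exact ENNReal.inv_mul_le_one _
      _ = _ := one_mul _
  · rw [lintegral_const_mul _ (measurable_latCount hm _ (measurableSet_boxM measurableSet_Ioo))]
    exact ENNReal.mul_ne_top (ENNReal.natCast_ne_top _) hG
  · have h1 := tendsto_finsetSum Finset.univ fun j (_ : j ∈ Finset.univ) =>
      tendsto_latCount (x j) (hdet ω).1 (hdet ω).2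
    simp only [Finset.sum_const, Finset.card_univ, nsmul_eq_mul, mul_one] at h1
    refine h1.congr fun N => ?_
    rw [Finset.mul_sum]

/-- Representatives of finitely many classes of exact order `q` modulo `ℤ_S`, forming an invariant
set. -/
structure ShiftFamily (S : Finset Prm) (q : ℕ) {J : Type*} (x : J → Matrix Unit n ℚ) : Prop where
  smul_mem : ∀ j, (q : ℚ) • x j ∈ intMat S Unit n
  order : ∀ j (k : ZS S), (k : ℚ) • x j ∈ intMat S Unit n → ∃ b : ZS S, k = q * b
  inj : ∀ j j', x j - x j' ∈ intMat S Unit n → j = j'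
  inv : ∀ j (γ : SLZ S n), ∃ j', x j * toQ γ - x j' ∈ intMat S Unit n

/-- A prime factor of `q` lies outside `S`, where `q` has norm less than one and `b` at most one. -/
lemma not_natCast_mul_eq_one {q : ℕ} (hq : q ∈ NS S) (hq1 : q ≠ 1) (b : ZS S) :
    (1 : ZS S) ≠ q * b := by
  intro h1
  obtain ⟨l, hl, hlq⟩ := Nat.exists_prime_and_dvd hq1
  have hlS : (⟨l, hl⟩ : Prm) ∉ S := fun hS => by
    have := hq.2 _ hS
    exact hl.one_lt.ne' (Nat.eq_one_of_dvd_coprimes this hlq dvd_rfl)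
  have hb := b.2 _ hlS
  have : Fact l.Prime := ⟨hl⟩
  have h2 : ((q : ℚ_[l])) * ((b : ℚ) : ℚ_[l]) = 1 := by
    have := congrArg (fun z : ZS S => ((z : ℚ) : ℚ_[l])) h1
    push_cast at this
    exact this.symm
  have h3 : ‖(q : ℚ_[l])‖ < 1 := Padic.norm_natCast_lt_one_iff.2 hlq
  have h4 := congrArg norm h2
  rw [norm_mul, norm_one] at h4
  have hb' : ‖((b : ℚ) : ℚ_[l])‖ ≤ 1 := hb
  nlinarith [norm_nonneg (q : ℚ_[l])]

/-- A zero would make the shift integral, hence of order one rather than `q`. -/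
lemma ShiftFamily.add_ne_zero {q : ℕ} (hq : q ∈ NS S) (hq1 : q ≠ 1) {J : Type*}
    {x : J → Matrix Unit n ℚ} (hx : ShiftFamily S q x) (j : J) {X : Matrix Unit n ℚ}
    (hX : X ∈ intMat S Unit n) : x j + X ≠ 0 := by
  intro h0
  obtain ⟨b, hb⟩ := hx.order j 1 (by
    have : x j = -X := eq_neg_of_add_eq_zero_left h0
    rw [this]
    simpa using hX)
  exact not_natCast_mul_eq_one hq hq1 b hb

/-- The first moment of a family of shifted lattices. -/
theorem ShiftFamily.first_moment [IsProbabilityMeasure P] (hm : Measurable h)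
    (hdet : ∀ ω, (h ω).det.1 = 1 ∧ ∀ p, ‖(h ω).det.2 p‖ = 1) {e : Unit ⊕ ι ≃ n} (i₀ : ι)
    (hP : MeanValue P h e) {q : ℕ} (hq : q ∈ NS S) (hq1 : q ≠ 1) {J : Type*} [Fintype J]
    {x : J → Matrix Unit n ℚ} (hx : ShiftFamily S q x) {Φ : Matrix Unit n (QS S) → ℝ≥0∞}
    (hΦ : Measurable Φ) :
    ∫⁻ ω, ∑ j, ∑' X : intMat S Unit n, Φ (ratMat S (x j + (X : Matrix Unit n ℚ)) * h ω) ∂P =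
      Fintype.card J * ∫⁻ X, Φ X := by
  let L : Set (Matrix Unit n ℚ) := Set.range fun z : J × intMat S Unit n =>
    x z.1 + (z.2 : Matrix Unit n ℚ)
  have hinj : Function.Injective fun z : J × intMat S Unit n =>
      x z.1 + (z.2 : Matrix Unit n ℚ) := by
    rintro ⟨j, X⟩ ⟨j', X'⟩ hz
    have hz' : x j + (X : Matrix Unit n ℚ) = x j' + (X' : Matrix Unit n ℚ) := hz
    have hj : j = j' := hx.inj j j' (by
      have : x j - x j' = (X' : Matrix Unit n ℚ) - X := by
        rw [sub_eq_sub_iff_add_eq_add, hz', add_comm]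
      rw [this]
      exact sub_mem X'.2 X.2)
    subst hj
    exact Prod.ext rfl (Subtype.ext (add_left_cancel hz'))
  have hq0 : (q : ℚ) ≠ 0 := by exact_mod_cast hq.1.ne'
  have hsum : ∀ (F : Matrix Unit n ℚ → ℝ≥0∞), ∑' X : L, F X =
      ∑ j, ∑' X : intMat S Unit n, F (x j + (X : Matrix Unit n ℚ)) := fun F => by
    rw [← (Equiv.ofInjective _ hinj).tsum_eq]
    exact (ENNReal.tsum_prod (f := fun j (X : intMat S Unit n) =>
      F (x j + (X : Matrix Unit n ℚ)))).trans (tsum_fintype _)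
  obtain ⟨C, hC⟩ := exists_const_of_invariant hm hP L (by
      rintro _ ⟨⟨j, X⟩, rfl⟩ γ
      obtain ⟨j', hj'⟩ := hx.inv j γ
      refine ⟨(j', ⟨(x j * toQ γ - x j') + (X : Matrix Unit n ℚ) * toQ γ,
        add_mem hj' (mul_mem_intMat X.2 (toQ_mem γ))⟩), ?_⟩
      simp only [Matrix.add_mul]
      abel) (by
      rintro _ ⟨⟨j, X⟩, rfl⟩
      have hne := hx.add_ne_zero hq hq1 j X.2
      -- Multiplied by `q`, a point of the shifted lattice is a nonzero integral vector, so the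
      -- point is `m / q` times a primitive row.
      have hmem : (q : ℚ) • (x j + (X : Matrix Unit n ℚ)) ∈ intMat S Unit n := by
        rw [smul_add]
        refine add_mem (hx.smul_mem j) fun i k => ?_
        exact mul_mem (natCast_mem _ q) (X.2 i k)
      obtain ⟨Y, hY, m, hmN, hXm⟩ := exists_prim_row e i₀ hmem (smul_ne_zero hq0 hne)
      have hm0 : (m : ℚ) ≠ 0 := by exact_mod_cast hmN.1.ne'
      refine ⟨diagonal fun _ => (q : ℚ)⁻¹ * m, ?_, Y, hY, ?_⟩
      · simp [hq0, hm0]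
      · have h1 := congrArg (fun M => (q : ℚ)⁻¹ • M) hXm
        simp only [smul_smul, inv_mul_cancel₀ hq0, one_smul] at h1
        refine h1.trans (Matrix.ext fun i k => ?_)
        simp)
  have hC' : ∀ Φ : Matrix Unit n (QS S) → ℝ≥0∞, Measurable Φ → ∫⁻ ω, ∑ j,
      ∑' X : intMat S Unit n, Φ (ratMat S (x j + (X : Matrix Unit n ℚ)) * h ω) ∂P =
        C * ∫⁻ X, Φ X := fun Φ hΦ => by
    rw [← hC Φ hΦ]
    refine lintegral_congr fun ω => ?_
    exact (hsum fun X => Φ (ratMat S X * h ω)).symm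
  have hlim := tendsto_lintegral_latCount hm hdet x (lintegral_latCount_ne_top hm i₀ hP)
  -- Test on boxes: the mean value formula gives exactly `C` for the normalized count, while point
  -- counting gives the number of shifts in the limit.
  have hCJ : C = Fintype.card J := by
    refine tendsto_nhds_unique ?_ hlim
    refine Filter.Tendsto.congr' ?_ tendsto_const_nhds
    filter_upwards [Filter.eventually_gt_atTop 0] with N hN
    have hBm : MeasurableSet (boxM S Unit n (Set.Ico (-(N : ℝ)) N)) :=
      measurableSet_boxM measurableSet_Ico
    have h1 := hC' _ (measurable_one.indicator hBm)
    have e2 : ENNReal.ofReal ((N : ℝ) - -N) = 2 * N := by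
      rw [show (N : ℝ) - -N = 2 * N by ring, ENNReal.ofReal_mul zero_le_two]; simp
    rw [lintegral_indicator_one hBm, volume_boxM, Real.volume_Ico, e2] at h1
    simp only [latCount]
    rw [h1, mul_left_comm, ENNReal.inv_mul_cancel, mul_one]
    · exact pow_ne_zero _ (mul_ne_zero two_ne_zero (by exact_mod_cast hN.ne'))
    · exact ENNReal.pow_ne_top (ENNReal.mul_ne_top (by simp) (ENNReal.natCast_ne_top N))
  rw [hC' Φ hΦ, hCJ]

end SArith
end

open MeasureTheory Matrix
open scoped ENNReal Pointwise

set_option linter.unusedSectionVars false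

noncomputable section

namespace SArith

/-! ### Pairs of vectors -/

variable {S : Finset Prm} {κ ι n : Type*} [Fintype κ] [Fintype ι] [Fintype n] [DecidableEq κ]
  [DecidableEq ι] [DecidableEq n]
variable {Ω : Type*} [MeasurableSpace Ω] {P : Measure Ω} {h : Ω → Matrix n n (QS S)}

/-- The column with entries `c 0`, `c 1`. -/
def colMat (c : Fin 2 → ℚ) : Matrix (Fin 2) Unit ℚ := Matrix.of fun i _ => c i

lemma colMat_mul_apply (c : Fin 2 → ℚ) (y : Matrix Unit n ℚ) (i : Fin 2) (j : n) :
    (colMat c * y) i j = c i * y () j := by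
  simp [colMat, Matrix.mul_apply]

lemma ratMat_colMat_mul_apply (c : Fin 2 → ℚ) (y : Matrix Unit n (QS S)) (i : Fin 2) (j : n) :
    (ratMat S (colMat c) * y) i j = algebraMap ℚ (QS S) (c i) * y () j := by
  simp [colMat, Matrix.mul_apply, ratMat]

lemma measurable_colMat_mul (c : Fin 2 → ℚ) :
    Measurable fun y : Matrix Unit n (QS S) => ratMat S (colMat c) * y :=
  (continuous_const.matrix_mul continuous_id :
    Continuous fun y : Matrix Unit n (QS S) => ratMat S (colMat c) * y).measurable

/-- Linear independence of the rows of a rational matrix. -/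
def RowsIndep (M : Matrix κ n ℚ) : Prop := ∀ c : Matrix Unit κ ℚ, c * M = 0 → c = 0

lemma RowsIndep.mul_toQ {M : Matrix κ n ℚ} (hM : RowsIndep M) (γ : SLZ S n) :
    RowsIndep (M * toQ γ) := by
  intro c hc
  refine hM c ?_
  have h1 := congrArg (fun A => A * toQ γ⁻¹) hc
  simpa only [Matrix.mul_assoc, ← toQ_mul, mul_inv_cancel, toQ_one, Matrix.mul_one,
    Matrix.zero_mul] using h1

/-- Clearing denominators and the common divisor, the relation between the rows becomes `a M₀ + b M₁
= 0` with coprime integers. Then `M` is the column `(b, -a)` times a row `y`, and Bézout writes `y`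
as an integer combination of the rows of `M`, so `y` keeps their arithmetic properties. -/
lemma exists_coprime_of_not_rowsIndep {M : Matrix (Fin 2) n ℚ} (hM : ¬ RowsIndep M) :
    ∃ z u : Fin 2 → ℤ, 0 ≤ z 0 ∧ u 0 * z 0 + u 1 * z 1 = 1 ∧
      ∃ y : Matrix Unit n ℚ, (∀ j, y () j = u 0 * M 0 j + u 1 * M 1 j) ∧
        M = colMat (fun i => z i) * y := by
  unfold RowsIndep at hM
  push Not at hM
  obtain ⟨c, hcM, hc⟩ := hM
  have hrow : ∀ j, c () 0 * M 0 j + c () 1 * M 1 j = 0 := fun j => by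
    have := congrFun (congrFun hcM ()) j
    simpa [Matrix.mul_apply, Fin.sum_univ_two] using this
  set a₀ : ℤ := (c () 0).num * (c () 1).den with ha₀
  set b₀ : ℤ := (c () 1).num * (c () 0).den with hb₀
  have hd0 : ((c () 0).den : ℚ) ≠ 0 := by exact_mod_cast (c () 0).den_ne_zero
  have hd1 : ((c () 1).den : ℚ) ≠ 0 := by exact_mod_cast (c () 1).den_ne_zero
  have hrow' : ∀ j, (a₀ : ℚ) * M 0 j + b₀ * M 1 j = 0 := fun j => by
    rw [ha₀, hb₀]
    push_cast
    rw [← Rat.mul_den_eq_num (c () 0), ← Rat.mul_den_eq_num (c () 1)]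
    linear_combination ((c () 0).den : ℚ) * (c () 1).den * hrow j
  have hg : 0 < Int.gcd a₀ b₀ := by
    rw [Int.gcd_pos_iff]
    by_contra! hcon
    refine hc (Matrix.ext fun i k => ?_)
    rcases hcon with ⟨h1, h2⟩
    have e0 : (c () 0).num = 0 := by
      rcases mul_eq_zero.1 h1 with h | h
      · exact h
      · exact absurd h (by exact_mod_cast (c () 1).den_ne_zero)
    have e1 : (c () 1).num = 0 := by
      rcases mul_eq_zero.1 h2 with h | h
      · exact h
      · exact absurd h (by exact_mod_cast (c () 0).den_ne_zero)
    fin_cases k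
    · exact Rat.num_eq_zero.1 e0
    · exact Rat.num_eq_zero.1 e1
  obtain ⟨a, b, hab, ha, hb⟩ := Int.exists_gcd_one hg
  have hg' : ((Int.gcd a₀ b₀ : ℕ) : ℚ) ≠ 0 := by exact_mod_cast hg.ne'
  have hrow2 : ∀ j, (a : ℚ) * M 0 j + b * M 1 j = 0 := fun j => by
    have ha' : (a₀ : ℚ) = a * (Int.gcd a₀ b₀ : ℕ) := by exact_mod_cast ha
    have hb' : (b₀ : ℚ) = b * (Int.gcd a₀ b₀ : ℕ) := by exact_mod_cast hb
    have h2 : ((Int.gcd a₀ b₀ : ℕ) : ℚ) * (a * M 0 j + b * M 1 j) = 0 := by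
      linear_combination hrow' j - M 0 j * ha' - M 1 j * hb'
    exact (mul_eq_zero.1 h2).resolve_left hg'
  obtain ⟨r, s, hrs⟩ := Int.isCoprime_iff_gcd_eq_one.2 hab
  have hrs' : (r : ℚ) * a + s * b = 1 := by exact_mod_cast hrs
  -- The sign `ε` makes the first coordinate nonnegative.
  have key : ∀ ε : ℤ, ε * ε = 1 → 0 ≤ ε * b → ∃ z u : Fin 2 → ℤ, 0 ≤ z 0 ∧
      u 0 * z 0 + u 1 * z 1 = 1 ∧
      ∃ y : Matrix Unit n ℚ, (∀ j, y () j = u 0 * M 0 j + u 1 * M 1 j) ∧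
        M = colMat (fun i => z i) * y := by
    intro ε hε hb0
    have hε' : (ε : ℚ) * ε = 1 := by exact_mod_cast hε
    refine ⟨![ε * b, -(ε * a)], ![ε * s, -(ε * r)], hb0, ?_,
      Matrix.of fun _ j => ε * s * M 0 j - ε * r * M 1 j, fun j => ?_, Matrix.ext fun i j => ?_⟩
    · simp only [cons_val_zero, cons_val_one]
      linear_combination hrs + (s * b + r * a) * hε
    · simp only [of_apply, cons_val_zero, cons_val_one]
      push_cast
      ring
    · rw [colMat_mul_apply]
      fin_cases i
      · simp only [Fin.zero_eta, cons_val_zero, of_apply]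
        push_cast
        linear_combination (-M 0 j) * hrs' + (-(b : ℚ) * (s * M 0 j - r * M 1 j)) * hε' +
          r * hrow2 j
      · simp only [Fin.mk_one, cons_val_one, of_apply]
        push_cast
        linear_combination (-M 1 j) * hrs' + ((a : ℚ) * (s * M 0 j - r * M 1 j)) * hε' +
          s * hrow2 j
  rcases le_total 0 b with hb0 | hb0
  · exact key 1 (by norm_num) (by simpa using hb0)
  · exact key (-1) (by norm_num) (by simpa using hb0)

/-- The lower triangular matrices in the reduction of pairs. -/
def lowerMat (a b c : ℕ) : Matrix (Fin 2) (Fin 2) ℚ := !![(a : ℚ), 0; (b : ℚ), (c : ℚ)]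

lemma det_lowerMat (a b c : ℕ) : (lowerMat a b c).det = ((a * c : ℕ) : ℚ) := by
  simp [lowerMat, det_fin_two]

lemma exists_prim_pair (e : Fin 2 ⊕ ι ≃ n) (i₀ : ι) {M : Matrix (Fin 2) n ℚ}
    (hM : M ∈ intMat S (Fin 2) n) (hI : RowsIndep M) :
    ∃ a ∈ NS S, ∃ c ∈ NS S, ∃ b < c, ∃ Y ∈ prim S e, M = lowerMat a b c * Y := by
  obtain ⟨γ, a, ha, c, hc, b, hb, h1, h2⟩ := exists_eq_two_rows (S := S) (n := n)
    (i₀ := e (Sum.inl 0)) (i₁ := e (Sum.inl 1)) (i₂ := e (Sum.inr i₀)) (by simp) (by simp) (by simp)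
    (v := fun j => ⟨M 0 j, hM 0 j⟩) (w := fun j => ⟨M 1 j, hM 1 j⟩) (by
      intro a b hab
      have := hI (Matrix.of fun _ => ![(a : ℚ), (b : ℚ)]) (Matrix.ext fun i j => by
        have := congrArg Subtype.val (congrFun hab j)
        simpa [Matrix.mul_apply, Fin.sum_univ_two] using this)
      refine ⟨Subtype.ext ?_, Subtype.ext ?_⟩
      · exact congrFun (congrFun this ()) 0
      · exact congrFun (congrFun this ()) 1)
  refine ⟨a, ha, c, hc, b, hb, _, ⟨γ, rfl⟩, Matrix.ext fun i j => ?_⟩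
  have e1 := congrArg Subtype.val (congrFun h1 j)
  have e2 := congrArg Subtype.val (congrFun h2 j)
  fin_cases i
  · simpa [Matrix.mul_apply, Fin.sum_univ_two, lowerMat, toQ] using e1
  · simpa [Matrix.mul_apply, Fin.sum_univ_two, lowerMat, toQ] using e2

/-- Pairs of coprime integers. -/
def CopPair : Type := {z : Fin 2 → ℤ // IsCoprime (z 0) (z 1)}

lemma CopPair.norm_pos (z : CopPair) : 0 < ‖z.1‖ := by
  rw [norm_pos_iff]
  intro h0
  have := z.2
  rw [h0] at this
  exact not_isCoprime_zero_zero this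

/-- The volume of the set of `y` for which `z 0 y` and `z 1 y` lie in a box. -/
lemma lintegral_colMat_le (z : CopPair) {R : ℝ} (hR : 0 ≤ R) :
    ∫⁻ y : Matrix Unit n (QS S), (boxM S (Fin 2) n (Set.Icc (-R) R)).indicator
      (1 : Matrix (Fin 2) n (QS S) → ℝ≥0∞) (ratMat S (colMat fun i => z.1 i) * y) ≤
      ENNReal.ofReal (2 * R) ^ Fintype.card n * ENNReal.ofReal (‖z.1‖ ^ Fintype.card n)⁻¹ := by
  have hz := z.norm_pos
  have hBm : MeasurableSet (boxM S Unit n (Set.Icc (-(R / ‖z.1‖)) (R / ‖z.1‖))) :=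
    measurableSet_boxM measurableSet_Icc
  have hle : ∀ y : Matrix Unit n (QS S), (boxM S (Fin 2) n (Set.Icc (-R) R)).indicator
      (1 : Matrix (Fin 2) n (QS S) → ℝ≥0∞) (ratMat S (colMat fun i => z.1 i) * y) ≤
      (boxM S Unit n (Set.Icc (-(R / ‖z.1‖)) (R / ‖z.1‖))).indicator
        (1 : Matrix Unit n (QS S) → ℝ≥0∞) y := by
    intro y
    by_cases hy : ratMat S (colMat fun i => z.1 i) * y ∈ boxM S (Fin 2) n (Set.Icc (-R) R)
    · have hmem : y ∈ boxM S Unit n (Set.Icc (-(R / ‖z.1‖)) (R / ‖z.1‖)) := by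
        intro i j
        have hyi : ∀ i, algebraMap ℚ (QS S) (z.1 i) * y () j ∈ boxR S (Set.Icc (-R) R) := fun i => by
          have := hy i j
          rwa [ratMat_colMat_mul_apply] at this
        refine ⟨?_, fun p => ?_⟩
        · rw [Set.mem_Icc, ← abs_le, le_div_iff₀ hz, mul_comm]
          obtain ⟨i', hi'⟩ : ∃ i', ‖z.1 i'‖ = ‖z.1‖ := by
            obtain ⟨i', -, hi'⟩ := Finset.exists_mem_eq_sup' (Finset.univ_nonempty (α := Fin 2))
              (fun i => ‖z.1 i‖₊)
            refine ⟨i', ?_⟩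
            rw [Finset.sup'_eq_sup] at hi'
            exact (congrArg NNReal.toReal hi').symm
          have := (hyi i').1
          rw [Set.mem_Icc, ← abs_le] at this
          have e1 : (algebraMap ℚ (QS S) (z.1 i') * y () j).1 = (z.1 i' : ℝ) * (y () j).1 := by simp
          rw [e1, abs_mul] at this
          rw [← hi', Int.norm_eq_abs]
          exact this
        -- At the primes of `S`, Bézout recovers `y` as an integer combination of `z 0 y` and `z 1
        -- y`, so it is integral as well.
        · obtain ⟨u, v, huv⟩ := z.2
          have e0 := (hyi 0).2 p
          have e1 := (hyi 1).2 p
          have e : (y i j).2 p = (u : ℚ_[(p : Prm)]) *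
              (algebraMap ℚ (QS S) (z.1 0) * y () j).2 p +
              (v : ℚ_[(p : Prm)]) * (algebraMap ℚ (QS S) (z.1 1) * y () j).2 p := by
            have huv' : (u : ℚ_[(p : Prm)]) * (z.1 0 : ℤ) + v * (z.1 1 : ℤ) = 1 := by
              exact_mod_cast congrArg (fun x : ℤ => (x : ℚ_[(p : Prm)])) huv
            have a0 : (algebraMap ℚ (QS S) (z.1 0) * y () j).2 p =
              ((z.1 0 : ℤ) : ℚ_[(p : Prm)]) * (y () j).2 p := by simp
            have a1 : (algebraMap ℚ (QS S) (z.1 1) * y () j).2 p =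
              ((z.1 1 : ℤ) : ℚ_[(p : Prm)]) * (y () j).2 p := by simp
            rw [a0, a1]
            linear_combination (-(y () j).2 p) * huv'
          rw [e]
          refine (Padic.nonarchimedean _ _).trans (max_le ?_ ?_)
          · rw [norm_mul]
            exact mul_le_one₀ (Padic.norm_int_le_one u) (norm_nonneg _) e0
          · rw [norm_mul]
            exact mul_le_one₀ (Padic.norm_int_le_one v) (norm_nonneg _) e1
      rw [Set.indicator_of_mem hy, Set.indicator_of_mem hmem]
      simp
    · rw [Set.indicator_of_notMem hy]
      exact zero_le
  refine (lintegral_mono hle).trans (le_of_eq ?_)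
  rw [lintegral_indicator_one hBm, volume_boxM, Real.volume_Icc, Fintype.card_unit, mul_one,
    ← ENNReal.ofReal_pow (by rw [sub_neg_eq_add]; positivity), ← ENNReal.ofReal_pow (by positivity),
    ← ENNReal.ofReal_mul (by positivity)]
  congr 1
  rw [show R / ‖z.1‖ - -(R / ‖z.1‖) = 2 * R * ‖z.1‖⁻¹ by field_simp; ring, mul_pow, inv_pow]

variable (n) in
/-- The constant `∑ ‖z‖⁻ⁿ` over coprime pairs. -/
def copSum : ℝ≥0∞ := ∑' z : CopPair, ENNReal.ofReal (‖z.1‖ ^ Fintype.card n)⁻¹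

/-- The sum of `‖z‖⁻ⁿ` over all of `ℤ²`, familiar from Eisenstein series, converges for `n > 2`; the
dependent pairs are controlled by it. -/
lemma copSum_ne_top (hn : 3 ≤ Fintype.card n) : copSum n ≠ ∞ := by
  have hs := EisensteinSeries.summable_one_div_norm_rpow (k := Fintype.card n)
    (by have : (3 : ℝ) ≤ Fintype.card n := by exact_mod_cast hn
        linarith)
  refine ne_top_of_le_ne_top hs.tsum_ofReal_ne_top ?_
  refine le_trans (ENNReal.tsum_le_tsum fun z => ?_)
    (ENNReal.tsum_comp_le_tsum_of_injective (f := fun z : CopPair => z.1)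
      Subtype.val_injective _)
  rw [Real.rpow_neg (norm_nonneg _), Real.rpow_natCast]

lemma tsum_le_of_cover {α β : Type*} (s : Set α) (F : α → ℝ≥0∞) (π : β → α)
    (hπ : ∀ a ∈ s, ∃ b, π b = a) : ∑' a : s, F a ≤ ∑' b, F (π b) := by
  choose σ hσ using fun a : s => hπ a a.2
  have hinj : Function.Injective σ := fun a a' h => Subtype.ext (by rw [← hσ a, ← hσ a', h])
  calc ∑' a : s, F a = ∑' a : s, F (π (σ a)) := by simp only [hσ]
    _ ≤ _ := ENNReal.tsum_comp_le_tsum_of_injective hinj fun b => F (π b)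

lemma ratMat_mul_mul (A : Matrix κ ι ℚ) (Y : Matrix ι n ℚ) (g : Matrix n n (QS S)) :
    ratMat S (A * Y) * g = ratMat S A * (ratMat S Y * g) := by
  rw [ratMat_mul, Matrix.mul_assoc]

/-- The `c` choices of `b` cost one power of `c`, leaving `∑ a⁻ⁿ ∑ c⁻⁽ⁿ⁻¹⁾`, which converges for `n
≥ 3`. -/
lemma tsum_lowerMat_ne_top (hn : 3 ≤ Fintype.card n) :
    ∑' a : NS S, ∑' c : NS S, ∑' _b : Fin c, (((a * c : ℕ) : ℝ≥0∞) ^ Fintype.card n)⁻¹ ≠ ∞ := by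
  obtain ⟨k, hk⟩ : ∃ k, Fintype.card n = k + 1 := ⟨Fintype.card n - 1, by omega⟩
  have e : ∀ a c : NS S, ∑' _b : Fin c, (((a * c : ℕ) : ℝ≥0∞) ^ Fintype.card n)⁻¹ =
      ((a : ℝ≥0∞) ^ Fintype.card n)⁻¹ * ((c : ℝ≥0∞) ^ k)⁻¹ := by
    intro a c
    have hc0 : ((c : ℕ) : ℝ≥0∞) ≠ 0 := by exact_mod_cast c.2.1.ne'
    have ha0 : ((a : ℕ) : ℝ≥0∞) ≠ 0 := by exact_mod_cast a.2.1.ne'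
    rw [tsum_fintype, Finset.sum_const, Finset.card_univ, Fintype.card_fin, nsmul_eq_mul,
      Nat.cast_mul, mul_pow, ENNReal.mul_inv (Or.inl (pow_ne_zero _ ha0))
      (Or.inl (ENNReal.pow_ne_top (ENNReal.natCast_ne_top _))), mul_left_comm]
    congr 1
    rw [hk, pow_succ, ENNReal.mul_inv (Or.inr (ENNReal.natCast_ne_top _)) (Or.inr hc0),
      mul_left_comm, ENNReal.mul_inv_cancel hc0 (ENNReal.natCast_ne_top _), mul_one]
  simp only [e, ENNReal.tsum_mul_left, ENNReal.tsum_mul_right]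
  exact ENNReal.mul_ne_top (tsum_NS_inv_pow_ne_top (by omega)) (tsum_NS_inv_pow_ne_top (by omega))

/-- The square of the number of lattice points in a box is integrable. -/
lemma lintegral_latCount_pair_ne_top [IsProbabilityMeasure P] (hm : Measurable h)
    {ι' : Type*} [Fintype ι'] [DecidableEq ι'] {e₁ : Unit ⊕ ι' ≃ n} (i₁ : ι')
    (hP₁ : MeanValue P h e₁) {e₂ : Fin 2 ⊕ ι ≃ n} (i₂ : ι) (hP₂ : MeanValue P h e₂) :
    ∫⁻ ω, latCount S 0 (h ω) (boxM S (Fin 2) n (Set.Ioo (-1) 1)) ∂P ≠ ∞ := by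
  have hcard : 3 ≤ Fintype.card n := by
    rw [← Fintype.card_congr e₂, Fintype.card_sum, Fintype.card_fin]
    have := Fintype.card_pos_iff.2 ⟨i₂⟩
    omega
  obtain ⟨K, hK, hb⟩ := exists_bound_nonzero hm i₁ hP₁
  obtain ⟨c₂, hc₂, hmv⟩ := hP₂
  set B := boxM S (Fin 2) n (Set.Icc (-1) 1) with hB
  have hBm : MeasurableSet B := measurableSet_boxM measurableSet_Icc
  set φ : Matrix (Fin 2) n (QS S) → ℝ≥0∞ := B.indicator 1 with hφ
  have hφm : Measurable φ := measurable_one.indicator hBm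
  have hmono : ∀ ω, latCount S 0 (h ω) (boxM S (Fin 2) n (Set.Ioo (-1) 1)) ≤
      latCount S 0 (h ω) B := fun ω => ENNReal.tsum_le_tsum fun X =>
    Set.indicator_le_indicator_of_subset (fun A hA i j =>
      ⟨Set.Ioo_subset_Icc_self (hA i j).1, (hA i j).2⟩) (fun _ => zero_le) _
  -- `T` parametrizes the nonzero dependent pairs, `T'` the independent ones in Hermite form.
  -- Repetitions do no harm, as only an upper bound is needed.
  let T := CopPair × {y : Matrix Unit n ℚ // y ∈ intMat S Unit n ∧ y ≠ 0}
  let T' := (NS S) × (Σ c : NS S, Fin c) × prim S e₂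
  let π : T ⊕ T' → Matrix (Fin 2) n ℚ := Sum.elim
    (fun t => colMat (fun i => t.1.1 i) * (t.2 : Matrix Unit n ℚ))
    (fun t => lowerMat t.1 t.2.1.2 t.2.1.1 * (t.2.2 : Matrix (Fin 2) n ℚ))
  have hcover : ∀ X ∈ {X : Matrix (Fin 2) n ℚ | X ∈ intMat S (Fin 2) n ∧ X ≠ 0},
      ∃ t, π t = X := by
    rintro X ⟨hX, hX0⟩
    by_cases hI : RowsIndep X
    · obtain ⟨a, ha, c, hc, b, hb, Y, hY, hXY⟩ := exists_prim_pair e₂ i₂ hX hI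
      exact ⟨Sum.inr (⟨a, ha⟩, ⟨⟨c, hc⟩, ⟨b, hb⟩⟩, ⟨Y, hY⟩), hXY.symm⟩
    · obtain ⟨z, u, -, huz, y, hy, hXy⟩ := exists_coprime_of_not_rowsIndep hI
      refine ⟨Sum.inl (⟨z, u 0, u 1, huz⟩, ⟨y, fun i j => ?_, ?_⟩), hXy.symm⟩
      · rw [show i = () from rfl, hy j]
        exact add_mem (mul_mem (intCast_mem _ _) (hX _ _)) (mul_mem (intCast_mem _ _) (hX _ _))
      · rintro rfl
        exact hX0 (by rw [hXy, Matrix.mul_zero])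
  have hle : ∀ ω, latCount S 0 (h ω) (boxM S (Fin 2) n (Set.Ioo (-1) 1)) ≤ 1 +
      (∑' z : CopPair, ∑' y : {y : Matrix Unit n ℚ // y ∈ intMat S Unit n ∧ y ≠ 0},
        φ (ratMat S (colMat fun i => z.1 i) * (ratMat S (y : Matrix Unit n ℚ) * h ω)) +
      ∑' a : NS S, ∑' c : NS S, ∑' b : Fin c, ∑' Y : prim S e₂,
        φ (ratMat S (lowerMat a b c) * (ratMat S (Y : Matrix (Fin 2) n ℚ) * h ω))) := by
    intro ω
    refine (hmono ω).trans ((latCount_zero_le _ _).trans (add_le_add_right ?_ _))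
    refine (tsum_le_of_cover _ (fun X => φ (ratMat S X * h ω)) π hcover).trans (le_of_eq ?_)
    rw [ENNReal.summable.tsum_sum ENNReal.summable]
    congr 1
    · refine (ENNReal.tsum_prod (f := fun (z : CopPair)
        (y : {y : Matrix Unit n ℚ // y ∈ intMat S Unit n ∧ y ≠ 0}) =>
          φ (ratMat S (colMat (fun i => z.1 i) * (y : Matrix Unit n ℚ)) * h ω))).trans ?_
      simp only [ratMat_mul_mul]
    · refine (ENNReal.tsum_prod (f := fun (a : NS S) (x : (Σ c : NS S, Fin c) × prim S e₂) =>
          φ (ratMat S (lowerMat a x.1.2 x.1.1 * (x.2 : Matrix (Fin 2) n ℚ)) * h ω))).trans ?_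
      refine tsum_congr fun a => ?_
      refine (ENNReal.tsum_prod (f := fun (x : Σ c : NS S, Fin c) (Y : prim S e₂) =>
          φ (ratMat S (lowerMat a x.2 x.1 * (Y : Matrix (Fin 2) n ℚ)) * h ω))).trans ?_
      refine (ENNReal.tsum_sigma (fun (c : NS S) (b : Fin c) => ∑' Y : prim S e₂,
          φ (ratMat S (lowerMat a b c * (Y : Matrix (Fin 2) n ℚ)) * h ω))).trans ?_
      simp only [ratMat_mul_mul]
  have : Countable CopPair := inferInstanceAs (Countable {z : Fin 2 → ℤ // IsCoprime (z 0) (z 1)})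
  have : Countable {y : Matrix Unit n ℚ // y ∈ intMat S Unit n ∧ y ≠ 0} := inferInstance
  have hm1 : ∀ (z : CopPair) (y : {y : Matrix Unit n ℚ // y ∈ intMat S Unit n ∧ y ≠ 0}),
      Measurable fun ω =>
        φ (ratMat S (colMat fun i => z.1 i) * (ratMat S (y : Matrix Unit n ℚ) * h ω)) := fun z y =>
    hφm.comp ((measurable_colMat_mul _).comp (measurable_mul_apply hm _))
  have hm2 : ∀ (a c : NS S) (b : Fin c) (Y : prim S e₂), Measurable fun ω =>
      φ (ratMat S (lowerMat a b c) * (ratMat S (Y : Matrix (Fin 2) n ℚ) * h ω)) := fun a c b Y =>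
    hφm.comp ((measurable_mul_left _).comp (measurable_mul_apply hm _))
  refine ne_top_of_le_ne_top ?_ (lintegral_mono hle)
  rw [lintegral_add_left measurable_const, lintegral_add_left
    (Measurable.tsum fun z => Measurable.tsum fun y => hm1 z y)]
  refine ENNReal.add_ne_top.2 ⟨by simp, ENNReal.add_ne_top.2 ⟨?_, ?_⟩⟩
  · rw [lintegral_tsum fun z => (Measurable.tsum fun y => hm1 z y).aemeasurable]
    refine ne_top_of_le_ne_top (b := ∑' z : CopPair, K * (ENNReal.ofReal (2 * 1) ^ Fintype.card n *
      ENNReal.ofReal (‖z.1‖ ^ Fintype.card n)⁻¹)) ?_ (ENNReal.tsum_le_tsum fun z => ?_)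
    · rw [ENNReal.tsum_mul_left, ENNReal.tsum_mul_left]
      exact ENNReal.mul_ne_top hK (ENNReal.mul_ne_top (ENNReal.pow_ne_top ENNReal.ofReal_ne_top)
        (copSum_ne_top hcard))
    · refine (hb (fun y => φ (ratMat S (colMat fun i => z.1 i) * y))
        (hφm.comp (measurable_colMat_mul _))).trans ?_
      gcongr
      exact lintegral_colMat_le z zero_le_one
  · rw [lintegral_tsum fun a => (Measurable.tsum fun c => Measurable.tsum fun b =>
      Measurable.tsum fun Y => hm2 a c b Y).aemeasurable]
    have hval : ∀ (a c : NS S) (b : Fin c), ∫⁻ ω, ∑' Y : prim S e₂,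
        φ (ratMat S (lowerMat a b c) * (ratMat S (Y : Matrix (Fin 2) n ℚ) * h ω)) ∂P =
        (((a * c : ℕ) : ℝ≥0∞) ^ Fintype.card n)⁻¹ * (c₂ * volume B) := by
      intro a c b
      have h1 := hmv (fun X => φ (ratMat S (lowerMat a b c) * X))
        (hφm.comp (measurable_mul_left _))
      rw [h1, lintegral_ratMat_mul (mul_mem_NS a.2 c.2) (det_lowerMat a b c) hφm, hφ,
        lintegral_indicator_one hBm, mul_left_comm]
    have hsum : ∀ a : NS S, ∫⁻ ω, ∑' c : NS S, ∑' b : Fin c, ∑' Y : prim S e₂,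
        φ (ratMat S (lowerMat a b c) * (ratMat S (Y : Matrix (Fin 2) n ℚ) * h ω)) ∂P =
        (∑' c : NS S, ∑' _b : Fin c, (((a * c : ℕ) : ℝ≥0∞) ^ Fintype.card n)⁻¹) *
          (c₂ * volume B) := by
      intro a
      rw [lintegral_tsum fun c => (Measurable.tsum fun b =>
        Measurable.tsum fun Y => hm2 a c b Y).aemeasurable, ← ENNReal.tsum_mul_right]
      refine tsum_congr fun c => ?_
      rw [lintegral_tsum fun b => (Measurable.tsum fun Y => hm2 a c b Y).aemeasurable,
        ← ENNReal.tsum_mul_right]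
      exact tsum_congr fun b => hval a c b
    simp only [hsum]
    rw [ENNReal.tsum_mul_right]
    refine ENNReal.mul_ne_top (tsum_lowerMat_ne_top hcard) (ENNReal.mul_ne_top hc₂ ?_)
    rw [hB, volume_boxM, Real.volume_Icc]
    exact ENNReal.pow_ne_top ENNReal.ofReal_ne_top

end SArith
end

open MeasureTheory Matrix
open scoped ENNReal Pointwise

set_option linter.unusedSectionVars false

noncomputable section

namespace SArith

/-! ### The second moment for random lattices -/

variable {S : Finset Prm} {κ ι n : Type*} [Fintype κ] [Fintype ι] [Fintype n] [DecidableEq κ]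
  [DecidableEq ι] [DecidableEq n]
variable {Ω : Type*} [MeasurableSpace Ω] {P : Measure Ω} {h : Ω → Matrix n n (QS S)}

lemma smul_mem_intMat {k : ℚ} (hk : k ∈ ZS S) {X : Matrix κ n ℚ} (hX : X ∈ intMat S κ n) :
    k • X ∈ intMat S κ n := fun i j => mul_mem hk (hX i j)

/-- Elements of `ℙ_S` scale the measure trivially. -/
lemma lintegral_inv_smul {s : ℕ} (hs : s ∈ PS S) {Φ : Matrix κ n (QS S) → ℝ≥0∞}
    (hΦ : Measurable Φ) :
    ∫⁻ X : Matrix κ n (QS S), Φ (algebraMap ℚ (QS S) (s : ℚ)⁻¹ • X) = ∫⁻ X, Φ X := by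
  have hs0 : (s : ℚ) ≠ 0 := by exact_mod_cast hs.1.ne'
  have hA : (diagonal fun _ : κ => algebraMap ℚ (QS S) (s : ℚ)⁻¹) =
      ratMat S (diagonal fun _ : κ => (s : ℚ)⁻¹) := by
    simp [ratMat, Matrix.diagonal_map]
  have hu : IsUnit (diagonal fun _ : κ => algebraMap ℚ (QS S) (s : ℚ)⁻¹).det := by
    rw [hA, det_ratMat]
    refine IsUnit.map _ (isUnit_iff_ne_zero.2 ?_)
    simp [hs0]
  obtain ⟨c, hc⟩ := exists_lintegral_mul_left (n := n) hu
  have hmul : ∀ X : Matrix κ n (QS S), (diagonal fun _ : κ => algebraMap ℚ (QS S) (s : ℚ)⁻¹) * X =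
      algebraMap ℚ (QS S) (s : ℚ)⁻¹ • X := fun X => by
    refine Matrix.ext fun i j => ?_
    rw [Matrix.diagonal_mul, Matrix.smul_apply, smul_eq_mul]
  simp only [hmul] at hc
  have hdet : ((1 : Matrix n n (QS S)).det.1 ≠ 0) := by simp
  have hdet' : ∀ p, ‖(1 : Matrix n n (QS S)).det.2 p‖ = 1 := by simp
  -- The scalar is found from the tiles with parameters `1` and `s`, which are scaled into each
  -- other and are fundamental domains of the same lattice. This is the product formula in disguise.
  have v1 := volume_tile (κ := κ) (one_mem_PS (S := S)) hdet hdet'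
  have vs := volume_tile (κ := κ) hs hdet hdet'
  have hm1 : MeasurableSet (tile κ 1 (1 : Matrix n n (QS S))) := measurableSet_tile _ _
  have hms : MeasurableSet (tile κ s (1 : Matrix n n (QS S))) := measurableSet_tile _ _
  have h1 := hc _ (measurable_one.indicator hm1)
  have hind : ∀ X : Matrix κ n (QS S), (tile κ 1 (1 : Matrix n n (QS S))).indicator
      (1 : Matrix κ n (QS S) → ℝ≥0∞) (algebraMap ℚ (QS S) (s : ℚ)⁻¹ • X) =
      (tile κ s (1 : Matrix n n (QS S))).indicator (1 : Matrix κ n (QS S) → ℝ≥0∞) X := fun X => by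
    have : (algebraMap ℚ (QS S) (s : ℚ)⁻¹ • X ∈ tile κ 1 (1 : Matrix n n (QS S))) ↔
        X ∈ tile κ s (1 : Matrix n n (QS S)) := by
      simp only [tile, inv_one, Matrix.mul_one, Nat.cast_one, map_one, one_mul, Matrix.smul_apply,
        smul_eq_mul, Set.mem_ofPred_eq]
    by_cases hX : X ∈ tile κ s (1 : Matrix n n (QS S))
    · rw [Set.indicator_of_mem hX, Set.indicator_of_mem (this.2 hX)]; rfl
    · rw [Set.indicator_of_notMem hX, Set.indicator_of_notMem fun h => hX (this.1 h)]
  simp only [hind] at h1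
  rw [lintegral_indicator_one hms, lintegral_indicator_one hm1, v1, vs] at h1
  have hc1 : c = 1 := by simpa using h1.symm
  rw [hc Φ hΦ, hc1, one_mul]

variable (S) in
/-- The index set of the second moment formula. -/
abbrev PairIndex (q : ℕ) : Type := Σ t : indexT S q, indexA S q t

/-- The vector `(t, a)`. -/
def pairVec {q : ℕ} (τ : PairIndex S q) : Fin 2 → ℚ := ![((τ.1 : ℕ) : ℚ), ((τ.2 : ZS S) : ℚ)]

lemma pairVec_ext {q : ℕ} {τ τ' : PairIndex S q} (h0 : (τ.1 : ℕ) = τ'.1)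
    (h1 : ((τ.2 : ZS S) : ℚ) = (τ'.2 : ZS S)) : τ = τ' := by
  obtain ⟨⟨t, ht⟩, ⟨a, ha⟩⟩ := τ
  obtain ⟨⟨t', ht'⟩, ⟨a', ha'⟩⟩ := τ'
  obtain rfl : t = t' := h0
  obtain rfl : a = a' := Subtype.ext h1
  rfl

/-- After clearing denominators `t` divides `c₂ k t₂`, and it is coprime to `k` by assumption and to
`c₂` because `c₂` has only prime factors in `S`. -/
lemma dvd_of_coprimeS {t t₂ : ℕ} (ht : t ∈ NS S) {a a₂ : ZS S}
    (h1 : CoprimeS S t ![a]) (h2 : CoprimeS S t₂ ![a₂])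
    (h : (a : ℚ) * t₂ = a₂ * t) : t ∣ t₂ := by
  obtain ⟨c, hc, k, hk, hg⟩ := h1
  obtain ⟨c₂, hc₂, k₂, hk₂, -⟩ := h2
  have e : (c₂ : ℤ) * k 0 * t₂ = (c * k₂ 0) * t := by
    have e1 := hk 0
    have e2 := hk₂ 0
    simp only [Matrix.cons_val_fin_one] at e1 e2
    have : ((c₂ : ℚ) * k 0 * t₂) = c * k₂ 0 * t := by
      rw [e1, e2]
      linear_combination (c * c₂ : ℚ) * h
    exact_mod_cast this
  have e' : c₂ * (k 0).natAbs * t₂ = c * (k₂ 0).natAbs * t := by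
    have := congrArg Int.natAbs e
    simpa [Int.natAbs_mul] using this
  have hcop : Nat.Coprime t (k 0).natAbs := by simpa using hg
  have hcop2 : Nat.Coprime t c₂ := (coprime_of_mem_PS_NS hc₂ ht).symm
  exact (hcop2.mul_right hcop).dvd_of_dvd_mul_left ⟨c * (k₂ 0).natAbs, by rw [e']; ring⟩

/-- Proportional index pairs coincide: their first coordinates divide each other. So the line
through a dependent pair determines its index. -/
lemma pairVec_eq_of_mul_eq {q : ℕ} {τ τ' : PairIndex S q}
    (h : pairVec τ 1 * pairVec τ' 0 = pairVec τ' 1 * pairVec τ 0) : τ = τ' := by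
  have h' : ((τ.2 : ZS S) : ℚ) * ((τ'.1 : ℕ) : ℚ) = ((τ'.2 : ZS S) : ℚ) * ((τ.1 : ℕ) : ℚ) := h
  have ht : (τ.1 : ℕ) = τ'.1 := Nat.dvd_antisymm
    (dvd_of_coprimeS τ.1.2.1 τ.2.2.2 τ'.2.2.2 h')
    (dvd_of_coprimeS τ'.1.2.1 τ'.2.2.2 τ.2.2.2 h'.symm)
  refine pairVec_ext ht ?_
  have h0 : (((τ.1 : ℕ)) : ℚ) ≠ 0 := by exact_mod_cast τ.1.2.1.1.ne'
  have e : ((τ'.1 : ℕ) : ℚ) = ((τ.1 : ℕ) : ℚ) := by rw [ht]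
  exact mul_right_cancel₀ h0 ((congrArg (((τ.2 : ZS S) : ℚ) * ·) e).symm.trans h')

lemma exists_inverse_mod {q t : ℕ} (ht : Nat.gcd t q = 1) :
    ∃ t' m : ℤ, (t : ℚ) * t' = 1 + q * m := by
  obtain ⟨u, v, huv⟩ := Nat.isCoprime_iff_coprime.2 (show Nat.Coprime t q from ht)
  refine ⟨u, -v, ?_⟩
  have : ((u * t + v * q : ℤ) : ℚ) = 1 := by rw [huv]; simp
  push_cast at this ⊢
  linear_combination this

/-- `t'` is invertible modulo `q`, so multiplication by it is a bijection on classes of order `q`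
and commutes with `SL_n(ℤ_S)`. -/
lemma ShiftFamily.smul {q t : ℕ} {t' m : ℤ} (htt : (t : ℚ) * t' = 1 + q * m) {J : Type*}
    {x : J → Matrix Unit n ℚ} (hx : ShiftFamily S q x) :
    ShiftFamily S q fun j => (t' : ℚ) • x j where
  smul_mem j := by
    rw [smul_comm]
    exact smul_mem_intMat (intCast_mem _ _) (hx.smul_mem j)
  order j k hk := by
    rw [smul_smul] at hk
    obtain ⟨b, hb⟩ := hx.order j (k * t') (by simpa using hk)
    refine ⟨t * b - k * m, ?_⟩
    have hb' := congrArg Subtype.val hb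
    refine Subtype.ext ?_
    push_cast at hb' ⊢
    linear_combination (-(k : ℚ)) * htt + (t : ℚ) * hb'
  inj j j' hj := by
    refine hx.inj j j' ?_
    have : x j - x j' = (t : ℚ) • ((t' : ℚ) • x j - (t' : ℚ) • x j') -
        (m : ℚ) • ((q : ℚ) • x j - (q : ℚ) • x j') := by
      rw [← smul_sub, ← smul_sub, smul_smul, smul_smul, htt, ← sub_smul,
        show (1 + q * m - m * q : ℚ) = 1 by ring, one_smul]
    rw [this]
    exact sub_mem (smul_mem_intMat (natCast_mem _ _) hj)
      (smul_mem_intMat (intCast_mem _ _) (sub_mem (hx.smul_mem j) (hx.smul_mem j')))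
  inv j γ := by
    obtain ⟨j', hj'⟩ := hx.inv j γ
    refine ⟨j', ?_⟩
    rw [Matrix.smul_mul, ← smul_sub]
    exact smul_mem_intMat (intCast_mem _ _) hj'

lemma not_rowsIndep_colMat_mul {c : Fin 2 → ℚ} (hc : c 0 ≠ 0) (y : Matrix Unit n ℚ) :
    ¬ RowsIndep (colMat c * y) := by
  intro hI
  have := hI (Matrix.of fun _ => ![c 1, -c 0]) (Matrix.ext fun i j => by
    rw [Matrix.mul_apply, Fin.sum_univ_two, colMat_mul_apply, colMat_mul_apply]
    simp
    ring)
  have h1 := congrFun (congrFun this ()) 1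
  simp at h1
  exact hc h1

/-- The dependent pairs in the family `(x j + ℤ_S) × (x j + ℤ_S)`. -/
lemma ShiftFamily.dependent_iff {q : ℕ} (hq : q ∈ NS S) (hq1 : q ≠ 1) {J : Type*}
    {x : J → Matrix Unit n ℚ} (hx : ShiftFamily S q x) {t' m : indexT S q → ℤ}
    (htt : ∀ t : indexT S q, ((t : ℕ) : ℚ) * t' t = 1 + q * m t) (j : J)
    (M : Matrix (Fin 2) n ℚ) :
    (M - colMat ![1, 1] * x j ∈ intMat S (Fin 2) n ∧ ¬ RowsIndep M) ↔
      ∃ τ : PairIndex S q, ∃ Y ∈ intMat S Unit n,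
        M = colMat (pairVec τ) * ((t' τ.1 : ℚ) • x j + Y) := by
  constructor
  · rintro ⟨hM, hI⟩
    obtain ⟨z, u, hz0, huz, y, hy, hMy⟩ := exists_coprime_of_not_rowsIndep hI
    have hrow : ∀ i, (Matrix.of fun (_ : Unit) k => M i k) - x j ∈ intMat S Unit n := by
      intro i k l
      have := hM i l
      rw [Matrix.sub_apply, colMat_mul_apply] at this
      fin_cases i <;> simpa using this
    have hMz : ∀ i, (Matrix.of fun (_ : Unit) k => M i k) = (z i : ℚ) • y := by
      intro i
      refine Matrix.ext fun k l => ?_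
      rw [Matrix.of_apply, hMy, colMat_mul_apply]
      rfl
    simp only [hMz] at hrow
    -- Both `z 0 y` and `z 1 y` are congruent to `x j`, so Bézout gives `y ≡ (u 0 + u 1) x j`.
    have hyx : y - ((u 0 + u 1 : ℤ) : ℚ) • x j ∈ intMat S Unit n := by
      have e : y - ((u 0 + u 1 : ℤ) : ℚ) • x j =
          (u 0 : ℚ) • ((z 0 : ℚ) • y - x j) + (u 1 : ℚ) • ((z 1 : ℚ) • y - x j) := by
        have huz' : (u 0 : ℚ) * z 0 + u 1 * z 1 = 1 := by exact_mod_cast huz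
        rw [smul_sub, smul_sub, smul_smul, smul_smul]
        refine Matrix.ext fun k l => ?_
        simp only [Matrix.sub_apply, Matrix.add_apply, Matrix.smul_apply, smul_eq_mul]
        push_cast
        linear_combination (-(y k l)) * huz'
      rw [e]
      exact add_mem (smul_mem_intMat (intCast_mem _ _) (hrow 0))
        (smul_mem_intMat (intCast_mem _ _) (hrow 1))
    -- A vanishing `z 0` would put the origin into the shifted lattice.
    have hz0' : z 0 ≠ 0 := by
      intro h0
      have := hrow 0
      rw [h0] at this
      refine hx.add_ne_zero hq hq1 j (neg_mem (neg_mem this)) ?_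
      simp
    -- The part `N` of `z 0` made of primes of `S` is a unit of `ℤ_S`; moving it into `y` turns `z`
    -- into the normalized pair `(t, a)`.
    obtain ⟨N, hN, t, ht, hNt⟩ := exists_PS_mul_NS (S := S) (z 0).natAbs (by simpa using hz0')
    have hzNt : (z 0 : ℚ) = N * t := by
      have : (z 0) = ((z 0).natAbs : ℤ) := by omega
      rw [this, hNt]; push_cast; rfl
    have hN0 : (N : ℚ) ≠ 0 := by exact_mod_cast hN.1.ne'
    -- Comparing `x j ≡ z 0 y ≡ z 0 (u 0 + u 1) x j` and using that `x j` has exact order `q`, the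
    -- integer `z 0` is invertible modulo `q`.
    obtain ⟨b, hb⟩ := hx.order j (1 - z 0 * (u 0 + u 1 : ℤ)) (by
      have e : ((1 - z 0 * (u 0 + u 1 : ℤ) : ZS S) : ℚ) • x j =
          (z 0 : ℚ) • (y - ((u 0 + u 1 : ℤ) : ℚ) • x j) - ((z 0 : ℚ) • y - x j) := by
        refine Matrix.ext fun k l => ?_
        simp only [Matrix.sub_apply, Matrix.smul_apply, smul_eq_mul]
        push_cast
        ring
      rw [e]
      exact sub_mem (smul_mem_intMat (intCast_mem _ _) hyx) (hrow 0))
    have hb' : 1 - (N * t : ℚ) * (u 0 + u 1) = q * b := by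
      have := congrArg Subtype.val hb
      push_cast at this
      rw [hzNt] at this
      exact this
    have htq : Nat.gcd t q = 1 := by
      by_contra hg
      have hgN : Nat.gcd t q ∈ NS S :=
        ⟨Nat.gcd_pos_of_pos_left _ ht.1, fun p hp =>
          Nat.Coprime.coprime_dvd_left (Nat.gcd_dvd_left _ _) (ht.2 p hp)⟩
      obtain ⟨r, hr⟩ := Nat.gcd_dvd_left t q
      obtain ⟨r', hr'⟩ := Nat.gcd_dvd_right t q
      refine not_natCast_mul_eq_one hgN hg (N * r * (u 0 + u 1) + r' * b) (Subtype.ext ?_)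
      have hr2 : (t : ℚ) = (Nat.gcd t q : ℕ) * r := by exact_mod_cast hr
      have hr3 : (q : ℚ) = (Nat.gcd t q : ℕ) * r' := by exact_mod_cast hr'
      push_cast
      linear_combination hb' + (N * (u 0 + u 1) : ℚ) * hr2 + (b : ℚ) * hr3
    let a : ZS S := ⟨(N : ℚ)⁻¹ * z 1, mul_mem (inv_mem_ZS hN) (intCast_mem _ _)⟩
    -- The difference `(z 1 - z 0) y` is integral, and `x j` is a multiple of `y` modulo integral
    -- vectors; the order of `x j` then yields `a ≡ t` modulo `q`.
    obtain ⟨b₂, hb₂⟩ := hx.order j (a - t) (by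
      have e : ((a - t : ZS S) : ℚ) • x j = (N : ℚ)⁻¹ • (((z 1 : ℚ) - z 0) •
          (z 0 : ℚ) • (((u 0 + u 1 : ℤ) : ℚ) • x j - y) + (z 0 : ℚ) • (((z 1 : ℚ) • y - x j) -
            ((z 0 : ℚ) • y - x j))) + (a - t : ℚ) • (b : ℚ) • (q : ℚ) • x j := by
        refine Matrix.ext fun k l => ?_
        simp only [Matrix.sub_apply, Matrix.add_apply, Matrix.smul_apply, smul_eq_mul, a]
        push_cast
        rw [hzNt]
        have := congrArg (fun r => r * x j k l) hb'
        field_simp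
        field_simp at this
        linear_combination ((z 1 : ℚ) - N * t) * this
      rw [e]
      refine add_mem (smul_mem_intMat (inv_mem_ZS hN) (add_mem ?_ ?_)) ?_
      · exact smul_mem_intMat (sub_mem (intCast_mem _ _) (intCast_mem _ _))
          (smul_mem_intMat (intCast_mem _ _) (by rw [← neg_sub]; exact neg_mem hyx))
      · exact smul_mem_intMat (intCast_mem _ _) (sub_mem (hrow 1) (hrow 0))
      · exact smul_mem_intMat (sub_mem a.2 (natCast_mem _ _))
          (smul_mem_intMat b.2 (hx.smul_mem j)))
    have hcop : CoprimeS S t ![a] := by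
      refine ⟨N, hN, ![z 1], fun i => ?_, ?_⟩
      · fin_cases i
        simp [a, hN0]
      · have : IsCoprime (t : ℤ) (z 1) := ⟨u 0 * N, u 1, by
          have h0 : z 0 = N * t := by exact_mod_cast hzNt
          rw [← huz, h0]; ring⟩
        have := Int.isCoprime_iff_gcd_eq_one.1 this
        simpa [Int.gcd] using this
    let τ : PairIndex S q := ⟨⟨t, ht, htq⟩, ⟨a, ⟨b₂, by rw [← hb₂]; ring⟩, hcop⟩⟩
    have htτ : (t : ℚ) * t' τ.1 = 1 + q * m τ.1 := htt τ.1
    -- By `hb'` the number `N (u 0 + u 1)` is an inverse of `t` modulo `q`, as is `t'`; hence `N y`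
    -- is congruent to `t' x j`.
    refine ⟨τ, (N : ℚ) • y - (t' τ.1 : ℚ) • x j, ?_, ?_⟩
    · have e : (N : ℚ) • y - (t' τ.1 : ℚ) • x j =
          (N : ℚ) • (y - ((u 0 + u 1 : ℤ) : ℚ) • x j) -
            ((t' τ.1 : ℚ) * b + (N * (u 0 + u 1) : ℚ) * m τ.1) • (q : ℚ) • x j := by
        refine Matrix.ext fun k l => ?_
        simp only [Matrix.sub_apply, Matrix.smul_apply, smul_eq_mul]
        push_cast
        linear_combination (-(t' τ.1 : ℚ) * x j k l) * hb' -
          ((N * (u 0 + u 1) : ℚ) * x j k l) * htτ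
      rw [e]
      refine sub_mem (smul_mem_intMat (natCast_mem _ _) hyx) (smul_mem_intMat ?_ (hx.smul_mem j))
      exact add_mem (mul_mem (intCast_mem _ _) b.2) (mul_mem (mul_mem (natCast_mem _ _)
        (add_mem (intCast_mem _ _) (intCast_mem _ _))) (intCast_mem _ _))
    · rw [add_sub_cancel]
      conv_lhs => rw [hMy]
      refine Matrix.ext fun k l => ?_
      rw [colMat_mul_apply, colMat_mul_apply, Matrix.smul_apply, smul_eq_mul]
      fin_cases k
      · simp [pairVec, τ, hzNt]; ring
      · simp [pairVec, τ, a]; field_simp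
  · rintro ⟨τ, Y, hY, rfl⟩
    have ht0 : pairVec τ 0 ≠ 0 := by
      have := τ.1.2.1.1.ne'
      simpa [pairVec] using this
    refine ⟨fun i k => ?_, not_rowsIndep_colMat_mul ht0 _⟩
    have htτ := htt τ.1
    obtain ⟨b, hb⟩ := τ.2.2.1
    have hb' : ((τ.2 : ZS S) : ℚ) = q * b + ((τ.1 : ℕ) : ℚ) := by
      have := congrArg Subtype.val hb
      push_cast at this
      exact this
    have hqx : (q : ℚ) * x j () k ∈ ZS S := hx.smul_mem j () k
    have hYk : Y () k ∈ ZS S := hY () k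
    have hτ2 := (τ.2 : ZS S).2
    rw [Matrix.sub_apply, colMat_mul_apply, colMat_mul_apply, Matrix.add_apply, Matrix.smul_apply,
      smul_eq_mul]
    fin_cases i
    · have e : pairVec τ 0 * ((t' τ.1 : ℚ) * x j () k + Y () k) - 1 * x j () k =
          m τ.1 * (q * x j () k) + ((τ.1 : ℕ) : ℚ) * Y () k := by
        simp only [pairVec, Matrix.cons_val_zero]
        linear_combination (x j () k) * htτ
      simp only [Fin.zero_eta, Matrix.cons_val_zero, e]
      exact add_mem (mul_mem (intCast_mem _ _) hqx) (mul_mem (natCast_mem _ _) hYk)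
    · have e : pairVec τ 1 * ((t' τ.1 : ℚ) * x j () k + Y () k) - 1 * x j () k =
          (m τ.1 + b * t' τ.1) * (q * x j () k) + ((τ.2 : ZS S) : ℚ) * Y () k := by
        simp only [pairVec, Matrix.cons_val_one, Matrix.cons_val_fin_one]
        linear_combination (x j () k) * htτ + ((t' τ.1 : ℚ) * x j () k) * hb'
      simp only [Fin.mk_one, Matrix.cons_val_one, Matrix.cons_val_fin_one, e]
      exact add_mem (mul_mem (add_mem (intCast_mem _ _) (mul_mem b.2 (intCast_mem _ _))) hqx)
        (mul_mem hτ2 hYk)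

/-- Scaling by the denominator of `a`, an element of `ℙ_S`, preserves the measure and replaces `(t,
a)` by an integer pair. -/
lemma lintegral_colMat_pairVec {q : ℕ} (τ : PairIndex S q) {Φ : Matrix (Fin 2) n (QS S) → ℝ≥0∞}
    (hΦ : Measurable Φ) :
    ∫⁻ y : Matrix Unit n (QS S), Φ (ratMat S (colMat (pairVec τ)) * y) =
      ∫⁻ y : Matrix Unit n (QS S), Φ (ratMat S (colMat
        ![(((τ.2 : ZS S) : ℚ).den * (τ.1 : ℕ) : ℚ), ((τ.2 : ZS S) : ℚ).num]) * y) := by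
  have hN := den_mem_PS (τ.2 : ZS S)
  have hN0 : ((((τ.2 : ZS S) : ℚ).den : ℕ) : ℚ) ≠ 0 := by exact_mod_cast hN.1.ne'
  have h1 := lintegral_inv_smul (κ := Unit) (n := n) hN (hΦ.comp (measurable_colMat_mul
    ![(((τ.2 : ZS S) : ℚ).den * (τ.1 : ℕ) : ℚ), ((τ.2 : ZS S) : ℚ).num]))
  simp only [Function.comp_def] at h1
  rw [← h1]
  refine lintegral_congr fun y => congrArg Φ (Matrix.ext fun i j => ?_)
  rw [ratMat_colMat_mul_apply, ratMat_colMat_mul_apply, Matrix.smul_apply, smul_eq_mul,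
    ← mul_assoc, ← map_mul]
  congr 2
  fin_cases i
  · simp only [pairVec, Fin.zero_eta, Matrix.cons_val_zero]
    field_simp
  · simp only [pairVec, Fin.mk_one, Matrix.cons_val_one, Matrix.cons_val_fin_one]
    rw [← div_eq_mul_inv, Rat.num_div_den]

/-- The primitive integral multiple of `(t, a)`. -/
def pairCop {q : ℕ} (τ : PairIndex S q) : CopPair :=
  ⟨![((τ.2 : ZS S) : ℚ).den * (τ.1 : ℕ), ((τ.2 : ZS S) : ℚ).num], by
    obtain ⟨c, hc, k, hk, hg⟩ := τ.2.2.2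
    have hk0 : (k 0 : ℚ) = c * ((τ.2 : ZS S) : ℚ) := by simpa using hk 0
    set a : ℚ := ((τ.2 : ZS S) : ℚ) with ha
    have hcop : IsCoprime (a.den : ℤ) a.num :=
      by
      rw [Int.isCoprime_iff_gcd_eq_one, Int.gcd_comm]
      exact a.reduced
    have hkN : k 0 * a.den = c * a.num := by
      have : (k 0 : ℚ) * a.den = c * a.num := by rw [hk0, mul_assoc, Rat.mul_den_eq_num]
      exact_mod_cast this
    have hdvd : (a.den : ℤ) ∣ c := hcop.dvd_of_dvd_mul_right ⟨k 0, by rw [← hkN, mul_comm]⟩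
    obtain ⟨r, hr⟩ := hdvd
    have hk1 : k 0 = r * a.num := by
      have h0 : (a.den : ℤ) ≠ 0 := by exact_mod_cast a.den_ne_zero
      refine mul_right_cancel₀ h0 ?_
      rw [hkN, hr]; ring
    have ht : IsCoprime (((τ.1 : ℕ)) : ℤ) (k 0) := by
      rw [Int.isCoprime_iff_gcd_eq_one]
      simpa [Int.gcd] using hg
    rw [hk1] at ht
    exact hcop.mul_left ht.of_mul_right_right⟩

/-- The integer pair is proportional to `(t, a)`, and distinct index pairs are never proportional.
-/
lemma pairCop_injective {q : ℕ} : Function.Injective (pairCop : PairIndex S q → CopPair) := by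
  intro τ τ' hτ
  have h0 : ((((τ.2 : ZS S) : ℚ).den * (τ.1 : ℕ) : ℤ)) = ((τ'.2 : ZS S) : ℚ).den * (τ'.1 : ℕ) :=
    congrArg (fun z : CopPair => z.1 0) hτ
  have h1 : ((τ.2 : ZS S) : ℚ).num = ((τ'.2 : ZS S) : ℚ).num :=
    congrArg (fun z : CopPair => z.1 1) hτ
  refine pairVec_eq_of_mul_eq ?_
  have h0' : (((τ.2 : ZS S) : ℚ).den : ℚ) * (τ.1 : ℕ) = ((τ'.2 : ZS S) : ℚ).den * (τ'.1 : ℕ) := by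
    exact_mod_cast h0
  have h1' : (((τ.2 : ZS S) : ℚ).num : ℚ) = ((τ'.2 : ZS S) : ℚ).num := by exact_mod_cast h1
  have hd : (((τ.2 : ZS S) : ℚ).den : ℚ) ≠ 0 := by exact_mod_cast Rat.den_ne_zero _
  have hd' : (((τ'.2 : ZS S) : ℚ).den : ℚ) ≠ 0 := by exact_mod_cast Rat.den_ne_zero _
  have e1 := Rat.mul_den_eq_num ((τ.2 : ZS S) : ℚ)
  have e2 := Rat.mul_den_eq_num ((τ'.2 : ZS S) : ℚ)
  simp only [pairVec, Matrix.cons_val_zero, Matrix.cons_val_one, Matrix.cons_val_fin_one]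
  refine mul_left_cancel₀ (mul_ne_zero hd hd') ?_
  linear_combination (((τ'.2 : ZS S) : ℚ).den * (τ'.1 : ℕ) : ℚ) * (e1 + h1') -
    (((τ'.2 : ZS S) : ℚ).num : ℚ) * h0' - (((τ.2 : ZS S) : ℚ).den * (τ.1 : ℕ) : ℚ) * e2

/-- Index pairs inject into coprime integer pairs without changing the integrals, so the sum is
bounded by the one over `CopPair`. -/
lemma tsum_lintegral_pairVec_le {q : ℕ} {R : ℝ} (hR : 0 ≤ R) :
    ∑' τ : PairIndex S q, ∫⁻ y : Matrix Unit n (QS S), (boxM S (Fin 2) n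
      (Set.Icc (-R) R)).indicator (1 : Matrix (Fin 2) n (QS S) → ℝ≥0∞)
        (ratMat S (colMat (pairVec τ)) * y) ≤ ENNReal.ofReal (2 * R) ^ Fintype.card n * copSum n := by
  rw [copSum, ← ENNReal.tsum_mul_left]
  refine le_trans (ENNReal.tsum_le_tsum fun τ => ?_)
    (ENNReal.tsum_comp_le_tsum_of_injective (f := pairCop) pairCop_injective _)
  rw [lintegral_colMat_pairVec τ (measurable_one.indicator (measurableSet_boxM measurableSet_Icc))]
  refine le_trans (le_of_eq ?_) (lintegral_colMat_le (S := S) (pairCop τ) hR)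
  have : (![(((τ.2 : ZS S) : ℚ).den * (τ.1 : ℕ) : ℚ), ((τ.2 : ZS S) : ℚ).num]) =
      fun i => (((pairCop τ).1 i : ℤ) : ℚ) := by
    funext i
    fin_cases i <;> simp [pairCop]
  rw [this]

instance countable_copPair : Countable CopPair :=
  inferInstanceAs (Countable {z : Fin 2 → ℤ // IsCoprime (z 0) (z 1)})

instance countable_pairIndex (q : ℕ) : Countable (PairIndex S q) :=
  (pairCop_injective (S := S) (q := q)).countable

end SArith
end

/-! ### Second moment: independent and dependent pairs in a family of shifted lattices. -/

open MeasureTheory Matrix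
open scoped ENNReal Pointwise

set_option linter.unusedSectionVars false

noncomputable section

namespace SArith

variable {S : Finset Prm} {ι n : Type*} [Fintype ι] [Fintype n] [DecidableEq ι] [DecidableEq n]
variable {Ω : Type*} [MeasurableSpace Ω] {P : Measure Ω} {h : Ω → Matrix n n (QS S)}

lemma ShiftFamily.injective_pair {q : ℕ} {J : Type*} {x : J → Matrix Unit n ℚ}
    (hx : ShiftFamily S q x) : Function.Injective fun z : J × intMat S (Fin 2) n =>
      colMat ![1, 1] * x z.1 + (z.2 : Matrix (Fin 2) n ℚ) := by
  rintro ⟨j, X⟩ ⟨j', X'⟩ hz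
  have hz' : colMat ![1, 1] * x j + (X : Matrix (Fin 2) n ℚ) =
    colMat ![1, 1] * x j' + (X' : Matrix (Fin 2) n ℚ) := hz
  have hj : j = j' := hx.inj j j' fun i k => by
    have h1 := congrFun (congrFun hz' 0) k
    rw [Matrix.add_apply, Matrix.add_apply, colMat_mul_apply, colMat_mul_apply] at h1
    simp only [Matrix.cons_val_zero, one_mul] at h1
    have : (x j - x j') i k = X'.1 0 k - X.1 0 k := by
      rw [Matrix.sub_apply, sub_eq_sub_iff_add_eq_add, h1, add_comm]
    rw [this]
    exact sub_mem (X'.2 0 k) (X.2 0 k)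
  subst hj
  exact Prod.ext rfl (Subtype.ext (add_left_cancel hz'))

/-- The direction of the pair determines `(t, a)`, since `y` is not zero; then `y` itself is
determined, and its class determines `j`. So no dependent pair is counted twice. -/
lemma ShiftFamily.injective_dependent {q : ℕ} (hq : q ∈ NS S) (hq1 : q ≠ 1) {J : Type*}
    {x : J → Matrix Unit n ℚ} (hx : ShiftFamily S q x) {t' m : indexT S q → ℤ}
    (htt : ∀ t : indexT S q, ((t : ℕ) : ℚ) * t' t = 1 + q * m t) :
    Function.Injective fun z : PairIndex S q × J × intMat S Unit n =>
      colMat (pairVec z.1) * ((t' z.1.1 : ℚ) • x z.2.1 + (z.2.2 : Matrix Unit n ℚ)) := by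
  rintro ⟨τ, j, Y⟩ ⟨τ₂, j₂, Y₂⟩ hz
  set y := (t' τ.1 : ℚ) • x j + (Y : Matrix Unit n ℚ) with hy
  set y₂ := (t' τ₂.1 : ℚ) • x j₂ + (Y₂ : Matrix Unit n ℚ) with hy₂
  have hz' : colMat (pairVec τ) * y = colMat (pairVec τ₂) * y₂ := hz
  have hc : ∀ i k, pairVec τ i * y () k = pairVec τ₂ i * y₂ () k := fun i k => by
    rw [← colMat_mul_apply, hz', colMat_mul_apply]
  have hy0 : y ≠ 0 := (hx.smul (htt τ.1)).add_ne_zero hq hq1 j Y.2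
  obtain ⟨k, hk⟩ : ∃ k, y () k ≠ 0 := by
    by_contra! h0
    exact hy0 (Matrix.ext fun i k => h0 k)
  have hτ : τ = τ₂ := pairVec_eq_of_mul_eq (by
    refine mul_right_cancel₀ hk ?_
    linear_combination (pairVec τ₂ 0) * hc 1 k - (pairVec τ₂ 1) * hc 0 k)
  subst hτ
  have ht0 : pairVec τ 0 ≠ 0 := by
    have := τ.1.2.1.1.ne'
    simpa [pairVec] using this
  have hyy : y = y₂ := Matrix.ext fun i k => mul_left_cancel₀ ht0 (hc 0 k)
  have hj : j = j₂ := (hx.smul (htt τ.1)).inj j j₂ (by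
    have : (t' τ.1 : ℚ) • x j - (t' τ.1 : ℚ) • x j₂ = (Y₂ : Matrix Unit n ℚ) - Y := by
      rw [sub_eq_sub_iff_add_eq_add, ← hy, hyy, hy₂, add_comm]
    rw [this]
    exact sub_mem Y₂.2 Y.2)
  subst hj
  have : (Y : Matrix Unit n ℚ) = Y₂ := add_left_cancel (hy.symm.trans (hyy.trans hy₂))
  rw [Subtype.ext this]

lemma colMat_one_mul_mem {x : Matrix Unit n ℚ} (hx : x ∈ intMat S Unit n) :
    colMat ![1, 1] * x ∈ intMat S (Fin 2) n := fun i k => by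
  rw [colMat_mul_apply]
  fin_cases i <;> simpa using hx () k

/-- The second moment of a family of shifted lattices. -/
theorem ShiftFamily.second_moment [IsProbabilityMeasure P] (hm : Measurable h)
    (hdet : ∀ ω, (h ω).det.1 = 1 ∧ ∀ p, ‖(h ω).det.2 p‖ = 1)
    {ι' : Type*} [Fintype ι'] [DecidableEq ι'] {e₁ : Unit ⊕ ι' ≃ n} (i₁ : ι')
    (hP₁ : MeanValue P h e₁) {e₂ : Fin 2 ⊕ ι ≃ n} (i₂ : ι) (hP₂ : MeanValue P h e₂)
    {q : ℕ} (hq : q ∈ NS S) (hq1 : q ≠ 1) {J : Type*} [Fintype J]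
    {x : J → Matrix Unit n ℚ} (hx : ShiftFamily S q x) {Φ : Matrix (Fin 2) n (QS S) → ℝ≥0∞}
    (hΦ : Measurable Φ) :
    ∫⁻ ω, ∑ j, ∑' X : intMat S (Fin 2) n,
        Φ (ratMat S (colMat ![1, 1] * x j + (X : Matrix (Fin 2) n ℚ)) * h ω) ∂P =
      Fintype.card J * ((∫⁻ X, Φ X) +
        ∑' τ : PairIndex S q, ∫⁻ y : Matrix Unit n (QS S), Φ (ratMat S (colMat (pairVec τ)) * y)) := by
  have hcard : 3 ≤ Fintype.card n := by
    rw [← Fintype.card_congr e₂, Fintype.card_sum, Fintype.card_fin]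
    have := Fintype.card_pos_iff.2 ⟨i₂⟩
    omega
  have hq0 : (q : ℚ) ≠ 0 := by exact_mod_cast hq.1.ne'
  choose t' m htt using fun t : indexT S q => exists_inverse_mod t.2.2
  let L : Set (Matrix (Fin 2) n ℚ) := Set.range fun z : J × intMat S (Fin 2) n =>
    colMat ![1, 1] * x z.1 + (z.2 : Matrix (Fin 2) n ℚ)
  let L₁ : Set (Matrix (Fin 2) n ℚ) := L ∩ {M | RowsIndep M}
  let ψ : PairIndex S q × J × intMat S Unit n → Matrix (Fin 2) n ℚ := fun z =>
    colMat (pairVec z.1) * ((t' z.1.1 : ℚ) • x z.2.1 + (z.2.2 : Matrix Unit n ℚ))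
  have hψ : Function.Injective ψ := hx.injective_dependent hq hq1 htt
  have hmemL : ∀ M, M ∈ L ↔ ∃ j, M - colMat ![1, 1] * x j ∈ intMat S (Fin 2) n := by
    intro M
    constructor
    · rintro ⟨⟨j, X⟩, rfl⟩
      exact ⟨j, by simp⟩
    · rintro ⟨j, hj⟩
      exact ⟨(j, ⟨_, hj⟩), by simp⟩
  have hL₂ : L ∩ {M | ¬ RowsIndep M} = Set.range ψ := by
    ext M
    constructor
    · rintro ⟨h1, h2⟩
      obtain ⟨j, hj⟩ := (hmemL M).1 h1
      obtain ⟨τ, Y, hY, hM⟩ := (hx.dependent_iff hq hq1 htt j M).1 ⟨hj, h2⟩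
      exact ⟨(τ, j, ⟨Y, hY⟩), hM.symm⟩
    · rintro ⟨⟨τ, j, Y⟩, rfl⟩
      have := (hx.dependent_iff hq hq1 htt j _).2 ⟨τ, Y, Y.2, rfl⟩
      exact ⟨(hmemL _).2 ⟨j, this.1⟩, this.2⟩
  have hLun : L = L₁ ∪ Set.range ψ := by
    rw [← hL₂, ← Set.inter_union_distrib_left]
    ext M
    by_cases hI : RowsIndep M <;> simp [hI]
  have hdisj : Disjoint L₁ (Set.range ψ) := by
    rw [← hL₂, Set.disjoint_left]
    exact fun M h1 h2 => h2.2 h1.2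
  have hsum : ∀ F : Matrix (Fin 2) n ℚ → ℝ≥0∞,
      ∑ j, ∑' X : intMat S (Fin 2) n, F (colMat ![1, 1] * x j + (X : Matrix (Fin 2) n ℚ)) =
      ∑' M : L₁, F M + ∑' τ : PairIndex S q, ∑ j, ∑' Y : intMat S Unit n,
        F (colMat (pairVec τ) * ((t' τ.1 : ℚ) • x j + (Y : Matrix Unit n ℚ))) := by
    intro F
    have e1 : ∑' M : L, F M = ∑ j, ∑' X : intMat S (Fin 2) n,
        F (colMat ![1, 1] * x j + (X : Matrix (Fin 2) n ℚ)) := by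
      rw [← (Equiv.ofInjective _ hx.injective_pair).tsum_eq]
      exact (ENNReal.tsum_prod (f := fun j (X : intMat S (Fin 2) n) =>
        F (colMat ![1, 1] * x j + (X : Matrix (Fin 2) n ℚ)))).trans (tsum_fintype _)
    have e2 : ∑' M : Set.range ψ, F M = ∑' τ : PairIndex S q, ∑ j, ∑' Y : intMat S Unit n,
        F (colMat (pairVec τ) * ((t' τ.1 : ℚ) • x j + (Y : Matrix Unit n ℚ))) := by
      rw [← (Equiv.ofInjective _ hψ).tsum_eq]
      refine (ENNReal.tsum_prod (f := fun τ (z : J × intMat S Unit n) =>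
        F (colMat (pairVec τ) * ((t' τ.1 : ℚ) • x z.1 + (z.2 : Matrix Unit n ℚ))))).trans ?_
      refine tsum_congr fun τ => ?_
      exact (ENNReal.tsum_prod (f := fun j (Y : intMat S Unit n) =>
        F (colMat (pairVec τ) * ((t' τ.1 : ℚ) • x j + (Y : Matrix Unit n ℚ))))).trans
          (tsum_fintype _)
    rw [← e1, ← e2, hLun]
    exact ENNReal.summable.tsum_union_disjoint hdisj ENNReal.summable
  -- Both rows carry the same shift, so the group permutes the classes of pairs, and it preserves
  -- independence. Multiplied by `q` a pair becomes integral, and Hermite reduction exhibits it as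
  -- an invertible matrix times a primitive pair.
  obtain ⟨C, hC⟩ := exists_const_of_invariant hm hP₂ L₁ (by
      rintro M ⟨hM, hI⟩ γ
      refine ⟨?_, hI.mul_toQ γ⟩
      obtain ⟨j, hj⟩ := (hmemL M).1 hM
      obtain ⟨j', hj'⟩ := hx.inv j γ
      refine (hmemL _).2 ⟨j', ?_⟩
      have : M * toQ γ - colMat ![1, 1] * x j' = (M - colMat ![1, 1] * x j) * toQ γ +
          colMat ![1, 1] * (x j * toQ γ - x j') := by
        rw [Matrix.sub_mul, Matrix.mul_sub, Matrix.mul_assoc]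
        abel
      rw [this]
      exact add_mem (mul_mem_intMat hj (toQ_mem γ)) (colMat_one_mul_mem hj')) (by
      rintro M ⟨hM, hI⟩
      obtain ⟨j, hj⟩ := (hmemL M).1 hM
      have hqM : (q : ℚ) • M ∈ intMat S (Fin 2) n := by
        have : (q : ℚ) • M = (q : ℚ) • (M - colMat ![1, 1] * x j) +
            colMat ![1, 1] * ((q : ℚ) • x j) := by
          rw [Matrix.mul_smul, smul_sub, sub_add_cancel]
        rw [this]
        exact add_mem (smul_mem_intMat (natCast_mem _ _) hj) (colMat_one_mul_mem (hx.smul_mem j))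
      have hqI : RowsIndep ((q : ℚ) • M) := fun c hc => hI c (by
        rw [Matrix.mul_smul] at hc
        exact (smul_eq_zero.1 hc).resolve_left hq0)
      obtain ⟨a, ha, c, hc, b, hb, Y, hY, hMY⟩ := exists_prim_pair e₂ i₂ hqM hqI
      refine ⟨(q : ℚ)⁻¹ • lowerMat a b c, ?_, Y, hY, ?_⟩
      · rw [Matrix.det_smul, det_lowerMat]
        refine mul_ne_zero (pow_ne_zero _ (inv_ne_zero hq0)) ?_
        exact_mod_cast (mul_pos ha.1 hc.1).ne'
      · rw [Matrix.smul_mul, ← hMY, smul_smul, inv_mul_cancel₀ hq0, one_smul])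
  have hmain : ∀ Φ : Matrix (Fin 2) n (QS S) → ℝ≥0∞, Measurable Φ →
      ∫⁻ ω, ∑ j, ∑' X : intMat S (Fin 2) n,
        Φ (ratMat S (colMat ![1, 1] * x j + (X : Matrix (Fin 2) n ℚ)) * h ω) ∂P =
      C * (∫⁻ X, Φ X) + Fintype.card J *
        ∑' τ : PairIndex S q, ∫⁻ y : Matrix Unit n (QS S),
          Φ (ratMat S (colMat (pairVec τ)) * y) := by
    intro Φ hΦ
    have hΦm : ∀ M : Matrix (Fin 2) n ℚ, Measurable fun ω => Φ (ratMat S M * h ω) := fun M =>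
      hΦ.comp (measurable_mul_apply hm _)
    rw [lintegral_congr fun ω => hsum fun M => Φ (ratMat S M * h ω),
      lintegral_add_left (Measurable.tsum fun M : L₁ => hΦm M), hC Φ hΦ,
      lintegral_tsum fun τ => (Finset.measurable_fun_sum _ fun j _ =>
        Measurable.tsum fun Y => hΦm _).aemeasurable, ← ENNReal.tsum_mul_left]
    congr 1
    refine tsum_congr fun τ => ?_
    -- For fixed `(t, a)` the dependent pairs run through the family of lattices shifted by `t' x
    -- j`, to which the first moment applies.
    have := (hx.smul (htt τ.1)).first_moment hm hdet i₁ hP₁ hq hq1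
      (Φ := fun y => Φ (ratMat S (colMat (pairVec τ)) * y)) (hΦ.comp (measurable_colMat_mul _))
    rw [← this]
    simp only [ratMat_mul_mul]
  have hlim := tendsto_lintegral_latCount hm hdet (fun j => colMat ![1, 1] * x j)
    (lintegral_latCount_pair_ne_top hm i₁ hP₁ i₂ hP₂)
  have hCJ : C = Fintype.card J := by
    have hD : Fintype.card n * Fintype.card (Fin 2) = Fintype.card n + Fintype.card n := by
      rw [Fintype.card_fin, mul_two]
    let E : ℕ → ℝ≥0∞ := fun N => ((2 * N : ℝ≥0∞) ^ (Fintype.card n * Fintype.card (Fin 2)))⁻¹ *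
      (Fintype.card J * ∑' τ : PairIndex S q, ∫⁻ y : Matrix Unit n (QS S),
        (boxM S (Fin 2) n (Set.Ico (-(N : ℝ)) N)).indicator
          (1 : Matrix (Fin 2) n (QS S) → ℝ≥0∞) (ratMat S (colMat (pairVec τ)) * y))
    have e2 : ∀ N : ℕ, ENNReal.ofReal (2 * (N : ℝ)) = 2 * N := fun N => by
      rw [ENNReal.ofReal_mul zero_le_two]; simp
    have hpow0 : ∀ N : ℕ, 0 < N → ∀ k, (2 * N : ℝ≥0∞) ^ k ≠ 0 := fun N hN k =>
      pow_ne_zero _ (mul_ne_zero two_ne_zero (by exact_mod_cast hN.ne'))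
    have hpowt : ∀ (N : ℕ) k, (2 * N : ℝ≥0∞) ^ k ≠ ∞ := fun N k =>
      ENNReal.pow_ne_top (ENNReal.mul_ne_top (by simp) (ENNReal.natCast_ne_top N))
    -- The dependent pairs contribute at most a constant times `(2N)ⁿ`, negligible against the
    -- normalization `(2N)²ⁿ`; only `C` survives in the limit.
    have hE : Filter.Tendsto E Filter.atTop (nhds 0) := by
      have hle : ∀ᶠ N : ℕ in Filter.atTop, E N ≤ (Fintype.card J * copSum n) * (N : ℝ≥0∞)⁻¹ := by
        filter_upwards [Filter.eventually_gt_atTop 0] with N hN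
        have hb : ∑' τ : PairIndex S q, ∫⁻ y : Matrix Unit n (QS S),
            (boxM S (Fin 2) n (Set.Ico (-(N : ℝ)) N)).indicator
              (1 : Matrix (Fin 2) n (QS S) → ℝ≥0∞) (ratMat S (colMat (pairVec τ)) * y) ≤
            (2 * N : ℝ≥0∞) ^ Fintype.card n * copSum n := by
          rw [← e2]
          refine le_trans (ENNReal.tsum_le_tsum fun τ => lintegral_mono fun y => ?_)
            (tsum_lintegral_pairVec_le (Nat.cast_nonneg N))
          exact Set.indicator_le_indicator_of_subset (fun A hA i j =>
            ⟨Set.Ico_subset_Icc_self (hA i j).1, (hA i j).2⟩) (fun _ => zero_le) _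
        calc E N ≤ ((2 * N : ℝ≥0∞) ^ (Fintype.card n + Fintype.card n))⁻¹ *
              (Fintype.card J * ((2 * N : ℝ≥0∞) ^ Fintype.card n * copSum n)) := by
              simp only [E, hD]
              gcongr
          _ = ((2 * N : ℝ≥0∞) ^ Fintype.card n)⁻¹ * ((2 * N : ℝ≥0∞) ^ Fintype.card n)⁻¹ *
              (2 * N : ℝ≥0∞) ^ Fintype.card n * (Fintype.card J * copSum n) := by
              rw [pow_add, ENNReal.mul_inv (Or.inl (hpow0 N hN _)) (Or.inl (hpowt N _))]
              ring
          _ = (Fintype.card J * copSum n) * ((2 * N : ℝ≥0∞) ^ Fintype.card n)⁻¹ := by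
              rw [mul_assoc (_)⁻¹, ENNReal.inv_mul_cancel (hpow0 N hN _) (hpowt N _), mul_one,
                mul_comm]
          _ ≤ _ := by
              gcongr
              have h1N : (1 : ℝ≥0∞) ≤ 2 * N := by
                have : 1 ≤ 2 * N := by omega
                exact_mod_cast this
              calc (N : ℝ≥0∞) ≤ 2 * N := by
                    have : N ≤ 2 * N := by omega
                    exact_mod_cast this
                _ ≤ (2 * N : ℝ≥0∞) ^ Fintype.card n := le_self_pow h1N (by omega)
      refine tendsto_of_tendsto_of_tendsto_of_le_of_le' tendsto_const_nhds ?_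
        (Filter.Eventually.of_forall fun _ => zero_le) hle
      have := ENNReal.Tendsto.const_mul (a := Fintype.card J * copSum n)
        ENNReal.tendsto_inv_nat_nhds_zero (Or.inr (ENNReal.mul_ne_top (ENNReal.natCast_ne_top _)
          (copSum_ne_top hcard)))
      simpa using this
    have hlim2 : Filter.Tendsto (fun N => C + E N) Filter.atTop (nhds (C + 0)) :=
      tendsto_const_nhds.add hE
    rw [add_zero] at hlim2
    refine tendsto_nhds_unique hlim2 (hlim.congr' ?_)
    filter_upwards [Filter.eventually_gt_atTop 0] with N hN
    have hBm : MeasurableSet (boxM S (Fin 2) n (Set.Ico (-(N : ℝ)) N)) :=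
      measurableSet_boxM measurableSet_Ico
    have h1 := hmain _ (measurable_one.indicator hBm)
    rw [lintegral_indicator_one hBm, volume_boxM, Real.volume_Ico,
      show (N : ℝ) - -N = 2 * N by ring, e2] at h1
    simp only [latCount, E]
    rw [h1, mul_add]
    congr 1
    rw [mul_left_comm, ENNReal.inv_mul_cancel (hpow0 N hN _) (hpowt N _), mul_one]
  rw [hmain Φ hΦ, hCJ, mul_add]

end SArith
end

open MeasureTheory Matrix
open scoped ENNReal Pointwise

set_option linter.unusedSectionVars false

noncomputable section

namespace SArith

/-! ### Mean values of signed functions -/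

section Signed

variable {Ω V I : Type*} [MeasurableSpace Ω] [MeasurableSpace V]

lemma tsum_enorm_ne_top_iff (u : I → ℝ) : ∑' i, ‖u i‖ₑ ≠ ∞ ↔ Summable u := by
  rw [← summable_norm_iff]
  exact ENNReal.tsum_coe_ne_top_iff_summable_coe

lemma tsum_eq_toReal_sub {u : I → ℝ} (hu : Summable u) :
    ∑' i, u i = (∑' i, ENNReal.ofReal (u i)).toReal - (∑' i, ENNReal.ofReal (-u i)).toReal := by
  have key : ∀ v : I → ℝ, Summable v →
      (∑' i, ENNReal.ofReal (v i)).toReal = ∑' i, max (v i) 0 := by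
    intro v hv
    rw [ENNReal.tsum_toReal_eq fun i => ENNReal.ofReal_ne_top]
    exact tsum_congr fun i => ENNReal.toReal_ofReal'
  have hp : ∀ v : I → ℝ, Summable v → Summable fun i => max (v i) 0 := fun v hv =>
    Summable.of_nonneg_of_le (fun i => le_max_right _ _)
      (fun i => max_le (le_abs_self _) (abs_nonneg _)) hv.abs
  rw [key u hu, key _ hu.neg, ← (hp u hu).tsum_sub (hp _ hu.neg)]
  refine tsum_congr fun i => ?_
  rcases le_total 0 (u i) with h | h
  · rw [max_eq_left h, max_eq_right (by linarith)]; ring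
  · rw [max_eq_right h, max_eq_left (by linarith)]; ring

variable [Countable I]

/-- Where the series is not summable its value is zero by convention, so the function is a
difference of sums of positive and negative parts, cut off to the measurable set of absolute
convergence. -/
lemma measurable_tsum_real {F : I → Ω → ℝ} (hF : ∀ i, Measurable (F i)) :
    Measurable fun ω => ∑' i, F i ω := by
  classical
  have hs : MeasurableSet {ω | ∑' i, ‖F i ω‖ₑ ≠ ∞} :=
    (measurableSet_eq_fun (Measurable.tsum fun i => (hF i).enorm) measurable_const).compl
  have e : (fun ω => ∑' i, F i ω) = {ω | ∑' i, ‖F i ω‖ₑ ≠ ∞}.indicator fun ω =>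
      (∑' i, ENNReal.ofReal (F i ω)).toReal - (∑' i, ENNReal.ofReal (-F i ω)).toReal := by
    funext ω
    by_cases hω : ∑' i, ‖F i ω‖ₑ ≠ ∞
    · rw [Set.indicator_of_mem (show ω ∈ {ω | ∑' i, ‖F i ω‖ₑ ≠ ∞} from hω)]
      exact tsum_eq_toReal_sub ((tsum_enorm_ne_top_iff _).1 hω)
    · rw [Set.indicator_of_notMem (show ω ∉ {ω | ∑' i, ‖F i ω‖ₑ ≠ ∞} from hω)]
      exact tsum_eq_zero_of_not_summable fun h => hω ((tsum_enorm_ne_top_iff _).2 h)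
  rw [e]
  refine Measurable.indicator (Measurable.sub ?_ ?_) hs
  · exact (Measurable.tsum fun i => (hF i).ennreal_ofReal).ennreal_toReal
  · exact (Measurable.tsum fun i => (hF i).neg.ennreal_ofReal).ennreal_toReal

variable {μ : Measure Ω} {ρ : Measure V} {G : I → Ω → V}

/-- A mean value formula for nonnegative functions extends to integrable functions. -/
lemma integral_tsum_of_lintegral_tsum (hG : ∀ i, Measurable (G i))
    (hmv : ∀ Φ : V → ℝ≥0∞, Measurable Φ → ∫⁻ ω, ∑' i, Φ (G i ω) ∂μ = ∫⁻ v, Φ v ∂ρ)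
    {f : V → ℝ} (hf : Measurable f) (hfi : Integrable f ρ) :
    (∀ᵐ ω ∂μ, Summable fun i => f (G i ω)) ∧ Integrable (fun ω => ∑' i, f (G i ω)) μ ∧
      ∫ ω, ∑' i, f (G i ω) ∂μ = ∫ v, f v ∂ρ := by
  have hpos : ∀ g : V → ℝ, Measurable g → Integrable g ρ →
      ∫⁻ ω, ∑' i, ENNReal.ofReal (g (G i ω)) ∂μ ≠ ∞ := fun g hg hgi => by
    rw [hmv (fun v => ENNReal.ofReal (g v)) hg.ennreal_ofReal]
    exact (lintegral_ofReal_le_lintegral_enorm g).trans_lt hgi.2 |>.ne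
  have hmeas : ∀ g : V → ℝ, Measurable g →
      Measurable fun ω => ∑' i, ENNReal.ofReal (g (G i ω)) := fun g hg =>
    Measurable.tsum fun i => (hg.comp (hG i)).ennreal_ofReal
  have hsum : ∀ᵐ ω ∂μ, Summable fun i => f (G i ω) := by
    have h1 : ∫⁻ ω, ∑' i, ‖f (G i ω)‖ₑ ∂μ ≠ ∞ := by
      rw [hmv (fun v => ‖f v‖ₑ) hf.enorm]
      exact hfi.2.ne
    filter_upwards [ae_lt_top (Measurable.tsum fun i => (hf.comp (hG i)).enorm) h1] with ω hω
    exact (tsum_enorm_ne_top_iff _).1 hω.ne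
  have hae : (fun ω => ∑' i, f (G i ω)) =ᵐ[μ] fun ω =>
      (∑' i, ENNReal.ofReal (f (G i ω))).toReal - (∑' i, ENNReal.ofReal (-f (G i ω))).toReal := by
    filter_upwards [hsum] with ω hω using tsum_eq_toReal_sub hω
  have hi1 := integrable_toReal_of_lintegral_ne_top (hmeas f hf).aemeasurable (hpos f hf hfi)
  have hi2 := integrable_toReal_of_lintegral_ne_top (hmeas _ hf.neg).aemeasurable
    (hpos _ hf.neg hfi.neg)
  refine ⟨hsum, (hi1.sub hi2).congr hae.symm, ?_⟩
  rw [integral_congr_ae hae]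
  refine (integral_sub hi1 hi2).trans ?_
  rw [integral_toReal (hmeas f hf).aemeasurable (ae_lt_top (hmeas f hf) (hpos f hf hfi)),
    integral_toReal (hmeas _ hf.neg).aemeasurable (ae_lt_top (hmeas _ hf.neg)
      (hpos _ hf.neg hfi.neg)), hmv (fun v => ENNReal.ofReal (f v)) hf.ennreal_ofReal,
    hmv (fun v => ENNReal.ofReal ((-f) v)) hf.neg.ennreal_ofReal,
    integral_eq_lintegral_pos_part_sub_lintegral_neg_part hfi]
  rfl

end Signed

end SArith
end

open MeasureTheory Matrix
open scoped ENNReal Pointwise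

set_option linter.unusedSectionVars false

noncomputable section

namespace SArith

/-! ### The space of shifted lattices -/

variable {S : Finset Prm} {d : ℕ}

/-- The row vector `p/q`. -/
def shiftMat (q : ℕ) (p : Fin d → ZS S) : Matrix Unit (Fin d) ℚ :=
  Matrix.of fun _ i => (p i : ℚ) / q

lemma mem_shiftedLattice {q : ℕ} {p : Fin d → ZS S} {v : Fin d → QS S} :
    v ∈ shiftedLattice q p ↔ ∃ X ∈ intMat S Unit (Fin d), ratMat S (shiftMat q p + X) () = v := by
  constructor
  · rintro ⟨k, rfl⟩
    refine ⟨Matrix.of fun _ i => (k i : ℚ), fun _ i => (k i).2, funext fun i => ?_⟩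
    simp only [ratMat, Matrix.map_apply, Matrix.add_apply, shiftMat, Matrix.of_apply]
    rw [add_comm]
  · rintro ⟨X, hX, rfl⟩
    refine ⟨fun i => ⟨X () i, hX () i⟩, funext fun i => ?_⟩
    simp only [ratMat, Matrix.map_apply, Matrix.add_apply, shiftMat, Matrix.of_apply]
    rw [add_comm]

lemma smul_shiftMat_mem {q : ℕ} (hq : q ∈ NS S) (p : Fin d → ZS S) :
    (q : ℚ) • shiftMat q p ∈ intMat S Unit (Fin d) := fun i j => by
  have hq0 : (q : ℚ) ≠ 0 := by exact_mod_cast hq.1.ne'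
  have : ((q : ℚ) • shiftMat q p) i j = p j := by
    simp only [shiftMat, Matrix.smul_apply, Matrix.of_apply, smul_eq_mul]
    field_simp
  rw [this]
  exact (p j).2

/-- Test `k / q` at each prime outside `S`. If the prime divides `q`, coprimality provides a
coordinate of `p` that is a unit there; if not, `q` is a unit. -/
lemma order_shiftMat {q : ℕ} (hq : q ∈ NS S) {p : Fin d → ZS S} (hqp : CoprimeS S q p) (k : ZS S)
    (hk : (k : ℚ) • shiftMat q p ∈ intMat S Unit (Fin d)) : ∃ b : ZS S, k = q * b := by
  have hq0 : (q : ℚ) ≠ 0 := by exact_mod_cast hq.1.ne'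
  refine ⟨⟨(k : ℚ) / q, fun l hl => ?_⟩, Subtype.ext ?_⟩
  · by_cases hlq : (l : ℕ) ∣ q
    · obtain ⟨c, hc, k', hk', hg⟩ := hqp
      obtain ⟨i, hi⟩ : ∃ i, ¬ (l : ℕ) ∣ (k' i).natAbs := by
        by_contra! hall
        have h1 : (l : ℕ) ∣ Nat.gcd q (Finset.univ.gcd fun i => (k' i).natAbs) :=
          Nat.dvd_gcd hlq (Finset.dvd_gcd fun i _ => hall i)
        rw [hg] at h1
        exact l.2.one_lt.ne' (Nat.dvd_one.1 h1)
      have h1 : ‖((k' i : ℚ) : ℚ_[(l : ℕ)])‖ = 1 := by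
        have := norm_natCast_eq_one hi
        rw [Rat.cast_intCast, Padic.norm_intCast_eq_one_iff]
        simpa using this
      have h2 : ‖((c : ℚ) : ℚ_[(l : ℕ)])‖ = 1 := by
        have := norm_natCast_eq_one (l := l) (k := c) fun hlc => hl (hc.2 l hlc)
        simpa using this
      have h3 : ‖((p i : ℚ) : ℚ_[(l : ℕ)])‖ = 1 := by
        rw [hk' i] at h1
        push_cast at h1 h2 ⊢
        rwa [norm_mul, h2, one_mul] at h1
      have h4 : ‖((((k : ℚ) • shiftMat q p) () i : ℚ) : ℚ_[(l : ℕ)])‖ ≤ 1 := hk () i l hl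
      have e : ((k : ℚ) • shiftMat q p) () i = (k : ℚ) / q * p i := by
        simp only [shiftMat, Matrix.smul_apply, Matrix.of_apply, smul_eq_mul]
        ring
      rw [e, Rat.cast_mul, norm_mul, h3, mul_one] at h4
      exact h4
    · have h1 : ‖((q : ℚ) : ℚ_[(l : ℕ)])‖ = 1 := by
        have := norm_natCast_eq_one (l := l) (k := q) hlq
        simpa using this
      rw [Rat.cast_div, norm_div, h1, div_one]
      exact k.2 l hl
  · push_cast
    field_simp

/-- Representatives for the classes of the orbit of a vector modulo `ℤ_S`. -/
lemma exists_shift_reps {q : ℕ} (hq : q ∈ NS S) {x₀ : Matrix Unit (Fin d) ℚ}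
    (h1 : (q : ℚ) • x₀ ∈ intMat S Unit (Fin d))
    (h2 : ∀ k : ZS S, (k : ℚ) • x₀ ∈ intMat S Unit (Fin d) → ∃ b : ZS S, k = q * b) :
    ∃ (J : Type) (_ : Fintype J) (γ : J → SLZ S (Fin d)),
      ShiftFamily S q (fun j => x₀ * toQ (γ j)) ∧
      ∀ δ : SLZ S (Fin d), ∃ j, x₀ * toQ δ - x₀ * toQ (γ j) ∈ intMat S Unit (Fin d) := by
  have hq0 : (q : ℚ) ≠ 0 := by exact_mod_cast hq.1.ne'
  let c : SLZ S (Fin d) → Matrix Unit (Fin d) ℚ ⧸ intMat S Unit (Fin d) := fun δ =>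
    QuotientAddGroup.mk (x₀ * toQ δ)
  have hmk : ∀ x y : Matrix Unit (Fin d) ℚ, (QuotientAddGroup.mk x :
      Matrix Unit (Fin d) ℚ ⧸ intMat S Unit (Fin d)) = QuotientAddGroup.mk y ↔
      x - y ∈ intMat S Unit (Fin d) := fun x y => by
    rw [QuotientAddGroup.eq, ← neg_mem_iff, neg_add_rev, neg_neg, add_comm, sub_eq_add_neg,
      add_comm]
  -- All vectors of the orbit become integral after multiplication by `q`, so each class is
  -- represented by a vector with entries `b / q`, `0 ≤ b < q`.
  have hfin : (Set.range c).Finite := by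
    refine (Set.finite_range fun b : Fin d → Fin q => (QuotientAddGroup.mk
      (Matrix.of fun (_ : Unit) i => ((b i : ℕ) : ℚ) / q) :
        Matrix Unit (Fin d) ℚ ⧸ intMat S Unit (Fin d))).subset ?_
    rintro _ ⟨δ, rfl⟩
    have hqint : (q : ℚ) • (x₀ * toQ δ) ∈ intMat S Unit (Fin d) := by
      rw [← Matrix.smul_mul]
      exact mul_mem_intMat h1 (toQ_mem δ)
    choose b hb z hz using fun i => exists_natCast_add_mul hq ⟨_, hqint () i⟩
    refine ⟨fun i => ⟨b i, hb i⟩, ((hmk _ _).2 fun _ i => ?_)⟩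
    have hz' : (q : ℚ) * (x₀ * toQ δ) () i = b i + q * z i := by
      have := congrArg Subtype.val (hz i)
      push_cast at this
      exact this
    have e : ((Matrix.of fun (_ : Unit) i => ((b i : ℕ) : ℚ) / q) - x₀ * toQ δ) () i = -(z i) := by
      rw [Matrix.sub_apply, Matrix.of_apply]
      field_simp
      linear_combination -hz'
    exact e ▸ neg_mem (z i).2
  have : Fintype (Set.range c) := hfin.fintype
  choose γ hγ using fun j : Set.range c => j.2
  have hrep : ∀ δ, ∃ j, x₀ * toQ δ - x₀ * toQ (γ j) ∈ intMat S Unit (Fin d) := fun δ =>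
    ⟨⟨c δ, δ, rfl⟩, (hmk _ _).1 (hγ ⟨c δ, δ, rfl⟩).symm⟩
  refine ⟨Set.range c, inferInstance, γ, ⟨fun j => ?_, fun j k hk => ?_, fun j j' hj => ?_,
    fun j δ => ?_⟩, hrep⟩
  · rw [← Matrix.smul_mul]
    exact mul_mem_intMat h1 (toQ_mem _)
  · refine h2 k ?_
    have := mul_mem_intMat hk (toQ_mem (γ j)⁻¹)
    rwa [← Matrix.smul_mul, Matrix.mul_assoc, ← toQ_mul, mul_inv_cancel, toQ_one,
      Matrix.mul_one] at this
  · have := (hmk _ _).2 hj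
    exact Subtype.ext ((hγ j).symm.trans (this.trans (hγ j')))
  · obtain ⟨j', hj'⟩ := hrep (γ j * δ)
    refine ⟨j', ?_⟩
    rwa [Matrix.mul_assoc, ← toQ_mul]

variable {H : Subgroup (GL (Fin d) (QS S))} {α : QS S →* QS S}

lemma vecMul_eq_mul (A : Matrix Unit (Fin d) (QS S)) (g : Matrix (Fin d) (Fin d) (QS S)) :
    A () ᵥ* g = (A * g) () := rfl

lemma mem_stab_ofSLZ_iff (hH : IsDetKernel H α) {q : ℕ} {p : Fin d → ZS S} (δ : SLZ S (Fin d)) :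
    ofSLZ hH δ ∈ stab H (shiftedLattice q p) ↔
      shiftMat q p * toQ δ - shiftMat q p ∈ intMat S Unit (Fin d) := by
  have hrow : ∀ A : Matrix Unit (Fin d) ℚ,
      ratMat S A () ᵥ* mat (ofSLZ hH δ) = ratMat S (A * toQ δ) () := fun A => by
    rw [vecMul_eq_mul, ratMat_mul, ratMat_toQ, mat_ofSLZ]
  have hinj : ∀ A B : Matrix Unit (Fin d) ℚ, ratMat S A () = ratMat S B () → A = B := fun A B h =>
    ratMat_injective (S := S) (funext fun _ => h)
  constructor
  · intro h
    have h' : translate (shiftedLattice q p) (ofSLZ hH δ) = shiftedLattice q p := h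
    have hmem : ratMat S (shiftMat q p * toQ δ) () ∈ shiftedLattice q p := by
      rw [← hrow]
      rw [← h']
      refine ⟨_, mem_shiftedLattice.2 ⟨0, zero_mem _, rfl⟩, ?_⟩
      rw [add_zero]
    obtain ⟨X, hX, hXe⟩ := mem_shiftedLattice.1 hmem
    rw [← hinj _ _ hXe, add_sub_cancel_left]
    exact hX
  · intro h
    refine Set.Subset.antisymm ?_ ?_
    · rintro _ ⟨v, hv, rfl⟩
      obtain ⟨X, hX, rfl⟩ := mem_shiftedLattice.1 hv
      refine mem_shiftedLattice.2 ⟨(shiftMat q p * toQ δ - shiftMat q p) + X * toQ δ,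
        add_mem h (mul_mem_intMat hX (toQ_mem δ)), ?_⟩
      refine Eq.trans ?_ (hrow _).symm
      rw [Matrix.add_mul, add_comm _ (X * toQ δ), ← add_assoc, add_comm (shiftMat q p),
        add_assoc, add_sub_cancel, add_comm]
    · intro v hv
      obtain ⟨X, hX, rfl⟩ := mem_shiftedLattice.1 hv
      have hinv : toQ δ⁻¹ * toQ δ = 1 := by rw [← toQ_mul, inv_mul_cancel, toQ_one]
      have hinv' : toQ δ * toQ δ⁻¹ = 1 := by rw [← toQ_mul, mul_inv_cancel, toQ_one]
      refine ⟨ratMat S ((shiftMat q p + X) * toQ δ⁻¹) (), mem_shiftedLattice.2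
        ⟨X * toQ δ⁻¹ - (shiftMat q p * toQ δ - shiftMat q p) * toQ δ⁻¹,
          sub_mem (mul_mem_intMat hX (toQ_mem _)) (mul_mem_intMat h (toQ_mem _)), ?_⟩, ?_⟩
      · have e : shiftMat q p + (X * toQ δ⁻¹ - (shiftMat q p * toQ δ - shiftMat q p) * toQ δ⁻¹) =
            (shiftMat q p + X) * toQ δ⁻¹ := by
          rw [Matrix.sub_mul, Matrix.mul_assoc _ (toQ δ), hinv', Matrix.mul_one, Matrix.add_mul]
          abel
        rw [e]
      · refine (hrow _).trans ?_
        rw [Matrix.mul_assoc, hinv, Matrix.mul_one]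

/-- The image of a basis vector is a difference of two points of the shifted lattice, hence
integral. -/
lemma exists_intMat_of_mem_stab {q : ℕ} {p : Fin d → ZS S} {h : H}
    (hh : h ∈ stab H (shiftedLattice q p)) :
    ∃ M ∈ intMat S (Fin d) (Fin d), ratMat S M = mat h := by
  have h' : translate (shiftedLattice q p) h = shiftedLattice q p := hh
  have hmem : ∀ X ∈ intMat S Unit (Fin d), ∃ X' ∈ intMat S Unit (Fin d),
      ratMat S (shiftMat q p + X') () = (ratMat S (shiftMat q p + X) * mat h) () := by
    intro X hX
    refine mem_shiftedLattice.1 ?_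
    rw [← h']
    exact ⟨_, mem_shiftedLattice.2 ⟨X, hX, rfl⟩, rfl⟩
  obtain ⟨X₀, hX₀, e₀⟩ := hmem 0 (zero_mem _)
  have hone : ∀ i, (Matrix.of fun (_ : Unit) j => (1 : Matrix (Fin d) (Fin d) ℚ) i j) ∈
      intMat S Unit (Fin d) := fun i _ j => by
    rw [Matrix.of_apply, Matrix.one_apply]
    split_ifs
    · exact one_mem _
    · exact zero_mem _
  choose X hX e using fun i => hmem _ (hone i)
  refine ⟨Matrix.of fun i j => (X i - X₀) () j, fun i j => sub_mem (hX i () j) (hX₀ () j),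
    Matrix.ext fun i j => ?_⟩
  have e1 := congrFun (e i) j
  have e2 := congrFun e₀ j
  conv_rhs at e1 => rw [ratMat_add, Matrix.add_mul, Matrix.add_apply]
  rw [add_zero] at e2
  rw [← e2] at e1
  have e3 : (ratMat S (Matrix.of fun (_ : Unit) j => (1 : Matrix (Fin d) (Fin d) ℚ) i j) *
      mat h) () j = mat h i j := by
    rw [Matrix.mul_apply, Finset.sum_eq_single i]
    · simp only [ratMat, Matrix.map_apply, Matrix.of_apply, Matrix.one_apply_eq]
      rw [map_one, one_mul]
    · intro k _ hk
      simp only [ratMat, Matrix.map_apply, Matrix.of_apply, Matrix.one_apply_ne' hk]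
      rw [map_zero, zero_mul]
    · simp
  rw [e3] at e1
  rw [← add_right_inj (ratMat S (shiftMat q p + X₀) () j), ← e1]
  simp only [ratMat, Matrix.map_apply, Matrix.add_apply, Matrix.sub_apply, Matrix.of_apply, map_add,
    map_sub]
  ring

/-- Both `h` and its inverse have entries in `ℤ_S`. -/
lemma stab_le_integralPoints (q : ℕ) (p : Fin d → ZS S) :
    stab H (shiftedLattice q p) ≤ integralPoints H := by
  intro h hh
  obtain ⟨M, hM, e⟩ := exists_intMat_of_mem_stab hh
  obtain ⟨M', hM', e'⟩ := exists_intMat_of_mem_stab (inv_mem hh)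
  have hMM : M * M' = 1 := ratMat_injective (S := S) (by
    rw [ratMat_mul, e, e', ← mat_mul, mul_inv_cancel, show (1 : Matrix (Fin d) (Fin d) ℚ) =
      toQ (1 : SLZ S (Fin d)) from toQ_one.symm, ratMat_toQ]
    simp [mat, toQS])
  let A : Matrix (Fin d) (Fin d) (ZS S) := Matrix.of fun i j => ⟨M i j, hM i j⟩
  let A' : Matrix (Fin d) (Fin d) (ZS S) := Matrix.of fun i j => ⟨M' i j, hM' i j⟩
  have hAA : A * A' = 1 := by
    have hi : Function.Injective fun B : Matrix (Fin d) (Fin d) (ZS S) =>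
        (ZS S).subtype.mapMatrix B := Matrix.map_injective Subtype.val_injective
    refine hi ?_
    simp only [map_mul, map_one]
    exact hMM
  rw [integralPoints, Subgroup.mem_subgroupOf]
  refine ⟨⟨A, A', hAA, mul_eq_one_comm.1 hAA⟩, Units.ext ?_⟩
  refine Eq.trans ?_ e
  rfl

end SArith
end

/-! ### The stabilizer of a shifted lattice: fundamental domain, orbit measure, and integrals. -/

open MeasureTheory Matrix
open scoped ENNReal Pointwise

set_option linter.unusedSectionVars false

noncomputable section

namespace SArith

variable {S : Finset Prm} {d : ℕ} {H : Subgroup (GL (Fin d) (QS S))} {α : QS S →* QS S}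
  {D : Set (Matrix (Fin d) (Fin d) (QS S))} {J : Type} [Fintype J] {γ : J → SLZ S (Fin d)}
  {q : ℕ} {p : Fin d → ZS S}

lemma ofSLZ_mul (hH : IsDetKernel H α) (γ δ : SLZ S (Fin d)) :
    ofSLZ hH (γ * δ) = ofSLZ hH γ * ofSLZ hH δ := mat_injective (by
  rw [mat_mul, mat_ofSLZ, mat_ofSLZ, mat_ofSLZ, ← ratMat_toQ, ← ratMat_toQ, ← ratMat_toQ, toQ_mul,
    ratMat_mul])

lemma ofSLZ_one (hH : IsDetKernel H α) : ofSLZ hH 1 = 1 :=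
  (left_eq_mul (a := ofSLZ hH 1)).1 (by rw [← ofSLZ_mul, mul_one])

lemma ofSLZ_inv (hH : IsDetKernel H α) (γ : SLZ S (Fin d)) :
    ofSLZ hH γ⁻¹ = (ofSLZ hH γ)⁻¹ :=
  eq_inv_of_mul_eq_one_left (by rw [← ofSLZ_mul, inv_mul_cancel, ofSLZ_one])

/-- A fundamental domain for the stabilizer of a shifted lattice. -/
def shiftDomain (hH : IsDetKernel H α) (D : Set (Matrix (Fin d) (Fin d) (QS S)))
    (γ : J → SLZ S (Fin d)) : Set H :=
  ⋃ j, (fun h => ofSLZ hH (γ j)⁻¹ * h) ⁻¹' domainIn H D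

lemma measurableSet_domainIn (hD : IsStrictFD D) : MeasurableSet (domainIn H D) :=
  continuous_mat.measurable hD.measurableSet

lemma measurableSet_shiftDomain (hH : IsDetKernel H α) (hD : IsStrictFD D) :
    MeasurableSet (shiftDomain hH D γ) :=
  MeasurableSet.iUnion fun j => measurable_const_mul (ofSLZ hH (γ j)⁻¹) (measurableSet_domainIn hD)

/-- The `γ j` represent the cosets of the stabilizer in `SL_d(ℤ_S)`, by orbit and stabilizer for the
class of `p/q`; translating a fundamental domain of the large group by them gives one for the
subgroup. -/
lemma isFundamentalDomain_shiftDomain (hH : IsDetKernel H α) (hD : IsStrictFD D)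
    (hx : ShiftFamily S q (fun j => shiftMat q p * toQ (γ j)))
    (hrep : ∀ δ : SLZ S (Fin d), ∃ j,
      shiftMat q p * toQ δ - shiftMat q p * toQ (γ j) ∈ intMat S Unit (Fin d)) (μ : Measure H) :
    IsFundamentalDomain (stab H (shiftedLattice q p)) (shiftDomain hH D γ) μ := by
  refine IsFundamentalDomain.mk' (measurableSet_shiftDomain hH hD).nullMeasurableSet fun h => ?_
  obtain ⟨δ, hδ, hu⟩ := exists_unique_domainIn hH hD h
  obtain ⟨j, hj⟩ := hrep δ⁻¹
  have hinv : toQ δ⁻¹ * toQ δ = 1 := by rw [← toQ_mul, inv_mul_cancel, toQ_one]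
  have hinv' : toQ δ * toQ δ⁻¹ = 1 := by rw [← toQ_mul, mul_inv_cancel, toQ_one]
  have hmem : ofSLZ hH (γ j * δ) ∈ stab H (shiftedLattice q p) := by
    rw [mem_stab_ofSLZ_iff]
    have := mul_mem_intMat (neg_mem hj) (toQ_mem δ)
    rwa [neg_sub, Matrix.sub_mul, Matrix.mul_assoc, Matrix.mul_assoc, hinv, Matrix.mul_one,
      ← toQ_mul] at this
  refine ⟨⟨_, hmem⟩, ?_, ?_⟩
  · refine Set.mem_iUnion.2 ⟨j, ?_⟩
    change ofSLZ hH (γ j)⁻¹ * (ofSLZ hH (γ j * δ) * h) ∈ domainIn H D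
    rwa [← mul_assoc, ← ofSLZ_mul, inv_mul_cancel_left]
  · rintro ⟨σ, hσ⟩ hσD
    obtain ⟨j', hj'⟩ := Set.mem_iUnion.1 hσD
    obtain ⟨ε, rfl⟩ := (mem_integralPoints_iff hH σ).1 (stab_le_integralPoints q p hσ)
    have h1 : ofSLZ hH ((γ j')⁻¹ * ε) * h ∈ domainIn H D := by
      rw [ofSLZ_mul, mul_assoc]
      exact hj'
    have h2 : ε = γ j' * δ := by rw [← hu _ h1, mul_inv_cancel_left]
    subst h2
    have h3 := (mem_stab_ofSLZ_iff hH _).1 hσ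
    have h4 : j' = j := hx.inj j' j (by
      have h5 := mul_mem_intMat h3 (toQ_mem δ⁻¹)
      rw [toQ_mul, ← Matrix.mul_assoc, Matrix.sub_mul, Matrix.mul_assoc _ (toQ δ), hinv',
        Matrix.mul_one] at h5
      have := add_mem h5 hj
      rwa [sub_add_sub_cancel] at this)
    subst h4
    rfl

variable [LocallyCompactSpace H]

/-- Preimages under the orbit map are invariant under the stabilizer, and invariant sets meet any
two fundamental domains in equal measure. So the domain chosen in the definition may be exchanged
for the explicit one. -/
lemma orbitMeasure_eq (hH : IsDetKernel H α) (hD : IsStrictFD D)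
    [(normHaar H).IsMulLeftInvariant]
    (hx : ShiftFamily S q (fun j => shiftMat q p * toQ (γ j)))
    (hrep : ∀ δ : SLZ S (Fin d), ∃ j,
      shiftMat q p * toQ δ - shiftMat q p * toQ (γ j) ∈ intMat S Unit (Fin d)) :
    orbitMeasure H (shiftedLattice q p) =
      ((normHaar H).restrict (shiftDomain hH D γ)).map (orbitMap H (shiftedLattice q p)) := by
  have hfd := isFundamentalDomain_shiftDomain hH hD hx hrep (normHaar H)
  have hex : HasFundamentalDomain (stab H (shiftedLattice q p)) H (normHaar H) := ⟨⟨_, hfd⟩⟩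
  have : Countable (integralPoints H) := countable_integralPoints hH
  have : Countable (stab H (shiftedLattice q p)) :=
    (Subgroup.inclusion_injective (stab_le_integralPoints q p)).countable
  have hmeas : Measurable (orbitMap H (shiftedLattice q p)) := fun s hs => hs
  rw [orbitMeasure, dif_pos hex]
  refine Measure.ext fun s hs => ?_
  have hs' := hmeas hs
  rw [Measure.map_apply hmeas hs, Measure.map_apply hmeas hs, Measure.restrict_apply hs',
    Measure.restrict_apply hs']
  refine hex.ExistsIsFundamentalDomain.choose_spec.measure_set_eq hfd hs' fun σ => ?_
  ext h
  have : orbitMap H (shiftedLattice q p) (σ • h) = orbitMap H (shiftedLattice q p) h := by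
    refine Subtype.ext ?_
    change translate _ ((σ : H) * h : GL (Fin d) (QS S)) = translate _ _
    rw [translate_mul, show translate (shiftedLattice q p) (σ : H) = _ from σ.2]
  simp only [Set.mem_preimage, this]

/-- The translates are disjoint because the classes are distinct, and left invariance moves each of
them back to the basic domain. -/
lemma setLIntegral_shiftDomain (hH : IsDetKernel H α) (hD : IsStrictFD D)
    [(normHaar H).IsMulLeftInvariant]
    (hx : ShiftFamily S q (fun j => shiftMat q p * toQ (γ j))) {F : H → ℝ≥0∞} (hF : Measurable F) :
    ∫⁻ h in shiftDomain hH D γ, F h ∂(normHaar H) =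
      ∫⁻ h in domainIn H D, ∑ j, F (ofSLZ hH (γ j) * h) ∂(normHaar H) := by
  have hdisj : Pairwise (Function.onFun Disjoint fun j =>
      (fun h => ofSLZ hH (γ j)⁻¹ * h) ⁻¹' domainIn H D) := by
    intro j j' hjj
    refine Set.disjoint_left.2 fun h h1 h2 => hjj ?_
    have h3 := inv_injective ((exists_unique_domainIn hH hD h).unique h1 h2)
    refine hx.inj j j' ?_
    simp only [h3, sub_self]
    exact zero_mem _
  rw [shiftDomain, lintegral_iUnion (fun j => measurable_const_mul (ofSLZ hH (γ j)⁻¹)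
    (measurableSet_domainIn hD)) hdisj, tsum_fintype]
  refine Eq.trans ?_ (lintegral_finsetSum Finset.univ
    (f := fun j h => F (ofSLZ hH (γ j) * h)) fun j _ => hF.comp (measurable_const_mul _)).symm
  refine Finset.sum_congr rfl fun j _ => ?_
  have h1 := (MeasureTheory.measurePreserving_mul_left (normHaar H) (ofSLZ hH (γ j)⁻¹)).setLIntegral_comp_preimage
    (measurableSet_domainIn hD) (f := fun h => F (ofSLZ hH (γ j) * h))
    (hF.comp (measurable_const_mul _))
  rw [← h1]
  refine lintegral_congr fun h => ?_
  rw [ofSLZ_inv, mul_inv_cancel_left]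

lemma tsum_intMat_mul_toQ {κ : Type*} [Fintype κ] (γ : SLZ S (Fin d)) (M : Matrix κ (Fin d) ℚ)
    (F : Matrix κ (Fin d) ℚ → ℝ≥0∞) :
    ∑' X : intMat S κ (Fin d), F ((M + (X : Matrix κ (Fin d) ℚ)) * toQ γ) =
      ∑' X : intMat S κ (Fin d), F (M * toQ γ + (X : Matrix κ (Fin d) ℚ)) := by
  have hinv : toQ γ⁻¹ * toQ γ = 1 := by rw [← toQ_mul, inv_mul_cancel, toQ_one]
  have hinv' : toQ γ * toQ γ⁻¹ = 1 := by rw [← toQ_mul, mul_inv_cancel, toQ_one]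
  let e : intMat S κ (Fin d) ≃ intMat S κ (Fin d) :=
    { toFun := fun X => ⟨(X : Matrix κ (Fin d) ℚ) * toQ γ, mul_mem_intMat X.2 (toQ_mem γ)⟩
      invFun := fun X => ⟨(X : Matrix κ (Fin d) ℚ) * toQ γ⁻¹, mul_mem_intMat X.2 (toQ_mem _)⟩
      left_inv := fun X => Subtype.ext (by
        change (X : Matrix κ (Fin d) ℚ) * toQ γ * toQ γ⁻¹ = X
        rw [Matrix.mul_assoc, hinv', Matrix.mul_one])
      right_inv := fun X => Subtype.ext (by
        change (X : Matrix κ (Fin d) ℚ) * toQ γ⁻¹ * toQ γ = X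
        rw [Matrix.mul_assoc, hinv, Matrix.mul_one]) }
  rw [← e.tsum_eq fun X : intMat S κ (Fin d) => F (M * toQ γ + (X : Matrix κ (Fin d) ℚ))]
  refine tsum_congr fun X => ?_
  rw [Matrix.add_mul]
  rfl

lemma setLIntegral_shiftDomain_tsum (hH : IsDetKernel H α) (hD : IsStrictFD D)
    [(normHaar H).IsMulLeftInvariant]
    (hx : ShiftFamily S q (fun j => shiftMat q p * toQ (γ j))) {κ : Type*} [Fintype κ]
    [DecidableEq κ] (M : Matrix κ (Fin d) ℚ) {Φ : Matrix κ (Fin d) (QS S) → ℝ≥0∞}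
    (hΦ : Measurable Φ) :
    ∫⁻ h in shiftDomain hH D γ, ∑' X : intMat S κ (Fin d),
        Φ (ratMat S (M + (X : Matrix κ (Fin d) ℚ)) * mat h) ∂(normHaar H) =
      ∫⁻ h in domainIn H D, ∑ j, ∑' X : intMat S κ (Fin d),
        Φ (ratMat S (M * toQ (γ j) + (X : Matrix κ (Fin d) ℚ)) * mat h) ∂(normHaar H) := by
  rw [setLIntegral_shiftDomain hH hD hx (F := fun h => ∑' X : intMat S κ (Fin d),
        Φ (ratMat S (M + (X : Matrix κ (Fin d) ℚ)) * mat h))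
    (Measurable.tsum fun X => hΦ.comp (measurable_mul_apply continuous_mat.measurable _))]
  refine lintegral_congr fun h => Finset.sum_congr rfl fun j _ => ?_
  rw [← tsum_intMat_mul_toQ (γ j) M fun A => Φ (ratMat S A * mat h)]
  refine tsum_congr fun X => ?_
  rw [mat_mul, mat_ofSLZ, ratMat_mul, Matrix.mul_assoc, ratMat_toQ]

end SArith
end

open MeasureTheory Matrix
open scoped ENNReal Pointwise

set_option linter.unusedSectionVars false

noncomputable section

namespace SArith

/-! ### Functions of compact support -/

variable {S : Finset Prm} {d : ℕ} {f : (Fin d → QS S) → ℝ}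

lemma integrable_of_bounded_of_hasCompactSupport (hfm : Measurable f)
    (hfb : ∃ C : ℝ, ∀ v, |f v| ≤ C) (hfc : HasCompactSupport f) : Integrable f := by
  obtain ⟨C, hC⟩ := hfb
  have h1 : IntegrableOn f (tsupport f) :=
    Measure.integrableOn_of_bounded (IsCompact.measure_lt_top hfc).ne hfm.aestronglyMeasurable
      (Filter.Eventually.of_forall hC)
  exact (integrableOn_iff_integrable_of_support_subset (subset_tsupport f)).1 h1

/-- The function `M ↦ f (M 0) f (M 1)` on pairs of vectors. -/
def pairFn (f : (Fin d → QS S) → ℝ) (M : Matrix (Fin 2) (Fin d) (QS S)) : ℝ := ∏ i, f (M i)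

lemma measurable_pairFn (hfm : Measurable f) : Measurable (pairFn f) :=
  Finset.measurable_fun_prod _ fun i _ => hfm.comp (measurable_pi_apply (X := fun _ => Fin d → QS S) i)

lemma integrable_pairFn (hf : Integrable f) : Integrable (pairFn f) :=
  Integrable.fintype_prod fun _ : Fin 2 => hf

lemma integral_pairFn (f : (Fin d → QS S) → ℝ) : ∫ M, pairFn f M = (∫ v, f v) ^ 2 := by
  have := integral_fintype_prod_volume_eq_pow (ι := Fin 2) f
  rw [Fintype.card_fin] at this
  exact this

lemma pairFn_colMat (f : (Fin d → QS S) → ℝ) (c : Fin 2 → ℚ) (y : Matrix Unit (Fin d) (QS S)) :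
    pairFn f (ratMat S (colMat c) * y) = f (c 0 • y ()) * f (c 1 • y ()) := by
  have h : ∀ i, (ratMat S (colMat c) * y) i = c i • y () := fun i => funext fun j => by
    rw [ratMat_colMat_mul_apply, Pi.smul_apply, Algebra.smul_def]
  rw [pairFn, Fin.prod_univ_two, h, h]

lemma integral_row (g : (Fin d → QS S) → ℝ) :
    ∫ y : Matrix Unit (Fin d) (QS S), g (y ()) = ∫ v, g v :=
  (volume_preserving_funUnique Unit (Fin d → QS S)).integral_comp' g

lemma lintegral_row (g : (Fin d → QS S) → ℝ≥0∞) :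
    ∫⁻ y : Matrix Unit (Fin d) (QS S), g (y ()) = ∫⁻ v, g v :=
  (volume_preserving_funUnique Unit (Fin d → QS S)).lintegral_comp_emb
    (MeasurableEquiv.measurableEmbedding _) g

lemma integral_pairFn_colMat {q : ℕ} (τ : PairIndex S q) :
    ∫ y : Matrix Unit (Fin d) (QS S), pairFn f (ratMat S (colMat (pairVec τ)) * y) =
      pairIntegral f τ.1 τ.2 := by
  simp only [pairFn_colMat]
  exact integral_row fun v => f (pairVec τ 0 • v) * f (pairVec τ 1 • v)

/-- A function of compact support is dominated by the indicator of a dilated box. -/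
lemma exists_box_of_hasCompactSupport (hfc : HasCompactSupport f) : ∃ s ∈ PS S, ∃ R : ℝ, 0 ≤ R ∧
    ∀ v, f v ≠ 0 → ∀ j, algebraMap ℚ (QS S) (s : ℚ) * v j ∈ boxR S (Set.Icc (-R) R) := by
  obtain ⟨C, hC⟩ := hfc.isCompact.isBounded.exists_norm_le
  obtain ⟨s, hs, hsC⟩ := exists_PS_norm_le S (max C 0)
  refine ⟨s, hs, s * max C 0, by positivity, fun v hv j => ?_⟩
  have hv1 : ‖v j‖ ≤ max C 0 := (norm_le_pi_norm v j).trans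
    ((hC v (subset_tsupport f hv)).trans (le_max_left _ _))
  refine ⟨?_, fun p => ?_⟩
  · rw [Set.mem_Icc, ← abs_le]
    have e : (algebraMap ℚ (QS S) (s : ℚ) * v j).1 = s * (v j).1 := by simp
    rw [e, abs_mul, Nat.abs_cast]
    exact mul_le_mul_of_nonneg_left ((norm_fst_le (v j)).trans hv1) (Nat.cast_nonneg _)
  · have e : (algebraMap ℚ (QS S) (s : ℚ) * v j).2 p = ((s : ℚ) : ℚ_[(p : Prm)]) * (v j).2 p := by
      simp
    rw [e, norm_mul]
    refine le_trans (mul_le_mul_of_nonneg_left ?_ (norm_nonneg _)) (hsC p)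
    exact ((norm_le_pi_norm (v j).2 p).trans (norm_snd_le (v j))).trans hv1

/-- The function is bounded by `C ^ 2` times the indicator of a box after scaling by some `s ∈ ℙ_S`,
which makes the support p-adically integral at no cost in measure; the box case is
`tsum_lintegral_pairVec_le`. -/
lemma tsum_lintegral_pairFn_ne_top (hd : 3 ≤ d) (hfb : ∃ C : ℝ, ∀ v, |f v| ≤ C)
    (hfc : HasCompactSupport f) (q : ℕ) :
    ∑' τ : PairIndex S q, ∫⁻ y : Matrix Unit (Fin d) (QS S),
      ‖pairFn f (ratMat S (colMat (pairVec τ)) * y)‖ₑ ≠ ∞ := by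
  obtain ⟨C, hC⟩ := hfb
  obtain ⟨s, hs, R, hR, hsR⟩ := exists_box_of_hasCompactSupport hfc
  have hs0 : (s : ℚ) ≠ 0 := by exact_mod_cast hs.1.ne'
  set B := boxM S (Fin 2) (Fin d) (Set.Icc (-R) R) with hB
  have hBm : MeasurableSet B := measurableSet_boxM measurableSet_Icc
  have hC0 : 0 ≤ C := (abs_nonneg _).trans (hC 0)
  have hle : ∀ M : Matrix (Fin 2) (Fin d) (QS S), ‖pairFn f M‖ₑ ≤ ENNReal.ofReal (C ^ 2) *
      B.indicator (1 : Matrix (Fin 2) (Fin d) (QS S) → ℝ≥0∞)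
        (algebraMap ℚ (QS S) (s : ℚ) • M) := by
    intro M
    by_cases hM : algebraMap ℚ (QS S) (s : ℚ) • M ∈ B
    · rw [Set.indicator_of_mem hM, Pi.one_apply, mul_one, ← ofReal_norm]
      refine ENNReal.ofReal_le_ofReal ?_
      rw [pairFn, Fin.prod_univ_two, norm_mul, sq]
      exact mul_le_mul (hC _) (hC _) (norm_nonneg _) hC0
    · have : ∃ i, f (M i) = 0 := by
        by_contra! hne
        exact hM fun i j => hsR (M i) (hne i) j
      obtain ⟨i, hi⟩ := this
      rw [pairFn, Finset.prod_eq_zero (Finset.mem_univ i) hi]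
      simp
  have hval : ∀ τ : PairIndex S q, ∫⁻ y : Matrix Unit (Fin d) (QS S),
      B.indicator (1 : Matrix (Fin 2) (Fin d) (QS S) → ℝ≥0∞)
        (algebraMap ℚ (QS S) (s : ℚ) • (ratMat S (colMat (pairVec τ)) * y)) =
      ∫⁻ y : Matrix Unit (Fin d) (QS S), B.indicator (1 : Matrix (Fin 2) (Fin d) (QS S) → ℝ≥0∞)
        (ratMat S (colMat (pairVec τ)) * y) := by
    intro τ
    have hmeas : Measurable fun y : Matrix Unit (Fin d) (QS S) =>
        algebraMap ℚ (QS S) (s : ℚ) • y := by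
      refine measurable_pi_lambda _ fun i => measurable_pi_lambda _ fun j => ?_
      exact (measurable_const_mul (algebraMap ℚ (QS S) (s : ℚ))).comp
        ((measurable_pi_apply j).comp (measurable_pi_apply (X := fun _ => Fin d → QS S) i))
    have h1 := lintegral_inv_smul (κ := Unit) (n := Fin d) hs
      (Φ := fun y => B.indicator (1 : Matrix (Fin 2) (Fin d) (QS S) → ℝ≥0∞)
        (ratMat S (colMat (pairVec τ)) * (algebraMap ℚ (QS S) (s : ℚ) • y)))
      (((measurable_one.indicator hBm).comp (measurable_colMat_mul _)).comp hmeas)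
    simp only [smul_smul, ← map_mul, mul_inv_cancel₀ hs0, map_one, one_smul] at h1
    rw [h1]
    simp only [Matrix.mul_smul]
  refine ne_top_of_le_ne_top (b := ENNReal.ofReal (C ^ 2) *
    (ENNReal.ofReal (2 * R) ^ Fintype.card (Fin d) * copSum (Fin d))) ?_ ?_
  · exact ENNReal.mul_ne_top ENNReal.ofReal_ne_top (ENNReal.mul_ne_top
      (ENNReal.pow_ne_top ENNReal.ofReal_ne_top) (copSum_ne_top (by simpa using hd)))
  · refine le_trans ?_ (mul_le_mul_right
      (tsum_lintegral_pairVec_le (S := S) (n := Fin d) (q := q) hR) _)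
    rw [← ENNReal.tsum_mul_left]
    refine ENNReal.tsum_le_tsum fun τ => ?_
    rw [← hB, ← hval, ← lintegral_const_mul' _ _ ENNReal.ofReal_ne_top]
    exact lintegral_mono fun y => hle _

variable (S d) in
/-- The measure on pairs of vectors in the second moment formula. -/
def pairMeasure (q : ℕ) : Measure (Matrix (Fin 2) (Fin d) (QS S)) :=
  volume + Measure.sum fun τ : PairIndex S q =>
    (volume : Measure (Matrix Unit (Fin d) (QS S))).map
      fun y => ratMat S (colMat (pairVec τ)) * y

lemma lintegral_pairMeasure (q : ℕ) {Φ : Matrix (Fin 2) (Fin d) (QS S) → ℝ≥0∞}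
    (hΦ : Measurable Φ) : ∫⁻ M, Φ M ∂(pairMeasure S d q) = (∫⁻ M, Φ M) +
      ∑' τ : PairIndex S q, ∫⁻ y : Matrix Unit (Fin d) (QS S),
        Φ (ratMat S (colMat (pairVec τ)) * y) := by
  rw [pairMeasure, lintegral_add_measure, lintegral_sum_measure]
  congr 1
  exact tsum_congr fun τ => lintegral_map hΦ (measurable_colMat_mul _)

lemma integrable_pairFn_pairMeasure (hd : 3 ≤ d) (hfm : Measurable f)
    (hfb : ∃ C : ℝ, ∀ v, |f v| ≤ C) (hfc : HasCompactSupport f) (q : ℕ) :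
    Integrable (pairFn f) (pairMeasure S d q) := by
  refine ⟨(measurable_pairFn hfm).aestronglyMeasurable, ?_⟩
  rw [HasFiniteIntegral, lintegral_pairMeasure q (measurable_pairFn hfm).enorm]
  exact ENNReal.add_lt_top.2 ⟨(integrable_pairFn
    (integrable_of_bounded_of_hasCompactSupport hfm hfb hfc)).2,
    (tsum_lintegral_pairFn_ne_top hd hfb hfc q).lt_top⟩

lemma hasSum_pairIntegral (hd : 3 ≤ d) (hfm : Measurable f)
    (hfb : ∃ C : ℝ, ∀ v, |f v| ≤ C) (hfc : HasCompactSupport f) (q : ℕ) :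
    HasSum (fun τ : PairIndex S q => pairIntegral f τ.1 τ.2)
      (∫ M, pairFn f M ∂(pairMeasure S d q) - (∫ v, f v) ^ 2) := by
  have hi := integrable_pairFn_pairMeasure hd hfm hfb hfc q
  rw [pairMeasure] at hi ⊢
  have h1 := hi.left_of_add_measure
  have h2 := hi.right_of_add_measure
  rw [integral_add_measure h1 h2, integral_pairFn, add_sub_cancel_left]
  have e : ∀ τ : PairIndex S q, ∫ M, pairFn f M ∂((volume : Measure (Matrix Unit (Fin d) (QS S))).map
      fun y => ratMat S (colMat (pairVec τ)) * y) = pairIntegral f τ.1 τ.2 := fun τ => by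
    rw [integral_map (measurable_colMat_mul _).aemeasurable
      (measurable_pairFn hfm).aestronglyMeasurable, integral_pairFn_colMat]
  have h3 := hasSum_integral_measure h2
  simp only [e] at h3
  exact h3

end SArith
end

open MeasureTheory Matrix
open scoped ENNReal Pointwise

set_option linter.unusedSectionVars false

noncomputable section

namespace SArith

/-! ### Moments of the Siegel transform -/

variable {S : Finset Prm} {d : ℕ} {H : Subgroup (GL (Fin d) (QS S))} {α : QS S →* QS S}
  {q : ℕ} {p : Fin d → ZS S} {f : (Fin d → QS S) → ℝ}

lemma siegel_translate (f : (Fin d → QS S) → ℝ) (h : H) :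
    siegel f (translate (shiftedLattice q p) h) = ∑' X : intMat S Unit (Fin d),
      f ((ratMat S (shiftMat q p + (X : Matrix Unit (Fin d) ℚ)) * mat h) ()) := by
  let ψ : intMat S Unit (Fin d) → Fin d → QS S := fun X =>
    (ratMat S (shiftMat q p + (X : Matrix Unit (Fin d) ℚ)) * mat h) ()
  have hψ : Function.Injective ψ := by
    intro X X' hX
    have h1 : ratMat S (shiftMat q p + (X : Matrix Unit (Fin d) ℚ)) * mat h =
        ratMat S (shiftMat q p + (X' : Matrix Unit (Fin d) ℚ)) * mat h := funext fun _ => hX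
    have h2 : mat h * mat h⁻¹ = 1 := by rw [← mat_mul, mul_inv_cancel]; rfl
    have h3 := congrArg (· * mat h⁻¹) h1
    simp only [Matrix.mul_assoc, h2, Matrix.mul_one] at h3
    exact Subtype.ext (add_left_cancel (ratMat_injective h3))
  have hr : translate (shiftedLattice q p) h = Set.range ψ := by
    ext v
    constructor
    · rintro ⟨w, hw, rfl⟩
      obtain ⟨X, hX, rfl⟩ := mem_shiftedLattice.1 hw
      exact ⟨⟨X, hX⟩, rfl⟩
    · rintro ⟨X, rfl⟩
      exact ⟨_, mem_shiftedLattice.2 ⟨X, X.2, rfl⟩, rfl⟩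
  rw [siegel, hr, ← (Equiv.ofInjective ψ hψ).tsum_eq]
  rfl

variable (S d) in
/-- Pairs of integral rows as integral matrices. -/
def pairEquiv : intMat S Unit (Fin d) × intMat S Unit (Fin d) ≃ intMat S (Fin 2) (Fin d) where
  toFun X := ⟨Matrix.of ![(X.1 : Matrix Unit (Fin d) ℚ) (), (X.2 : Matrix Unit (Fin d) ℚ) ()],
    fun i j => by
      fin_cases i
      · exact X.1.2 () j
      · exact X.2.2 () j⟩
  invFun X := (⟨Matrix.of fun _ => (X : Matrix (Fin 2) (Fin d) ℚ) 0, fun _ j => X.2 0 j⟩,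
    ⟨Matrix.of fun _ => (X : Matrix (Fin 2) (Fin d) ℚ) 1, fun _ j => X.2 1 j⟩)
  left_inv X := rfl
  right_inv X := Subtype.ext (funext fun i => by fin_cases i <;> rfl)

lemma pairFn_pairEquiv (f : (Fin d → QS S) → ℝ) (x : Matrix Unit (Fin d) ℚ)
    (g : Matrix (Fin d) (Fin d) (QS S)) (X : intMat S Unit (Fin d) × intMat S Unit (Fin d)) :
    pairFn f (ratMat S (colMat ![1, 1] * x + (pairEquiv S d X : Matrix (Fin 2) (Fin d) ℚ)) * g) =
      f ((ratMat S (x + (X.1 : Matrix Unit (Fin d) ℚ)) * g) ()) *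
        f ((ratMat S (x + (X.2 : Matrix Unit (Fin d) ℚ)) * g) ()) := by
  have hrow : ∀ j, (ratMat S (colMat ![1, 1] * x + (pairEquiv S d X : Matrix (Fin 2) (Fin d) ℚ)))
      0 j = ratMat S (x + (X.1 : Matrix Unit (Fin d) ℚ)) () j ∧
      (ratMat S (colMat ![1, 1] * x + (pairEquiv S d X : Matrix (Fin 2) (Fin d) ℚ)))
      1 j = ratMat S (x + (X.2 : Matrix Unit (Fin d) ℚ)) () j := by
    intro j
    have e0 : (pairEquiv S d X : Matrix (Fin 2) (Fin d) ℚ) 0 j = X.1.1 () j := rfl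
    have e1 : (pairEquiv S d X : Matrix (Fin 2) (Fin d) ℚ) 1 j = X.2.1 () j := rfl
    simp only [ratMat, Matrix.map_apply, Matrix.add_apply, colMat_mul_apply, e0, e1,
      Matrix.cons_val_zero, Matrix.cons_val_one, Matrix.cons_val_fin_one, one_mul, and_self]
  rw [pairFn, Fin.prod_univ_two]
  congr 2
  · exact funext fun j => by simp only [Matrix.mul_apply, (hrow _).1]
  · exact funext fun j => by simp only [Matrix.mul_apply, (hrow _).2]

/-- The product of two absolutely convergent series is the double series, whose index pairs are
integral matrices with two rows. -/
lemma siegel_translate_sq (h : H)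
    (hs : Summable fun X : intMat S Unit (Fin d) =>
      f ((ratMat S (shiftMat q p + (X : Matrix Unit (Fin d) ℚ)) * mat h) ())) :
    siegel f (translate (shiftedLattice q p) h) ^ 2 = ∑' X : intMat S (Fin 2) (Fin d),
      pairFn f (ratMat S (colMat ![1, 1] * shiftMat q p + (X : Matrix (Fin 2) (Fin d) ℚ)) *
        mat h) := by
  rw [siegel_translate, sq, tsum_mul_tsum_of_summable_norm hs.norm hs.norm,
    ← (pairEquiv S d).tsum_eq]
  exact tsum_congr fun X => (pairFn_pairEquiv f _ _ X).symm

variable {D : Set (Matrix (Fin d) (Fin d) (QS S))} {J : Type} [Fintype J] {γ : J → SLZ S (Fin d)}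

lemma measurable_siegel (hfm : Measurable f) :
    Measurable fun L : OrbitSpace H (shiftedLattice q p) => siegel f L.1 := by
  have h1 : Measurable ((fun L : OrbitSpace H (shiftedLattice q p) => siegel f L.1) ∘
      orbitMap H (shiftedLattice q p)) := by
    have e : ((fun L : OrbitSpace H (shiftedLattice q p) => siegel f L.1) ∘
        orbitMap H (shiftedLattice q p)) = fun h : H => ∑' X : intMat S Unit (Fin d),
      f ((ratMat S (shiftMat q p + (X : Matrix Unit (Fin d) ℚ)) * mat h) ()) :=
      funext fun h => siegel_translate f h
    rw [e]
    exact measurable_tsum_real fun X => hfm.comp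
      ((measurable_pi_apply (X := fun _ => Fin d → QS S) ()).comp
        (measurable_mul_apply continuous_mat.measurable _))
  -- In the quotient σ-algebra, measurability is tested after composing with the orbit map.
  exact fun s hs => h1 hs

/-- The moments of the Siegel transform on the space of shifted lattices. -/
theorem moments [LocallyCompactSpace H] (hH : IsDetKernel H α) (hq : q ∈ NS S) (hq1 : q ≠ 1)
    (hd2 : 2 ≤ d) (hD : IsStrictFD D)
    (hx : ShiftFamily S q (fun j => shiftMat q p * toQ (γ j)))
    (hrep : ∀ δ : SLZ S (Fin d), ∃ j,
      shiftMat q p * toQ δ - shiftMat q p * toQ (γ j) ∈ intMat S Unit (Fin d))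
    (hfm : Measurable f) (hfb : ∃ C : ℝ, ∀ v, |f v| ≤ C) (hfc : HasCompactSupport f) :
    covolume (integralPoints H) H (normHaar H) = 1 ∧
    orbitMeasure H (shiftedLattice q p) Set.univ = Fintype.card J ∧
    (Integrable (fun L : OrbitSpace H (shiftedLattice q p) => siegel f L.1)
      (orbitMeasure H (shiftedLattice q p)) ∧
      ∫ L : OrbitSpace H (shiftedLattice q p), siegel f L.1 ∂(orbitMeasure H (shiftedLattice q p)) =
        Fintype.card J * ∫ v, f v) ∧
    (3 ≤ d → Integrable (fun L : OrbitSpace H (shiftedLattice q p) => siegel f L.1 ^ 2)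
      (orbitMeasure H (shiftedLattice q p)) ∧
      ∫ L : OrbitSpace H (shiftedLattice q p), siegel f L.1 ^ 2
          ∂(orbitMeasure H (shiftedLattice q p)) =
        Fintype.card J * ((∫ v, f v) ^ 2 + ∑' t : indexT S q, ∑' a : indexA S q t,
          pairIntegral f t a)) := by
  obtain ⟨l, rfl⟩ : ∃ l, d = l + 2 := ⟨d - 2, by omega⟩
  obtain ⟨hone, hinv, hcov, hmean⟩ := normHaar_properties hH (k := l + 1) rfl hD
  set P := (normHaar H).restrict (domainIn H D) with hPdef
  have hprob : IsProbabilityMeasure P := ⟨by rw [hPdef, Measure.restrict_apply_univ, hone]⟩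
  have hm : Measurable (mat : H → Matrix (Fin (l + 2)) (Fin (l + 2)) (QS S)) :=
    continuous_mat.measurable
  have hdet : ∀ h : H, (mat h).det.1 = 1 ∧ ∀ p, ‖(mat h).det.2 p‖ = 1 := fun h =>
    ⟨hH.det_fst h, (hH.det_mem h).2⟩
  obtain e₁ : Unit ⊕ Fin (l + 1) ≃ Fin (l + 2) := Fintype.equivOfCardEq (by simp; omega)
  have hP₁ : MeanValue P (mat : H → _) e₁ := hmean e₁
  set E := shiftDomain hH D γ with hE
  set μ := (normHaar H).restrict E with hμ
  have horb := orbitMeasure_eq hH hD hx hrep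
  have hmo : Measurable (orbitMap H (shiftedLattice q p)) := fun s hs => hs
  have hfi := integrable_of_bounded_of_hasCompactSupport hfm hfb hfc
  have hrowm : Measurable fun y : Matrix Unit (Fin (l + 2)) (QS S) => y () :=
    measurable_pi_apply (X := fun _ => Fin (l + 2) → QS S) ()
  have hrowi : Integrable fun y : Matrix Unit (Fin (l + 2)) (QS S) => f (y ()) := by
    refine ⟨(hfm.comp hrowm).aestronglyMeasurable, ?_⟩
    rw [HasFiniteIntegral, lintegral_row fun v => ‖f v‖ₑ]
    exact hfi.2
  have hJ : (Fintype.card J : ℝ≥0∞) ≠ ∞ := ENNReal.natCast_ne_top _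
  -- The first moment for nonnegative functions is the mean value formula against `card J` times the
  -- volume; this passes to `f` and also yields almost everywhere summability, needed for squaring
  -- the series.
  obtain ⟨s1, i1, v1⟩ := integral_tsum_of_lintegral_tsum (μ := μ)
    (ρ := (Fintype.card J : ℝ≥0∞) • (volume : Measure (Matrix Unit (Fin (l + 2)) (QS S))))
    (G := fun (X : intMat S Unit (Fin (l + 2))) (h : H) =>
      ratMat S (shiftMat q p + (X : Matrix Unit (Fin (l + 2)) ℚ)) * mat h)
    (fun X => measurable_mul_apply hm _) (fun Φ hΦ => by
      rw [hμ, hE, setLIntegral_shiftDomain_tsum hH hD hx _ hΦ, lintegral_smul_measure, smul_eq_mul]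
      exact hx.first_moment hm hdet 0 hP₁ hq hq1 hΦ) (hfm.comp hrowm) (hrowi.smul_measure hJ)
  simp only [Function.comp_def] at s1 i1 v1
  have hsi : (fun h : H => siegel f (orbitMap H (shiftedLattice q p) h).1) = fun h =>
      ∑' X : intMat S Unit (Fin (l + 2)),
        f ((ratMat S (shiftMat q p + (X : Matrix Unit (Fin (l + 2)) ℚ)) * mat h) ()) :=
    funext fun h => siegel_translate f h
  refine ⟨hcov, ?_, ⟨?_, ?_⟩, fun hd3 => ?_⟩
  · rw [horb, Measure.map_apply hmo MeasurableSet.univ, Set.preimage_univ,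
      Measure.restrict_apply_univ]
    have := setLIntegral_shiftDomain hH hD hx (F := fun _ => 1) measurable_const
    simp only [Finset.sum_const, Finset.card_univ, lintegral_const, Measure.restrict_apply_univ,
      hone, one_mul, mul_one, nsmul_eq_mul] at this
    exact this
  · rw [horb, integrable_map_measure (measurable_siegel hfm).aestronglyMeasurable hmo.aemeasurable]
    change Integrable (fun h : H => siegel f (orbitMap H (shiftedLattice q p) h).1) μ
    rw [hsi]
    exact i1
  · rw [horb, integral_map hmo.aemeasurable (measurable_siegel hfm).aestronglyMeasurable, hsi, v1,
      integral_smul_measure, integral_row, ENNReal.toReal_natCast, smul_eq_mul]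
  · obtain ⟨l, rfl⟩ : ∃ l', l = l' + 1 := ⟨l - 1, by omega⟩
    obtain e₂ : Fin 2 ⊕ Fin (l + 1) ≃ Fin (l + 1 + 2) := Fintype.equivOfCardEq (by simp; omega)
    have hP₂ : MeanValue P (mat : H → _) e₂ := hmean e₂
    -- The right side of the second moment formula is one integral against `pairMeasure`, so the
    -- same passage to signed functions applies.
    obtain ⟨-, i2, v2⟩ := integral_tsum_of_lintegral_tsum (μ := μ)
      (ρ := (Fintype.card J : ℝ≥0∞) • pairMeasure S (l + 1 + 2) q)
      (G := fun (X : intMat S (Fin 2) (Fin (l + 1 + 2))) (h : H) =>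
        ratMat S (colMat ![1, 1] * shiftMat q p + (X : Matrix (Fin 2) (Fin (l + 1 + 2)) ℚ)) * mat h)
      (fun X => measurable_mul_apply hm _) (fun Φ hΦ => by
        rw [hμ, hE, setLIntegral_shiftDomain_tsum hH hD hx _ hΦ, lintegral_smul_measure,
          smul_eq_mul, lintegral_pairMeasure q hΦ]
        simp only [Matrix.mul_assoc]
        exact hx.second_moment hm hdet 0 hP₁ 0 hP₂ hq hq1 hΦ) (measurable_pairFn hfm)
      ((integrable_pairFn_pairMeasure hd3 hfm hfb hfc q).smul_measure hJ)
    have hsum := hasSum_pairIntegral hd3 hfm hfb hfc q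
    have hae : (fun h : H => siegel f (orbitMap H (shiftedLattice q p) h).1 ^ 2) =ᵐ[μ] fun h =>
        ∑' X : intMat S (Fin 2) (Fin (l + 1 + 2)), pairFn f (ratMat S (colMat ![1, 1] *
          shiftMat q p + (X : Matrix (Fin 2) (Fin (l + 1 + 2)) ℚ)) * mat h) := by
      filter_upwards [s1] with h hh using siegel_translate_sq h hh
    have hsm := (measurable_siegel (H := H) (q := q) (p := p) hfm).pow_const 2
    refine ⟨?_, ?_⟩
    · rw [horb, integrable_map_measure hsm.aestronglyMeasurable hmo.aemeasurable]
      exact i2.congr hae.symm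
    · rw [horb, integral_map hmo.aemeasurable hsm.aestronglyMeasurable, integral_congr_ae hae, v2,
        integral_smul_measure, ENNReal.toReal_natCast, smul_eq_mul]
      congr 1
      have h3 := hsum.tsum_eq
      rw [hsum.summable.tsum_sigma] at h3
      rw [h3]
      ring

end SArith
end

/-! ### Both moments for both groups. -/

theorem theorem4p3 (S : Finset SArith.Prm) (d q : ℕ) (hqS : q ∈ SArith.NS S) (hq1 : q ≠ 1)
    (p : Fin d → SArith.ZS S) (hqp : SArith.CoprimeS S q p)
    (f : (Fin d → SArith.QS S) → ℝ) (hfm : Measurable f) (hfb : ∃ C : ℝ, ∀ v, |f v| ≤ C)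
    (hfc : HasCompactSupport f) :
    -- first moment
    (2 ≤ d →
      -- the measures are normalized as claimed, and the total masses are finite and non-zero
      (covolume (SArith.integralPoints (SArith.UL S d)) (SArith.UL S d)
          (SArith.normHaar (SArith.UL S d)) = 1 ∧
        covolume (SArith.integralPoints (SArith.SL S d)) (SArith.SL S d)
          (SArith.normHaar (SArith.SL S d)) = 1 ∧
        SArith.muY q p Set.univ ≠ 0 ∧ SArith.muY q p Set.univ ≠ ∞ ∧
        SArith.nuZ q p Set.univ = SArith.muY q p Set.univ) ∧
      (Integrable (fun L : SArith.Y q p => SArith.siegel f L.1) (SArith.muY q p) ∧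
        ((SArith.muY q p).real Set.univ)⁻¹ *
          ∫ L : SArith.Y q p, SArith.siegel f L.1 ∂(SArith.muY q p) = ∫ v, f v) ∧
      (Integrable (fun L : SArith.Z q p => SArith.siegel f L.1) (SArith.nuZ q p) ∧
        ((SArith.nuZ q p).real Set.univ)⁻¹ *
          ∫ L : SArith.Z q p, SArith.siegel f L.1 ∂(SArith.nuZ q p) = ∫ v, f v)) ∧
    -- second moment
    (3 ≤ d →
      Summable (fun x : (Σ t : SArith.indexT S q, SArith.indexA S q t) =>
        SArith.pairIntegral f x.1 x.2) ∧
      (Integrable (fun L : SArith.Y q p => SArith.siegel f L.1 ^ 2) (SArith.muY q p) ∧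
        ((SArith.muY q p).real Set.univ)⁻¹ *
          ∫ L : SArith.Y q p, SArith.siegel f L.1 ^ 2 ∂(SArith.muY q p) =
            (∫ v, f v) ^ 2 + ∑' t : SArith.indexT S q, ∑' a : SArith.indexA S q t,
              SArith.pairIntegral f t a) ∧
      (Integrable (fun L : SArith.Z q p => SArith.siegel f L.1 ^ 2) (SArith.nuZ q p) ∧
        ((SArith.nuZ q p).real Set.univ)⁻¹ *
          ∫ L : SArith.Z q p, SArith.siegel f L.1 ^ 2 ∂(SArith.nuZ q p) =
            (∫ v, f v) ^ 2 + ∑' t : SArith.indexT S q, ∑' a : SArith.indexA S q t,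
              SArith.pairIntegral f t a)) := by
  obtain ⟨D, hD⟩ := SArith.exists_isStrictFD (S := S) (n := Fin d)
  obtain ⟨J, _, γ, hx, hrep⟩ := SArith.exists_shift_reps hqS (SArith.smul_shiftMat_mem hqS p)
    (SArith.order_shiftMat hqS hqp)
  obtain ⟨j₀, -⟩ := hrep 1
  have : Nonempty J := ⟨j₀⟩
  have hJ : Fintype.card J ≠ 0 := Fintype.card_ne_zero
  have hJ' : (Fintype.card J : ℝ) ≠ 0 := by exact_mod_cast hJ
  have hcancel : ∀ c : ℝ, (Fintype.card J : ℝ)⁻¹ * (Fintype.card J * c) = c := fun c =>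
    inv_mul_cancel_left₀ hJ' c
  -- The same representatives `γ`, indexed by `J`, serve `UL` and `SL`; hence the two total masses
  -- agree.
  have hUL := fun hd => SArith.moments (SArith.isDetKernel_UL (S := S) (d := d)) hqS hq1 hd hD hx
    hrep hfm hfb hfc
  have hSL := fun hd => SArith.moments (SArith.isDetKernel_SL (S := S) (d := d)) hqS hq1 hd hD hx
    hrep hfm hfb hfc
  refine ⟨fun hd => ?_, fun hd => ?_⟩
  · obtain ⟨cU, mU, ⟨iU, vU⟩, -⟩ := hUL hd
    obtain ⟨cS, mS, ⟨iS, vS⟩, -⟩ := hSL hd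
    refine ⟨⟨cU, cS, ?_, ?_, ?_⟩, ⟨iU, ?_⟩, iS, ?_⟩
    · rw [mU]
      exact_mod_cast hJ
    · rw [mU]
      exact ENNReal.natCast_ne_top _
    · rw [mS, mU]
    · rw [Measure.real, mU, vU, ENNReal.toReal_natCast, hcancel]
    · rw [Measure.real, mS, vS, ENNReal.toReal_natCast, hcancel]
  · obtain ⟨-, mU, -, hU⟩ := hUL (by omega)
    obtain ⟨-, mS, -, hS⟩ := hSL (by omega)
    obtain ⟨iU, vU⟩ := hU hd
    obtain ⟨iS, vS⟩ := hS hd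
    refine ⟨(SArith.hasSum_pairIntegral hd hfm hfb hfc q).summable, ⟨iU, ?_⟩, iS, ?_⟩
    · rw [Measure.real, mU, vU, ENNReal.toReal_natCast, hcancel]
    · rw [Measure.real, mS, vS, ENNReal.toReal_natCast, hcancel]
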